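/- Let $M$ be a compact connected complex manifold of dimension $m\ge 2$ with a Kähler metric $\omega=\sqrt{-1}\,g_{\alpha\bar\beta}\,dz^\alpha\wedge d\bar z^\beta$, and let $\pi:\mathcal X\to M$ be a proper surjective holomorphic submersion of complex manifolds with $n$-dimensional fibres ($n\ge 0$). Let $L$ be a holomorphic line bundle over $\mathcal X$ and let $\phi$ be a smooth Hermitian metric on $L$ (with local weights also denoted $\phi$, i.e. $|s|^2=e^{-\phi}$ for a local holomorphic frame $s$) whose curvature $\sqrt{-1}\partial\bar\partial\phi$ is positive on every fibre of $\pi$. In local holomorphic coordinates $(z;v)$ of $\mathcal X$ with $\pi(z;v)=z$, let $$c(\phi)=\left(\phi_{\alpha\bar\beta}-\phi_{\alpha\bar j}\phi^{i\bar j}\phi_{i\bar\beta}\right)\sqrt{-1}\,dz^\alpha\wedge d\bar z^\beta,\qquad tr_\omega c(\phi)=g^{\alpha\bar\beta}\left(\phi_{\alpha\bar\beta}-\phi_{\alpha\bar j}\phi^{i\bar j}\phi_{i\bar\beta}\right)$$ be the geodesic curvature and its trace, where $\alpha,\beta$ refer to $z$, $i,j$ refer to $v$, $(\phi^{i\bar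 j})$ is the inverse of $(\phi_{i\bar j})$ and $(g^{\alpha\bar\beta})$ that of $(g_{\alpha\bar\beta})$. For $k\ge 0$ and any smooth Hermitian metric $\psi$ on $L$ put $$S_k(L,\psi)=\int_{\mathcal X/M}\left(\frac{\sqrt{-1}}{2\pi}\partial\bar\partial\psi\right)^{n+k},\qquad S_k(L)=\pi_*\left(c_1(L)^{n+k}\right)=[S_k(L,\psi)],$$ so that $S_0(L)$ is the number $\int_{\mathcal X_y}c_1(L)^n$, for any $y\in M$, and let $$\lambda_{\mathcal X,L}=\frac{2\pi m}{n+1}\,\frac{([\omega]^{m-1}c_1(L)^{n+1})[\mathcal X]}{([\omega]^{m}c_1(L)^{n})[\mathcal X]}.$$ Suppose that $\phi$ is geodesic-Einstein with respect to $\omega$, i.e. $tr_\omega c(\phi)=\lambda_{\mathcal X,L}$ on $\mathcal X$. Then, as real $(m,m)$-forms on $M$, $$S_2(L,\phi)\wedge\omega^{m-2}\le\frac{(n+1)(n+2)}{8\pi^2m^2}\,\lambda_{\mathcal X,L}^2\,S_0(L)\,\omega^m .$$ Equality holds at a point $y\in M$ if and only if $c(\phi)=\frac{\lambda_{\mathcal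 X,L}}{m}\,\pi^*\omega$ at all points of $\mathcal X_y=\pi^{-1}(y)$; hence equality holds on $M$ if and only if $c(\phi)=\frac{\lambda_{\mathcal X,L}}{m}\,\pi^*\omega$ on $\mathcal X$. Moreover $$\int_M S_2(L)\wedge[\omega]^{m-2}\le\frac{(n+1)(n+2)}{8\pi^2m^2}\,\lambda_{\mathcal X,L}^2\,S_0(L)\int_M[\omega]^m .$$ -/

import Mathlib

open scoped Manifold ContDiff

noncomputable section

namespace GeodesicEinstein

/-! ### Linear algebra: exterior products of real forms -/

/-- The model space of complex manifolds of dimension `N`. -/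
abbrev Cn (N : ℕ) : Type := Fin N → ℂ

/-- The exterior product of a real `p`-form and a real `q`-form on a vector space, written as
functions of `p` and `q` vectors:
`(a ∧ b)(v₁, …, v_{p+q}) = 1/(p! q!) ∑_σ sgn(σ) a(v_{σ 1}, …, v_{σ p}) b(v_{σ (p+1)}, …)`. -/
def wedge {V : Type*} {p q : ℕ} (a : (Fin p → V) → ℝ) (b : (Fin q → V) → ℝ) :
    (Fin (p + q) → V) → ℝ := fun v =>
  ((p.factorial : ℝ) * (q.factorial : ℝ))⁻¹ *
    ∑ σ : Equiv.Perm (Fin (p + q)), ((Equiv.Perm.sign σ : ℤ) : ℝ) *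
      (a (fun i => v (σ (Fin.castAdd q i))) * b (fun j => v (σ (Fin.natAdd p j))))

/-- The `k`-th exterior power of a real `2`-form. -/
def wedgePow {V : Type*} (a : (Fin 2 → V) → ℝ) : (k : ℕ) → (Fin (2 * k) → V) → ℝ
  | 0 => fun _ => 1
  | k + 1 => wedge (wedgePow a k) a

/-- The positively oriented real frame `e₁, i e₁, e₂, i e₂, …, e_N, i e_N` of `ℂ^N`
(numbered from `0`, and continued by zero vectors from index `2 N` on). -/
def frame (N : ℕ) (j : ℕ) : Cn N :=
  fun k => if (k : ℕ) = j / 2 then (if j % 2 = 0 then 1 else Complex.I) else 0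

/-- The real `2`-form `i ∑ H_{jk} dz^j ∧ d\bar z^k` on `ℂ^N` given by a Hermitian matrix `H`. -/
def formOfMatrix {N : ℕ} (H : Matrix (Fin N) (Fin N) ℂ) : (Fin 2 → Cn N) → ℝ := fun v =>
  (∑ j, ∑ k, Complex.I * H j k *
    (v 0 j * (starRingEnd ℂ) (v 1 k) - v 1 j * (starRingEnd ℂ) (v 0 k))).re

/-! ### Wirtinger derivatives -/

/-- `∂f/∂z^j = (∂f/∂x^j - i ∂f/∂y^j)/2`. -/
def dz {N : ℕ} (j : Fin N) (f : Cn N → ℂ) (p : Cn N) : ℂ :=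
  (fderiv ℝ f p (Pi.single j 1) - Complex.I * fderiv ℝ f p (Pi.single j Complex.I)) / 2

/-- `∂f/∂\bar z^j = (∂f/∂x^j + i ∂f/∂y^j)/2`. -/
def dzbar {N : ℕ} (j : Fin N) (f : Cn N → ℂ) (p : Cn N) : ℂ :=
  (fderiv ℝ f p (Pi.single j 1) + Complex.I * fderiv ℝ f p (Pi.single j Complex.I)) / 2

/-- The matrix `f_{j\bar k} = ∂²f/∂z^j∂\bar z^k` of a real function `f`. -/
def complexHessian {N : ℕ} (f : Cn N → ℝ) (p : Cn N) : Matrix (Fin N) (Fin N) ℂ :=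
  Matrix.of fun j k => dz j (dzbar k (fun q => (f q : ℂ))) p

/-! ### Forms on complex manifolds and their integrals -/

/-- Real `d`-forms on an `N`-dimensional complex manifold `X`, as functions of `d` tangent
vectors at each point. -/
abbrev Form (N : ℕ) (X : Type*) [TopologicalSpace X] [ChartedSpace (Cn N) X] (d : ℕ) : Type _ :=
  (x : X) → (Fin d → TangentSpace 𝓘(ℂ, Cn N) x) → ℝ

section Manifold

variable {X : Type*} [TopologicalSpace X]

/-- The value of a form of top degree `2 N` at `x` on the standard positively oriented real frame
of the tangent space (`T_x X` is `ℂ^N` through the preferred holomorphic chart at `x`). An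
inequality between real forms of top degree is an inequality between these values. -/
def topCoeff (N : ℕ) [ChartedSpace (Cn N) X] {d : ℕ} (η : Form N X d) (x : X) : ℝ :=
  η x (fun j => (frame N j : Cn N))

/-- A finite smooth partition of unity subordinate to holomorphic charts. -/
structure ChartPartition (N : ℕ) (X : Type*) [TopologicalSpace X] [ChartedSpace (Cn N) X] where
  size : ℕ
  chart : Fin size → OpenPartialHomeomorph X (Cn N)
  chart_mem : ∀ i, chart i ∈ IsManifold.maximalAtlas 𝓘(ℂ, Cn N) ω X
  ρ : Fin size → X → ℝ
  smooth : ∀ i, ContMDiff 𝓘(ℝ, Cn N) 𝓘(ℝ, ℝ) ∞ (ρ i)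
  nonneg : ∀ i x, 0 ≤ ρ i x
  sum_eq_one : ∀ x, ∑ i, ρ i x = 1
  tsupport_subset : ∀ i, tsupport (ρ i) ⊆ (chart i).source

open Classical in
/-- The integral of a form of top degree `2 N` over a compact complex manifold with its complex
orientation, by means of a partition of unity. -/
def topIntegral (N : ℕ) [ChartedSpace (Cn N) X] {d : ℕ} (η : Form N X d) : ℝ :=
  if h : Nonempty (ChartPartition N X) then
    ∑ i, ∫ p in (h.some.chart i).target,
      h.some.ρ i ((h.some.chart i).symm p) *
        η ((h.some.chart i).symm p)
          (fun j => mfderiv 𝓘(ℂ, Cn N) 𝓘(ℂ, Cn N) (h.some.chart i).symm p (frame N j : Cn N))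
  else 0

end Manifold

section Fibration

variable (m n : ℕ) {X M : Type*} [TopologicalSpace X] [ChartedSpace (Cn (m + n)) X]
  [TopologicalSpace M] [ChartedSpace (Cn m) M]

/-- A proper surjective holomorphic map of complex manifolds whose differential has maximal rank
everywhere, with `n`-dimensional fibres over the `m`-dimensional base. -/
structure IsHolomorphicFibration (π : X → M) : Prop where
  proper : IsProperMap π
  surjective : Function.Surjective π
  holomorphic : ContMDiff 𝓘(ℂ, Cn (m + n)) 𝓘(ℂ, Cn m) ω π
  submersion : ∀ x, Function.Surjective (mfderiv 𝓘(ℂ, Cn (m + n)) 𝓘(ℂ, Cn m) π x)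

/-- `e = (z; v)` and `e' = z` form an admissible holomorphic coordinate system: in these
coordinates `π (z; v) = z`. -/
def IsAdmissible (π : X → M) (e : OpenPartialHomeomorph X (Cn (m + n)))
    (e' : OpenPartialHomeomorph M (Cn m)) : Prop :=
  e ∈ IsManifold.maximalAtlas 𝓘(ℂ, Cn (m + n)) ω X ∧
  e' ∈ IsManifold.maximalAtlas 𝓘(ℂ, Cn m) ω M ∧
  ∀ x ∈ e.source, π x ∈ e'.source ∧ ∀ α : Fin m, e x (Fin.castAdd n α) = e' (π x) α

/-- A finite smooth partition of unity on the total space subordinate to admissible coordinate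
systems. -/
structure AdmissiblePartition (π : X → M) where
  size : ℕ
  chart : Fin size → OpenPartialHomeomorph X (Cn (m + n))
  base : Fin size → OpenPartialHomeomorph M (Cn m)
  admissible : ∀ i, IsAdmissible m n π (chart i) (base i)
  ρ : Fin size → X → ℝ
  smooth : ∀ i, ContMDiff 𝓘(ℝ, Cn (m + n)) 𝓘(ℝ, ℝ) ∞ (ρ i)
  nonneg : ∀ i x, 0 ≤ ρ i x
  sum_eq_one : ∀ x, ∑ i, ρ i x = 1
  tsupport_subset : ∀ i, tsupport (ρ i) ⊆ (chart i).source

open Classical in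
/-- The integral along the fibres `π_* β = ∫_{X/M} β` of a form `β` of degree `p + 2 n` on the
total space, a form of degree `p` on the base. In admissible coordinates `(z; v)`, its value at
`y` on `w₁, …, w_p` is the integral over the fibre of
`β(w̃₁, …, w̃_p, ∂/∂(Re v¹), ∂/∂(Im v¹), …, ∂/∂(Re vⁿ), ∂/∂(Im vⁿ))`, where `w̃` is the lift of `w`
with the same `z`-components and vanishing `v`-components. The local contributions are summed by
means of a partition of unity. -/
def fiberIntegral (π : X → M) {d : ℕ} (β : Form (m + n) X d) (p : ℕ) : Form m M p := fun y w =>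
  if h : Nonempty (AdmissiblePartition m n π) then
    ∑ i, ∫ v in {v : Cn n | y ∈ (h.some.base i).source ∧
        Fin.append (h.some.base i y) v ∈ (h.some.chart i).target},
      h.some.ρ i ((h.some.chart i).symm (Fin.append (h.some.base i y) v)) *
        β ((h.some.chart i).symm (Fin.append (h.some.base i y) v))
          (fun j : Fin d =>
            mfderiv 𝓘(ℂ, Cn (m + n)) 𝓘(ℂ, Cn (m + n)) (h.some.chart i).symm
              (Fin.append (h.some.base i y) v)
              (if hj : (j : ℕ) < p then
                (Fin.append
                  (mfderiv 𝓘(ℂ, Cn m) 𝓘(ℂ, Cn m) (h.some.base i) y (w ⟨j, hj⟩) : Cn m)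
                  (0 : Cn n) : Cn (m + n))
              else (Fin.append (0 : Cn m) (frame n (j - p)) : Cn (m + n))))
  else 0

/-- The pull-back `π^* η`. -/
def pullback (π : X → M) {d : ℕ} (η : Form m M d) : Form (m + n) X d := fun x v =>
  η (π x) (fun j => mfderiv 𝓘(ℂ, Cn (m + n)) 𝓘(ℂ, Cn m) π x (v j))

end Fibration

/-! ### Kähler metrics -/

/-- A Kähler metric on an `m`-dimensional complex manifold: a smooth Hermitian metric `g`, linear
in the first and conjugate-linear in the second variable, whose fundamental form
`ω = i g_{α\bar β} dz^α ∧ d\bar z^β`, i.e. `ω(u, v) = -2 Im g(u, v)`, is closed. -/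
structure KaehlerMetric (m : ℕ) (M : Type*) [TopologicalSpace M] [ChartedSpace (Cn m) M] where
  g : (y : M) → TangentSpace 𝓘(ℂ, Cn m) y → TangentSpace 𝓘(ℂ, Cn m) y → ℂ
  add_left : ∀ y u v w, g y (u + v) w = g y u w + g y v w
  smul_left : ∀ y (c : ℂ) u v, g y (c • u) v = c * g y u v
  conj_symm : ∀ y u v, (starRingEnd ℂ) (g y u v) = g y v u
  pos : ∀ y u, u ≠ 0 → 0 < (g y u u).re
  smooth : ∀ e ∈ IsManifold.maximalAtlas 𝓘(ℂ, Cn m) ω M, ∀ u v : Cn m,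
    ContDiffOn ℝ ∞ (fun p : Cn m => g (e.symm p)
      (mfderiv 𝓘(ℂ, Cn m) 𝓘(ℂ, Cn m) e.symm p u)
      (mfderiv 𝓘(ℂ, Cn m) 𝓘(ℂ, Cn m) e.symm p v)) e.target
  /-- `dω(u, v, w) = D_u ω(v, w) + D_v ω(w, u) + D_w ω(u, v) = 0` for constant vector fields
  `u, v, w` in holomorphic coordinates. -/
  closed : ∀ e ∈ IsManifold.maximalAtlas 𝓘(ℂ, Cn m) ω M, ∀ p ∈ e.target, ∀ u v w : Cn m,
    let ωloc : Cn m → Cn m → Cn m → ℝ := fun a b q =>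
      -2 * (g (e.symm q) (mfderiv 𝓘(ℂ, Cn m) 𝓘(ℂ, Cn m) e.symm q a)
        (mfderiv 𝓘(ℂ, Cn m) 𝓘(ℂ, Cn m) e.symm q b)).im
    fderiv ℝ (ωloc v w) p u + fderiv ℝ (ωloc w u) p v + fderiv ℝ (ωloc u v) p w = 0

namespace KaehlerMetric

variable {m : ℕ} {M : Type*} [TopologicalSpace M] [ChartedSpace (Cn m) M]

/-- The Kähler form `ω = i g_{α\bar β} dz^α ∧ d\bar z^β`. -/
def form (g : KaehlerMetric m M) : Form m M 2 := fun y v => -2 * (g.g y (v 0) (v 1)).im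

/-- `ω^k`. -/
def formPow (g : KaehlerMetric m M) (k : ℕ) : Form m M (2 * k) := fun y => wedgePow (g.form y) k

/-- The matrix `g_{α\bar β} = g(∂/∂z^α, ∂/∂z^β)` at `y` in the holomorphic coordinates `e'`. -/
def matrix (g : KaehlerMetric m M) (e' : OpenPartialHomeomorph M (Cn m)) (y : M) :
    Matrix (Fin m) (Fin m) ℂ :=
  Matrix.of fun α β => g.g (e'.symm (e' y))
    (mfderiv 𝓘(ℂ, Cn m) 𝓘(ℂ, Cn m) e'.symm (e' y) (Pi.single α 1 : Cn m))
    (mfderiv 𝓘(ℂ, Cn m) 𝓘(ℂ, Cn m) e'.symm (e' y) (Pi.single β 1 : Cn m))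

end KaehlerMetric

/-! ### Hermitian metrics on a holomorphic line bundle -/

section LineBundle

variable {N : ℕ} {X : Type*} [TopologicalSpace X] [ChartedSpace (Cn N) X]

/-- A smooth Hermitian metric on a line bundle `L`, given by `ξ ↦ |ξ|²`; smoothness means that
`|s|²` is smooth for the local frames `s` of `L` that come from its local trivializations. -/
structure HermitianMetric (N : ℕ) {X : Type*} [TopologicalSpace X] [ChartedSpace (Cn N) X]
    (L : X → Type*) [∀ x, AddCommGroup (L x)] [∀ x, Module ℂ (L x)]
    [∀ x, TopologicalSpace (L x)] [TopologicalSpace (Bundle.TotalSpace ℂ L)]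
    [FiberBundle ℂ L] where
  normSq : (x : X) → L x → ℝ
  normSq_smul : ∀ x (c : ℂ) (ξ : L x), normSq x (c • ξ) = ‖c‖ ^ 2 * normSq x ξ
  pos : ∀ x (ξ : L x), ξ ≠ 0 → 0 < normSq x ξ
  smooth : ∀ (t : Bundle.Trivialization ℂ (Bundle.TotalSpace.proj : Bundle.TotalSpace ℂ L → X))
    [MemTrivializationAtlas t],
    ContMDiffOn 𝓘(ℝ, Cn N) 𝓘(ℝ, ℝ) ∞ (fun x => normSq x (t.symm x 1)) t.baseSet

namespace HermitianMetric

variable {L : X → Type*} [∀ x, AddCommGroup (L x)] [∀ x, Module ℂ (L x)]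
  [∀ x, TopologicalSpace (L x)] [TopologicalSpace (Bundle.TotalSpace ℂ L)] [FiberBundle ℂ L]

/-- The local weight `φ` of the metric in the local trivialization of `L` around `x₀`, that is,
`|s|² = e^{-φ}` for the corresponding local holomorphic frame `s`. -/
def weight (φ : HermitianMetric N L) (x₀ : X) : X → ℝ := fun x =>
  -Real.log (φ.normSq x ((trivializationAt ℂ L x₀).symm x 1))

/-- The matrix `φ_{j\bar k}` of second derivatives of the local weight at `x`, in the holomorphic
coordinates `e` around `x`. -/
def hessian (φ : HermitianMetric N L) (e : OpenPartialHomeomorph X (Cn N)) (x : X) :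
    Matrix (Fin N) (Fin N) ℂ :=
  complexHessian (fun p => φ.weight x (e.symm p)) (e x)

/-- The curvature form `i ∂∂̄φ`, computed at each point in the preferred coordinates there. -/
def curvatureForm (φ : HermitianMetric N L) : Form N X 2 := fun x =>
  formOfMatrix (φ.hessian (chartAt (Cn N) x) x)

/-- The powers `c₁(L, φ)^k` of the Chern form `c₁(L, φ) = (i/2π) ∂∂̄φ`. -/
def chernFormPow (φ : HermitianMetric N L) (k : ℕ) : Form N X (2 * k) := fun x =>
  wedgePow (fun v => (2 * Real.pi)⁻¹ * φ.curvatureForm x v) k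

end HermitianMetric

end LineBundle

/-! ### Relatively positive metrics, geodesic curvature, `S`-forms -/

section Relative

variable {m n : ℕ} {X M : Type*} [TopologicalSpace X] [ChartedSpace (Cn (m + n)) X]
  [TopologicalSpace M] [ChartedSpace (Cn m) M]
  {L : X → Type*} [∀ x, AddCommGroup (L x)] [∀ x, Module ℂ (L x)]
  [∀ x, TopologicalSpace (L x)] [TopologicalSpace (Bundle.TotalSpace ℂ L)] [FiberBundle ℂ L]

/-- `φ ∈ F⁺(L)`: the curvature form `i ∂∂̄φ` is positive on every fibre of `π`. -/
def IsRelativelyPositive (π : X → M) (φ : HermitianMetric (m + n) L) : Prop :=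
  ∀ (x : X) (u : TangentSpace 𝓘(ℂ, Cn (m + n)) x),
    mfderiv 𝓘(ℂ, Cn (m + n)) 𝓘(ℂ, Cn m) π x u = 0 → u ≠ 0 →
    0 < φ.curvatureForm x ![u, Complex.I • u]

/-- The coefficients `c(φ)_{α\bar β} = φ_{α\bar β} - φ_{α\bar j} φ^{i\bar j} φ_{i\bar β}` at `x`
of the geodesic curvature `c(φ) = c(φ)_{α\bar β} i dz^α ∧ d\bar z^β`, in the coordinates
`e = (z; v)`; here `φ^{i\bar j} φ_{k\bar j} = δ^i_k`. -/
def geodesicCurvature (φ : HermitianMetric (m + n) L)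
    (e : OpenPartialHomeomorph X (Cn (m + n))) (x : X) : Matrix (Fin m) (Fin m) ℂ :=
  let H := φ.hessian e x
  H.submatrix (Fin.castAdd n) (Fin.castAdd n) -
    H.submatrix (Fin.castAdd n) (Fin.natAdd m) *
      (H.submatrix (Fin.natAdd m) (Fin.natAdd m))⁻¹ *
        H.submatrix (Fin.natAdd m) (Fin.castAdd n)

/-- `tr_ω c(φ) = g^{α\bar β} c(φ)_{α\bar β}` is equal to the constant `c` on the total space. -/
def TraceGeodesicCurvatureEq (π : X → M) (g : KaehlerMetric m M) (φ : HermitianMetric (m + n) L)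
    (c : ℝ) : Prop :=
  ∀ e e', IsAdmissible m n π e e' → ∀ x ∈ e.source,
    ((g.matrix e' (π x))⁻¹ * geodesicCurvature φ e x).trace = (c : ℂ)

/-- `c(φ) = c ω` (with `ω` pulled back to the total space) at the point `x`. -/
def GeodesicCurvatureEqAt (π : X → M) (g : KaehlerMetric m M) (φ : HermitianMetric (m + n) L)
    (c : ℝ) (x : X) : Prop :=
  ∀ e e', IsAdmissible m n π e e' → x ∈ e.source →
    geodesicCurvature φ e x = (c : ℂ) • g.matrix e' (π x)

/-- The `S`-form `S_k(L, φ) = ∫_{X/M} ((i/2π) ∂∂̄φ)^{n+k}`, a form of degree `2 k` on the base. -/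
def SForm (π : X → M) (φ : HermitianMetric (m + n) L) (k : ℕ) : Form m M (2 * k) :=
  fiberIntegral m n π (φ.chernFormPow (n + k)) (2 * k)

/-- The fibre integral `∫_{X_y} c₁(L)^n`, with `c₁(L)` represented by the Chern form of `ψ`. -/
def SZero (π : X → M) (ψ : HermitianMetric (m + n) L) (y : M) : ℝ :=
  SForm π ψ 0 y (fun _ => 0)

/-- The form `S₂(L, φ) ∧ ω^{m-2}`. -/
def STwoWedge (π : X → M) (g : KaehlerMetric m M) (φ : HermitianMetric (m + n) L) :
    Form m M (2 * 2 + 2 * (m - 2)) :=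
  fun y => wedge (SForm π φ 2 y) (g.formPow (m - 2) y)

/-- The number
`λ_{X,L} = (2 π m / (n + 1)) ([ω]^{m-1} c₁(L)^{n+1})[X] / ([ω]^m c₁(L)^n)[X]`,
with `c₁(L)` represented by the Chern form of `ψ`. -/
def lambdaXL (π : X → M) (g : KaehlerMetric m M) (ψ : HermitianMetric (m + n) L) : ℝ :=
  2 * Real.pi * m / (n + 1) *
    (topIntegral (m + n) (X := X) (fun x =>
        wedge (pullback m n π (g.formPow (m - 1)) x) (ψ.chernFormPow (n + 1) x)) /
      topIntegral (m + n) (X := X) (fun x =>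
        wedge (pullback m n π (g.formPow m) x) (ψ.chernFormPow n x)))

end Relative

end GeodesicEinstein

end

open GeodesicEinstein

/-!
The inequality is a fibre integral of a pointwise inequality for Hermitian matrices.

In admissible coordinates `(z; v)` let `H = (φ_{j\bar k})` be the full curvature matrix and let `G` be
the matrix of `ω`, extended by zero in the directions of `v`. The forms `S₂(L, φ) ∧ ω^{m-2}`,
`S₀(L, φ)` and `ω^m` are then integrals over the fibre of coefficients of determinants. For the first,
contracting `(i∂∂̄φ)^{n+2}` with the vertical vectors and multiplying by `ω^{m-2}` yields the
coefficient of `t^{m-2}` in `det (H + t G)` (`wedge_contraction`, `STwoWedge_eq`). By a Schur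
complement this polynomial is the product of the determinant of the vertical block of `H`, the density
of `S₀` (`SZero_eq`), and of `det (c(φ) + t ω)` (`detPoly_pad`). The coefficient of `t^{m-2}` in the
latter is, up to the factor `det ω`, the elementary symmetric function of degree two of the
eigenvalues of `c(φ)` relative to `ω`. Their sum is the prescribed trace `λ`, so this function is at
most `(m - 1) λ² / (2 m)`, and it differs from this value by a defect `δ ≥ 0` that vanishes exactly
where `c(φ) = (λ / m) ω` (`coeff_detPoly_eq`). The defect is a function on the total space
(`exists_defect`), and integration over the fibre gives
`S₂(L, φ) ∧ ω^{m-2} = const · λ² S₀(L, φ) ω^m - R`, where `R ≥ 0` is the integral of `δ` against a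
positive density (`STwoWedge_eq_sub`). As `δ` is continuous, `R` vanishes only if `δ` vanishes on the
whole fibre.

The number `S₀(L)` and the integral of `S₂(L) ∧ [ω]^{m-2}` may be evaluated with any metric on `L`.
Two metrics differ by a factor `exp (-u)` with a global function `u`, so the curvatures differ by
`i∂∂̄u`, and the derivative of the integral of `det (A + t i∂∂̄u)` in `t` is the integral of a divergence,
because the cofactors of a closed matrix field are divergence free (`piola`). Integration by parts in
the charts leaves only derivatives of the partition of unity, and these cancel
(`sum_integral_variation_eq_zero`). Applied on a fibre, this shows that `S₀` does not depend on the
metric (`SZero_eq_SZero`). Applied to the derivative along the base, it shows that `S₀` does not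
depend on the fibre either (`SZero_const`): there the coordinates of the fibres and the partition of
unity move with the point of the base, which is why `sum_integral_variation_eq_zero` allows a velocity
of the change of charts. Applied on the total space to the coefficients of `det (H + t G)`, and
combined with Fubini's theorem, it shows that the integral of `S₂(L) ∧ ω^{m-2}` does not depend on the
metric (`topIntegral_STwoWedge_eq`).

Fibre integrals and integrals over the base are defined through a partition of unity, which exists on
compact manifolds, for the total space by the holomorphic inverse function theorem
(`nonempty_admissiblePartition`, `nonempty_chartPartition`). The partitions of unity of the fibres are
restrictions of one on the total space.
-/

noncomputable section

namespace GeodesicEinstein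

open scoped Matrix
open MeasureTheory

/-! ### Exterior products as alternating sums -/

/-- The alternating sum `∑_σ sgn(σ) A(v_{σ 1}, …, v_{σ d})` of a complex function of `d` vectors. -/
def alt {V : Type*} {d : ℕ} (A : (Fin d → V) → ℂ) (v : Fin d → V) : ℂ :=
  ∑ σ : Equiv.Perm (Fin d), ((Equiv.Perm.sign σ : ℤ) : ℂ) * A (fun i => v (σ i))

theorem sum_sign_mul_right {ι : Type*} [Fintype ι] [DecidableEq ι]
    (F : Equiv.Perm ι → ℂ) (ρ : Equiv.Perm ι) :
    ∑ σ : Equiv.Perm ι, ((Equiv.Perm.sign σ : ℤ) : ℂ) * F (σ * ρ) =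
      ((Equiv.Perm.sign ρ : ℤ) : ℂ) *
        ∑ σ : Equiv.Perm ι, ((Equiv.Perm.sign σ : ℤ) : ℂ) * F σ := by
  conv_rhs => rw [← Equiv.sum_comp (Equiv.mulRight ρ), Finset.mul_sum]
  refine Finset.sum_congr rfl fun σ _ => ?_
  have h : ((Equiv.Perm.sign ρ : ℤ) : ℂ) * ((Equiv.Perm.sign ρ : ℤ) : ℂ) = 1 := by
    rw [← Int.cast_mul, ← Units.val_mul, Int.units_mul_self]; simp
  simp only [Equiv.coe_mulRight, Equiv.Perm.sign_mul, Units.val_mul, Int.cast_mul]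
  linear_combination (-((Equiv.Perm.sign σ : ℤ) : ℂ) * F (σ * ρ)) * h

/-- The permutation of `p + q` places that permutes the two blocks separately. -/
def blockPerm {p q : ℕ} (τ : Equiv.Perm (Fin p)) (τ' : Equiv.Perm (Fin q)) :
    Equiv.Perm (Fin (p + q)) :=
  finSumFinEquiv.permCongr (Equiv.Perm.sumCongr τ τ')

@[simp] theorem blockPerm_castAdd {p q : ℕ} (τ : Equiv.Perm (Fin p)) (τ' : Equiv.Perm (Fin q))
    (i : Fin p) : blockPerm τ τ' (Fin.castAdd q i) = Fin.castAdd q (τ i) := by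
  simp [blockPerm, Equiv.permCongr_apply]

@[simp] theorem blockPerm_natAdd {p q : ℕ} (τ : Equiv.Perm (Fin p)) (τ' : Equiv.Perm (Fin q))
    (j : Fin q) : blockPerm τ τ' (Fin.natAdd p j) = Fin.natAdd p (τ' j) := by
  simp [blockPerm, Equiv.permCongr_apply]

@[simp] theorem sign_blockPerm {p q : ℕ} (τ : Equiv.Perm (Fin p)) (τ' : Equiv.Perm (Fin q)) :
    Equiv.Perm.sign (blockPerm τ τ') = Equiv.Perm.sign τ * Equiv.Perm.sign τ' := by
  simp [blockPerm, Equiv.Perm.sign_permCongr, Equiv.Perm.sign_sumCongr]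

/-- If `b` is the alternating sum of `B`, the terms of the wedge product fall into groups of `q!`
equal ones, which cancels the factor `1 / q!`. -/
theorem wedge_alt_right {V : Type*} {p q : ℕ} (a : (Fin p → V) → ℝ) (b : (Fin q → V) → ℝ)
    (B : (Fin q → V) → ℂ) (hb : ∀ v, (b v : ℂ) = alt B v) (v : Fin (p + q) → V) :
    ((wedge a b v : ℝ) : ℂ) = (p.factorial : ℂ)⁻¹ *
      ∑ σ : Equiv.Perm (Fin (p + q)), ((Equiv.Perm.sign σ : ℤ) : ℂ) *
        ((a (fun i => v (σ (Fin.castAdd q i))) : ℂ) * B (fun j => v (σ (Fin.natAdd p j)))) := by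
  have key : ∑ σ : Equiv.Perm (Fin (p + q)), ((Equiv.Perm.sign σ : ℤ) : ℂ) *
        ((a (fun i => v (σ (Fin.castAdd q i))) : ℂ) *
          (b (fun j => v (σ (Fin.natAdd p j))) : ℂ)) = (q.factorial : ℂ) *
      ∑ σ : Equiv.Perm (Fin (p + q)), ((Equiv.Perm.sign σ : ℤ) : ℂ) *
        ((a (fun i => v (σ (Fin.castAdd q i))) : ℂ) * B (fun j => v (σ (Fin.natAdd p j)))) := by
    simp only [hb, alt, Finset.mul_sum]
    rw [Finset.sum_comm]
    have h1 : ∀ τ : Equiv.Perm (Fin q), ∑ σ : Equiv.Perm (Fin (p + q)),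
        ((Equiv.Perm.sign σ : ℤ) : ℂ) * ((a (fun i => v (σ (Fin.castAdd q i))) : ℂ) *
          (((Equiv.Perm.sign τ : ℤ) : ℂ) * B (fun j => v (σ (Fin.natAdd p (τ j)))))) =
        ∑ σ : Equiv.Perm (Fin (p + q)), ((Equiv.Perm.sign σ : ℤ) : ℂ) *
        ((a (fun i => v (σ (Fin.castAdd q i))) : ℂ) * B (fun j => v (σ (Fin.natAdd p j)))) := by
      intro τ
      have h2 := sum_sign_mul_right (fun σ : Equiv.Perm (Fin (p + q)) =>
        ((a (fun i => v (σ (Fin.castAdd q i))) : ℂ) * B (fun j => v (σ (Fin.natAdd p j)))))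
        (blockPerm 1 τ)
      simp only [Equiv.Perm.mul_apply, blockPerm_castAdd, blockPerm_natAdd, sign_blockPerm,
        Equiv.Perm.one_apply, map_one, one_mul] at h2
      have h : ((Equiv.Perm.sign τ : ℤ) : ℂ) * ((Equiv.Perm.sign τ : ℤ) : ℂ) = 1 := by
        rw [← Int.cast_mul, ← Units.val_mul, Int.units_mul_self]; simp
      rw [← one_mul (∑ σ : Equiv.Perm (Fin (p + q)), _ * (_ * B (fun j => v (σ (Fin.natAdd p j))))),
        ← h, mul_assoc, ← h2, Finset.mul_sum]
      refine Finset.sum_congr rfl fun σ _ => by ring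
    rw [Finset.sum_congr rfl fun τ _ => h1 τ, Finset.sum_const, Finset.card_univ,
      Fintype.card_perm, Fintype.card_fin, nsmul_eq_mul, Finset.mul_sum]
  rw [wedge]
  push_cast
  rw [key, mul_inv]
  have : (q.factorial : ℂ) ≠ 0 := by exact_mod_cast q.factorial_ne_zero
  field_simp

/-- The wedge product of alternating sums is the alternating sum of the tensor product. -/
theorem wedge_alt {V : Type*} {p q : ℕ} (a : (Fin p → V) → ℝ) (b : (Fin q → V) → ℝ)
    (A : (Fin p → V) → ℂ) (B : (Fin q → V) → ℂ) (ha : ∀ v, (a v : ℂ) = alt A v)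
    (hb : ∀ v, (b v : ℂ) = alt B v) (v : Fin (p + q) → V) :
    ((wedge a b v : ℝ) : ℂ) =
      alt (fun w => A (fun i => w (Fin.castAdd q i)) * B (fun j => w (Fin.natAdd p j))) v := by
  rw [wedge_alt_right a b B hb]
  simp only [ha, alt, Finset.sum_mul, Finset.mul_sum]
  rw [Finset.sum_comm]
  have h1 : ∀ τ : Equiv.Perm (Fin p), ∑ σ : Equiv.Perm (Fin (p + q)), (p.factorial : ℂ)⁻¹ *
        (((Equiv.Perm.sign σ : ℤ) : ℂ) * (((Equiv.Perm.sign τ : ℤ) : ℂ) *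
          A (fun i => v (σ (Fin.castAdd q (τ i)))) * B (fun j => v (σ (Fin.natAdd p j))))) =
        (p.factorial : ℂ)⁻¹ * ∑ σ : Equiv.Perm (Fin (p + q)), ((Equiv.Perm.sign σ : ℤ) : ℂ) *
        (A (fun i => v (σ (Fin.castAdd q i))) * B (fun j => v (σ (Fin.natAdd p j)))) := by
    intro τ
    have h2 := sum_sign_mul_right (fun σ : Equiv.Perm (Fin (p + q)) =>
      (A (fun i => v (σ (Fin.castAdd q i))) * B (fun j => v (σ (Fin.natAdd p j)))))
      (blockPerm τ 1)
    simp only [Equiv.Perm.mul_apply, blockPerm_castAdd, blockPerm_natAdd, sign_blockPerm,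
      Equiv.Perm.one_apply, map_one, mul_one] at h2
    have h : ((Equiv.Perm.sign τ : ℤ) : ℂ) * ((Equiv.Perm.sign τ : ℤ) : ℂ) = 1 := by
      rw [← Int.cast_mul, ← Units.val_mul, Int.units_mul_self]; simp
    rw [← one_mul (∑ σ : Equiv.Perm (Fin (p + q)), _ * (_ * B (fun j => v (σ (Fin.natAdd p j))))),
      ← h, mul_assoc, ← h2, Finset.mul_sum, Finset.mul_sum]
    refine Finset.sum_congr rfl fun σ _ => by ring
  rw [Finset.sum_congr rfl fun τ _ => h1 τ, Finset.sum_const, Finset.card_univ,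
    Fintype.card_perm, Fintype.card_fin, nsmul_eq_mul]
  have : (p.factorial : ℂ) ≠ 0 := by exact_mod_cast p.factorial_ne_zero
  rw [← mul_assoc, mul_inv_cancel₀ this, one_mul]

/-- The place `2 l + b` of the `b`-th argument (`b = 0, 1`) of the `l`-th factor in a product of
`k` two-forms. -/
def place {k : ℕ} (l : Fin k) (b : Fin 2) : Fin (2 * k) := ⟨2 * l + b, by omega⟩

/-- A power of a two-form is the alternating sum of a product over pairs of adjacent places. -/
theorem wedgePow_eq_alt {V : Type*} (a : (Fin 2 → V) → ℝ) (B : V → V → ℂ)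
    (ha : ∀ v, (a v : ℂ) = B (v 0) (v 1) - B (v 1) (v 0)) (k : ℕ) (v : Fin (2 * k) → V) :
    ((wedgePow a k v : ℝ) : ℂ) =
      alt (fun w => ∏ l : Fin k, B (w (place l 0)) (w (place l 1))) v := by
  induction k with
  | zero => simp [wedgePow, alt]
  | succ k ih =>
    have ha' : ∀ v, (a v : ℂ) = alt (fun w : Fin 2 → V => B (w 0) (w 1)) v := by
      intro v
      have : (Finset.univ : Finset (Equiv.Perm (Fin 2))) = {1, Equiv.swap 0 1} := by decide
      rw [ha, alt, this, Finset.sum_pair (by decide)]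
      simp
      ring
    have h := wedge_alt (wedgePow a k) a _ _ ih ha' v
    rw [wedgePow]
    refine h.trans ?_
    unfold alt
    refine Finset.sum_congr rfl fun σ _ => ?_
    congr 1
    beta_reduce
    rw [Fin.prod_univ_castSucc]
    rfl

/-! ### Contraction of alternating products with vertical vectors -/

section Contraction

variable {S P Q : Type*} [Fintype S] [DecidableEq S] [Fintype P] [DecidableEq P] [Fintype Q]
  [DecidableEq Q]

/-- Laplace expansion of a determinant along the blocks `P` and `Q` of its columns. -/
theorem laplace_fromCols (f : Matrix (P ⊕ Q) P ℂ) (e : Matrix (P ⊕ Q) Q ℂ) :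
    ∑ σ : Equiv.Perm (P ⊕ Q), ((Equiv.Perm.sign σ : ℤ) : ℂ) *
      ((f.submatrix (fun p => σ (Sum.inl p)) id).det * ∏ q, e (σ (Sum.inr q)) q) =
    ((Fintype.card P).factorial : ℂ) * (Matrix.fromCols f e).det := by
  have h0 : (Matrix.fromCols f e).det = ∑ σ : Equiv.Perm (P ⊕ Q), ((Equiv.Perm.sign σ : ℤ) : ℂ) *
      ((∏ p, f (σ (Sum.inl p)) p) * ∏ q, e (σ (Sum.inr q)) q) := by
    rw [Matrix.det_apply']
    refine Finset.sum_congr rfl fun σ _ => ?_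
    rw [Fintype.prod_sum_type]
    simp
  rw [h0]
  simp only [Matrix.det_apply', Matrix.submatrix_apply, id, Finset.sum_mul, Finset.mul_sum]
  rw [Finset.sum_comm]
  have h1 : ∀ τ : Equiv.Perm P, ∑ σ : Equiv.Perm (P ⊕ Q), ((Equiv.Perm.sign σ : ℤ) : ℂ) *
      (((Equiv.Perm.sign τ : ℤ) : ℂ) * (∏ p, f (σ (Sum.inl (τ p))) p) *
        ∏ q, e (σ (Sum.inr q)) q) = ∑ σ : Equiv.Perm (P ⊕ Q), ((Equiv.Perm.sign σ : ℤ) : ℂ) *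
      ((∏ p, f (σ (Sum.inl p)) p) * ∏ q, e (σ (Sum.inr q)) q) := by
    intro τ
    have h2 := sum_sign_mul_right (fun σ : Equiv.Perm (P ⊕ Q) =>
      (∏ p, f (σ (Sum.inl p)) p) * ∏ q, e (σ (Sum.inr q)) q) (Equiv.Perm.sumCongr τ 1)
    simp only [Equiv.Perm.mul_apply, Equiv.Perm.sumCongr_apply, Sum.map_inl, Sum.map_inr,
      Equiv.Perm.one_apply, Equiv.Perm.sign_sumCongr, map_one, mul_one] at h2
    have h : ((Equiv.Perm.sign τ : ℤ) : ℂ) * ((Equiv.Perm.sign τ : ℤ) : ℂ) = 1 := by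
      rw [← Int.cast_mul, ← Units.val_mul, Int.units_mul_self]; simp
    rw [← one_mul (∑ σ : Equiv.Perm (P ⊕ Q), _ * ((∏ p, f (σ (Sum.inl p)) p) * _)),
      ← h, mul_assoc, ← h2, Finset.mul_sum]
    refine Finset.sum_congr rfl fun σ _ => by ring
  rw [Finset.sum_congr rfl fun τ _ => h1 τ, Finset.sum_const, Finset.card_univ,
    Fintype.card_perm, nsmul_eq_mul]
  simp only [Finset.mul_sum]

/-- Rows of a matrix over `ℂ` can be moved off the singular locus by adding a multiple of the
identity. -/
theorem eq_of_eq_on_det_ne_zero (a : Matrix S S ℂ) (F G : ℂ → ℂ) (hF : Continuous F)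
    (hG : Continuous G) (h : ∀ t, (a + Matrix.scalar S t).det ≠ 0 → F t = G t) : F 0 = G 0 := by
  have hfin : Set.Finite {t : ℂ | (Matrix.charpoly (-a)).IsRoot t} :=
    Polynomial.finite_setOfPred_isRoot (Matrix.charpoly_monic _).ne_zero
  have hd : Dense {t : ℂ | (Matrix.charpoly (-a)).IsRoot t}ᶜ := hfin.countable.dense_compl ℝ
  have : F = G := by
    refine Continuous.ext_on hd hF hG fun t ht => h t ?_
    intro h0
    apply ht
    rw [Set.mem_ofPred_eq, Polynomial.IsRoot.def, Matrix.eval_charpoly, sub_neg_eq_add, add_comm]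
    exact h0
  rw [this]

/-- Contraction with the vectors indexed by `S`, on which the covectors indexed by `Q` vanish,
commutes with exterior multiplication by those covectors. -/
theorem contraction_formula (a : Matrix S S ℂ) (b : Matrix S P ℂ) (c : Matrix (P ⊕ Q) S ℂ)
    (d : Matrix (P ⊕ Q) P ℂ) (e : Matrix (P ⊕ Q) Q ℂ) :
    ∑ σ : Equiv.Perm (P ⊕ Q), ((Equiv.Perm.sign σ : ℤ) : ℂ) *
      ((Matrix.fromBlocks a b (c.submatrix (fun p => σ (Sum.inl p)) id)
        (d.submatrix (fun p => σ (Sum.inl p)) id)).det * ∏ q, e (σ (Sum.inr q)) q) =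
    ((Fintype.card P).factorial : ℂ) *
      (Matrix.fromBlocks a (Matrix.fromCols b 0) c (Matrix.fromCols d e)).det := by
  have key := eq_of_eq_on_det_ne_zero a
    (fun t => ∑ σ : Equiv.Perm (P ⊕ Q), ((Equiv.Perm.sign σ : ℤ) : ℂ) *
      ((Matrix.fromBlocks (a + Matrix.scalar S t) b (c.submatrix (fun p => σ (Sum.inl p)) id)
        (d.submatrix (fun p => σ (Sum.inl p)) id)).det * ∏ q, e (σ (Sum.inr q)) q))
    (fun t => ((Fintype.card P).factorial : ℂ) *
      (Matrix.fromBlocks (a + Matrix.scalar S t) (Matrix.fromCols b 0) c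
        (Matrix.fromCols d e)).det) ?_ ?_ ?_
  · simpa using key
  · have hc : Continuous fun t : ℂ => a + Matrix.scalar S t := by
      refine continuous_const.add ?_
      refine continuous_matrix fun i j => ?_
      by_cases hij : i = j
      · simpa [Matrix.scalar_apply, hij] using continuous_id'
      · simpa [Matrix.scalar_apply, hij] using continuous_const
    refine continuous_finsetSum _ fun σ _ => continuous_const.mul (Continuous.mul ?_ continuous_const)
    exact (hc.matrix_fromBlocks continuous_const continuous_const continuous_const).matrix_det
  · have hc : Continuous fun t : ℂ => a + Matrix.scalar S t := by
      refine continuous_const.add ?_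
      refine continuous_matrix fun i j => ?_
      by_cases hij : i = j
      · simpa [Matrix.scalar_apply, hij] using continuous_id'
      · simpa [Matrix.scalar_apply, hij] using continuous_const
    exact continuous_const.mul
      (hc.matrix_fromBlocks continuous_const continuous_const continuous_const).matrix_det
  · intro t ht
    set a' := a + Matrix.scalar S t
    have : Invertible a' := Matrix.invertibleOfIsUnitDet _ (isUnit_iff_ne_zero.2 ht)
    rw [Matrix.det_fromBlocks₁₁, mul_left_comm]
    have h2 : Matrix.fromCols d e - c * ⅟a' * Matrix.fromCols b 0 =
        Matrix.fromCols (d - c * ⅟a' * b) e := by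
      rw [Matrix.mul_fromCols, Matrix.mul_zero]
      ext i (j | j) <;> simp
    rw [h2, ← laplace_fromCols, Finset.mul_sum]
    refine Finset.sum_congr rfl fun σ _ => ?_
    rw [Matrix.det_fromBlocks₁₁, mul_assoc, mul_left_comm]
    rfl

end Contraction

/-! ### Mixed discriminants -/

section MixedDet

variable {κ ν : Type*} [Fintype κ] [DecidableEq κ] [Fintype ν] [DecidableEq ν]

/-- The mixed discriminant of a family of matrices: the complete polarization of `card! • det`. -/
def mixedDet (A : κ → Matrix ν ν ℂ) : ℂ :=
  ∑ J : κ ≃ ν, ∑ K : κ ≃ ν, ((Equiv.Perm.sign (J.trans K.symm) : ℤ) : ℂ) * ∏ l, A l (J l) (K l)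

theorem mixedDet_const (e : κ ≃ ν) (M : Matrix ν ν ℂ) :
    mixedDet (fun _ : κ => M) = ((Fintype.card κ).factorial : ℂ) * M.det := by
  have h : ∀ J : κ ≃ ν, ∑ K : κ ≃ ν, ((Equiv.Perm.sign (J.trans K.symm) : ℤ) : ℂ) *
      ∏ l, M (J l) (K l) = M.det := by
    intro J
    rw [← Matrix.det_transpose, Matrix.det_apply', ← Equiv.sum_comp (Equiv.equivCongr J.symm
      (Equiv.refl ν) : (ν ≃ ν) ≃ (κ ≃ ν))]
    refine Finset.sum_congr rfl fun K _ => ?_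
    congr 1
    · congr 2
      rw [← Equiv.Perm.sign_inv, ← Equiv.Perm.sign_permCongr J]
      congr 1
      ext x
      simp [Equiv.equivCongr, Equiv.Perm.inv_def]
    · rw [← Equiv.prod_comp J]
      simp [Equiv.equivCongr]
  rw [mixedDet, Finset.sum_congr rfl fun J _ => h J, Finset.sum_const, Finset.card_univ,
    Fintype.card_equiv e, nsmul_eq_mul]

theorem mixedDet_comp_perm (A : κ → Matrix ν ν ℂ) (ρ : Equiv.Perm κ) :
    mixedDet (fun l => A (ρ l)) = mixedDet A := by
  rw [mixedDet, ← Equiv.sum_comp (Equiv.equivCongr ρ.symm (Equiv.refl ν)), mixedDet]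
  refine Finset.sum_congr rfl fun J _ => ?_
  rw [← Equiv.sum_comp (Equiv.equivCongr ρ.symm (Equiv.refl ν))]
  refine Finset.sum_congr rfl fun K _ => ?_
  congr 1
  · congr 2
    rw [← Equiv.Perm.sign_permCongr ρ]
    congr 1
    ext x
    simp [Equiv.equivCongr]
  · conv_rhs => rw [← Equiv.prod_comp ρ]
    simp [Equiv.equivCongr]

/-- The mixed discriminant of `α` copies of `H` and `β` copies of `G` is, up to factorials, the
coefficient of `X ^ β` in `det (H + X G)`. -/
theorem mixedDet_elim {α β : Type*} [Fintype α] [DecidableEq α] [Fintype β] [DecidableEq β]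
    (e : α ⊕ β ≃ ν) (H G : Matrix ν ν ℂ) :
    mixedDet (Sum.elim (fun _ : α => H) (fun _ : β => G)) =
      ((Fintype.card α).factorial * (Fintype.card β).factorial : ℂ) *
        ((H.map Polynomial.C + (Polynomial.X : Polynomial ℂ) • G.map Polynomial.C).det).coeff
          (Fintype.card β) := by
  classical
  set p : Polynomial ℂ :=
    (H.map Polynomial.C + (Polynomial.X : Polynomial ℂ) • G.map Polynomial.C).det with hp
  set AS : Finset (α ⊕ β) → (α ⊕ β) → Matrix ν ν ℂ := fun S l => if l ∈ S then G else H with hAS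
  set q : Polynomial ℂ := ∑ S : Finset (α ⊕ β), Polynomial.C (mixedDet (AS S)) *
    Polynomial.X ^ S.card with hq
  have hpq : Polynomial.C ((Fintype.card (α ⊕ β)).factorial : ℂ) * p = q := by
    refine Polynomial.funext fun t => ?_
    have hev : p.eval t = (H + t • G).det := by
      rw [hp, ← Polynomial.coe_evalRingHom, RingHom.map_det]
      congr 1
      ext i j
      simp only [RingHom.mapMatrix_apply, Matrix.map_apply, Matrix.add_apply, Matrix.smul_apply,
        Polynomial.coe_evalRingHom, Polynomial.eval_add, Polynomial.eval_C, smul_eq_mul,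
        Polynomial.eval_mul, Polynomial.eval_X]
    rw [Polynomial.eval_mul, Polynomial.eval_C, hev, ← mixedDet_const e, hq,
      Polynomial.eval_finsetSum]
    simp only [Polynomial.eval_mul, Polynomial.eval_C, Polynomial.eval_pow, Polynomial.eval_X]
    simp only [mixedDet, Finset.sum_mul]
    conv_rhs => rw [Finset.sum_comm]
    refine Finset.sum_congr rfl fun J _ => ?_
    conv_rhs => rw [Finset.sum_comm]
    refine Finset.sum_congr rfl fun K _ => ?_
    have : ∏ l, (H + t • G) (J l) (K l) = ∑ S : Finset (α ⊕ β),
        (∏ l, AS S l (J l) (K l)) * t ^ S.card := by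
      simp only [Matrix.add_apply, Matrix.smul_apply, smul_eq_mul]
      rw [show (∏ l, (H (J l) (K l) + t * G (J l) (K l))) =
        ∏ l, (t * G (J l) (K l) + H (J l) (K l)) from
          Finset.prod_congr rfl fun l _ => add_comm _ _, Fintype.prod_add]
      refine Finset.sum_congr rfl fun S _ => ?_
      rw [← Finset.prod_mul_prod_compl S, Finset.prod_mul_distrib, Finset.prod_const]
      have h1 : ∏ l ∈ S, AS S l (J l) (K l) = ∏ l ∈ S, G (J l) (K l) :=
        Finset.prod_congr rfl fun l hl => by simp [hAS, hl]
      have h2 : ∏ l ∈ Sᶜ, AS S l (J l) (K l) = ∏ l ∈ Sᶜ, H (J l) (K l) :=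
        Finset.prod_congr rfl fun l hl => by
          simp [hAS, Finset.mem_compl.1 hl]
      rw [h1, h2]
      ring
    rw [this, Finset.mul_sum]
    refine Finset.sum_congr rfl fun S _ => by ring
  have hcoeff := congrArg (fun r => r.coeff (Fintype.card β)) hpq
  simp only [Polynomial.coeff_C_mul, hq, Polynomial.finsetSum_coeff, Polynomial.coeff_X_pow,
    mul_ite, mul_one, mul_zero] at hcoeff
  set S₀ : Finset (α ⊕ β) := Finset.univ.map Function.Embedding.inr with hS₀
  have hS₀c : S₀.card = Fintype.card β := by simp [hS₀, Finset.card_univ]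
  have hA₀ : AS S₀ = Sum.elim (fun _ : α => H) (fun _ : β => G) := by
    ext (l | l) <;> simp [hAS, hS₀]
  have hall : ∀ S : Finset (α ⊕ β), S.card = Fintype.card β → mixedDet (AS S) = mixedDet (AS S₀) := by
    intro S hS
    obtain ⟨ρ, hρ⟩ : ∃ ρ : Equiv.Perm (α ⊕ β), ∀ l, ρ l ∈ S₀ ↔ l ∈ S := by
      have e1 : {l // l ∈ S} ≃ {l // l ∈ S₀} := Fintype.equivOfCardEq (by simp [hS, hS₀c])
      refine ⟨e1.extendSubtype, fun l => ?_⟩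
      by_cases hl : l ∈ S
      · simp only [hl, iff_true]
        exact e1.extendSubtype_mem _ hl
      · simp only [hl, iff_false]
        exact e1.extendSubtype_not_mem _ hl
    rw [← mixedDet_comp_perm (AS S₀) ρ]
    congr 1
    ext l : 1
    simp [hAS, hρ]
  have hsum : (∑ S : Finset (α ⊕ β), if Fintype.card β = S.card then mixedDet (AS S) else 0) =
      ((Fintype.card (α ⊕ β)).choose (Fintype.card β) : ℂ) * mixedDet (AS S₀) := by
    rw [← Finset.sum_filter, Finset.sum_congr rfl fun S hS => hall S (Finset.mem_filter.1 hS).2.symm,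
      Finset.sum_const, nsmul_eq_mul]
    congr 2
    rw [← Finset.card_univ (α := α ⊕ β), ← Finset.card_powersetCard]
    congr 1
    ext S
    simp [Finset.mem_powersetCard, eq_comm]
  rw [hsum, hA₀] at hcoeff
  have hch : ((Fintype.card (α ⊕ β)).factorial : ℂ) =
      ((Fintype.card (α ⊕ β)).choose (Fintype.card β) : ℂ) *
        ((Fintype.card α).factorial * (Fintype.card β).factorial) := by
    have := Nat.choose_mul_factorial_mul_factorial
      (show Fintype.card β ≤ Fintype.card (α ⊕ β) by simp)
    rw [Fintype.card_sum, Nat.add_sub_cancel] at this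
    rw [Fintype.card_sum, ← this]
    push_cast
    ring
  have hne : ((Fintype.card (α ⊕ β)).choose (Fintype.card β) : ℂ) ≠ 0 := by
    exact_mod_cast (Nat.choose_pos (by simp)).ne'
  rw [hch, mul_assoc] at hcoeff
  exact (mul_left_cancel₀ hne hcoeff).symm

end MixedDet

/-! ### Powers of `(1,1)`-forms on a complex frame -/

/-- The sesquilinear form `∑ i H_{jk} v_j \bar w_k`, whose skew part is `formOfMatrix H`. -/
def sesq {N : ℕ} (H : Matrix (Fin N) (Fin N) ℂ) (v w : Cn N) : ℂ :=
  ∑ j, ∑ k, Complex.I * H j k * (v j * (starRingEnd ℂ) (w k))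

theorem formOfMatrix_eq_sesq {N : ℕ} {H : Matrix (Fin N) (Fin N) ℂ} (hH : H.IsHermitian)
    (v : Fin 2 → Cn N) :
    (formOfMatrix H v : ℂ) = sesq H (v 0) (v 1) - sesq H (v 1) (v 0) := by
  have h1 : sesq H (v 0) (v 1) - sesq H (v 1) (v 0) = ∑ j, ∑ k, Complex.I * H j k *
    (v 0 j * (starRingEnd ℂ) (v 1 k) - v 1 j * (starRingEnd ℂ) (v 0 k)) := by
    simp only [sesq, mul_sub, Finset.sum_sub_distrib]
  rw [h1, formOfMatrix]
  refine Complex.conj_eq_iff_re.1 ?_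
  simp only [map_sum, map_mul, map_sub, Complex.conj_conj, Complex.conj_I]
  rw [Finset.sum_comm]
  refine Finset.sum_congr rfl fun j _ => Finset.sum_congr rfl fun k _ => ?_
  have : (starRingEnd ℂ) (H k j) = H j k := by
    have := congrFun (congrFun hH j) k
    simpa [Matrix.conjTranspose_apply] using this
  rw [this]
  ring

/-- The complex-valued covectors `dz^j` (second index `0`) and `d\bar z^j` (second index `1`). -/
def covec {N : ℕ} (r : Fin N × Fin 2) (v : Cn N) : ℂ :=
  if r.2 = 0 then v r.1 else (starRingEnd ℂ) (v r.1)

/-- The choice of `dz^{J_l}` and `d\bar z^{K_l}` given by `P_l = (J_l, K_l)`. -/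
def sel {κ ν : Type*} (P : κ → ν × ν) (r : κ × Fin 2) : ν × Fin 2 :=
  (if r.2 = 0 then (P r.1).1 else (P r.1).2, r.2)

theorem prod_sesq {κ : Type*} [Fintype κ] [DecidableEq κ] {N : ℕ}
    (H : κ → Matrix (Fin N) (Fin N) ℂ) (v : κ × Fin 2 → Cn N) :
    ∏ l, sesq (H l) (v (l, 0)) (v (l, 1)) =
      ∑ P : κ → Fin N × Fin N, (∏ l, Complex.I * H l (P l).1 (P l).2) *
        ∏ r, covec (sel P r) (v r) := by
  have h : ∀ l, sesq (H l) (v (l, 0)) (v (l, 1)) = ∑ p : Fin N × Fin N,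
      Complex.I * H l p.1 p.2 * (v (l, 0) p.1 * (starRingEnd ℂ) (v (l, 1) p.2)) := by
    intro l
    rw [sesq, ← Fintype.sum_prod_type']
  rw [Finset.prod_congr rfl fun l _ => h l, Finset.prod_univ_sum, Fintype.piFinset_univ]
  refine Finset.sum_congr rfl fun P _ => ?_
  rw [Finset.prod_mul_distrib]
  congr 1
  rw [Fintype.prod_prod_type]
  refine Finset.prod_congr rfl fun l _ => ?_
  simp [Fin.prod_univ_two, covec, sel]

/-- The numbering of the places of `k` two-forms. -/
def placeEquiv (k : ℕ) : Fin k × Fin 2 ≃ Fin (2 * k) where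
  toFun r := place r.1 r.2
  invFun i := (⟨i / 2, by omega⟩, ⟨i % 2, by omega⟩)
  left_inv r := by
    rcases r with ⟨⟨l, hl⟩, ⟨b, hb⟩⟩
    simp only [place, Prod.mk.injEq, Fin.mk.injEq]
    omega
  right_inv i := by
    simp only [place]
    ext
    simp only
    omega

/-- The matrix of values of the covectors selected by `P` on the vectors `v`. -/
def covMat {κ : Type*} {N : ℕ} (P : κ → Fin N × Fin N) {ρ : Type*} (v : ρ → Cn N) :
    Matrix ρ (κ × Fin 2) ℂ :=
  Matrix.of fun x r => covec (sel P r) (v x)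

/-- The power `(i H)^k`, expanded as a sum over all choices `P` of monomials `dz^a ∧ dz̄^b`, one for
each factor; the value of the product of the chosen monomials is a determinant of coordinates. -/
theorem wedgePow_formOfMatrix {N : ℕ} {H : Matrix (Fin N) (Fin N) ℂ} (hH : H.IsHermitian)
    (k : ℕ) (v : Fin (2 * k) → Cn N) :
    ((wedgePow (formOfMatrix H) k v : ℝ) : ℂ) =
      ∑ P : Fin k → Fin N × Fin N, (∏ l, Complex.I * H (P l).1 (P l).2) *
        (covMat P (fun r => v (placeEquiv k r))).det := by
  rw [wedgePow_eq_alt _ (sesq H) (formOfMatrix_eq_sesq hH), alt]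
  have h1 : ∀ σ : Equiv.Perm (Fin (2 * k)), ∏ l : Fin k, sesq H (v (σ (place l 0)))
      (v (σ (place l 1))) = ∑ P : Fin k → Fin N × Fin N,
        (∏ l, Complex.I * H (P l).1 (P l).2) *
          ∏ r, covec (sel P r) (v (σ (placeEquiv k r))) := fun σ =>
    prod_sesq (fun _ => H) (fun r => v (σ (placeEquiv k r)))
  simp only [h1, Finset.mul_sum]
  rw [Finset.sum_comm]
  refine Finset.sum_congr rfl fun P _ => ?_
  rw [Matrix.det_apply', Finset.mul_sum, ← Equiv.sum_comp (placeEquiv k).permCongr]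
  refine Finset.sum_congr rfl fun σ _ => ?_
  rw [Equiv.Perm.sign_permCongr, mul_left_comm]
  simp [covMat]

/-- The real frame vector `∂/∂(Re z^j)` or `∂/∂(Im z^j)`. -/
def stdVec {N : ℕ} (r : Fin N × Fin 2) : Cn N :=
  Pi.single r.1 (if r.2 = 0 then 1 else Complex.I)

theorem frame_eq {N : ℕ} (i : ℕ) (hi : i / 2 < N) :
    frame N i = stdVec (⟨i / 2, hi⟩, ⟨i % 2, Nat.mod_lt _ two_pos⟩) := by
  ext k
  have : (k : ℕ) = i / 2 ↔ k = ⟨i / 2, hi⟩ := by rw [Fin.ext_iff]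
  by_cases hk : k = ⟨i / 2, hi⟩
  · subst hk
    simp only [frame, stdVec, Pi.single_eq_same, if_true]
    by_cases h2 : i % 2 = 0 <;> simp [h2, Fin.ext_iff]
  · simp [frame, stdVec, this, hk]

section Std

variable {κ : Type*} [Fintype κ] [DecidableEq κ] {N : ℕ}

theorem det_covMat_std_same (e : κ ≃ Fin N) :
    (covMat (fun l => (e l, e l)) (fun r : κ × Fin 2 => stdVec (e r.1, r.2))).det =
      (-2 * Complex.I) ^ N := by
  have h : covMat (fun l => (e l, e l)) (fun r : κ × Fin 2 => stdVec (e r.1, r.2)) =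
      (Matrix.blockDiagonal (fun _ : κ => !![(1 : ℂ), 1; Complex.I, -Complex.I])).submatrix
        (Equiv.prodComm κ (Fin 2)) (Equiv.prodComm κ (Fin 2)) := by
    ext ⟨x, b⟩ ⟨l, c⟩
    simp only [covMat, covec, sel, stdVec, Matrix.of_apply, Matrix.submatrix_apply,
      Equiv.prodComm_apply, Prod.swap_prod_mk, Matrix.blockDiagonal_apply, ite_self]
    by_cases hx : x = l
    · subst hx
      fin_cases b <;> fin_cases c <;> simp
    · have : e l ≠ e x := fun h => hx (e.injective h).symm
      fin_cases b <;> fin_cases c <;> simp [hx, this]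
  rw [h, Matrix.det_submatrix_equiv_self, Matrix.det_blockDiagonal, Finset.prod_const,
    Finset.card_univ, Fintype.card_congr e, Fintype.card_fin]
  congr 1
  rw [Matrix.det_fin_two_of]
  ring

/-- The product of monomials given by bijections `J`, `K`, evaluated on the standard frame: each pair
`∂/∂x, ∂/∂y` contributes `(dz ∧ dz̄)(∂/∂x, ∂/∂y) = -2 i`. -/
theorem det_covMat_std_equiv (e J K : κ ≃ Fin N) :
    (covMat (fun l => (J l, K l)) (fun r : κ × Fin 2 => stdVec (e r.1, r.2))).det =
      ((Equiv.Perm.sign (J.trans K.symm) : ℤ) : ℂ) * (-2 * Complex.I) ^ N := by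
  set τ : Fin 2 → Equiv.Perm κ := fun b => if b = 0 then J.trans e.symm else K.trans e.symm
  have h : covMat (fun l => (J l, K l)) (fun r : κ × Fin 2 => stdVec (e r.1, r.2)) =
      (covMat (fun l => (e l, e l)) (fun r : κ × Fin 2 => stdVec (e r.1, r.2))).submatrix id
        (Equiv.prodCongrLeft τ) := by
    ext x ⟨l, c⟩
    fin_cases c <;> simp [covMat, covec, sel, τ, Equiv.prodCongrLeft]
  rw [h, Matrix.det_permute', det_covMat_std_same, Equiv.Perm.sign_prodCongrLeft]
  congr 3
  rw [Fin.prod_univ_two]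
  have hK : Equiv.Perm.sign (K.trans e.symm) = Equiv.Perm.sign (e.trans K.symm) := by
    rw [← Equiv.Perm.sign_inv]; rfl
  have h3 : J.trans K.symm = (e.trans K.symm) * (J.trans e.symm) := by
    ext x; simp
  simp only [τ, if_true, one_ne_zero, if_false, h3, map_mul, hK, mul_comm]

theorem det_covMat_eq_zero (P : κ → Fin N × Fin N) (v : κ × Fin 2 → Cn N)
    (h : ¬ (Function.Injective (fun l => (P l).1) ∧ Function.Injective (fun l => (P l).2))) :
    (covMat P v).det = 0 := by
  rw [not_and_or] at h
  rcases h with h | h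
  · simp only [Function.Injective, not_forall] at h
    obtain ⟨a, b, hab, hne⟩ := h
    refine Matrix.det_zero_of_column_eq (i := (a, 0)) (j := (b, 0)) (by simpa using hne) fun x => ?_
    simp [covMat, sel, hab]
  · simp only [Function.Injective, not_forall] at h
    obtain ⟨a, b, hab, hne⟩ := h
    refine Matrix.det_zero_of_column_eq (i := (a, 1)) (j := (b, 1)) (by simpa using hne) fun x => ?_
    simp [covMat, sel, hab]

/-- The product of the `(1,1)`-forms given by `A_l` on the standard frame of `ℂ^N`. -/
theorem sum_covMat_std (e : κ ≃ Fin N) (A : κ → Matrix (Fin N) (Fin N) ℂ) :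
    ∑ P : κ → Fin N × Fin N, (∏ l, Complex.I * A l (P l).1 (P l).2) *
      (covMat P (fun r : κ × Fin 2 => stdVec (e r.1, r.2))).det = 2 ^ N * mixedDet A := by
  classical
  have hcard : Fintype.card κ = N := by rw [Fintype.card_congr e, Fintype.card_fin]
  set f : (κ ≃ Fin N) × (κ ≃ Fin N) → (κ → Fin N × Fin N) := fun JK l => (JK.1 l, JK.2 l) with hf
  have hinj : Function.Injective f := by
    rintro ⟨J, K⟩ ⟨J', K'⟩ h
    have h1 : ∀ l, J l = J' l := fun l => congrArg Prod.fst (congrFun h l)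
    have h2 : ∀ l, K l = K' l := fun l => congrArg Prod.snd (congrFun h l)
    rw [Equiv.ext h1, Equiv.ext h2]
  rw [mixedDet, ← Fintype.sum_prod_type', Finset.mul_sum]
  symm
  refine Finset.sum_of_injOn f hinj.injOn (fun _ _ => Finset.mem_coe.2 (Finset.mem_univ _))
    (fun P _ hP => ?_) (fun JK _ => ?_)
  · rw [det_covMat_eq_zero, mul_zero]
    rintro ⟨h1, h2⟩
    apply hP
    have hb1 := (Fintype.bijective_iff_injective_and_card _).2 ⟨h1, by simpa using hcard⟩
    have hb2 := (Fintype.bijective_iff_injective_and_card _).2 ⟨h2, by simpa using hcard⟩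
    exact ⟨(Equiv.ofBijective _ hb1, Equiv.ofBijective _ hb2), Finset.mem_coe.2 (Finset.mem_univ _),
      rfl⟩
  · simp only [hf]
    rw [det_covMat_std_equiv, Finset.prod_mul_distrib, Finset.prod_const, Finset.card_univ, hcard]
    have h2 : Complex.I ^ N * (-2 * Complex.I) ^ N = 2 ^ N := by
      rw [← mul_pow]
      congr 1
      linear_combination (-2) * Complex.I_mul_I
    linear_combination (-((Equiv.Perm.sign (JK.1.trans JK.2.symm) : ℤ) : ℂ) *
      ∏ l, A l (JK.1 l) (JK.2 l)) * h2

end Std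

/-- The top power of a `(1,1)`-form on the standard frame. -/
theorem wedgePow_frame {N : ℕ} {H : Matrix (Fin N) (Fin N) ℂ} (hH : H.IsHermitian) :
    ((wedgePow (formOfMatrix H) N (fun j => frame N j) : ℝ) : ℂ) =
      2 ^ N * N.factorial * H.det := by
  rw [wedgePow_formOfMatrix hH]
  have : (fun r : Fin N × Fin 2 => frame N (placeEquiv N r)) =
      fun r => stdVec ((Equiv.refl (Fin N)) r.1, r.2) := by
    funext r
    rw [frame_eq _ (by omega)]
    congr 1
    exact (placeEquiv N).symm_apply_apply r
  rw [this, sum_covMat_std (Equiv.refl (Fin N)) (fun _ => H), mixedDet_const (Equiv.refl _),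
    Fintype.card_fin, mul_assoc]

/-! ### Fibre contraction of powers of `(1,1)`-forms -/

/-- The matrix on `ℂ^m × ℂ^n` that is `G` on the base directions and zero elsewhere. -/
def pad {m : ℕ} (n : ℕ) (G : Matrix (Fin m) (Fin m) ℂ) : Matrix (Fin (m + n)) (Fin (m + n)) ℂ :=
  (Matrix.fromBlocks G 0 0 0).submatrix finSumFinEquiv.symm finSumFinEquiv.symm

section pad
variable {m n : ℕ} (G : Matrix (Fin m) (Fin m) ℂ)

@[simp] theorem pad_castAdd_castAdd (i j : Fin m) :
    pad n G (Fin.castAdd n i) (Fin.castAdd n j) = G i j := by simp [pad]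

@[simp] theorem pad_natAdd_left (i : Fin n) (j : Fin (m + n)) :
    pad n G (Fin.natAdd m i) j = 0 := by
  simp only [pad, Matrix.submatrix_apply, finSumFinEquiv_symm_apply_natAdd]
  cases finSumFinEquiv.symm j <;> simp

@[simp] theorem pad_natAdd_right (i : Fin (m + n)) (j : Fin n) :
    pad n G i (Fin.natAdd m j) = 0 := by
  simp only [pad, Matrix.submatrix_apply, finSumFinEquiv_symm_apply_natAdd]
  cases finSumFinEquiv.symm i <;> simp

end pad

theorem sesq_pad {m n : ℕ} (G : Matrix (Fin m) (Fin m) ℂ) (v w : Cn m) :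
    sesq (pad n G) (Fin.append v (0 : Cn n)) (Fin.append w (0 : Cn n)) = sesq G v w := by
  simp [sesq, Fin.sum_univ_add]

theorem stdVec_eq_frame {N : ℕ} (r : Fin N × Fin 2) : stdVec r = frame N (2 * r.1 + r.2) := by
  rw [frame_eq _ (by omega)]
  congr 1
  ext <;> simp <;> omega

theorem append_frame_zero {m n j : ℕ} (hj : j < 2 * m) :
    Fin.append (frame m j) (0 : Cn n) = frame (m + n) j := by
  ext k
  refine Fin.addCases (fun i => ?_) (fun i => ?_) k
  · simp [frame]
  · have : ¬ (m + (i : ℕ) = j / 2) := by omega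
    simp [frame, this]

theorem append_zero_frame {m n j : ℕ} :
    Fin.append (0 : Cn m) (frame n j) = frame (m + n) (2 * m + j) := by
  ext k
  refine Fin.addCases (fun i => ?_) (fun i => ?_) k
  · have : ¬ ((i : ℕ) = (2 * m + j) / 2) := by omega
    simp [frame, this]
  · have h1 : (m + (i : ℕ) = (2 * m + j) / 2) ↔ (i : ℕ) = j / 2 := by omega
    have h2 : (2 * m + j) % 2 = j % 2 := by omega
    simp [frame, h1, h2]

/-- The vectors `w̃_1, …, w̃_p, ∂/∂(Re v¹), ∂/∂(Im v¹), …` that enter fibre integration. -/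
def liftFrame {m : ℕ} (n : ℕ) {p : ℕ} (w : Fin p → Cn m) (j : ℕ) : Cn (m + n) :=
  if hj : j < p then Fin.append (w ⟨j, hj⟩) (0 : Cn n) else Fin.append (0 : Cn m) (frame n (j - p))

section Lift

variable {m n k q : ℕ}

/-- The numbering of the coordinates of `ℂ^m × ℂ^n` by the factors of a product of `n + k` and `q`
two-forms: the first `k` of the `n + k` factors and the `q` factors belong to the base. -/
def factorCoord (hkq : k + q = m) : Fin (n + k) ⊕ Fin q ≃ Fin (m + n) :=
  Equiv.ofBijective
    (Sum.elim (fun l => if hl : (l : ℕ) < k then ⟨l, by omega⟩ else ⟨m + (l - k), by omega⟩)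
      (fun l => ⟨k + l, by omega⟩)) <| by
    rw [Fintype.bijective_iff_injective_and_card]
    refine ⟨?_, by simp; omega⟩
    rintro (a | a) (b | b) h
    · simp only [Sum.elim_inl] at h
      split_ifs at h <;> simp only [Fin.mk.injEq] at h <;> congr 1 <;> ext <;> omega
    · simp only [Sum.elim_inl, Sum.elim_inr] at h
      split_ifs at h <;> simp only [Fin.mk.injEq] at h <;> omega
    · simp only [Sum.elim_inl, Sum.elim_inr] at h
      split_ifs at h <;> simp only [Fin.mk.injEq] at h <;> omega
    · simp only [Sum.elim_inr, Fin.mk.injEq] at h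
      congr 1; ext; omega

/-- The places of `n + k` two-forms: first the `2 n` vertical vectors, then the `2 k` lifts. -/
def vertPlace (n k : ℕ) : Fin (2 * n) ⊕ Fin (2 * k) ≃ Fin (n + k) × Fin 2 :=
  (Equiv.sumComm _ _).trans (finSumFinEquiv.trans
    ((finCongr (by ring : 2 * k + 2 * n = 2 * (n + k))).trans (placeEquiv (n + k)).symm))

theorem placeEquiv_vertPlace_inl (s : Fin (2 * n)) :
    ((placeEquiv (n + k) (vertPlace n k (Sum.inl s)) : Fin (2 * (n + k))) : ℕ) = 2 * k + s := by
  simp [vertPlace]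

theorem placeEquiv_vertPlace_inr (s : Fin (2 * k)) :
    ((placeEquiv (n + k) (vertPlace n k (Sum.inr s)) : Fin (2 * (n + k))) : ℕ) = s := by
  simp [vertPlace]

/-- Contracting with vertical vectors commutes with multiplication by the monomial `P'` of the base,
which vanishes on vertical vectors. -/
theorem sum_contraction (hkq : k + q = m) (P : Fin (n + k) → Fin (m + n) × Fin (m + n))
    (P' : Fin q → Fin (m + n) × Fin (m + n))
    (hP' : ∀ r (x : Cn n), covec (sel P' r) (Fin.append (0 : Cn m) x) = 0) :
    ∑ σ : Equiv.Perm (Fin (2 * k + 2 * q)), ((Equiv.Perm.sign σ : ℤ) : ℂ) *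
      ((covMat P (fun r => liftFrame n
          (fun i => frame m (σ (Fin.castAdd (2 * q) i))) (placeEquiv (n + k) r))).det *
        ∏ r, covec (sel P' r)
          (Fin.append (frame m (σ (Fin.natAdd (2 * k) (placeEquiv q r)))) (0 : Cn n))) =
    ((2 * k).factorial : ℂ) * (covMat (Sum.elim P P')
      (fun r : (Fin (n + k) ⊕ Fin q) × Fin 2 => stdVec (factorCoord hkq r.1, r.2))).det := by
  set η₀ : Fin (2 * k) ⊕ (Fin q × Fin 2) ≃ Fin (2 * k + 2 * q) :=
    (Equiv.sumCongr (Equiv.refl _) (placeEquiv q)).trans finSumFinEquiv with hη₀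
  have hη₀l : ∀ i, η₀ (Sum.inl i) = Fin.castAdd (2 * q) i := fun i => by simp [hη₀]
  have hη₀r : ∀ r, η₀ (Sum.inr r) = Fin.natAdd (2 * k) (placeEquiv q r) := fun r => by simp [hη₀]
  set a : Matrix (Fin (2 * n)) (Fin (2 * n)) ℂ := Matrix.of fun x s =>
    covec (sel P (vertPlace n k (Sum.inl s))) (Fin.append (0 : Cn m) (frame n x)) with ha
  set b : Matrix (Fin (2 * n)) (Fin (2 * k)) ℂ := Matrix.of fun x s =>
    covec (sel P (vertPlace n k (Sum.inr s))) (Fin.append (0 : Cn m) (frame n x)) with hb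
  set c : Matrix (Fin (2 * k) ⊕ (Fin q × Fin 2)) (Fin (2 * n)) ℂ := Matrix.of fun y s =>
    covec (sel P (vertPlace n k (Sum.inl s))) (Fin.append (frame m (η₀ y)) (0 : Cn n)) with hc
  set d : Matrix (Fin (2 * k) ⊕ (Fin q × Fin 2)) (Fin (2 * k)) ℂ := Matrix.of fun y s =>
    covec (sel P (vertPlace n k (Sum.inr s))) (Fin.append (frame m (η₀ y)) (0 : Cn n)) with hd
  set e : Matrix (Fin (2 * k) ⊕ (Fin q × Fin 2)) (Fin q × Fin 2) ℂ := Matrix.of fun y r =>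
    covec (sel P' r) (Fin.append (frame m (η₀ y)) (0 : Cn n)) with he
  have hmain := contraction_formula a b c d e
  rw [Fintype.card_fin] at hmain
  have hfin : (Matrix.fromBlocks a (Matrix.fromCols b 0) c (Matrix.fromCols d e)).det =
      (covMat (Sum.elim P P')
        (fun r : (Fin (n + k) ⊕ Fin q) × Fin 2 => stdVec (factorCoord hkq r.1, r.2))).det := by
    set η₂ : Fin (2 * n) ⊕ (Fin (2 * k) ⊕ (Fin q × Fin 2)) ≃ (Fin (n + k) ⊕ Fin q) × Fin 2 :=
      (Equiv.sumAssoc _ _ _).symm.trans ((Equiv.sumCongr (vertPlace n k) (Equiv.refl _)).trans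
        (Equiv.sumProdDistrib _ _ _).symm) with hη₂
    have e1 : ∀ s, η₂ (Sum.inl s) = (Sum.inl (vertPlace n k (Sum.inl s)).1,
        (vertPlace n k (Sum.inl s)).2) := fun s => by simp [hη₂]
    have e2 : ∀ s, η₂ (Sum.inr (Sum.inl s)) = (Sum.inl (vertPlace n k (Sum.inr s)).1,
        (vertPlace n k (Sum.inr s)).2) := fun s => by simp [hη₂]
    have e3 : ∀ r, η₂ (Sum.inr (Sum.inr r)) = (Sum.inr r.1, r.2) := fun s => by simp [hη₂]
    have r1 : ∀ x, stdVec (factorCoord (n := n) hkq (η₂ (Sum.inl x)).1, (η₂ (Sum.inl x)).2) =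
        Fin.append (0 : Cn m) (frame n x) := by
      intro x
      have hp := placeEquiv_vertPlace_inl (k := k) x
      simp only [placeEquiv, Equiv.coe_fn_mk, place] at hp
      rw [stdVec_eq_frame, append_zero_frame, e1]
      congr 1
      simp only [factorCoord, Equiv.ofBijective_apply, Sum.elim_inl]
      split_ifs <;> simp only <;> omega
    have r2 : ∀ y, stdVec (factorCoord (n := n) hkq (η₂ (Sum.inr y)).1, (η₂ (Sum.inr y)).2) =
        Fin.append (frame m (η₀ y)) (0 : Cn n) := by
      rintro (x | r)
      · have hp := placeEquiv_vertPlace_inr (n := n) x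
        simp only [placeEquiv, Equiv.coe_fn_mk, place] at hp
        rw [stdVec_eq_frame, hη₀l, append_frame_zero (by simp; omega), e2]
        congr 1
        simp only [factorCoord, Equiv.ofBijective_apply, Sum.elim_inl, Fin.val_castAdd]
        split_ifs <;> simp only <;> omega
      · rw [stdVec_eq_frame, hη₀r, append_frame_zero (by simp; omega), e3]
        congr 1
        simp only [factorCoord, Equiv.ofBijective_apply, Sum.elim_inr, Fin.val_natAdd, placeEquiv,
          Equiv.coe_fn_mk, place]
        omega
    rw [← Matrix.det_submatrix_equiv_self η₂ (covMat _ _)]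
    congr 1
    ext x r
    rw [Matrix.submatrix_apply, covMat, Matrix.of_apply]
    rcases x with x | y
    · rw [r1]
      rcases r with s | s | r
      · rw [e1]; simp [ha, sel]
      · rw [e2]; simp [hb, sel]
      · rw [e3]
        simpa [sel] using (hP' r (frame n x)).symm
    · rw [r2]
      rcases r with s | s | r
      · rw [e1]; simp [hc, sel]
      · rw [e2]; simp [hd, sel]
      · rw [e3]; simp [he, sel]
  rw [← hfin, ← hmain, ← Equiv.sum_comp η₀.permCongr]
  refine Finset.sum_congr rfl fun σ _ => ?_
  rw [Equiv.Perm.sign_permCongr]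
  have hs1 : ∀ i, η₀.permCongr σ (Fin.castAdd (2 * q) i) = η₀ (σ (Sum.inl i)) := fun i => by
    rw [← hη₀l]; simp [Equiv.permCongr_apply]
  have hs2 : ∀ r, η₀.permCongr σ (Fin.natAdd (2 * k) (placeEquiv q r)) = η₀ (σ (Sum.inr r)) :=
    fun r => by rw [← hη₀r]; simp [Equiv.permCongr_apply]
  simp only [hs1, hs2]
  congr 2
  rw [← Matrix.det_submatrix_equiv_self (vertPlace n k)]
  congr 1
  ext x r
  rw [Matrix.submatrix_apply, covMat, Matrix.of_apply]
  rcases x with x | x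
  · have h1 : liftFrame n (fun i => frame m (η₀ (σ (Sum.inl i))))
        (placeEquiv (n + k) (vertPlace n k (Sum.inl x))) = Fin.append (0 : Cn m) (frame n x) := by
      rw [liftFrame, dif_neg (by rw [placeEquiv_vertPlace_inl]; omega), placeEquiv_vertPlace_inl,
        Nat.add_sub_cancel_left]
    rw [h1]
    rcases r with s | s <;> simp [ha, hb]
  · have h1 : liftFrame n (fun i => frame m (η₀ (σ (Sum.inl i))))
        (placeEquiv (n + k) (vertPlace n k (Sum.inr x))) =
        Fin.append (frame m (η₀ (σ (Sum.inl x)))) (0 : Cn n) := by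
      rw [liftFrame, dif_pos (by rw [placeEquiv_vertPlace_inr]; exact x.2)]
      have hx : ∀ h, (⟨(placeEquiv (n + k) (vertPlace n k (Sum.inr x)) : Fin (2 * (n + k))), h⟩ :
          Fin (2 * k)) = x := fun h => Fin.ext (placeEquiv_vertPlace_inr x)
      rw [hx]
    rw [h1]
    rcases r with s | s <;> simp [hc, hd]

/-- The value on the standard frame of the product of the contraction of the `(n+k)`-th power of
`i H` with the vertical frame and of the `q`-th power of `i G`: it is a coefficient of the
polynomial `det (H + X G)`. -/
theorem wedge_contraction (hkq : k + q = m) {H : Matrix (Fin (m + n)) (Fin (m + n)) ℂ}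
    (hH : H.IsHermitian) {G : Matrix (Fin m) (Fin m) ℂ} (hG : G.IsHermitian) :
    ((wedge (fun w : Fin (2 * k) → Cn m => wedgePow (formOfMatrix H) (n + k)
          (fun j => liftFrame n w j)) (wedgePow (formOfMatrix G) q) (fun j => frame m j) : ℝ) : ℂ) =
      2 ^ (m + n) * ((n + k).factorial * q.factorial) *
        ((H.map Polynomial.C + (Polynomial.X : Polynomial ℂ) • (pad n G).map Polynomial.C).det).coeff
          q := by
  rw [wedge_alt_right _ _ _ (wedgePow_eq_alt _ (sesq G) (formOfMatrix_eq_sesq hG) q)]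
  have h1 : ∀ σ : Equiv.Perm (Fin (2 * k + 2 * q)), ∏ l : Fin q,
      sesq G (frame m (σ (Fin.natAdd (2 * k) (place l 0))))
        (frame m (σ (Fin.natAdd (2 * k) (place l 1)))) =
      ∑ P' : Fin q → Fin (m + n) × Fin (m + n),
        (∏ l, Complex.I * pad n G (P' l).1 (P' l).2) * ∏ r, covec (sel P' r)
          (Fin.append (frame m (σ (Fin.natAdd (2 * k) (placeEquiv q r)))) (0 : Cn n)) := by
    intro σ
    rw [← prod_sesq (fun _ => pad n G)
      (fun r => Fin.append (frame m (σ (Fin.natAdd (2 * k) (placeEquiv q r)))) (0 : Cn n))]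
    refine Finset.prod_congr rfl fun l _ => ?_
    rw [sesq_pad]
    rfl
  simp only [h1, wedgePow_formOfMatrix hH, Finset.sum_mul_sum]
  simp only [Finset.mul_sum]
  rw [Finset.sum_comm]
  have h2 : ∀ (P : Fin (n + k) → Fin (m + n) × Fin (m + n))
      (P' : Fin q → Fin (m + n) × Fin (m + n)), ∑ σ : Equiv.Perm (Fin (2 * k + 2 * q)),
      ((2 * k).factorial : ℂ)⁻¹ * (((Equiv.Perm.sign σ : ℤ) : ℂ) *
        (((∏ l, Complex.I * H (P l).1 (P l).2) *
          (covMat P (fun r => liftFrame n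
            (fun i => frame m (σ (Fin.castAdd (2 * q) i))) (placeEquiv (n + k) r))).det) *
        ((∏ l, Complex.I * pad n G (P' l).1 (P' l).2) * ∏ r, covec (sel P' r)
          (Fin.append (frame m (σ (Fin.natAdd (2 * k) (placeEquiv q r)))) (0 : Cn n))))) =
      (∏ l : Fin (n + k) ⊕ Fin q, Complex.I *
        (Sum.elim (fun _ : Fin (n + k) => H) (fun _ : Fin q => pad n G) l)
          (Sum.elim P P' l).1 (Sum.elim P P' l).2) *
        (covMat (Sum.elim P P')
      (fun r : (Fin (n + k) ⊕ Fin q) × Fin 2 => stdVec (factorCoord hkq r.1, r.2))).det := by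
    intro P P'
    rw [Fintype.prod_sum_type]
    simp only [Sum.elim_inl, Sum.elim_inr]
    by_cases h0 : ∏ l, Complex.I * pad n G (P' l).1 (P' l).2 = 0
    · simp [h0]
    have hP' : ∀ r (x : Cn n), covec (sel P' r) (Fin.append (0 : Cn m) x) = 0 := by
      rintro ⟨l, b⟩ x
      have h3 : pad n G (P' l).1 (P' l).2 ≠ 0 := fun h => h0
        (Finset.prod_eq_zero (Finset.mem_univ l) (by rw [h, mul_zero]))
      obtain ⟨j, hj⟩ : ∃ j, (P' l).1 = Fin.castAdd n j := by
        revert h3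
        refine Fin.addCases (fun i _ => ⟨i, rfl⟩) (fun i h => ?_) (P' l).1
        simp at h
      obtain ⟨j', hj'⟩ : ∃ j, (P' l).2 = Fin.castAdd n j := by
        revert h3
        refine Fin.addCases (fun i _ => ⟨i, rfl⟩) (fun i h => ?_) (P' l).2
        simp at h
      fin_cases b <;> simp [covec, sel, hj, hj']
    have h4 := sum_contraction hkq P P' hP'
    have h5 : ((2 * k).factorial : ℂ) ≠ 0 := by exact_mod_cast (2 * k).factorial_ne_zero
    rw [← mul_right_inj' h5, mul_left_comm, ← h4, Finset.mul_sum, Finset.mul_sum]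
    refine Finset.sum_congr rfl fun σ _ => ?_
    field_simp
  have h6 : ∀ P : Fin (n + k) → Fin (m + n) × Fin (m + n),
      ∑ σ : Equiv.Perm (Fin (2 * k + 2 * q)), ∑ P' : Fin q → Fin (m + n) × Fin (m + n),
      ((2 * k).factorial : ℂ)⁻¹ * (((Equiv.Perm.sign σ : ℤ) : ℂ) *
        (((∏ l, Complex.I * H (P l).1 (P l).2) *
          (covMat P (fun r => liftFrame n
            (fun i => frame m (σ (Fin.castAdd (2 * q) i))) (placeEquiv (n + k) r))).det) *
        ((∏ l, Complex.I * pad n G (P' l).1 (P' l).2) * ∏ r, covec (sel P' r)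
          (Fin.append (frame m (σ (Fin.natAdd (2 * k) (placeEquiv q r)))) (0 : Cn n))))) =
      ∑ P' : Fin q → Fin (m + n) × Fin (m + n), (∏ l : Fin (n + k) ⊕ Fin q, Complex.I *
        (Sum.elim (fun _ : Fin (n + k) => H) (fun _ : Fin q => pad n G) l)
          (Sum.elim P P' l).1 (Sum.elim P P' l).2) *
        (covMat (Sum.elim P P')
      (fun r : (Fin (n + k) ⊕ Fin q) × Fin 2 => stdVec (factorCoord hkq r.1, r.2))).det := by
    intro P
    rw [Finset.sum_comm]
    exact Finset.sum_congr rfl fun P' _ => h2 P P'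
  rw [Finset.sum_congr rfl fun P _ => h6 P, ← Fintype.sum_prod_type']
  have h7 := sum_covMat_std (factorCoord (n := n) hkq)
    (Sum.elim (fun _ : Fin (n + k) => H) (fun _ : Fin q => pad n G))
  rw [← Equiv.sum_comp (Equiv.sumArrowEquivProdArrow _ _ _).symm] at h7
  refine Eq.trans ?_ (h7.trans ?_)
  · rfl
  · rw [mixedDet_elim (factorCoord hkq), Fintype.card_fin, Fintype.card_fin]
    ring

end Lift

/-! ### The coefficients of `det (H + X G)` -/

section Pencils

open scoped ComplexOrder

/-- The polynomial `det (H + X G)`. -/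
def detPoly {ι : Type*} [Fintype ι] [DecidableEq ι] (H G : Matrix ι ι ℂ) : Polynomial ℂ :=
  (H.map Polynomial.C + (Polynomial.X : Polynomial ℂ) • G.map Polynomial.C).det

theorem eval_detPoly {ι : Type*} [Fintype ι] [DecidableEq ι] (H G : Matrix ι ι ℂ) (t : ℂ) :
    (detPoly H G).eval t = (H + t • G).det := by
  rw [detPoly, ← Polynomial.coe_evalRingHom, RingHom.map_det]
  congr 1
  ext i j
  simp only [RingHom.mapMatrix_apply, Matrix.map_apply, Matrix.add_apply, Matrix.smul_apply,
    Polynomial.coe_evalRingHom, Polynomial.eval_add, Polynomial.eval_C, smul_eq_mul,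
    Polynomial.eval_mul, Polynomial.eval_X]

/-- The Schur complement `φ_{α\bar β} - φ_{α\bar j} φ^{i\bar j} φ_{i\bar β}` of the vertical block. -/
def schur {m n : ℕ} (H : Matrix (Fin (m + n)) (Fin (m + n)) ℂ) : Matrix (Fin m) (Fin m) ℂ :=
  H.submatrix (Fin.castAdd n) (Fin.castAdd n) -
    H.submatrix (Fin.castAdd n) (Fin.natAdd m) *
      (H.submatrix (Fin.natAdd m) (Fin.natAdd m))⁻¹ *
        H.submatrix (Fin.natAdd m) (Fin.castAdd n)

/-- The vertical block of a matrix on `ℂ^m × ℂ^n`. -/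
abbrev vert {m n : ℕ} (H : Matrix (Fin (m + n)) (Fin (m + n)) ℂ) : Matrix (Fin n) (Fin n) ℂ :=
  H.submatrix (Fin.natAdd m) (Fin.natAdd m)

/-- A Schur complement factors the determinant of the curvature into a vertical part and a part that
involves only the geodesic curvature. -/
theorem detPoly_pad {m n : ℕ} (H : Matrix (Fin (m + n)) (Fin (m + n)) ℂ)
    (G : Matrix (Fin m) (Fin m) ℂ) (hD : (vert H).det ≠ 0) :
    detPoly H (pad n G) = Polynomial.C (vert H).det * detPoly (schur H) G := by
  refine Polynomial.funext fun t => ?_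
  rw [Polynomial.eval_mul, Polynomial.eval_C, eval_detPoly, eval_detPoly]
  have : Invertible (vert H) := Matrix.invertibleOfIsUnitDet _ (isUnit_iff_ne_zero.2 hD)
  have h1 : H + t • pad n G = (Matrix.fromBlocks
      (H.submatrix (Fin.castAdd n) (Fin.castAdd n) + t • G)
      (H.submatrix (Fin.castAdd n) (Fin.natAdd m)) (H.submatrix (Fin.natAdd m) (Fin.castAdd n))
      (vert H)).submatrix finSumFinEquiv.symm finSumFinEquiv.symm := by
    ext i j
    refine Fin.addCases (fun i => ?_) (fun i => ?_) i <;>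
    refine Fin.addCases (fun j => ?_) (fun j => ?_) j <;> simp
  rw [h1, Matrix.det_submatrix_equiv_self, Matrix.det_fromBlocks₂₂, schur, Matrix.invOf_eq_nonsing_inv]
  congr 2
  abel

theorem isHermitian_schur {m n : ℕ} {H : Matrix (Fin (m + n)) (Fin (m + n)) ℂ}
    (hH : H.IsHermitian) : (schur H).IsHermitian := by
  have h1 : (vert H)ᴴ = vert H := by rw [Matrix.conjTranspose_submatrix, hH.eq]
  rw [Matrix.IsHermitian, schur, Matrix.conjTranspose_sub, Matrix.conjTranspose_mul,
    Matrix.conjTranspose_mul, Matrix.conjTranspose_nonsing_inv]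
  simp only [Matrix.conjTranspose_submatrix, hH.eq, Matrix.mul_assoc]

/-- Simultaneous diagonalization of a Hermitian matrix `c` and a positive matrix `G`. -/
theorem exists_relative_eigenvalues {m : ℕ} {c G : Matrix (Fin m) (Fin m) ℂ}
    (hc : c.IsHermitian) (hG : G.PosDef) :
    ∃ μ : Fin m → ℝ, detPoly c G = Polynomial.C G.det *
        ∏ i, (Polynomial.X + Polynomial.C (μ i : ℂ)) ∧
      (G⁻¹ * c).trace = ∑ i, (μ i : ℂ) ∧ ∀ s : ℝ, (∀ i, μ i = s) → c = (s : ℂ) • G := by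
  obtain ⟨B, hB⟩ : ∃ B : Matrix (Fin m) (Fin m) ℂ, G = Bᴴ * B := by
    open scoped MatrixOrder in
    exact CStarAlgebra.nonneg_iff_eq_star_mul_self.mp hG.posSemidef.nonneg
  have hBdet : IsUnit B.det := by
    rw [isUnit_iff_ne_zero]
    intro h0
    have := hG.det_pos.ne'
    rw [hB, Matrix.det_mul, h0, mul_zero] at this
    exact this rfl
  have hBdet' : IsUnit Bᴴ.det := by rw [Matrix.det_conjTranspose]; exact hBdet.star
  set K := (B⁻¹)ᴴ * c * B⁻¹ with hK
  have hKh : K.IsHermitian := Matrix.isHermitian_conjTranspose_mul_mul _ hc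
  have hcK : c = Bᴴ * K * B := by
    rw [hK, Matrix.conjTranspose_nonsing_inv, Matrix.mul_assoc, Matrix.mul_assoc,
      Matrix.nonsing_inv_mul _ hBdet, Matrix.mul_one, ← Matrix.mul_assoc, Matrix.mul_nonsing_inv _ hBdet',
      Matrix.one_mul]
  refine ⟨hKh.eigenvalues, ?_, ?_, ?_⟩
  · refine Polynomial.funext fun t => ?_
    have h1 : c + t • G = Bᴴ * (K + t • 1) * B := by
      rw [Matrix.mul_add, Matrix.add_mul, ← hcK, hB]; simp
    have h2 := congrArg (fun p => p.eval (-t)) hKh.charpoly_eq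
    simp only [Matrix.eval_charpoly, Polynomial.eval_prod, Polynomial.eval_sub, Polynomial.eval_X,
      Polynomial.eval_C] at h2
    have h3 : Matrix.scalar (Fin m) (-t) - K = -(K + t • 1) := by
      rw [neg_add, sub_eq_add_neg, add_comm, Matrix.scalar_apply, ← Matrix.smul_one_eq_diagonal,
        neg_smul]
    rw [h3, Matrix.det_neg] at h2
    have h4 : ∏ i, (-t - ((hKh.eigenvalues i : ℝ) : ℂ)) =
        (-1) ^ Fintype.card (Fin m) * ∏ i, (t + ((hKh.eigenvalues i : ℝ) : ℂ)) := by
      rw [← Finset.card_univ, ← Finset.prod_const, ← Finset.prod_mul_distrib]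
      exact Finset.prod_congr rfl fun i _ => by ring
    have h5 : (K + t • 1).det = ∏ i, (t + ((hKh.eigenvalues i : ℝ) : ℂ)) :=
      mul_left_cancel₀ (pow_ne_zero _ (by norm_num)) (h2.trans h4)
    rw [eval_detPoly, h1, Matrix.det_mul, Matrix.det_mul, h5, Polynomial.eval_mul,
      Polynomial.eval_C, Polynomial.eval_prod, hB, Matrix.det_mul]
    simp only [Polynomial.eval_add, Polynomial.eval_X, Polynomial.eval_C]
    ring
  · rw [hcK, hB, Matrix.mul_inv_rev, Matrix.mul_assoc, ← Matrix.mul_assoc _ (Bᴴ * K),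
      ← Matrix.mul_assoc _ Bᴴ, Matrix.nonsing_inv_mul _ hBdet', Matrix.one_mul, Matrix.trace_mul_comm,
      Matrix.mul_assoc, Matrix.mul_nonsing_inv _ hBdet, Matrix.mul_one,
      hKh.trace_eq_sum_eigenvalues]
    rfl
  · intro s hs
    have h1 : K = (s : ℂ) • 1 := by
      rw [hKh.spectral_theorem]
      have : (RCLike.ofReal ∘ hKh.eigenvalues : Fin m → ℂ) = fun _ => (s : ℂ) := by
        funext i; simp [hs i]
      rw [this, ← Matrix.smul_one_eq_diagonal, map_smul, map_one]
    rw [hcK, h1, hB]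
    simp

/-- Newton's identity for the elementary symmetric function of degree two. -/
theorem coeff_prod_X_add_C {m : ℕ} (hm : 2 ≤ m) (μ : Fin m → ℝ) :
    (∏ i, (Polynomial.X + Polynomial.C (μ i : ℂ))).coeff (m - 2) =
      ((((∑ i, μ i) ^ 2 - ∑ i, μ i ^ 2) / 2 : ℝ) : ℂ) := by
  have h1 : ∏ i, (Polynomial.X + Polynomial.C (μ i : ℂ)) =
      ((Finset.univ.val.map (fun i => (μ i : ℂ))).map
        fun r => Polynomial.X + Polynomial.C r).prod := by
    rw [Multiset.map_map]; rfl
  rw [h1, Multiset.prod_X_add_C_coeff _ (by simp), ← MvPolynomial.aeval_esymm_eq_multiset_esymm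
    (Fin m) ℂ]
  have hc : (Finset.univ.val.map (fun i => (μ i : ℂ))).card - (m - 2) = 2 := by
    simp; omega
  rw [hc]
  have h2 := congrArg (MvPolynomial.aeval (fun i => (μ i : ℂ)))
    (MvPolynomial.mul_esymm_eq_sum (Fin m) ℂ 2)
  have h3 : (Finset.HasAntidiagonal.antidiagonal 2).filter (fun a : ℕ × ℕ => a.1 < 2) =
      {(0, 2), (1, 1)} := by
    decide
  rw [h3, Finset.sum_pair (by decide)] at h2
  simp only [MvPolynomial.psum, map_mul, map_add, map_sum, map_pow, MvPolynomial.aeval_X, map_neg,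
    map_one, MvPolynomial.esymm_zero, MvPolynomial.esymm_one, map_natCast] at h2
  push_cast at h2 ⊢
  simp only [pow_one] at h2
  linear_combination h2 / 2

/-- The second coefficient of `det (c + X G)` is at most its value at multiples of `G`, with
equality only there. The defect `δ` is half the square of the trace-free part of `c`. -/
theorem coeff_detPoly_eq {m : ℕ} (hm : 2 ≤ m) {c G : Matrix (Fin m) (Fin m) ℂ}
    (hc : c.IsHermitian) (hG : G.PosDef) {s : ℝ} (hs : (G⁻¹ * c).trace = (s : ℂ)) :
    ∃ δ : ℝ, 0 ≤ δ ∧ (δ = 0 ↔ c = ((s / m : ℝ) : ℂ) • G) ∧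
      (detPoly c G).coeff (m - 2) = G.det * (((m - 1) / (2 * m) * s ^ 2 - δ : ℝ) : ℂ) := by
  obtain ⟨μ, h1, h2, h3⟩ := exists_relative_eigenvalues hc hG
  have hm0 : (m : ℝ) ≠ 0 := by positivity
  have hsum : ∑ i, μ i = s := by
    rw [hs] at h2
    exact_mod_cast h2.symm
  have hsq : ∑ i, (μ i - s / m) ^ 2 = ∑ i, μ i ^ 2 - s ^ 2 / m := by
    have : ∀ i, (μ i - s / m) ^ 2 = μ i ^ 2 - 2 * (s / m) * μ i + (s / m) ^ 2 := fun i => by ring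
    simp only [this, Finset.sum_add_distrib, Finset.sum_sub_distrib, ← Finset.mul_sum, hsum,
      Finset.sum_const, Finset.card_univ, Fintype.card_fin, nsmul_eq_mul]
    field_simp
    ring
  have hcoeff : (detPoly c G).coeff (m - 2) =
      G.det * (((m - 1) / (2 * m) * s ^ 2 - (∑ i, (μ i - s / m) ^ 2) / 2 : ℝ) : ℂ) := by
    rw [h1, Polynomial.coeff_C_mul, coeff_prod_X_add_C hm, hsum, hsq]
    congr 2
    field_simp
    ring
  refine ⟨(∑ i, (μ i - s / m) ^ 2) / 2, by positivity, ⟨fun h => ?_, fun h => ?_⟩, hcoeff⟩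
  · refine h3 _ fun i => ?_
    have h0 : ∑ i, (μ i - s / m) ^ 2 = 0 := by linarith
    rw [Finset.sum_eq_zero_iff_of_nonneg fun _ _ => sq_nonneg _] at h0
    exact sub_eq_zero.1 (pow_eq_zero_iff two_ne_zero |>.1 (h0 i (Finset.mem_univ i)))
  · -- For `c = (s / m) G` the polynomial is `det G (X + s / m) ^ m`.
    have h4 : detPoly c G = Polynomial.C G.det *
        ∏ _i : Fin m, (Polynomial.X + Polynomial.C ((s / m : ℝ) : ℂ)) := by
      refine Polynomial.funext fun t => ?_
      rw [eval_detPoly, h, ← add_smul, Matrix.det_smul, Fintype.card_fin]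
      simp [mul_comm, add_comm]
    have h5 := coeff_prod_X_add_C hm (fun _ : Fin m => s / m)
    rw [h4, Polynomial.coeff_C_mul, h5] at hcoeff
    have h6 := mul_left_cancel₀ hG.det_pos.ne' hcoeff
    have h7 : ((∑ _i : Fin m, s / m) ^ 2 - ∑ _i : Fin m, (s / m) ^ 2) / 2 =
        (m - 1) / (2 * m) * s ^ 2 - (∑ i, (μ i - s / m) ^ 2) / 2 := by exact_mod_cast h6
    simp only [Finset.sum_const, Finset.card_univ, Fintype.card_fin, nsmul_eq_mul] at h7
    have h8 : ((m : ℝ) * (s / m)) ^ 2 - m * (s / m) ^ 2 = 2 * ((m - 1) / (2 * m) * s ^ 2) := by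
      field_simp
    linarith

end Pencils

/-! ### Calculus of Wirtinger derivatives -/

section Wirtinger

/-- `∂/∂z^j` as a functional of the real differential. -/
def dzL {N : ℕ} (j : Fin N) : (Cn N →L[ℝ] ℂ) →L[ℝ] ℂ :=
  (2⁻¹ : ℂ) • (ContinuousLinearMap.apply ℝ ℂ (Pi.single j (1 : ℂ) : Cn N) -
    Complex.I • ContinuousLinearMap.apply ℝ ℂ (Pi.single j Complex.I : Cn N))

/-- `∂/∂\bar z^j` as a functional of the real differential. -/
def dzbarL {N : ℕ} (j : Fin N) : (Cn N →L[ℝ] ℂ) →L[ℝ] ℂ :=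
  (2⁻¹ : ℂ) • (ContinuousLinearMap.apply ℝ ℂ (Pi.single j (1 : ℂ) : Cn N) +
    Complex.I • ContinuousLinearMap.apply ℝ ℂ (Pi.single j Complex.I : Cn N))

variable {N : ℕ}

theorem one_le_infty : (1 : WithTop ℕ∞) ≤ ∞ :=
  WithTop.coe_le_coe.2 (le_top : (1 : ℕ∞) ≤ ⊤)

theorem two_le_infty : (2 : WithTop ℕ∞) ≤ ∞ :=
  WithTop.coe_le_coe.2 (le_top : (2 : ℕ∞) ≤ ⊤)

theorem dzL_apply (j : Fin N) (l : Cn N →L[ℝ] ℂ) :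
    dzL j l = (l (Pi.single j 1) - Complex.I * l (Pi.single j Complex.I)) / 2 := by
  simp [dzL, div_eq_inv_mul]

theorem dzbarL_apply (j : Fin N) (l : Cn N →L[ℝ] ℂ) :
    dzbarL j l = (l (Pi.single j 1) + Complex.I * l (Pi.single j Complex.I)) / 2 := by
  simp [dzbarL, div_eq_inv_mul]
  ring

theorem dz_eq (j : Fin N) (f : Cn N → ℂ) (p : Cn N) : dz j f p = dzL j (fderiv ℝ f p) := by
  rw [dzL_apply, dz]

theorem dzbar_eq (j : Fin N) (f : Cn N → ℂ) (p : Cn N) :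
    dzbar j f p = dzbarL j (fderiv ℝ f p) := by
  rw [dzbarL_apply, dzbar]

theorem dzL_smul (j : Fin N) (c : ℂ) (l : Cn N →L[ℝ] ℂ) : dzL j (c • l) = c * dzL j l := by
  simp only [dzL_apply, smul_apply, smul_eq_mul]; ring

theorem realLinear_eq_sum (l : Cn N →L[ℝ] ℂ) (w : Cn N) :
    l w = ∑ q, (w q * dzL q l + (starRingEnd ℂ) (w q) * dzbarL q l) := by
  have h1 : w = ∑ q, ((w q).re • (Pi.single q (1 : ℂ) : Cn N) +
      (w q).im • (Pi.single q Complex.I : Cn N)) := by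
    ext k
    simp only [Finset.sum_apply, Pi.add_apply, Pi.smul_apply, Pi.single_apply, Finset.sum_add_distrib]
    simp only [smul_ite, smul_zero, Finset.sum_ite_eq, Finset.mem_univ, if_true]
    simp [Complex.re_add_im]
  conv_lhs => rw [h1]
  simp only [map_sum, map_add, map_smul, dzL_apply, dzbarL_apply, Complex.real_smul]
  refine Finset.sum_congr rfl fun q _ => ?_
  have h2 : w q = (w q).re + (w q).im * Complex.I := (Complex.re_add_im _).symm
  have h3 : (starRingEnd ℂ) (w q) = (w q).re - (w q).im * Complex.I := by
    apply Complex.ext <;> simp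
  rw [h3]
  conv_rhs => rw [h2]
  simp only [Complex.add_re, Complex.ofReal_re, Complex.mul_re, Complex.I_re, mul_zero,
    Complex.ofReal_im, Complex.I_im, mul_one, sub_zero, add_zero, Complex.add_im, Complex.mul_im,
    zero_add]
  linear_combination ((w q).im : ℂ) * l (Pi.single q Complex.I) * Complex.I_sq

theorem dz_congr {f g : Cn N → ℂ} {p : Cn N} (h : f =ᶠ[nhds p] g) (j : Fin N) :
    dz j f p = dz j g p := by rw [dz_eq, dz_eq, h.fderiv_eq]

theorem dzbar_congr {f g : Cn N → ℂ} {p : Cn N} (h : f =ᶠ[nhds p] g) (j : Fin N) :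
    dzbar j f p = dzbar j g p := by rw [dzbar_eq, dzbar_eq, h.fderiv_eq]

theorem dzbar_eventuallyEq {f g : Cn N → ℂ} {p : Cn N} (h : f =ᶠ[nhds p] g) (j : Fin N) :
    dzbar j f =ᶠ[nhds p] dzbar j g :=
  h.eventuallyEq_nhds.mono fun _ hq => dzbar_congr hq j

theorem dz_add {f g : Cn N → ℂ} {p : Cn N} (hf : DifferentiableAt ℝ f p)
    (hg : DifferentiableAt ℝ g p) (j : Fin N) :
    dz j (fun x => f x + g x) p = dz j f p + dz j g p := by
  simp only [dz_eq]; rw [fderiv_fun_add hf hg, map_add]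

theorem dz_sub {f g : Cn N → ℂ} {p : Cn N} (hf : DifferentiableAt ℝ f p)
    (hg : DifferentiableAt ℝ g p) (j : Fin N) :
    dz j (fun x => f x - g x) p = dz j f p - dz j g p := by
  simp only [dz_eq]; rw [fderiv_fun_sub hf hg, map_sub]

theorem dzbar_sub {f g : Cn N → ℂ} {p : Cn N} (hf : DifferentiableAt ℝ f p)
    (hg : DifferentiableAt ℝ g p) (j : Fin N) :
    dzbar j (fun x => f x - g x) p = dzbar j f p - dzbar j g p := by
  simp only [dzbar_eq]; rw [fderiv_fun_sub hf hg, map_sub]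

theorem dzbar_add {f g : Cn N → ℂ} {p : Cn N} (hf : DifferentiableAt ℝ f p)
    (hg : DifferentiableAt ℝ g p) (j : Fin N) :
    dzbar j (fun x => f x + g x) p = dzbar j f p + dzbar j g p := by
  simp only [dzbar_eq]; rw [fderiv_fun_add hf hg, map_add]

theorem dz_mul {f g : Cn N → ℂ} {p : Cn N} (hf : DifferentiableAt ℝ f p)
    (hg : DifferentiableAt ℝ g p) (j : Fin N) :
    dz j (fun x => f x * g x) p = f p * dz j g p + g p * dz j f p := by
  simp only [dz_eq]; rw [fderiv_fun_mul hf hg, map_add, dzL_smul, dzL_smul]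

theorem dz_sum {ι : Type*} (s : Finset ι) {f : ι → Cn N → ℂ} {p : Cn N}
    (hf : ∀ i ∈ s, DifferentiableAt ℝ (f i) p) (j : Fin N) :
    dz j (fun x => ∑ i ∈ s, f i x) p = ∑ i ∈ s, dz j (f i) p := by
  simp only [dz_eq]; rw [fderiv_fun_sum hf, map_sum]

theorem dz_prod {ι : Type*} [DecidableEq ι] (s : Finset ι) {f : ι → Cn N → ℂ} {p : Cn N}
    (hf : ∀ i ∈ s, DifferentiableAt ℝ (f i) p) (j : Fin N) :
    dz j (fun x => ∏ i ∈ s, f i x) p = ∑ i ∈ s, (∏ l ∈ s.erase i, f l p) * dz j (f i) p := by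
  simp only [dz_eq]; rw [fderiv_finsetProd hf, map_sum]
  exact Finset.sum_congr rfl fun i _ => dzL_smul _ _ _

theorem dz_const (c : ℂ) (j : Fin N) (p : Cn N) : dz j (fun _ => c) p = 0 := by
  rw [dz_eq]; simp

theorem dz_const_mul {f : Cn N → ℂ} {p : Cn N} (hf : DifferentiableAt ℝ f p) (c : ℂ) (j : Fin N) :
    dz j (fun x => c * f x) p = c * dz j f p := by
  simp only [dz_eq]; rw [fderiv_const_mul hf, dzL_smul]

theorem fderiv_conj_apply {f : Cn N → ℂ} {p : Cn N} (hf : DifferentiableAt ℝ f p) (v : Cn N) :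
    fderiv ℝ (fun x => (starRingEnd ℂ) (f x)) p v = (starRingEnd ℂ) (fderiv ℝ f p v) := by
  have h : HasFDerivAt (fun x => (starRingEnd ℂ) (f x))
      ((Complex.conjCLE : ℂ →L[ℝ] ℂ).comp (fderiv ℝ f p)) p :=
    (Complex.conjCLE : ℂ →L[ℝ] ℂ).hasFDerivAt.comp p hf.hasFDerivAt
  rw [h.fderiv]; rfl

theorem dz_conj {f : Cn N → ℂ} {p : Cn N} (hf : DifferentiableAt ℝ f p) (j : Fin N) :
    dz j (fun x => (starRingEnd ℂ) (f x)) p = (starRingEnd ℂ) (dzbar j f p) := by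
  rw [dz, dzbar, fderiv_conj_apply hf, fderiv_conj_apply hf]
  simp only [map_div₀, map_add, map_mul, Complex.conj_I, map_ofNat]
  ring

theorem dzbar_conj {f : Cn N → ℂ} {p : Cn N} (hf : DifferentiableAt ℝ f p) (j : Fin N) :
    dzbar j (fun x => (starRingEnd ℂ) (f x)) p = (starRingEnd ℂ) (dz j f p) := by
  rw [dz, dzbar, fderiv_conj_apply hf, fderiv_conj_apply hf]
  simp only [map_div₀, map_sub, map_mul, Complex.conj_I, map_ofNat]
  ring

theorem dzbar_eq_zero {f : Cn N → ℂ} {p : Cn N} (hf : DifferentiableAt ℂ f p) (j : Fin N) :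
    dzbar j f p = 0 := by
  have h := hf.hasFDerivAt.restrictScalars ℝ
  have h1 : (Pi.single j Complex.I : Cn N) = Complex.I • (Pi.single j 1 : Cn N) := by
    rw [← Pi.single_smul]; simp
  rw [dzbar, h.fderiv, h1]
  simp only [ContinuousLinearMap.coe_restrictScalars', map_smul, smul_eq_mul]
  linear_combination (fderiv ℂ f p (Pi.single j 1)) / 2 * Complex.I_sq

theorem dz_eq_fderiv {f : Cn N → ℂ} {p : Cn N} (hf : DifferentiableAt ℂ f p) (j : Fin N) :
    dz j f p = fderiv ℂ f p (Pi.single j 1) := by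
  have h := hf.hasFDerivAt.restrictScalars ℝ
  have h1 : (Pi.single j Complex.I : Cn N) = Complex.I • (Pi.single j 1 : Cn N) := by
    rw [← Pi.single_smul]; simp
  rw [dz, h.fderiv, h1]
  simp only [ContinuousLinearMap.coe_restrictScalars', map_smul, smul_eq_mul]
  linear_combination (-fderiv ℂ f p (Pi.single j 1)) / 2 * Complex.I_sq

/-- The complex Jacobian matrix of a map. -/
def jac {K N : ℕ} (h : Cn K → Cn N) (p : Cn K) : Matrix (Fin N) (Fin K) ℂ :=
  Matrix.of fun q j => fderiv ℂ h p (Pi.single j 1) q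

theorem jac_eq_toMatrix' {K N : ℕ} (h : Cn K → Cn N) (p : Cn K) :
    jac h p = LinearMap.toMatrix' (fderiv ℂ h p : Cn K →ₗ[ℂ] Cn N) := by
  ext q j
  rw [LinearMap.toMatrix'_apply, jac, Matrix.of_apply]
  congr 2

theorem jac_mulVec {K N : ℕ} (h : Cn K → Cn N) (p : Cn K) (v : Cn K) :
    Matrix.mulVec (jac h p) v = fderiv ℂ h p v := by
  rw [jac_eq_toMatrix', LinearMap.toMatrix'_mulVec]; rfl

theorem jac_comp {K L N : ℕ} {h : Cn L → Cn N} {k : Cn K → Cn L} {p : Cn K}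
    (hh : DifferentiableAt ℂ h (k p)) (hk : DifferentiableAt ℂ k p) :
    jac (h ∘ k) p = jac h (k p) * jac k p := by
  rw [jac_eq_toMatrix', jac_eq_toMatrix', jac_eq_toMatrix', ← LinearMap.toMatrix'_comp,
    fderiv_comp p hh hk]
  rfl

theorem jac_congr {K N : ℕ} {h k : Cn K → Cn N} {p : Cn K} (hk : h =ᶠ[nhds p] k) :
    jac h p = jac k p := by
  rw [jac_eq_toMatrix', jac_eq_toMatrix', hk.fderiv_eq]

theorem jac_id {K : ℕ} (p : Cn K) : jac (fun x : Cn K => x) p = 1 := by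
  rw [jac_eq_toMatrix', fderiv_fun_id]; exact LinearMap.toMatrix'_id

theorem det_fderiv_real {K : ℕ} {h : Cn K → Cn K} {p : Cn K} (hh : DifferentiableAt ℂ h p) :
    (fderiv ℝ h p).det = Complex.normSq (jac h p).det := by
  rw [(hh.hasFDerivAt.restrictScalars ℝ).fderiv, ContinuousLinearMap.det, jac_eq_toMatrix',
    LinearMap.det_toMatrix']
  have := LinearMap.det_restrictScalars (R := ℝ) (f := (fderiv ℂ h p : Cn K →ₗ[ℂ] Cn K))
  rw [Algebra.norm_complex_eq] at this
  exact this

section Chain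

variable {K : ℕ} {h : Cn K → Cn N} {p : Cn K} {f : Cn N → ℂ}

theorem dz_comp (hh : DifferentiableAt ℂ h p) (hf : DifferentiableAt ℝ f (h p)) (j : Fin K) :
    dz j (fun x => f (h x)) p = ∑ q, jac h p q j * dz q f (h p) := by
  have h1 := hf.hasFDerivAt.comp p (hh.hasFDerivAt.restrictScalars ℝ)
  have h2 : (Pi.single j Complex.I : Cn K) = Complex.I • (Pi.single j 1 : Cn K) := by
    rw [← Pi.single_smul]; simp
  have h3 : fderiv ℝ (fun x => f (h x)) p = _ := h1.fderiv
  rw [dz, h3, h2]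
  simp only [ContinuousLinearMap.comp_apply, ContinuousLinearMap.coe_restrictScalars', map_smul]
  rw [realLinear_eq_sum, realLinear_eq_sum, Finset.mul_sum, ← Finset.sum_sub_distrib, Finset.sum_div]
  refine Finset.sum_congr rfl fun q _ => ?_
  simp only [← dz_eq, ← dzbar_eq, jac, Matrix.of_apply, Pi.smul_apply, smul_eq_mul, map_mul,
    Complex.conj_I]
  linear_combination (-(fderiv ℂ h p (Pi.single j 1) q) * dz q f (h p) +
    (starRingEnd ℂ) (fderiv ℂ h p (Pi.single j 1) q) * dzbar q f (h p)) / 2 * Complex.I_sq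

theorem dzbar_comp (hh : DifferentiableAt ℂ h p) (hf : DifferentiableAt ℝ f (h p)) (j : Fin K) :
    dzbar j (fun x => f (h x)) p = ∑ q, (starRingEnd ℂ) (jac h p q j) * dzbar q f (h p) := by
  have h1 := hf.hasFDerivAt.comp p (hh.hasFDerivAt.restrictScalars ℝ)
  have h2 : (Pi.single j Complex.I : Cn K) = Complex.I • (Pi.single j 1 : Cn K) := by
    rw [← Pi.single_smul]; simp
  have h3 : fderiv ℝ (fun x => f (h x)) p = _ := h1.fderiv
  rw [dzbar, h3, h2]
  simp only [ContinuousLinearMap.comp_apply, ContinuousLinearMap.coe_restrictScalars', map_smul]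
  rw [realLinear_eq_sum, realLinear_eq_sum, Finset.mul_sum, ← Finset.sum_add_distrib, Finset.sum_div]
  refine Finset.sum_congr rfl fun q _ => ?_
  simp only [← dz_eq, ← dzbar_eq, jac, Matrix.of_apply, Pi.smul_apply, smul_eq_mul, map_mul,
    Complex.conj_I]
  linear_combination ((fderiv ℂ h p (Pi.single j 1) q) * dz q f (h p) -
    (starRingEnd ℂ) (fderiv ℂ h p (Pi.single j 1) q) * dzbar q f (h p)) / 2 * Complex.I_sq

end Chain

theorem contDiffAt_dz {f : Cn N → ℂ} {p : Cn N} (hf : ContDiffAt ℝ ∞ f p) (j : Fin N) :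
    ContDiffAt ℝ ∞ (dz j f) p := by
  have h : dz j f = fun x => dzL j (fderiv ℝ f x) := funext fun x => dz_eq j f x
  rw [h]
  exact (dzL j).contDiff.contDiffAt.comp p (hf.fderiv_right (by simp))

theorem contDiffAt_dzbar {f : Cn N → ℂ} {p : Cn N} (hf : ContDiffAt ℝ ∞ f p) (j : Fin N) :
    ContDiffAt ℝ ∞ (dzbar j f) p := by
  have h : dzbar j f = fun x => dzbarL j (fderiv ℝ f x) := funext fun x => dzbar_eq j f x
  rw [h]
  exact (dzbarL j).contDiff.contDiffAt.comp p (hf.fderiv_right (by simp))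

theorem fderiv_comp_functional {f : Cn N → ℂ} {p : Cn N} (hf : ContDiffAt ℝ ∞ f p)
    (L : (Cn N →L[ℝ] ℂ) →L[ℝ] ℂ) (v : Cn N) :
    fderiv ℝ (fun x => L (fderiv ℝ f x)) p v = L (fderiv ℝ (fderiv ℝ f) p v) := by
  have h1 : DifferentiableAt ℝ (fderiv ℝ f) p :=
    (hf.fderiv_right (m := ∞) (by simp)).differentiableAt (by simp)
  have h2 := L.hasFDerivAt.comp p h1.hasFDerivAt
  have h3 : fderiv ℝ (fun x => L (fderiv ℝ f x)) p = _ := h2.fderiv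
  rw [h3]; rfl

theorem dz_dzbar_comm {f : Cn N → ℂ} {p : Cn N} (hf : ContDiffAt ℝ ∞ f p) (j k : Fin N) :
    dz j (dzbar k f) p = dzbar k (dz j f) p := by
  have h1 : dz j f = fun x => dzL j (fderiv ℝ f x) := funext fun x => dz_eq j f x
  have h2 : dzbar k f = fun x => dzbarL k (fderiv ℝ f x) := funext fun x => dzbar_eq k f x
  have hs : IsSymmSndFDerivAt ℝ f p := hf.isSymmSndFDerivAt (by
    rw [minSmoothness_of_isRCLikeNormedField]; exact two_le_infty)
  rw [dz, dzbar, h1, h2]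
  simp only [fderiv_comp_functional hf]
  simp only [dzL_apply, dzbarL_apply]
  rw [hs.eq (Pi.single k 1) (Pi.single j 1), hs.eq (Pi.single k Complex.I) (Pi.single j 1),
    hs.eq (Pi.single k 1) (Pi.single j Complex.I), hs.eq (Pi.single k Complex.I) (Pi.single j Complex.I)]
  ring

theorem dz_dz_comm {f : Cn N → ℂ} {p : Cn N} (hf : ContDiffAt ℝ ∞ f p) (j k : Fin N) :
    dz j (dz k f) p = dz k (dz j f) p := by
  have h1 : ∀ j, dz j f = fun x => dzL j (fderiv ℝ f x) := fun j => funext fun x => dz_eq j f x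
  have hs : IsSymmSndFDerivAt ℝ f p := hf.isSymmSndFDerivAt (by
    rw [minSmoothness_of_isRCLikeNormedField]; exact two_le_infty)
  rw [dz, dz, h1 k, h1 j]
  simp only [fderiv_comp_functional hf]
  simp only [dzL_apply]
  rw [hs.eq (Pi.single k 1) (Pi.single j 1), hs.eq (Pi.single k Complex.I) (Pi.single j 1),
    hs.eq (Pi.single k 1) (Pi.single j Complex.I), hs.eq (Pi.single k Complex.I) (Pi.single j Complex.I)]
  ring

end Wirtinger

section Hessians

variable {N : ℕ}

/-! ### The complex Hessian -/

theorem complexHessian_apply (f : Cn N → ℝ) (p : Cn N) (j k : Fin N) :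
    complexHessian f p j k = dz j (dzbar k (fun q => (f q : ℂ))) p := rfl

theorem complexHessian_congr {f g : Cn N → ℝ} {p : Cn N} (h : f =ᶠ[nhds p] g) :
    complexHessian f p = complexHessian g p := by
  ext j k
  rw [complexHessian_apply, complexHessian_apply]
  exact dz_congr (dzbar_eventuallyEq (h.mono fun x hx => by simp [hx]) k) j

theorem contDiffAt_ofReal {f : Cn N → ℝ} {p : Cn N} {r : WithTop ℕ∞} (hf : ContDiffAt ℝ r f p) :
    ContDiffAt ℝ r (fun q => (f q : ℂ)) p :=
  Complex.ofRealCLM.contDiff.contDiffAt.comp p hf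

theorem eventually_differentiableAt {F : Type*} [NormedAddCommGroup F] [NormedSpace ℝ F]
    {f : Cn N → F} {p : Cn N} (hf : ContDiffAt ℝ ∞ f p) :
    ∀ᶠ x in nhds p, DifferentiableAt ℝ f x :=
  ((hf.of_le (m := 1) (by exact one_le_infty)).eventually (by decide)).mono
    fun _ hx => hx.differentiableAt one_ne_zero

theorem contDiffAt_complexHessian {f : Cn N → ℝ} {p : Cn N} (hf : ContDiffAt ℝ ∞ f p)
    (j k : Fin N) : ContDiffAt ℝ ∞ (fun x => complexHessian f x j k) p :=
  contDiffAt_dz (contDiffAt_dzbar (contDiffAt_ofReal hf) k) j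

theorem complexHessian_isHermitian {f : Cn N → ℝ} {p : Cn N} (hf : ContDiffAt ℝ ∞ f p) :
    (complexHessian f p).IsHermitian := by
  have hf' := contDiffAt_ofReal hf
  ext j k
  rw [Matrix.conjTranspose_apply, complexHessian_apply, complexHessian_apply,
    dz_dzbar_comm hf' j k]
  have h1 : dz j (fun q => (f q : ℂ)) =ᶠ[nhds p]
      fun x => (starRingEnd ℂ) (dzbar j (fun q => (f q : ℂ)) x) := by
    filter_upwards [eventually_differentiableAt hf'] with x hx
    rw [← dz_conj hx]
    simp
  rw [dzbar_congr h1, dzbar_conj ((contDiffAt_dzbar hf' j).differentiableAt (by simp))]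
  rfl

theorem complexHessian_sub {f g : Cn N → ℝ} {p : Cn N} (hf : ContDiffAt ℝ ∞ f p)
    (hg : ContDiffAt ℝ ∞ g p) :
    complexHessian (fun x => f x - g x) p = complexHessian f p - complexHessian g p := by
  have hf' := contDiffAt_ofReal hf
  have hg' := contDiffAt_ofReal hg
  ext j k
  rw [Matrix.sub_apply, complexHessian_apply, complexHessian_apply, complexHessian_apply,
    ← dz_sub ((contDiffAt_dzbar hf' k).differentiableAt (by simp))
      ((contDiffAt_dzbar hg' k).differentiableAt (by simp))]
  refine dz_congr ?_ j
  filter_upwards [eventually_differentiableAt hf', eventually_differentiableAt hg'] with x hx hx'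
  rw [← dzbar_sub hx hx']
  simp

/-- The form `i ∂∂̄f` is closed. -/
theorem dz_complexHessian {f : Cn N → ℝ} {p : Cn N} (hf : ContDiffAt ℝ ∞ f p) (l j k : Fin N) :
    dz l (fun x => complexHessian f x j k) p = dz j (fun x => complexHessian f x l k) p :=
  dz_dz_comm (contDiffAt_dzbar (contDiffAt_ofReal hf) k) l j

section Holomorphic

variable {K : ℕ} {h : Cn K → Cn N} {p : Cn K}

theorem eventually_differentiableAt_complex {F : Type*} [NormedAddCommGroup F] [NormedSpace ℂ F]
    {h : Cn K → F} (hh : ContDiffAt ℂ ω h p) : ∀ᶠ x in nhds p, DifferentiableAt ℂ h x :=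
  (hh.eventually (by decide)).mono fun _ hx => hx.differentiableAt (by simp)

theorem differentiableAt_jac (hh : ContDiffAt ℂ ω h p) (q : Fin N) (j : Fin K) :
    DifferentiableAt ℂ (fun x => jac h x q j) p := by
  have h1 : DifferentiableAt ℂ (fderiv ℂ h) p :=
    (hh.fderiv_right (m := ω) (by simp)).differentiableAt (by simp)
  have h2 := h1.clm_apply (differentiableAt_const (Pi.single j (1 : ℂ) : Cn K))
  exact (differentiableAt_pi.1 h2) q

/-- The complex Hessian transforms as a `(1,1)`-form under holomorphic maps. -/
theorem complexHessian_comp {f : Cn N → ℝ} (hh : ContDiffAt ℂ ω h p)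
    (hf : ContDiffAt ℝ ∞ f (h p)) :
    complexHessian (fun x => f (h x)) p =
      (jac h p)ᵀ * complexHessian f (h p) * (jac h p).map (starRingEnd ℂ) := by
  have hf' := contDiffAt_ofReal hf
  have hhd : DifferentiableAt ℂ h p := hh.differentiableAt (by simp)
  have hjd : ∀ q k, DifferentiableAt ℝ (fun x => (starRingEnd ℂ) (jac h x q k)) p := fun q k =>
    (Complex.conjCLE : ℂ →L[ℝ] ℂ).differentiableAt.comp p
      ((differentiableAt_jac hh q k).restrictScalars ℝ)
  have hfd : ∀ q, DifferentiableAt ℝ (dzbar q (fun x => (f x : ℂ))) (h p) := fun q =>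
    (contDiffAt_dzbar hf' q).differentiableAt (by simp)
  have hfd' : ∀ q, DifferentiableAt ℝ (fun x => dzbar q (fun x => (f x : ℂ)) (h x)) p := fun q =>
    (hfd q).comp p (hhd.restrictScalars ℝ)
  ext j k
  rw [complexHessian_apply]
  have h1 : dzbar k (fun x => (f (h x) : ℂ)) =ᶠ[nhds p]
      fun x => ∑ q, (starRingEnd ℂ) (jac h x q k) * dzbar q (fun y => (f y : ℂ)) (h x) := by
    filter_upwards [eventually_differentiableAt_complex hh,
      hhd.continuousAt.eventually (eventually_differentiableAt hf')] with x hx hx'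
    exact dzbar_comp hx hx' k
  rw [dz_congr h1, dz_sum _ fun q _ => (hjd q k).fun_mul (hfd' q)]
  simp only [Matrix.mul_apply, Matrix.transpose_apply, Matrix.map_apply, Finset.sum_mul]
  refine Finset.sum_congr rfl fun q _ => ?_
  rw [dz_mul (hjd q k) (hfd' q), dz_comp hhd (hfd q),
    dz_conj ((differentiableAt_jac hh q k).restrictScalars ℝ),
    dzbar_eq_zero (differentiableAt_jac hh q k), map_zero, mul_zero, add_zero, Finset.mul_sum]
  refine Finset.sum_congr rfl fun r _ => ?_
  rw [complexHessian_apply]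
  ring

/-- The logarithm of the modulus of a nonvanishing holomorphic function is pluriharmonic. -/
theorem complexHessian_log_norm {h : Cn N → ℂ} {p : Cn N} (hh : ContDiffAt ℂ ω h p)
    (h0 : h p ≠ 0) : complexHessian (fun x => Real.log (‖h x‖ ^ 2)) p = 0 := by
  -- Near `p`, `log |h|² = L + conj L + const` with the holomorphic branch `L = log (h / h p)`.
  set L : Cn N → ℂ := fun x => Complex.log (h x / h p) with hL
  have hquot : ContDiffAt ℂ ω (fun x => h x / h p) p := hh.div_const _
  have hne : h p / h p ∈ Complex.slitPlane := by rw [div_self h0]; exact Complex.one_mem_slitPlane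
  have hLp : ContDiffAt ℂ ω L p := by
    have h1 : ContDiffAt ℂ ω Complex.log (h p / h p) := Complex.contDiffAt_log hne
    exact ContDiffAt.comp p h1 hquot
  have hev : ∀ᶠ x in nhds p, h x / h p ∈ Complex.slitPlane :=
    hquot.continuousAt.eventually (Complex.isOpen_slitPlane.mem_nhds hne)
  have hLd := eventually_differentiableAt_complex hLp
  have hform : (fun x => ((Real.log (‖h x‖ ^ 2) : ℝ) : ℂ)) =ᶠ[nhds p]
      fun x => (L x + (starRingEnd ℂ) (L x)) + ((Real.log (‖h p‖ ^ 2) : ℝ) : ℂ) := by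
    filter_upwards [hev] with x hx
    have hx0 : h x ≠ 0 := by
      intro hx0
      rw [hx0, zero_div] at hx
      exact Complex.slitPlane_ne_zero hx rfl
    rw [Complex.add_conj, hL]
    simp only [Complex.log_re, norm_div, Real.log_pow]
    rw [Real.log_div (norm_ne_zero_iff.2 hx0) (norm_ne_zero_iff.2 h0)]
    push_cast
    ring
  have hconj : ∀ x, DifferentiableAt ℂ L x →
      DifferentiableAt ℝ (fun x => (starRingEnd ℂ) (L x)) x := fun x hx =>
    (Complex.conjCLE : ℂ →L[ℝ] ℂ).differentiableAt.comp x (hx.restrictScalars ℝ)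
  ext j k
  rw [complexHessian_apply, Matrix.zero_apply, dz_congr (dzbar_eventuallyEq hform k)]
  have h2 : dzbar k (fun x => (L x + (starRingEnd ℂ) (L x)) + ((Real.log (‖h p‖ ^ 2) : ℝ) : ℂ))
      =ᶠ[nhds p] fun x => (starRingEnd ℂ) (fderiv ℂ L x (Pi.single k 1)) := by
    filter_upwards [hLd] with x hx
    rw [dzbar_add ((hx.restrictScalars ℝ).fun_add (hconj x hx)) (differentiableAt_const _),
      dzbar_add (hx.restrictScalars ℝ) (hconj x hx), dzbar_eq_zero hx,
      dzbar_conj (hx.restrictScalars ℝ), dz_eq_fderiv hx, dzbar_eq_zero (differentiableAt_const _)]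
    simp
  have h3 : DifferentiableAt ℂ (fun x => fderiv ℂ L x (Pi.single k 1)) p :=
    ((hLp.fderiv_right (m := ω) (by simp)).differentiableAt (by simp)).clm_apply
      (differentiableAt_const _)
  rw [dz_congr h2, dz_conj (h3.restrictScalars ℝ), dzbar_eq_zero h3, map_zero]

end Holomorphic

/-! ### Cofactors of closed matrix fields -/

section Cofactor

variable {ι : Type*} [Fintype ι] [DecidableEq ι]

theorem adjugate_eq_sum (F : Matrix ι ι ℂ) (q p : ι) :
    F.adjugate q p = ∑ σ : Equiv.Perm ι, if σ p = q then
      ((Equiv.Perm.sign σ : ℤ) : ℂ) * ∏ i ∈ Finset.univ.erase p, F i (σ i) else 0 := by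
  rw [Matrix.adjugate_apply, ← Matrix.det_transpose, Matrix.det_apply']
  refine Finset.sum_congr rfl fun σ _ => ?_
  rw [← Finset.mul_prod_erase _ _ (Finset.mem_univ p)]
  have h1 : ∏ i ∈ Finset.univ.erase p, (F.updateRow p (Pi.single q 1))ᵀ (σ i) i =
      ∏ i ∈ Finset.univ.erase p, F i (σ i) :=
    Finset.prod_congr rfl fun i hi => by
      rw [Matrix.transpose_apply, Matrix.updateRow_ne (Finset.ne_of_mem_erase hi)]
  rw [h1, Matrix.transpose_apply, Matrix.updateRow_self, Pi.single_apply]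
  split_ifs <;> simp

theorem sum_adjugate_mul (F E : Matrix ι ι ℂ) :
    ∑ p, ∑ q, F.adjugate q p * E p q = ∑ p, ∑ σ : Equiv.Perm ι,
      ((Equiv.Perm.sign σ : ℤ) : ℂ) * (∏ i ∈ Finset.univ.erase p, F i (σ i)) * E p (σ p) := by
  refine Finset.sum_congr rfl fun p _ => ?_
  simp only [adjugate_eq_sum, Finset.sum_mul]
  rw [Finset.sum_comm]
  refine Finset.sum_congr rfl fun σ _ => ?_
  simp [ite_mul]

/-- Jacobi's formula for the derivative of a determinant. -/
theorem hasFDerivAt_det {E : Type*} [NormedAddCommGroup E] [NormedSpace ℝ E]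
    {F : E → Matrix ι ι ℂ} {F' : ι → ι → (E →L[ℝ] ℂ)} {x : E}
    (hF : ∀ i j, HasFDerivAt (fun y => F y i j) (F' i j) x) :
    HasFDerivAt (fun y => (F y).det) (∑ p, ∑ q, (F x).adjugate q p • F' p q) x := by
  have h1 : (fun y => (F y).det) = fun y => ∑ σ : Equiv.Perm ι,
      ((Equiv.Perm.sign σ : ℤ) : ℂ) * ∏ i, F y i (σ i) := by
    funext y
    rw [← Matrix.det_transpose, Matrix.det_apply']
    rfl
  rw [h1]
  have h2 := HasFDerivAt.fun_sum (u := Finset.univ) fun (σ : Equiv.Perm ι) _ =>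
    (HasFDerivAt.finsetProd (u := Finset.univ) (fun i _ => hF i (σ i))).const_mul
      ((Equiv.Perm.sign σ : ℤ) : ℂ)
  refine h2.congr_fderiv ?_
  ext v
  have h3 := sum_adjugate_mul (F x) (Matrix.of fun p q => F' p q v)
  simp only [Matrix.of_apply] at h3
  simp only [sum_apply, smul_apply, smul_eq_mul, Finset.mul_sum]
  rw [h3, Finset.sum_comm]
  refine Finset.sum_congr rfl fun p _ => Finset.sum_congr rfl fun σ _ => by ring

theorem dz_det {F : Cn N → Matrix ι ι ℂ} {x : Cn N}
    (hF : ∀ i j, DifferentiableAt ℝ (fun y => F y i j) x) (l : Fin N) :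
    dz l (fun y => (F y).det) x = ∑ p, ∑ q, (F x).adjugate q p * dz l (fun y => F y p q) x := by
  rw [dz_eq, (hasFDerivAt_det fun i j => (hF i j).hasFDerivAt).fderiv]
  simp only [map_sum, dzL_smul, dz_eq]

theorem contDiffAt_det {E : Type*} [NormedAddCommGroup E] [NormedSpace ℝ E]
    {F : E → Matrix ι ι ℂ} {x : E} {r : WithTop ℕ∞}
    (hF : ∀ i j, ContDiffAt ℝ r (fun y => F y i j) x) : ContDiffAt ℝ r (fun y => (F y).det) x := by
  simp only [Matrix.det_apply']
  exact ContDiffAt.sum fun σ _ => contDiffAt_const.mul (contDiffAt_prod fun i _ => hF _ _)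

theorem contDiffAt_adjugate {E : Type*} [NormedAddCommGroup E] [NormedSpace ℝ E]
    {F : E → Matrix ι ι ℂ} {x : E} {r : WithTop ℕ∞}
    (hF : ∀ i j, ContDiffAt ℝ r (fun y => F y i j) x) (q p : ι) :
    ContDiffAt ℝ r (fun y => (F y).adjugate q p) x := by
  simp only [adjugate_eq_sum]
  refine ContDiffAt.sum fun σ _ => ?_
  split_ifs
  · exact contDiffAt_const.mul (contDiffAt_prod fun i _ => hF _ _)
  · exact contDiffAt_const

/-- The Piola identity: the cofactor matrix of a closed field of matrices is divergence free. -/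
theorem piola {F : Cn N → Matrix (Fin N) (Fin N) ℂ} {x : Cn N}
    (hF : ∀ i j, DifferentiableAt ℝ (fun y => F y i j) x)
    (hcl : ∀ l p q, dz l (fun y => F y p q) x = dz p (fun y => F y l q) x) (q : Fin N) :
    ∑ p, dz p (fun y => (F y).adjugate q p) x = 0 := by
  have hd : ∀ (σ : Equiv.Perm (Fin N)) (s : Finset (Fin N)),
      DifferentiableAt ℝ (fun y => ∏ i ∈ s, F y i (σ i)) x := fun σ s =>
    (HasFDerivAt.finsetProd (u := s) fun i _ => (hF i (σ i)).hasFDerivAt).differentiableAt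
  have h1 : ∀ p, dz p (fun y => (F y).adjugate q p) x = ∑ σ : Equiv.Perm (Fin N),
      if σ p = q then ∑ r ∈ Finset.univ.erase p, ((Equiv.Perm.sign σ : ℤ) : ℂ) *
        (∏ i ∈ (Finset.univ.erase p).erase r, F x i (σ i)) * dz p (fun y => F y r (σ r)) x
      else 0 := by
    intro p
    simp only [adjugate_eq_sum]
    rw [dz_sum]
    · refine Finset.sum_congr rfl fun σ _ => ?_
      split_ifs with h
      · rw [dz_const_mul (hd σ _),
          dz_prod _ fun i _ => hF _ _, Finset.mul_sum]
        exact Finset.sum_congr rfl fun r _ => by ring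
      · exact dz_const _ _ _
    · intro σ _
      split_ifs
      · exact (hd σ _).const_mul _
      · exact differentiableAt_const _
  simp only [h1, ← Finset.sum_filter]
  rw [Finset.sum_sigma', Finset.sum_sigma']
  -- The terms `(p, σ, r)` and `(r, σ ∘ (p r), p)` cancel.
  refine Finset.sum_involution (fun a _ => ⟨⟨a.2, a.1.2 * Equiv.swap a.1.1 a.2⟩, a.1.1⟩)
    ?_ ?_ ?_ ?_
  · rintro ⟨⟨p, σ⟩, r⟩ ha
    simp only [Finset.mem_sigma, Finset.mem_univ, Finset.mem_filter, true_and,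
      Finset.mem_erase, and_true] at ha
    obtain ⟨hσ, hr⟩ := ha
    have hprod : ∏ i ∈ (Finset.univ.erase r).erase p, F x i (σ (Equiv.swap p r i)) =
        ∏ i ∈ (Finset.univ.erase p).erase r, F x i (σ i) := by
      rw [Finset.erase_right_comm]
      refine Finset.prod_congr rfl fun i hi => ?_
      simp only [Finset.mem_erase, Finset.mem_univ, and_true] at hi
      rw [Equiv.swap_apply_of_ne_of_ne hi.2 hi.1]
    simp only [Equiv.Perm.mul_apply, Equiv.swap_apply_left, Equiv.Perm.sign_mul,
      Equiv.Perm.sign_swap hr.symm, hprod]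
    rw [hcl r p (σ r)]
    push_cast
    ring
  · rintro ⟨⟨p, σ⟩, r⟩ ha _ h
    simp only [Finset.mem_sigma, Finset.mem_univ, Finset.mem_filter, true_and,
      Finset.mem_erase, and_true] at ha
    simp only [Sigma.mk.injEq] at h
    exact ha.2 h.1.1
  · rintro ⟨⟨p, σ⟩, r⟩ ha
    simp only [Finset.mem_sigma, Finset.mem_univ, Finset.mem_filter, true_and,
      Finset.mem_erase, and_true] at ha ⊢
    refine ⟨?_, fun h => ha.2 h.symm⟩
    rw [Equiv.Perm.mul_apply, Equiv.swap_apply_right]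
    exact ha.1
  · rintro ⟨⟨p, σ⟩, r⟩ ha
    simp only [Equiv.swap_comm r p, mul_assoc, Equiv.swap_mul_self, mul_one]

end Cofactor

open MeasureTheory in
/-- Stokes' theorem for compactly supported functions. -/
theorem integral_dz_eq_zero {F : Cn N → ℂ} (hF : ContDiff ℝ 1 F) (hc : HasCompactSupport F)
    (j : Fin N) : ∫ p, dz j F p = 0 := by
  have key : ∀ v : Cn N, Integrable (fun p => fderiv ℝ F p v) ∧ ∫ p, fderiv ℝ F p v = 0 := by
    intro v
    have hcont : Continuous (fun p => fderiv ℝ F p v) :=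
      (hF.continuous_fderiv one_ne_zero).clm_apply continuous_const
    have hcs : HasCompactSupport (fun p => fderiv ℝ F p v) := hc.fderiv_apply (𝕜 := ℝ) v
    have hi := hcont.integrable_of_hasCompactSupport hcs (μ := volume)
    refine ⟨hi, ?_⟩
    have := integral_mul_fderiv_eq_neg_fderiv_mul_of_integrable (μ := volume) (f := fun _ => (1 : ℂ))
      (g := F) (v := v) (by simp) (by simpa using hi)
      (by simpa using hF.continuous.integrable_of_hasCompactSupport hc)
      (fun x _ => differentiableAt_const _) (fun x _ => hF.differentiable one_ne_zero x)
    simpa using this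
  simp only [dz]
  rw [integral_div, integral_sub (key _).1 ((key _).1.const_mul _), integral_const_mul,
    (key _).2, (key _).2]
  simp

end Hessians

/-! ### Integration over finite systems of holomorphic charts -/

section Extension

variable {Y : Type*} [TopologicalSpace Y] {k : ℕ} {E : Type*} [NormedAddCommGroup E]

/-- The expression of a function in a chart, extended by zero outside the target of the chart. -/
def chartExt (e : OpenPartialHomeomorph Y (Cn k)) (f : Y → E) : Cn k → E :=
  e.target.indicator (fun p => f (e.symm p))

theorem chartExt_eventuallyEq (e : OpenPartialHomeomorph Y (Cn k)) (f : Y → E) {p : Cn k}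
    (hp : p ∈ e.target) : chartExt e f =ᶠ[nhds p] fun p => f (e.symm p) := by
  filter_upwards [e.open_target.mem_nhds hp] with x hx
  exact Set.indicator_of_mem hx _

theorem chartExt_eq_zero (e : OpenPartialHomeomorph Y (Cn k)) {f : Y → E} {K : Set Y}
    (hf : ∀ y, y ∉ K → f y = 0) {p : Cn k} (hp : p ∉ e '' K) : chartExt e f p = 0 := by
  rw [chartExt, Set.indicator_apply_eq_zero]
  intro hpt
  refine hf _ fun hK => hp ⟨e.symm p, hK, e.right_inv hpt⟩

variable {e : OpenPartialHomeomorph Y (Cn k)} {f : Y → E} {K : Set Y}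

theorem chartExt_eventually_zero (hK : IsCompact K) (hKs : K ⊆ e.source)
    (hf : ∀ y, y ∉ K → f y = 0) {p : Cn k} (hp : p ∉ e.target) :
    chartExt e f =ᶠ[nhds p] fun _ => 0 := by
  have hc : IsClosed (e '' K) := (hK.image_of_continuousOn (e.continuousOn.mono hKs)).isClosed
  have hp' : p ∉ e '' K := by
    rintro ⟨y, hy, rfl⟩
    exact hp (e.map_source (hKs hy))
  filter_upwards [hc.isOpen_compl.mem_nhds hp'] with x hx
  exact chartExt_eq_zero e hf hx

theorem hasCompactSupport_chartExt (hK : IsCompact K) (hKs : K ⊆ e.source)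
    (hf : ∀ y, y ∉ K → f y = 0) : HasCompactSupport (chartExt e f) :=
  HasCompactSupport.intro (hK.image_of_continuousOn (e.continuousOn.mono hKs))
    fun _ hp => chartExt_eq_zero e hf hp

theorem continuous_chartExt (hK : IsCompact K) (hKs : K ⊆ e.source)
    (hf : ∀ y, y ∉ K → f y = 0) (hfc : ContinuousOn f e.source) : Continuous (chartExt e f) := by
  rw [continuous_iff_continuousAt]
  intro p
  by_cases hp : p ∈ e.target
  · refine ContinuousAt.congr ?_ (chartExt_eventuallyEq e f hp).symm
    exact ContinuousAt.comp (hfc.continuousAt (e.open_source.mem_nhds (e.map_target hp)))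
      (e.continuousAt_symm hp)
  · exact continuousAt_const.congr (chartExt_eventually_zero hK hKs hf hp).symm

theorem contDiff_chartExt [NormedSpace ℝ E] {r : WithTop ℕ∞} (hK : IsCompact K)
    (hKs : K ⊆ e.source) (hf : ∀ y, y ∉ K → f y = 0)
    (hfc : ∀ p ∈ e.target, ContDiffAt ℝ r (fun p => f (e.symm p)) p) :
    ContDiff ℝ r (chartExt e f) := by
  rw [contDiff_iff_contDiffAt]
  intro p
  by_cases hp : p ∈ e.target
  · exact (hfc p hp).congr_of_eventuallyEq (chartExt_eventuallyEq e f hp)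
  · exact contDiffAt_const.congr_of_eventuallyEq (chartExt_eventually_zero hK hKs hf hp)

theorem setIntegral_target_eq [NormedSpace ℝ E] (e : OpenPartialHomeomorph Y (Cn k)) (f : Y → E) :
    ∫ p in e.target, f (e.symm p) = ∫ p, chartExt e f p :=
  (integral_indicator e.open_target.measurableSet).symm

theorem integrableOn_target (hK : IsCompact K) (hKs : K ⊆ e.source)
    (hf : ∀ y, y ∉ K → f y = 0) (hfc : ContinuousOn f e.source) :
    IntegrableOn (fun p => f (e.symm p)) e.target := by
  rw [← integrable_indicator_iff e.open_target.measurableSet]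
  exact (continuous_chartExt hK hKs hf hfc).integrable_of_hasCompactSupport
    (hasCompactSupport_chartExt hK hKs hf)

end Extension

section Charts

variable {Y : Type*} [TopologicalSpace Y] {k : ℕ}

/-- Change of variables between two holomorphic charts. -/
theorem setIntegral_chart_change (e e' : OpenPartialHomeomorph Y (Cn k))
    (hol : ∀ y ∈ e.source, y ∈ e'.source → ContDiffAt ℂ ω (e' ∘ e.symm) (e y))
    (A B : Y → ℂ) (hA : ∀ y ∈ e.source, y ∉ e'.source → A y = 0)
    (hB : ∀ y ∈ e'.source, y ∉ e.source → B y = 0)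
    (hAB : ∀ y ∈ e.source, y ∈ e'.source →
      A y = Complex.normSq (jac (e' ∘ e.symm) (e y)).det * B y) :
    ∫ p in e.target, A (e.symm p) = ∫ p in e'.target, B (e'.symm p) := by
  set S : Set (Cn k) := {p | p ∈ e.target ∧ e.symm p ∈ e'.source} with hS
  have hSo : IsOpen S := e.symm.isOpen_inter_preimage e'.open_source
  have hSm : MeasurableSet S := hSo.measurableSet
  have himg : (e' ∘ e.symm) '' S = {p | p ∈ e'.target ∧ e'.symm p ∈ e.source} := by
    ext p
    constructor
    · rintro ⟨x, ⟨hx, hx'⟩, rfl⟩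
      refine ⟨e'.map_source hx', ?_⟩
      simp only [Function.comp_apply, e'.left_inv hx']
      exact e.map_target hx
    · rintro ⟨hp, hp'⟩
      refine ⟨e (e'.symm p), ⟨e.map_source hp', ?_⟩, ?_⟩
      · rw [e.left_inv hp']; exact e'.map_target hp
      · simp only [Function.comp_apply, e.left_inv hp', e'.right_inv hp]
  have h1 : ∫ p in e.target, A (e.symm p) = ∫ p in S, A (e.symm p) := by
    refine setIntegral_eq_of_subset_of_forall_sdiff_eq_zero e.open_target.measurableSet
      (fun p hp => hp.1) fun p hp => ?_
    exact hA _ (e.map_target hp.1) fun h => hp.2 ⟨hp.1, h⟩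
  have h2 : ∫ p in e'.target, B (e'.symm p) = ∫ p in (e' ∘ e.symm) '' S, B (e'.symm p) := by
    rw [himg]
    refine setIntegral_eq_of_subset_of_forall_sdiff_eq_zero e'.open_target.measurableSet
      (fun p hp => hp.1) fun p hp => ?_
    exact hB _ (e'.map_target hp.1) fun h => hp.2 ⟨hp.1, h⟩
  have hdiff : ∀ x ∈ S, DifferentiableAt ℂ (e' ∘ e.symm) x := fun x hx => by
    have := hol (e.symm x) (e.map_target hx.1) hx.2
    rw [e.right_inv hx.1] at this
    exact this.differentiableAt (by simp)
  have hinj : Set.InjOn (e' ∘ e.symm) S := by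
    intro x hx y hy hxy
    have := e'.injOn hx.2 hy.2 hxy
    exact e.symm.injOn hx.1 hy.1 this
  rw [h1, h2, integral_image_eq_integral_abs_det_fderiv_smul volume hSm
    (fun x hx => ((hdiff x hx).restrictScalars ℝ).hasFDerivAt.hasFDerivWithinAt) hinj]
  refine setIntegral_congr_fun hSm fun x hx => ?_
  have h3 := hAB (e.symm x) (e.map_target hx.1) hx.2
  rw [e.right_inv hx.1] at h3
  simp only [h3, det_fderiv_real (hdiff x hx), abs_of_nonneg (Complex.normSq_nonneg _),
    Function.comp_apply, e'.left_inv hx.2, Complex.real_smul]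

variable {ι : Type*} [Fintype ι] {e : ι → OpenPartialHomeomorph Y (Cn k)} {ρ : ι → Y → ℝ}

/-- The hypotheses under which integrals over a space with holomorphic charts can be computed by
means of a partition of unity. -/
structure IsChartSystem (e : ι → OpenPartialHomeomorph Y (Cn k)) (ρ : ι → Y → ℝ) : Prop where
  hol : ∀ i j, ∀ y ∈ (e i).source, y ∈ (e j).source → ContDiffAt ℂ ω (e j ∘ (e i).symm) (e i y)
  smooth : ∀ i j, ∀ p ∈ (e i).target, ContDiffAt ℝ ∞ (fun p => ρ j ((e i).symm p)) p
  sum_eq_one : ∀ y, ∑ i, ρ i y = 1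
  compact : ∀ i, HasCompactSupport (ρ i)
  subset : ∀ i, tsupport (ρ i) ⊆ (e i).source

theorem IsChartSystem.continuousOn (h : IsChartSystem e ρ) (i j : ι) :
    ContinuousOn (ρ j) (e i).source := by
  intro y hy
  have h1 := (h.smooth i j (e i y) ((e i).map_source hy)).continuousAt
  have h2 : ContinuousAt (fun y => ρ j ((e i).symm (e i y))) y :=
    ContinuousAt.comp (g := fun p => ρ j ((e i).symm p)) h1 ((e i).continuousAt hy)
  refine (h2.congr ?_).continuousWithinAt
  filter_upwards [(e i).open_source.mem_nhds hy] with x hx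
  rw [(e i).left_inv hx]

theorem notMem_tsupport_eq_zero {ρ : Y → ℝ} {y : Y} (hy : y ∉ tsupport ρ) : ρ y = 0 :=
  image_eq_zero_of_notMem_tsupport hy

/-- If the densities `q_{ij}` (the `j`-th density in the `i`-th chart) add up to zero over `j`,
then so do their integrals. -/
theorem sum_integral_density_eq_zero (h : IsChartSystem e ρ) (q : ι → ι → Y → ℂ)
    (hqc : ∀ i j, ContinuousOn (q i j) (e i).source)
    (hq0 : ∀ i j, ∀ y ∈ (e i).source, y ∉ tsupport (ρ j) → q i j y = 0)
    (hqt : ∀ i l j, ∀ y ∈ (e i).source, y ∈ (e l).source →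
      q i j y = Complex.normSq (jac (e l ∘ (e i).symm) (e i y)).det * q l j y)
    (hqs : ∀ i, ∀ y ∈ (e i).source, ∑ j, q i j y = 0) :
    ∑ i, ∫ p in (e i).target, q i i ((e i).symm p) = 0 := by
  classical
  -- `ρ_l q_{ij}`, cut off outside the domain of the `i`-th chart.
  set A : ι → ι → ι → Y → ℂ := fun i j l y => if y ∈ (e i).source then ρ l y * q i j y else 0
    with hA
  have hAeq : ∀ i j l, ∀ y ∈ (e i).source, A i j l y = ρ l y * q i j y := fun i j l y hy => if_pos hy
  have hAc : ∀ i j l, ContinuousOn (A i j l) (e i).source := fun i j l =>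
    ((Complex.continuous_ofReal.comp_continuousOn (h.continuousOn i l)).mul (hqc i j)).congr
      fun y hy => hAeq i j l y hy
  have hA0 : ∀ i j l y, y ∉ tsupport (ρ l) → A i j l y = 0 := fun i j l y hy => by
    simp only [hA, notMem_tsupport_eq_zero hy]; simp
  have hA0' : ∀ i j l y, y ∉ tsupport (ρ j) → A i j l y = 0 := fun i j l y hy => by
    simp only [hA]
    split_ifs with hys
    · rw [hq0 i j y hys hy, mul_zero]
    · rfl
  have hint1 : ∀ i l, IntegrableOn (fun p => A i i l ((e i).symm p)) (e i).target := fun i l =>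
    integrableOn_target (h.compact i) (h.subset i) (fun y hy => hA0' i i l y hy) (hAc i i l)
  have hint2 : ∀ i l, IntegrableOn (fun p => A l i l ((e l).symm p)) (e l).target := fun i l =>
    integrableOn_target (h.compact l) (h.subset l) (fun y hy => hA0 l i l y hy) (hAc l i l)
  have step1 : ∀ i, ∫ p in (e i).target, q i i ((e i).symm p) =
      ∑ l, ∫ p in (e i).target, A i i l ((e i).symm p) := by
    intro i
    rw [← integral_finsetSum _ fun l _ => hint1 i l]
    refine setIntegral_congr_fun (e i).open_target.measurableSet fun p hp => ?_
    have hs := (e i).map_target hp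
    simp only [hAeq _ _ _ _ hs, ← Finset.sum_mul, ← Complex.ofReal_sum, h.sum_eq_one,
      Complex.ofReal_one, one_mul]
  have step2 : ∀ i l, ∫ p in (e i).target, A i i l ((e i).symm p) =
      ∫ p in (e l).target, A l i l ((e l).symm p) := by
    intro i l
    refine setIntegral_chart_change (e i) (e l) (h.hol i l) _ _ (fun y _ hy => ?_)
      (fun y _ hy => ?_) fun y hy hy' => ?_
    · exact hA0 _ _ _ _ fun h' => hy (h.subset l h')
    · exact hA0' _ _ _ _ fun h' => hy (h.subset i h')
    · rw [hAeq _ _ _ _ hy, hAeq _ _ _ _ hy', hqt i l i y hy hy']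
      ring
  rw [Finset.sum_congr rfl fun i _ => (step1 i).trans (Finset.sum_congr rfl fun l _ => step2 i l),
    Finset.sum_comm]
  refine Finset.sum_eq_zero fun l _ => ?_
  rw [← integral_finsetSum _ fun i _ => hint2 i l]
  refine setIntegral_eq_zero_of_forall_eq_zero fun p hp => ?_
  have hs := (e l).map_target hp
  have hp' : ∀ i, A l i l ((e l).symm p) = ρ l ((e l).symm p) * q l i ((e l).symm p) :=
    fun i => hAeq l i l _ hs
  simp only [hp']
  rw [← Finset.mul_sum, hqs l _ hs, mul_zero]

/-- Transformation of the density `ρ̇ det F - ∑ f_p (adj F)_{qp} b_q`. -/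
theorem density_transform (J F F' : Matrix (Fin k) (Fin k) ℂ) (f f' b b' w : Fin k → ℂ) (r r' : ℂ)
    (hF : F = Jᵀ * F' * J.map (starRingEnd ℂ)) (hf : f = Jᵀ *ᵥ f')
    (hb : b = (J.map (starRingEnd ℂ))ᵀ *ᵥ (b' + F'ᵀ *ᵥ w)) (hr : r = r' + w ⬝ᵥ f') :
    r * F.det - b ⬝ᵥ (F.adjugate *ᵥ f) =
      Complex.normSq J.det * (r' * F'.det - b' ⬝ᵥ (F'.adjugate *ᵥ f')) := by
  set Jc := J.map (starRingEnd ℂ) with hJc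
  have hdetc : Jc.det = (starRingEnd ℂ) J.det := by
    rw [hJc, ← RingHom.mapMatrix_apply, ← RingHom.map_det]
  have hn : (Complex.normSq J.det : ℂ) = J.det * Jc.det := by
    rw [hdetc, Complex.mul_conj]
  have h1 : F.adjugate *ᵥ f = (J.det) • (Jc.adjugate *ᵥ (F'.adjugate *ᵥ f')) := by
    rw [hF, hf, Matrix.adjugate_mul_distrib, Matrix.adjugate_mul_distrib, Matrix.mulVec_mulVec,
      Matrix.mul_assoc, Matrix.mul_assoc, Matrix.adjugate_mul, Matrix.det_transpose,
      Matrix.mul_smul, Matrix.mul_smul, Matrix.mul_one, Matrix.smul_mulVec, Matrix.mulVec_mulVec]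
  have h2 : b ⬝ᵥ (Jc.adjugate *ᵥ (F'.adjugate *ᵥ f')) =
      Jc.det * ((b' + F'ᵀ *ᵥ w) ⬝ᵥ (F'.adjugate *ᵥ f')) := by
    rw [hb, Matrix.mulVec_transpose, ← Matrix.dotProduct_mulVec, Matrix.mulVec_mulVec,
      Matrix.mul_adjugate, Matrix.smul_mulVec, Matrix.one_mulVec, dotProduct_smul, smul_eq_mul]
  have h3 : (F'ᵀ *ᵥ w) ⬝ᵥ (F'.adjugate *ᵥ f') = F'.det * (w ⬝ᵥ f') := by
    rw [Matrix.mulVec_transpose, ← Matrix.dotProduct_mulVec, Matrix.mulVec_mulVec,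
      Matrix.mul_adjugate, Matrix.smul_mulVec, Matrix.one_mulVec, dotProduct_smul, smul_eq_mul]
  have h4 : F.det = J.det * F'.det * Jc.det := by
    rw [hF, Matrix.det_mul, Matrix.det_mul, Matrix.det_transpose]
  rw [h1, dotProduct_smul, h2, add_dotProduct, h3, h4, hr, hn, smul_eq_mul]
  ring

/-- Stokes' theorem in the form of a first variation formula: `F` is a closed `(1,1)`-form with
parameters, `b` the `(0,1)`-form whose `∂`-derivative is the derivative of `F` with respect to the
parameter, `ρ̇` is the derivative of the partition of unity, and `w` is the velocity of the change of
charts. -/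
theorem sum_integral_variation_eq_zero (h : IsChartSystem e ρ)
    (F : ι → Cn k → Matrix (Fin k) (Fin k) ℂ) (b : ι → Cn k → Fin k → ℂ) (r : ι → ι → Cn k → ℂ)
    (w : ι → ι → Y → Fin k → ℂ)
    (hFs : ∀ i, ∀ p ∈ (e i).target, ∀ a c, ContDiffAt ℝ ∞ (fun x => F i x a c) p)
    (hbs : ∀ i, ∀ p ∈ (e i).target, ∀ a, ContDiffAt ℝ ∞ (fun x => b i x a) p)
    (hrc : ∀ i j, ContinuousOn (r i j) (e i).target)
    (hr0 : ∀ i j, ∀ p ∈ (e i).target, (e i).symm p ∉ tsupport (ρ j) → r i j p = 0)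
    (hrs : ∀ i, ∀ p ∈ (e i).target, ∑ j, r i j p = 0)
    (hcl : ∀ i, ∀ p ∈ (e i).target, ∀ l a c,
      dz l (fun x => F i x a c) p = dz a (fun x => F i x l c) p)
    (hFt : ∀ i l, ∀ y ∈ (e i).source, y ∈ (e l).source → F i (e i y) =
      (jac (e l ∘ (e i).symm) (e i y))ᵀ * F l (e l y) *
        (jac (e l ∘ (e i).symm) (e i y)).map (starRingEnd ℂ))
    (hbt : ∀ i l, ∀ y ∈ (e i).source, y ∈ (e l).source → b i (e i y) =
      ((jac (e l ∘ (e i).symm) (e i y)).map (starRingEnd ℂ))ᵀ *ᵥ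
        (b l (e l y) + (F l (e l y))ᵀ *ᵥ w i l y))
    (hrt : ∀ i l j, ∀ y ∈ (e i).source, y ∈ (e l).source → r i j (e i y) = r l j (e l y) +
      w i l y ⬝ᵥ fun a => dz a (fun p => (ρ j ((e l).symm p) : ℂ)) (e l y)) :
    ∑ i, ∫ p in (e i).target, (r i i p * (F i p).det + ρ i ((e i).symm p) *
      ∑ a, ∑ c, (F i p).adjugate c a * dz a (fun x => b i x c) p) = 0 := by
  set dρ : ι → ι → Cn k → Fin k → ℂ := fun i j p a => dz a (fun p => (ρ j ((e i).symm p) : ℂ)) p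
    with hdρ
  have hρs : ∀ i j, ∀ p ∈ (e i).target, ContDiffAt ℝ ∞ (fun p => (ρ j ((e i).symm p) : ℂ)) p :=
    fun i j p hp => contDiffAt_ofReal (h.smooth i j p hp)
  have hdρs : ∀ i j, ∀ p ∈ (e i).target, ∀ a, ContDiffAt ℝ ∞ (fun p => dρ i j p a) p :=
    fun i j p hp a => contDiffAt_dz (hρs i j p hp) a
  set Q : ι → ι → Cn k → ℂ := fun i j p =>
    r i j p * (F i p).det - b i p ⬝ᵥ ((F i p).adjugate *ᵥ dρ i j p) with hQ
  have hvs : ∀ i j, ∀ p ∈ (e i).target,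
      ContDiffAt ℝ ∞ (fun p => b i p ⬝ᵥ ((F i p).adjugate *ᵥ dρ i j p)) p := by
    intro i j p hp
    simp only [dotProduct, Matrix.mulVec]
    exact ContDiffAt.sum fun a _ => (hbs i p hp a).mul (ContDiffAt.sum fun c _ =>
      (contDiffAt_adjugate (hFs i p hp) a c).mul (hdρs i j p hp c))
  have hQc : ∀ i j, ContinuousOn (Q i j) (e i).target := fun i j =>
    ((hrc i j).mul fun p hp =>
      (contDiffAt_det (hFs i p hp)).continuousAt.continuousWithinAt).sub
      fun p hp => (hvs i j p hp).continuousAt.continuousWithinAt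
  have hdρ0 : ∀ i j, ∀ p ∈ (e i).target, (e i).symm p ∉ tsupport (ρ j) → dρ i j p = 0 := by
    intro i j p hp hp'
    funext a
    have : (fun p => (ρ j ((e i).symm p) : ℂ)) =ᶠ[nhds p] fun _ => 0 := by
      filter_upwards [(e i).continuousAt_symm hp
        ((isClosed_tsupport (ρ j)).isOpen_compl.mem_nhds hp')] with x hx
      rw [notMem_tsupport_eq_zero hx, Complex.ofReal_zero]
    simp only [hdρ, dz_congr this, dz_const, Pi.zero_apply]
  -- the densities `Q` integrate to zero
  have main : ∑ i, ∫ p in (e i).target, Q i i (e i ((e i).symm p)) = 0 := by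
    refine sum_integral_density_eq_zero h (fun i j y => Q i j (e i y)) (fun i j => ?_)
      (fun i j y hy hy' => ?_) (fun i l j y hy hy' => ?_) (fun i y hy => ?_)
    · exact (hQc i j).comp (e i).continuousOn (e i).mapsTo
    · have hyt := (e i).map_source hy
      have hy'' : (e i).symm (e i y) ∉ tsupport (ρ j) := by rwa [(e i).left_inv hy]
      simp only [hQ, hr0 i j _ hyt hy'', hdρ0 i j _ hyt hy'']
      simp
    · refine density_transform _ _ _ _ _ _ _ (w i l y) _ _ (hFt i l y hy hy') ?_
        (hbt i l y hy hy') (hrt i l j y hy hy')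
      funext a
      have hd := (h.hol i l y hy hy').differentiableAt (by simp)
      have hev : (fun p => (ρ j ((e i).symm p) : ℂ)) =ᶠ[nhds (e i y)]
          fun p => (fun p' => (ρ j ((e l).symm p') : ℂ)) ((e l ∘ (e i).symm) p) := by
        have hopen : IsOpen {p | p ∈ (e i).target ∧ (e i).symm p ∈ (e l).source} :=
          (e i).symm.isOpen_inter_preimage (e l).open_source
        filter_upwards [hopen.mem_nhds ⟨(e i).map_source hy, by rwa [(e i).left_inv hy]⟩]
          with p hp
        simp only [Function.comp_apply, (e l).left_inv hp.2]
      have hly : (e l ∘ (e i).symm) (e i y) = e l y := by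
        simp only [Function.comp_apply, (e i).left_inv hy]
      have hdl : DifferentiableAt ℝ (fun p' => (ρ j ((e l).symm p') : ℂ))
          ((e l ∘ (e i).symm) (e i y)) := by
        rw [hly]
        exact (hρs l j _ ((e l).map_source hy')).differentiableAt (by simp)
      simp only [hdρ]
      rw [dz_congr hev, dz_comp hd hdl, hly]
      rfl
    · have hyt := (e i).map_source hy
      have h1 : ∑ j, dρ i j (e i y) = 0 := by
        funext a
        rw [Finset.sum_apply]
        simp only [hdρ]
        rw [← dz_sum _ fun j _ => (hρs i j _ hyt).differentiableAt (by simp)]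
        have : (fun p => ∑ j, (ρ j ((e i).symm p) : ℂ)) = fun _ => 1 := by
          funext p
          rw [← Complex.ofReal_sum, h.sum_eq_one, Complex.ofReal_one]
        rw [this, dz_const, Pi.zero_apply]
      simp only [hQ, Finset.sum_sub_distrib, ← Finset.sum_mul, hrs i _ hyt, zero_mul,
        ← dotProduct_sum, ← Matrix.mulVec_sum, h1]
      simp
  -- integration by parts in each chart
  rw [← main]
  refine Finset.sum_congr rfl fun i _ => ?_
  set V : Fin k → Y → ℂ := fun a y => ρ i y * ∑ c, b i (e i y) c * (F i (e i y)).adjugate c a with hV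
  have hV0 : ∀ a y, y ∉ tsupport (ρ i) → V a y = 0 := fun a y hy => by
    simp [hV, notMem_tsupport_eq_zero hy]
  have hVloc : ∀ a, ∀ p ∈ (e i).target, (fun p => V a ((e i).symm p)) =ᶠ[nhds p]
      fun p => (ρ i ((e i).symm p) : ℂ) * ∑ c, b i p c * (F i p).adjugate c a := by
    intro a p hp
    filter_upwards [(e i).open_target.mem_nhds hp] with x hx
    simp only [hV, (e i).right_inv hx]
  have hbF : ∀ a, ∀ p ∈ (e i).target,
      ContDiffAt ℝ ∞ (fun p => ∑ c, b i p c * (F i p).adjugate c a) p := fun a p hp =>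
    ContDiffAt.sum fun c _ => (hbs i p hp c).mul (contDiffAt_adjugate (hFs i p hp) c a)
  have hVs : ∀ a, ContDiff ℝ ∞ (chartExt (e i) (V a)) := fun a =>
    contDiff_chartExt (h.compact i) (h.subset i) (hV0 a) fun p hp =>
      ((hρs i i p hp).mul (hbF a p hp)).congr_of_eventuallyEq (hVloc a p hp)
  have hVc : ∀ a, HasCompactSupport (chartExt (e i) (V a)) := fun a =>
    hasCompactSupport_chartExt (h.compact i) (h.subset i) (hV0 a)
  have hdiv : ∀ p ∈ (e i).target, ∑ a, dz a (chartExt (e i) (V a)) p =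
      (r i i p * (F i p).det + ρ i ((e i).symm p) *
        ∑ a, ∑ c, (F i p).adjugate c a * dz a (fun x => b i x c) p) -
      Q i i (e i ((e i).symm p)) := by
    intro p hp
    have hpi := piola (fun a c => (hFs i p hp a c).differentiableAt (by simp)) (hcl i p hp)
    have h1 : ∀ a, dz a (chartExt (e i) (V a)) p = ρ i ((e i).symm p) *
        ∑ c, ((F i p).adjugate c a * dz a (fun x => b i x c) p +
          b i p c * dz a (fun x => (F i x).adjugate c a) p) +
        (∑ c, b i p c * (F i p).adjugate c a) * dρ i i p a := by
      intro a
      rw [dz_congr ((chartExt_eventuallyEq (e i) (V a) hp).trans (hVloc a p hp)),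
        dz_mul ((hρs i i p hp).differentiableAt (by simp)) ((hbF a p hp).differentiableAt (by simp)),
        dz_sum _ fun c _ => ((hbs i p hp c).mul
          (contDiffAt_adjugate (hFs i p hp) c a)).differentiableAt (by simp)]
      congr 2
      refine Finset.sum_congr rfl fun c _ => ?_
      rw [dz_mul ((hbs i p hp c).differentiableAt (by simp))
        ((contDiffAt_adjugate (hFs i p hp) c a).differentiableAt (by simp))]
      ring
    have h2 : ∑ a, ∑ c, b i p c * dz a (fun x => (F i x).adjugate c a) p = 0 := by
      rw [Finset.sum_comm]
      refine Finset.sum_eq_zero fun c _ => ?_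
      rw [← Finset.mul_sum, hpi c, mul_zero]
    have h3 : ∑ a, (∑ c, b i p c * (F i p).adjugate c a) * dρ i i p a =
        b i p ⬝ᵥ ((F i p).adjugate *ᵥ dρ i i p) := by
      simp only [dotProduct, Matrix.mulVec, Finset.sum_mul, Finset.mul_sum]
      rw [Finset.sum_comm]
      exact Finset.sum_congr rfl fun c _ => Finset.sum_congr rfl fun a _ => by ring
    simp only [h1, Finset.sum_add_distrib, ← Finset.mul_sum, hQ, (e i).right_inv hp]
    rw [h2, h3]
    ring
  have hint : ∀ a, Integrable (fun p => dz a (chartExt (e i) (V a)) p) := by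
    intro a
    have hc : Continuous (fun p => dz a (chartExt (e i) (V a)) p) := by
      simp only [dz_eq]
      exact (dzL a).continuous.comp ((hVs a).continuous_fderiv (by simp))
    refine hc.integrable_of_hasCompactSupport ?_
    simp only [dz_eq]
    exact ((hVc a).fderiv (𝕜 := ℝ)).comp_left (g := dzL a) (map_zero _)
  have hzero : ∫ p in (e i).target, ∑ a, dz a (chartExt (e i) (V a)) p = 0 := by
    rw [integral_finsetSum _ fun a _ => (hint a).integrableOn]
    refine Finset.sum_eq_zero fun a _ => ?_
    rw [setIntegral_eq_integral_of_forall_compl_eq_zero, integral_dz_eq_zero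
      ((hVs a).of_le one_le_infty) (hVc a)]
    intro p hp
    rw [dz_congr (chartExt_eventually_zero (h.compact i) (h.subset i) (hV0 a) hp), dz_const]
  have hQint : IntegrableOn (fun p => Q i i (e i ((e i).symm p))) (e i).target := by
    refine integrableOn_target (f := (e i).source.indicator (fun y => Q i i (e i y)))
      (h.compact i) (h.subset i) (fun y hy => ?_) ?_ |>.congr_fun ?_ (e i).open_target.measurableSet
    · rw [Set.indicator_apply_eq_zero]
      intro hys
      have hyt := (e i).map_source hys
      have hy'' : (e i).symm (e i y) ∉ tsupport (ρ i) := by rwa [(e i).left_inv hys]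
      simp only [hQ, hr0 i i _ hyt hy'', hdρ0 i i _ hyt hy'']
      simp
    · exact ((hQc i i).comp (e i).continuousOn (e i).mapsTo).congr fun y hy =>
        Set.indicator_of_mem hy _
    · intro p hp
      exact Set.indicator_of_mem ((e i).map_target hp) _
  have hsplit : ∀ p ∈ (e i).target, r i i p * (F i p).det + ρ i ((e i).symm p) *
        ∑ a, ∑ c, (F i p).adjugate c a * dz a (fun x => b i x c) p =
      (∑ a, dz a (chartExt (e i) (V a)) p) + Q i i (e i ((e i).symm p)) := fun p hp => by
    rw [hdiv p hp]; ring
  rw [setIntegral_congr_fun (e i).open_target.measurableSet hsplit, integral_add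
    (integrable_finsetSum _ fun a _ => (hint a).integrableOn) hQint, hzero, zero_add]

end Charts

/-! ### Holomorphic charts, Kähler forms and curvature forms -/

section Charts

variable {N : ℕ} {X : Type*} [TopologicalSpace X]

theorem eventually_symm_mem {e e' : OpenPartialHomeomorph X (Cn N)} {x : X} (hx : x ∈ e.source)
    (hx' : x ∈ e'.source) : ∀ᶠ p in nhds (e x), p ∈ e.target ∧ e.symm p ∈ e'.source :=
  (e.symm.isOpen_inter_preimage e'.open_source).mem_nhds
    ⟨e.map_source hx, by simpa [e.left_inv hx] using hx'⟩

variable [ChartedSpace (Cn N) X]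

theorem contDiffAt_transition {e e' : OpenPartialHomeomorph X (Cn N)}
    (he : e ∈ IsManifold.maximalAtlas 𝓘(ℂ, Cn N) ω X)
    (he' : e' ∈ IsManifold.maximalAtlas 𝓘(ℂ, Cn N) ω X) {x : X} (hx : x ∈ e.source)
    (hx' : x ∈ e'.source) : ContDiffAt ℂ ω (e' ∘ e.symm) (e x) := by
  have h' : ContMDiffAt 𝓘(ℂ, Cn N) 𝓘(ℂ, Cn N) ω e' (e.symm (e x)) := by
    rw [e.left_inv hx]
    exact contMDiffAt_of_mem_maximalAtlas he' hx'
  exact (h'.comp _ (contMDiffAt_symm_of_mem_maximalAtlas he (e.map_source hx))).contDiffAt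

theorem jac_transition {e e' e'' : OpenPartialHomeomorph X (Cn N)}
    (he : e ∈ IsManifold.maximalAtlas 𝓘(ℂ, Cn N) ω X)
    (he' : e' ∈ IsManifold.maximalAtlas 𝓘(ℂ, Cn N) ω X)
    (he'' : e'' ∈ IsManifold.maximalAtlas 𝓘(ℂ, Cn N) ω X) {x : X} (hx : x ∈ e.source)
    (hx' : x ∈ e'.source) (hx'' : x ∈ e''.source) :
    jac (e'' ∘ e.symm) (e x) = jac (e'' ∘ e'.symm) (e' x) * jac (e' ∘ e.symm) (e x) := by
  have h0 : (e' ∘ e.symm) (e x) = e' x := by simp [e.left_inv hx]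
  have h1 := (contDiffAt_transition he' he'' hx' hx'').differentiableAt (by simp)
  have h2 := (contDiffAt_transition he he' hx hx').differentiableAt (by simp)
  rw [← h0] at h1 ⊢
  rw [← jac_comp h1 h2]
  refine jac_congr ?_
  filter_upwards [eventually_symm_mem hx hx'] with p hp
  simp only [Function.comp_apply, e'.left_inv hp.2]

theorem jac_transition_mul_symm {e e' : OpenPartialHomeomorph X (Cn N)}
    (he : e ∈ IsManifold.maximalAtlas 𝓘(ℂ, Cn N) ω X)
    (he' : e' ∈ IsManifold.maximalAtlas 𝓘(ℂ, Cn N) ω X) {x : X} (hx : x ∈ e.source)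
    (hx' : x ∈ e'.source) :
    jac (e ∘ e'.symm) (e' x) * jac (e' ∘ e.symm) (e x) = 1 := by
  rw [← jac_transition he he' he hx hx' hx, ← jac_id (e x)]
  refine jac_congr ?_
  filter_upwards [e.open_target.mem_nhds (e.map_source hx)] with p hp
  exact e.right_inv hp

theorem contDiffAt_comp_symm {E : Type*} [NormedAddCommGroup E] [NormedSpace ℝ E] {f : X → E}
    {x : X} [IsManifold 𝓘(ℂ, Cn N) ω X] (hf : ContMDiffAt 𝓘(ℝ, Cn N) 𝓘(ℝ, E) ∞ f x)
    {e : OpenPartialHomeomorph X (Cn N)}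
    (he : e ∈ IsManifold.maximalAtlas 𝓘(ℂ, Cn N) ω X) (hx : x ∈ e.source) :
    ContDiffAt ℝ ∞ (fun p => f (e.symm p)) (e x) := by
  have h1 := (contMDiffAt_iff.1 hf).2
  simp only [mfld_simps, contDiffWithinAt_univ, chartAt_self_eq] at h1
  have h2 := (contDiffAt_transition he (IsManifold.chart_mem_maximalAtlas x) hx
    (mem_chart_source (Cn N) x)).restrict_scalars ℝ |>.of_le (m := ∞) le_top
  have h3 : (chartAt (Cn N) x ∘ e.symm) (e x) = chartAt (Cn N) x x := by simp [e.left_inv hx]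
  rw [← h3] at h1
  refine (h1.comp _ h2).congr_of_eventuallyEq ?_
  filter_upwards [eventually_symm_mem hx (mem_chart_source (Cn N) x)] with p hp
  simp only [Function.comp_apply, (chartAt (Cn N) x).left_inv hp.2]

/-- The tangent space of `X` at `x` is the model space of the preferred chart at `x`; in these
terms the differential of the inverse of a chart is a matrix of transition derivatives. -/
theorem mfderiv_symm_apply {e : OpenPartialHomeomorph X (Cn N)}
    [IsManifold 𝓘(ℂ, Cn N) ω X]
    (he : e ∈ IsManifold.maximalAtlas 𝓘(ℂ, Cn N) ω X) {x : X} (hx : x ∈ e.source) (v : Cn N) :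
    (mfderiv 𝓘(ℂ, Cn N) 𝓘(ℂ, Cn N) e.symm (e x) v : Cn N) =
      (jac (chartAt (Cn N) x ∘ e.symm) (e x)).mulVec v := by
  have h := (contMDiffAt_symm_of_mem_maximalAtlas he (e.map_source hx)).mdifferentiableAt
    (by simp)
  rw [h.mfderiv, jac_mulVec]
  simp only [writtenInExtChartAt, mfld_simps, fderivWithin_univ, e.left_inv hx, chartAt_self_eq]
  rfl

theorem mfderiv_chart_apply {e : OpenPartialHomeomorph X (Cn N)} [IsManifold 𝓘(ℂ, Cn N) ω X]
    (he : e ∈ IsManifold.maximalAtlas 𝓘(ℂ, Cn N) ω X) {x : X} (hx : x ∈ e.source) (v : Cn N) :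
    (mfderiv 𝓘(ℂ, Cn N) 𝓘(ℂ, Cn N) e x v : Cn N) =
      (jac (e ∘ (chartAt (Cn N) x).symm) (chartAt (Cn N) x x)).mulVec v := by
  have h := (contMDiffAt_of_mem_maximalAtlas he hx).mdifferentiableAt (by simp)
  rw [h.mfderiv, jac_mulVec]
  simp only [writtenInExtChartAt, mfld_simps, fderivWithin_univ, chartAt_self_eq]
  rfl

theorem sesq_eq (H : Matrix (Fin N) (Fin N) ℂ) (v w : Cn N) :
    sesq H v w = Complex.I * (v ⬝ᵥ (H *ᵥ (star w))) := by
  simp only [sesq, dotProduct, Matrix.mulVec, Finset.mul_sum, Pi.star_apply, RCLike.star_def]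
  exact Finset.sum_congr rfl fun _ _ => Finset.sum_congr rfl fun _ _ => by ring

theorem sesq_congruence {K : ℕ} (J : Matrix (Fin N) (Fin K) ℂ) (H : Matrix (Fin N) (Fin N) ℂ)
    (v w : Cn K) :
    sesq (Jᵀ * H * J.map (starRingEnd ℂ)) v w = sesq H (J *ᵥ v) (J *ᵥ w) := by
  have h : star (J *ᵥ w) = J.map (starRingEnd ℂ) *ᵥ star w := by
    rw [Matrix.star_mulVec, ← Matrix.mulVec_transpose]
    rfl
  rw [sesq_eq, sesq_eq, h, ← Matrix.mulVec_mulVec, ← Matrix.mulVec_mulVec, Matrix.mulVec_transpose,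
    dotProduct_comm, ← Matrix.dotProduct_mulVec, dotProduct_comm]

theorem isHermitian_congruence {K : ℕ} (J : Matrix (Fin N) (Fin K) ℂ)
    {H : Matrix (Fin N) (Fin N) ℂ} (hH : H.IsHermitian) :
    (Jᵀ * H * J.map (starRingEnd ℂ)).IsHermitian := by
  have h1 : (J.map (starRingEnd ℂ))ᴴ = Jᵀ := by
    ext i j; simp [Matrix.conjTranspose_apply]
  have h2 : (Jᵀ)ᴴ = J.map (starRingEnd ℂ) := by
    ext i j; simp [Matrix.conjTranspose_apply]
  rw [Matrix.IsHermitian, Matrix.conjTranspose_mul, Matrix.conjTranspose_mul, h1, h2, hH.eq,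
    Matrix.mul_assoc]

theorem formOfMatrix_congruence {K : ℕ} (J : Matrix (Fin N) (Fin K) ℂ)
    {H : Matrix (Fin N) (Fin N) ℂ} (hH : H.IsHermitian) (v : Fin 2 → Cn K) :
    formOfMatrix (Jᵀ * H * J.map (starRingEnd ℂ)) v = formOfMatrix H (fun j => J *ᵥ v j) := by
  rw [← Complex.ofReal_inj, formOfMatrix_eq_sesq (isHermitian_congruence J hH),
    formOfMatrix_eq_sesq hH, sesq_congruence, sesq_congruence]

end Charts

section Kaehler

variable {m : ℕ} {M : Type*} [TopologicalSpace M] [ChartedSpace (Cn m) M]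

namespace KaehlerMetric

variable (g : KaehlerMetric m M)

/-- The Hermitian metric, pulled back under a complex linear map `A` into the tangent space, in matrix
form. -/
theorem g_eq_dotProduct (y : M) {K : ℕ} (A : Cn K → TangentSpace 𝓘(ℂ, Cn m) y)
    (hadd : ∀ u v, A (u + v) = A u + A v) (hsmul : ∀ (c : ℂ) u, A (c • u) = c • A u)
    (u v : Cn K) : g.g y (A u) (A v) = u ⬝ᵥ (Matrix.of (fun a b =>
      g.g y (A (Pi.single a 1)) (A (Pi.single b 1))) *ᵥ star v) := by
  let l : TangentSpace 𝓘(ℂ, Cn m) y → Cn K →ₗ[ℂ] ℂ := fun w =>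
    { toFun := fun u => g.g y (A u) w
      map_add' := fun u v => by rw [hadd, g.add_left]
      map_smul' := fun c u => by rw [hsmul, g.smul_left]; rfl }
  have h : ∀ w u, g.g y (A u) w = ∑ a, u a * g.g y (A (Pi.single a 1)) w := fun w u => by
    have h1 : ∀ a : Fin K, (Pi.single a 1 : Cn K) = fun j => if a = j then 1 else 0 := fun a => by
      ext j
      simp [Pi.single_apply, eq_comm]
    have := LinearMap.pi_apply_eq_sum_univ (l w) u
    simp only [h1]
    exact this
  rw [h, dotProduct]
  refine Finset.sum_congr rfl fun a _ => ?_
  rw [← g.conj_symm, h, map_sum, Matrix.mulVec, dotProduct]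
  congr 1
  refine Finset.sum_congr rfl fun b _ => ?_
  rw [map_mul, g.conj_symm, Matrix.of_apply, mul_comm]
  rfl

/-- The matrix of the metric at `y` in the preferred chart at `y`. -/
def chartMatrix (y : M) : Matrix (Fin m) (Fin m) ℂ :=
  Matrix.of fun a b => g.g y (Pi.single a 1 : Cn m) (Pi.single b 1 : Cn m)

theorem g_eq_chartMatrix (y : M) (u v : Cn m) :
    g.g y u v = u ⬝ᵥ (g.chartMatrix y *ᵥ star v) :=
  g.g_eq_dotProduct y (fun u : Cn m => u) (fun _ _ => rfl) (fun _ _ => rfl) u v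

theorem isHermitian_chartMatrix (y : M) : (g.chartMatrix y).IsHermitian := by
  ext a b
  rw [Matrix.conjTranspose_apply]
  exact g.conj_symm _ _ _

open scoped ComplexOrder in
theorem posDef_chartMatrix (y : M) : (g.chartMatrix y).PosDef := by
  refine Matrix.PosDef.of_dotProduct_mulVec_pos (g.isHermitian_chartMatrix y) fun v hv => ?_
  have h1 := g.pos y (star v : Cn m) (star_ne_zero.2 hv)
  have h2 := g.conj_symm y (star v : Cn m) (star v : Cn m)
  have h3 := g.g_eq_chartMatrix y (star v) (star v)
  rw [star_star] at h3
  rw [← h3, Complex.pos_iff]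
  exact ⟨h1, (Complex.conj_eq_iff_im.1 h2).symm⟩

theorem form_eq (y : M) (v : Fin 2 → Cn m) : g.form y v = formOfMatrix (g.chartMatrix y) v := by
  rw [← Complex.ofReal_inj, formOfMatrix_eq_sesq (g.isHermitian_chartMatrix y), sesq_eq, sesq_eq,
    ← g.g_eq_chartMatrix, ← g.g_eq_chartMatrix, ← g.conj_symm y (v 0) (v 1)]
  apply Complex.ext <;> simp [form]
  ring

variable {e f : OpenPartialHomeomorph M (Cn m)}

theorem matrix_symm_apply {p : Cn m} (hp : p ∈ e.target) (a b : Fin m) :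
    g.matrix e (e.symm p) a b = g.g (e.symm p)
      (mfderiv 𝓘(ℂ, Cn m) 𝓘(ℂ, Cn m) e.symm p (Pi.single a 1 : Cn m))
      (mfderiv 𝓘(ℂ, Cn m) 𝓘(ℂ, Cn m) e.symm p (Pi.single b 1 : Cn m)) := by
  let F : Cn m → ℂ := fun p => g.g (e.symm p)
      (mfderiv 𝓘(ℂ, Cn m) 𝓘(ℂ, Cn m) e.symm p (Pi.single a 1 : Cn m))
      (mfderiv 𝓘(ℂ, Cn m) 𝓘(ℂ, Cn m) e.symm p (Pi.single b 1 : Cn m))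
  change F (e (e.symm p)) = F p
  rw [e.right_inv hp]

theorem contDiffAt_matrix (he : e ∈ IsManifold.maximalAtlas 𝓘(ℂ, Cn m) ω M) {p : Cn m}
    (hp : p ∈ e.target) (a b : Fin m) :
    ContDiffAt ℝ ∞ (fun p => g.matrix e (e.symm p) a b) p := by
  refine ((g.smooth e he (Pi.single a 1) (Pi.single b 1)).contDiffAt
    (e.open_target.mem_nhds hp)).congr_of_eventuallyEq ?_
  filter_upwards [e.open_target.mem_nhds hp] with q hq
  exact g.matrix_symm_apply hq a b

/-- The Kähler condition. -/
theorem dz_matrix (he : e ∈ IsManifold.maximalAtlas 𝓘(ℂ, Cn m) ω M) {p : Cn m}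
    (hp : p ∈ e.target) (l a b : Fin m) :
    dz l (fun p => g.matrix e (e.symm p) a b) p = dz a (fun p => g.matrix e (e.symm p) l b) p := by
  set G : Fin m → Fin m → Cn m → ℂ := fun a b q => g.g (e.symm q)
      (mfderiv 𝓘(ℂ, Cn m) 𝓘(ℂ, Cn m) e.symm q (Pi.single a 1 : Cn m))
      (mfderiv 𝓘(ℂ, Cn m) 𝓘(ℂ, Cn m) e.symm q (Pi.single b 1 : Cn m)) with hG
  have hGe : ∀ a b, (fun p => g.matrix e (e.symm p) a b) =ᶠ[nhds p] G a b := fun a b => by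
    filter_upwards [e.open_target.mem_nhds hp] with q hq
    exact g.matrix_symm_apply hq a b
  have hGd : ∀ a b, DifferentiableAt ℝ (G a b) p := fun a b =>
    ((g.smooth e he (Pi.single a 1) (Pi.single b 1)).contDiffAt
      (e.open_target.mem_nhds hp)).differentiableAt (by simp)
  have hconj : ∀ a b w, fderiv ℝ (G b a) p w = (starRingEnd ℂ) (fderiv ℝ (G a b) p w) := by
    intro a b w
    rw [← fderiv_conj_apply (hGd a b)]
    congr 2
    funext q
    exact (g.conj_symm _ _ _).symm
  have hω : ∀ (a b : Fin m) (s t : ℂ) (w : Cn m), fderiv ℝ (fun q => -2 * (g.g (e.symm q)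
      (mfderiv 𝓘(ℂ, Cn m) 𝓘(ℂ, Cn m) e.symm q (Pi.single a s : Cn m))
      (mfderiv 𝓘(ℂ, Cn m) 𝓘(ℂ, Cn m) e.symm q (Pi.single b t : Cn m))).im) p w =
      -2 * (s * (starRingEnd ℂ) t * fderiv ℝ (G a b) p w).im := by
    intro a b s t w
    have h1 : (fun q => -2 * (g.g (e.symm q)
        (mfderiv 𝓘(ℂ, Cn m) 𝓘(ℂ, Cn m) e.symm q (Pi.single a s : Cn m))
        (mfderiv 𝓘(ℂ, Cn m) 𝓘(ℂ, Cn m) e.symm q (Pi.single b t : Cn m))).im) =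
        fun q => -2 * (s * (starRingEnd ℂ) t * G a b q).im := by
      funext q
      have h2 : ∀ (c : Fin m) (r : ℂ), (Pi.single c r : Cn m) = r • Pi.single c 1 := fun c r => by
        rw [← Pi.single_smul, smul_eq_mul, mul_one]
      have h4 : ∀ (c : Fin m) (r : ℂ),
          mfderiv 𝓘(ℂ, Cn m) 𝓘(ℂ, Cn m) e.symm q (Pi.single c r : Cn m) =
            r • mfderiv 𝓘(ℂ, Cn m) 𝓘(ℂ, Cn m) e.symm q (Pi.single c 1 : Cn m) := fun c r =>
        (congrArg _ (h2 c r)).trans (map_smul _ r _)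
      rw [h4 a s, h4 b t, g.smul_left, ← g.conj_symm, g.smul_left, map_mul, g.conj_symm,
        ← mul_assoc]
    rw [h1]
    have h3 : HasFDerivAt (fun q => -2 * (s * (starRingEnd ℂ) t * G a b q).im)
        ((-2 : ℝ) • Complex.imCLM.comp ((s * (starRingEnd ℂ) t) • fderiv ℝ (G a b) p)) p :=
      (Complex.imCLM.hasFDerivAt.comp p ((hGd a b).hasFDerivAt.const_mul _)).const_mul (-2 : ℝ)
    rw [h3.fderiv]
    simp
  have hcl : ∀ r s t : ℂ, _ := fun r s t =>
    g.closed e he p hp (Pi.single l r) (Pi.single a s) (Pi.single b t)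
  simp only [hω] at hcl
  have e1 := hcl 1 1 1
  have e2 := hcl Complex.I Complex.I 1
  have e3 := hcl 1 1 Complex.I
  have e4 := hcl Complex.I Complex.I Complex.I
  rw [dz_congr (hGe a b), dz_congr (hGe l b), dz, dz]
  simp only [hconj l b] at e1 e2 e3 e4
  simp only [Complex.mul_im, Complex.mul_re, Complex.conj_re, Complex.conj_im, Complex.I_re,
    Complex.I_im, Complex.one_re, Complex.one_im, map_one] at e1 e2 e3 e4
  congr 1
  apply Complex.ext
  · simp only [Complex.sub_re, Complex.mul_re, Complex.I_re, Complex.I_im]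
    linarith
  · simp only [Complex.sub_im, Complex.mul_im, Complex.I_re, Complex.I_im]
    linarith

variable [IsManifold 𝓘(ℂ, Cn m) ω M]

theorem matrix_eq (he : e ∈ IsManifold.maximalAtlas 𝓘(ℂ, Cn m) ω M) {y : M} (hy : y ∈ e.source) :
    g.matrix e y = (jac (chartAt (Cn m) y ∘ e.symm) (e y))ᵀ * g.chartMatrix y *
      (jac (chartAt (Cn m) y ∘ e.symm) (e y)).map (starRingEnd ℂ) := by
  let g' : M → Cn m → Cn m → ℂ := g.g
  have h : ∀ a b, g.matrix e y a b = g' (e.symm (e y))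
      (mfderiv 𝓘(ℂ, Cn m) 𝓘(ℂ, Cn m) e.symm (e y) (Pi.single a 1 : Cn m))
      (mfderiv 𝓘(ℂ, Cn m) 𝓘(ℂ, Cn m) e.symm (e y) (Pi.single b 1 : Cn m)) := fun a b => rfl
  ext a b
  rw [h, mfderiv_symm_apply he hy, mfderiv_symm_apply he hy, e.left_inv hy]
  refine (g.g_eq_chartMatrix y _ _).trans ?_
  set J := jac (chartAt (Cn m) y ∘ e.symm) (e y)
  simp only [Matrix.mulVec_single_one]
  simp only [Matrix.mul_apply, dotProduct, Matrix.mulVec, Pi.star_apply,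
    Matrix.col_apply, Matrix.transpose_apply, Matrix.map_apply, Finset.mul_sum, Finset.sum_mul]
  rw [Finset.sum_comm]
  exact Finset.sum_congr rfl fun _ _ => Finset.sum_congr rfl fun _ _ => by
    rw [RCLike.star_def]; ring

theorem isHermitian_matrix (he : e ∈ IsManifold.maximalAtlas 𝓘(ℂ, Cn m) ω M) {y : M}
    (hy : y ∈ e.source) : (g.matrix e y).IsHermitian := by
  rw [g.matrix_eq he hy]
  exact isHermitian_congruence _ (g.isHermitian_chartMatrix y)

theorem matrix_transition (he : e ∈ IsManifold.maximalAtlas 𝓘(ℂ, Cn m) ω M)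
    (hf : f ∈ IsManifold.maximalAtlas 𝓘(ℂ, Cn m) ω M) {y : M} (hy : y ∈ e.source)
    (hy' : y ∈ f.source) :
    g.matrix e y = (jac (f ∘ e.symm) (e y))ᵀ * g.matrix f y *
      (jac (f ∘ e.symm) (e y)).map (starRingEnd ℂ) := by
  rw [g.matrix_eq he hy, g.matrix_eq hf hy', jac_transition he hf
    (IsManifold.chart_mem_maximalAtlas y) hy hy' (mem_chart_source (Cn m) y),
    Matrix.transpose_mul, Matrix.map_mul]
  simp only [Matrix.mul_assoc]

open scoped ComplexOrder in
theorem posDef_matrix (he : e ∈ IsManifold.maximalAtlas 𝓘(ℂ, Cn m) ω M) {y : M}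
    (hy : y ∈ e.source) : (g.matrix e y).PosDef := by
  refine Matrix.PosDef.of_dotProduct_mulVec_pos (g.isHermitian_matrix he hy) fun v hv => ?_
  set J := jac (chartAt (Cn m) y ∘ e.symm) (e y) with hJ
  have hinv : jac (e ∘ (chartAt (Cn m) y).symm) (chartAt (Cn m) y y) * J = 1 :=
    jac_transition_mul_symm he (IsManifold.chart_mem_maximalAtlas y) hy (mem_chart_source (Cn m) y)
  have hw : J.map (starRingEnd ℂ) *ᵥ v ≠ 0 := by
    intro h0
    apply hv
    have h1 : (jac (e ∘ (chartAt (Cn m) y).symm) (chartAt (Cn m) y y)).map (starRingEnd ℂ) *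
        J.map (starRingEnd ℂ) = 1 := by
      rw [← Matrix.map_mul, hinv, Matrix.map_one _ (map_zero _) (map_one _)]
    rw [← Matrix.one_mulVec v, ← h1, ← Matrix.mulVec_mulVec, h0, Matrix.mulVec_zero]
  have h := (g.posDef_chartMatrix y).dotProduct_mulVec_pos hw
  have h2 : star (J.map (starRingEnd ℂ) *ᵥ v) = star v ᵥ* Jᵀ := by
    rw [Matrix.star_mulVec]
    congr 1
    ext i j; simp [Matrix.conjTranspose_apply]
  rw [g.matrix_eq he hy, ← Matrix.mulVec_mulVec, ← Matrix.mulVec_mulVec, Matrix.dotProduct_mulVec,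
    ← h2]
  exact h

end KaehlerMetric
end Kaehler

/-! ### Curvature of Hermitian metrics in arbitrary charts and frames -/

namespace HermitianMetric

variable {N : ℕ} {X : Type*} [TopologicalSpace X] [ChartedSpace (Cn N) X]
  {L : X → Type*} [∀ x, AddCommGroup (L x)] [∀ x, Module ℂ (L x)]
  [∀ x, TopologicalSpace (L x)] [TopologicalSpace (Bundle.TotalSpace ℂ L)] [FiberBundle ℂ L]
  [VectorBundle ℂ ℂ L]

section Weight

variable (φ ψ : HermitianMetric N L) (x₀ x₁ : X)

theorem normSq_symm_pos {x : X} (hx : x ∈ (trivializationAt ℂ L x₀).baseSet) :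
    0 < φ.normSq x ((trivializationAt ℂ L x₀).symm x 1) := by
  refine φ.pos x _ fun h => ?_
  have h1 := (trivializationAt ℂ L x₀).continuousLinearMapAt_symmL (R := ℂ) hx (1 : ℂ)
  rw [(trivializationAt ℂ L x₀).symmL_apply hx, h, map_zero] at h1
  exact zero_ne_one h1

/-- The transition function from the frame at `x₀` to the frame at `x₁`. -/
def frameChange (L : X → Type*) [∀ x, AddCommGroup (L x)] [∀ x, Module ℂ (L x)]
    [∀ x, TopologicalSpace (L x)] [TopologicalSpace (Bundle.TotalSpace ℂ L)] [FiberBundle ℂ L]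
    [VectorBundle ℂ ℂ L] (x₀ x₁ : X) (x : X) : ℂ :=
  (trivializationAt ℂ L x₁).coordChangeL ℂ (trivializationAt ℂ L x₀) x 1

variable {x₀ x₁}

theorem symm_eq_smul {x : X} (hx₀ : x ∈ (trivializationAt ℂ L x₀).baseSet)
    (hx₁ : x ∈ (trivializationAt ℂ L x₁).baseSet) :
    (trivializationAt ℂ L x₁).symm x (1 : ℂ) =
      frameChange L x₀ x₁ x • (trivializationAt ℂ L x₀).symm x (1 : ℂ) := by
  have h1 : (trivializationAt ℂ L x₀).symm x
      ((trivializationAt ℂ L x₀ ⟨x, (trivializationAt ℂ L x₁).symm x 1⟩).2) =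
      (trivializationAt ℂ L x₁).symm x 1 :=
    (trivializationAt ℂ L x₀).symm_proj_apply ⟨x, (trivializationAt ℂ L x₁).symm x 1⟩ hx₀
  rw [frameChange, Bundle.Trivialization.coordChangeL_apply _ _ ⟨hx₁, hx₀⟩]
  rw [← (trivializationAt ℂ L x₀).symmL_apply (R := ℂ) hx₀] at h1 ⊢
  rw [← map_smul, smul_eq_mul, mul_one, h1]

theorem frameChange_ne_zero {x : X} (hx₀ : x ∈ (trivializationAt ℂ L x₀).baseSet)
    (hx₁ : x ∈ (trivializationAt ℂ L x₁).baseSet) (φ : HermitianMetric N L) :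
    frameChange L x₀ x₁ x ≠ 0 := by
  intro h
  have h1 := φ.normSq_symm_pos x₁ hx₁
  rw [symm_eq_smul hx₀ hx₁, h, φ.normSq_smul] at h1
  simp at h1

theorem weight_eq_sub {x : X} (hx₀ : x ∈ (trivializationAt ℂ L x₀).baseSet)
    (hx₁ : x ∈ (trivializationAt ℂ L x₁).baseSet) :
    φ.weight x₁ x = φ.weight x₀ x - Real.log (‖frameChange L x₀ x₁ x‖ ^ 2) := by
  have h := frameChange_ne_zero hx₀ hx₁ φ
  rw [weight, weight, symm_eq_smul hx₀ hx₁, φ.normSq_smul,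
    Real.log_mul (by positivity) (φ.normSq_symm_pos x₀ hx₀).ne']
  ring

/-- The difference `ψ - φ` of the weights of two metrics, a function on the whole of `X`. -/
def weightDiff (x : X) : ℝ := ψ.weight x x - φ.weight x x

theorem weightDiff_eq {x : X} (hx₀ : x ∈ (trivializationAt ℂ L x₀).baseSet) :
    weightDiff φ ψ x = ψ.weight x₀ x - φ.weight x₀ x := by
  have hx := FiberBundle.mem_baseSet_trivializationAt' (F := ℂ) (E := L) x
  rw [weightDiff, weight_eq_sub φ hx₀ hx, weight_eq_sub ψ hx₀ hx]
  ring

theorem contDiffAt_frameChange [ContMDiffVectorBundle ω ℂ L 𝓘(ℂ, Cn N)]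
    {e : OpenPartialHomeomorph X (Cn N)} (he : e ∈ IsManifold.maximalAtlas 𝓘(ℂ, Cn N) ω X) {x : X}
    (hx : x ∈ e.source) (hx₀ : x ∈ (trivializationAt ℂ L x₀).baseSet)
    (hx₁ : x ∈ (trivializationAt ℂ L x₁).baseSet) :
    ContDiffAt ℂ ω (fun p => frameChange L x₀ x₁ (e.symm p)) (e x) := by
  have h1 := contMDiffAt_coordChangeL (n := ω) (IB := 𝓘(ℂ, Cn N)) (𝕜 := ℂ) hx₁ hx₀
  rw [← e.left_inv hx] at h1
  have h2 := (h1.comp _ (contMDiffAt_symm_of_mem_maximalAtlas he (e.map_source hx))).contDiffAt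
  exact h2.clm_apply contDiffAt_const

variable [IsManifold 𝓘(ℂ, Cn N) ω X] {e f : OpenPartialHomeomorph X (Cn N)}

theorem contDiffAt_weight (he : e ∈ IsManifold.maximalAtlas 𝓘(ℂ, Cn N) ω X) {x : X}
    (hx : x ∈ e.source) (hx₀ : x ∈ (trivializationAt ℂ L x₀).baseSet) :
    ContDiffAt ℝ ∞ (fun p => φ.weight x₀ (e.symm p)) (e x) := by
  have h1 := contDiffAt_comp_symm ((φ.smooth (trivializationAt ℂ L x₀)).contMDiffAt
    ((trivializationAt ℂ L x₀).open_baseSet.mem_nhds hx₀)) he hx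
  refine (h1.log ?_).neg
  rw [e.left_inv hx]
  exact (φ.normSq_symm_pos x₀ hx₀).ne'

theorem contDiffAt_weightDiff (he : e ∈ IsManifold.maximalAtlas 𝓘(ℂ, Cn N) ω X) {p : Cn N}
    (hp : p ∈ e.target) : ContDiffAt ℝ ∞ (fun p => weightDiff φ ψ (e.symm p)) p := by
  have hx := e.map_target hp
  have hx₀ := FiberBundle.mem_baseSet_trivializationAt' (F := ℂ) (E := L) (e.symm p)
  have h := (contDiffAt_weight ψ he hx hx₀).sub (contDiffAt_weight φ he hx hx₀)
  rw [e.right_inv hp] at h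
  refine h.congr_of_eventuallyEq ?_
  filter_upwards [(e.symm.continuousAt hp).preimage_mem_nhds
    ((trivializationAt ℂ L (e.symm p)).open_baseSet.mem_nhds hx₀)] with q hq
  exact weightDiff_eq φ ψ hq

theorem contDiffAt_weight_symm (he : e ∈ IsManifold.maximalAtlas 𝓘(ℂ, Cn N) ω X) {p : Cn N}
    (hp : p ∈ e.target) : ContDiffAt ℝ ∞ (fun q => φ.weight (e.symm p) (e.symm q)) p := by
  have h := contDiffAt_weight φ he (e.map_target hp)
    (FiberBundle.mem_baseSet_trivializationAt' (F := ℂ) (E := L) (e.symm p))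
  rwa [e.right_inv hp] at h

theorem isHermitian_hessian (he : e ∈ IsManifold.maximalAtlas 𝓘(ℂ, Cn N) ω X) {x : X}
    (hx : x ∈ e.source) : (φ.hessian e x).IsHermitian :=
  complexHessian_isHermitian (contDiffAt_weight φ he hx
    (FiberBundle.mem_baseSet_trivializationAt' (F := ℂ) (E := L) x))

theorem hessian_transition (he : e ∈ IsManifold.maximalAtlas 𝓘(ℂ, Cn N) ω X)
    (hf : f ∈ IsManifold.maximalAtlas 𝓘(ℂ, Cn N) ω X) {x : X} (hx : x ∈ e.source)
    (hx' : x ∈ f.source) :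
    φ.hessian e x = (jac (f ∘ e.symm) (e x))ᵀ * φ.hessian f x *
      (jac (f ∘ e.symm) (e x)).map (starRingEnd ℂ) := by
  have h0 : (f ∘ e.symm) (e x) = f x := by simp [e.left_inv hx]
  have h1 := contDiffAt_weight φ hf hx'
    (FiberBundle.mem_baseSet_trivializationAt' (F := ℂ) (E := L) x)
  rw [← h0] at h1
  have h2 := complexHessian_comp (contDiffAt_transition he hf hx hx') h1
  rw [h0] at h2
  rw [hessian, hessian, ← h2]
  refine complexHessian_congr ?_
  filter_upwards [eventually_symm_mem hx hx'] with p hp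
  simp only [Function.comp_apply, f.left_inv hp.2]

theorem hessian_sub (he : e ∈ IsManifold.maximalAtlas 𝓘(ℂ, Cn N) ω X) {x : X}
    (hx : x ∈ e.source) : ψ.hessian e x - φ.hessian e x =
      complexHessian (fun p => weightDiff φ ψ (e.symm p)) (e x) := by
  have hx₀ := FiberBundle.mem_baseSet_trivializationAt' (F := ℂ) (E := L) x
  rw [hessian, hessian, ← complexHessian_sub (contDiffAt_weight ψ he hx hx₀)
    (contDiffAt_weight φ he hx hx₀)]
  refine complexHessian_congr ?_
  have hc := e.symm.continuousAt (e.map_source hx)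
  rw [ContinuousAt, e.left_inv hx] at hc
  filter_upwards [hc ((trivializationAt ℂ L x).open_baseSet.mem_nhds hx₀)] with q hq
  exact (weightDiff_eq φ ψ hq).symm

/-- The curvature form on coordinate vectors. -/
theorem curvatureForm_mfderiv (he : e ∈ IsManifold.maximalAtlas 𝓘(ℂ, Cn N) ω X) {x : X}
    (hx : x ∈ e.source) (v : Fin 2 → Cn N) :
    φ.curvatureForm x (fun j => (mfderiv 𝓘(ℂ, Cn N) 𝓘(ℂ, Cn N) e.symm (e x) (v j) : Cn N)) =
      formOfMatrix (φ.hessian e x) v := by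
  have hc := IsManifold.chart_mem_maximalAtlas (I := 𝓘(ℂ, Cn N)) (n := ω) x
  have hxc := mem_chart_source (Cn N) x
  rw [φ.hessian_transition he hc hx hxc, formOfMatrix_congruence _ (φ.isHermitian_hessian hc hxc)]
  simp only [mfderiv_symm_apply he hx]
  rfl

variable [ContMDiffVectorBundle ω ℂ L 𝓘(ℂ, Cn N)]

/-- The second derivatives of the weight do not depend on the holomorphic frame. -/
theorem complexHessian_weight (he : e ∈ IsManifold.maximalAtlas 𝓘(ℂ, Cn N) ω X) {x : X}
    (hx : x ∈ e.source) (hx₀ : x ∈ (trivializationAt ℂ L x₀).baseSet) :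
    complexHessian (fun p => φ.weight x₀ (e.symm p)) (e x) = φ.hessian e x := by
  have hx₁ := FiberBundle.mem_baseSet_trivializationAt' (F := ℂ) (E := L) x
  have hd := contDiffAt_frameChange he hx hx₀ hx₁
  have h0 : frameChange L x₀ x (e.symm (e x)) ≠ 0 := by
    rw [e.left_inv hx]; exact frameChange_ne_zero hx₀ hx₁ φ
  have hl : ContDiffAt ℝ ∞ (fun p => Real.log (‖frameChange L x₀ x (e.symm p)‖ ^ 2)) (e x) := by
    refine ContDiffAt.log ?_ (by positivity)
    exact ((hd.restrict_scalars ℝ).of_le le_top).norm_sq ℝ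
  have h : (fun p => φ.weight x (e.symm p)) =ᶠ[nhds (e x)] fun p =>
      φ.weight x₀ (e.symm p) - Real.log (‖frameChange L x₀ x (e.symm p)‖ ^ 2) := by
    have hc := e.symm.continuousAt (e.map_source hx)
    rw [ContinuousAt, e.left_inv hx] at hc
    filter_upwards [hc ((trivializationAt ℂ L x₀).open_baseSet.mem_nhds hx₀),
      hc ((trivializationAt ℂ L x).open_baseSet.mem_nhds hx₁)] with q hq hq'
    exact weight_eq_sub φ hq hq'
  rw [hessian, complexHessian_congr h, complexHessian_sub (contDiffAt_weight φ he hx hx₀) hl,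
    complexHessian_log_norm hd h0, sub_zero]

theorem hessian_eventuallyEq (he : e ∈ IsManifold.maximalAtlas 𝓘(ℂ, Cn N) ω X) {p : Cn N}
    (hp : p ∈ e.target) : (fun q => φ.hessian e (e.symm q)) =ᶠ[nhds p]
      complexHessian (fun q => φ.weight (e.symm p) (e.symm q)) := by
  have hx₀ := FiberBundle.mem_baseSet_trivializationAt' (F := ℂ) (E := L) (e.symm p)
  filter_upwards [(e.symm.continuousAt hp).preimage_mem_nhds
    ((trivializationAt ℂ L (e.symm p)).open_baseSet.mem_nhds hx₀), e.open_target.mem_nhds hp]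
    with q hq hq'
  have h := complexHessian_weight φ he (e.map_target hq') hq
  rw [e.right_inv hq'] at h
  exact h.symm

theorem contDiffAt_hessian (he : e ∈ IsManifold.maximalAtlas 𝓘(ℂ, Cn N) ω X) {p : Cn N}
    (hp : p ∈ e.target) (a b : Fin N) :
    ContDiffAt ℝ ∞ (fun q => φ.hessian e (e.symm q) a b) p := by
  refine (contDiffAt_complexHessian (φ.contDiffAt_weight_symm he hp) a b).congr_of_eventuallyEq ?_
  filter_upwards [φ.hessian_eventuallyEq he hp] with q hq
  rw [hq]

/-- The curvature form is closed. -/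
theorem dz_hessian (he : e ∈ IsManifold.maximalAtlas 𝓘(ℂ, Cn N) ω X) {p : Cn N}
    (hp : p ∈ e.target) (l a b : Fin N) :
    dz l (fun q => φ.hessian e (e.symm q) a b) p =
      dz a (fun q => φ.hessian e (e.symm q) l b) p := by
  have h : ∀ a b, (fun q => φ.hessian e (e.symm q) a b) =ᶠ[nhds p]
      fun q => complexHessian (fun q => φ.weight (e.symm p) (e.symm q)) q a b := fun a b => by
    filter_upwards [φ.hessian_eventuallyEq he hp] with q hq
    rw [hq]
  rw [dz_congr (h a b), dz_congr (h l b), dz_complexHessian (φ.contDiffAt_weight_symm he hp)]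

end Weight

end HermitianMetric

/-! ### Admissible coordinates -/

theorem mem_contDiffGroupoid_iff {N : ℕ} {e : OpenPartialHomeomorph (Cn N) (Cn N)} :
    e ∈ contDiffGroupoid ω 𝓘(ℂ, Cn N) ↔
      ContDiffOn ℂ ω e e.source ∧ ContDiffOn ℂ ω e.symm e.target := by
  rw [contDiffGroupoid, mem_groupoid_of_pregroupoid]
  simp [contDiffPregroupoid]

theorem trans_mem_maximalAtlas {N : ℕ} {X : Type*} [TopologicalSpace X] [ChartedSpace (Cn N) X]
    {e : OpenPartialHomeomorph X (Cn N)} {h : OpenPartialHomeomorph (Cn N) (Cn N)}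
    (he : e ∈ IsManifold.maximalAtlas 𝓘(ℂ, Cn N) ω X) (hh : h ∈ contDiffGroupoid ω 𝓘(ℂ, Cn N)) :
    e.trans h ∈ IsManifold.maximalAtlas 𝓘(ℂ, Cn N) ω X := by
  rw [IsManifold.maximalAtlas, mem_maximalAtlas_iff] at he ⊢
  intro e' he'
  constructor
  · rw [OpenPartialHomeomorph.trans_symm_eq_symm_trans_symm, OpenPartialHomeomorph.trans_assoc]
    exact (contDiffGroupoid ω 𝓘(ℂ, Cn N)).trans ((contDiffGroupoid ω 𝓘(ℂ, Cn N)).symm hh)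
      (he e' he').1
  · rw [← OpenPartialHomeomorph.trans_assoc]
    exact (contDiffGroupoid ω 𝓘(ℂ, Cn N)).trans (he e' he').2 hh

section Append

variable {m n : ℕ}

/-- The horizontal part `z` of `(z; v)`. -/
def horPart (p : Cn (m + n)) : Cn m := fun i => p (Fin.castAdd n i)

/-- The vertical part `v` of `(z; v)`. -/
def verPart (p : Cn (m + n)) : Cn n := fun j => p (Fin.natAdd m j)

@[simp] theorem horPart_append (z : Cn m) (v : Cn n) : horPart (Fin.append z v) = z := by
  ext i; simp [horPart]

@[simp] theorem verPart_append (z : Cn m) (v : Cn n) : verPart (Fin.append z v) = v := by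
  ext i; simp [verPart]

@[simp] theorem append_horPart_verPart (p : Cn (m + n)) :
    (Fin.append (horPart p) (verPart p) : Cn (m + n)) = p := by
  ext i
  refine Fin.addCases (fun i => ?_) (fun i => ?_) i <;> simp [horPart, verPart]

variable (m n) in
/-- The isomorphism `(z, v) ↦ (z; v)`. -/
def appendL : (Cn m × Cn n) ≃L[ℂ] Cn (m + n) :=
  LinearEquiv.toContinuousLinearEquiv
    { toFun := fun q => Fin.append q.1 q.2
      invFun := fun p => (horPart p, verPart p)
      map_add' := fun q r => by
        ext i
        refine Fin.addCases (fun i => ?_) (fun i => ?_) i <;> simp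
      map_smul' := fun c q => by
        ext i
        refine Fin.addCases (fun i => ?_) (fun i => ?_) i <;> simp
      left_inv := fun q => by simp
      right_inv := fun p => by simp }

theorem appendL_symm_apply (p : Cn (m + n)) : (appendL m n).symm p = (horPart p, verPart p) := rfl

theorem contDiff_append_right {r : WithTop ℕ∞} (z : Cn m) :
    ContDiff ℂ r (fun v : Cn n => (Fin.append z v : Cn (m + n))) :=
  (appendL m n).contDiff.comp (contDiff_const.prodMk contDiff_id)

theorem contDiff_append {r : WithTop ℕ∞} :
    ContDiff ℂ r (fun q : Cn m × Cn n => (Fin.append q.1 q.2 : Cn (m + n))) :=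
  (appendL m n).contDiff

theorem contDiff_horPart {r : WithTop ℕ∞} : ContDiff ℂ r (horPart : Cn (m + n) → Cn m) :=
  contDiff_fst.comp (appendL m n).symm.contDiff

theorem contDiff_verPart {r : WithTop ℕ∞} : ContDiff ℂ r (verPart : Cn (m + n) → Cn n) :=
  contDiff_snd.comp (appendL m n).symm.contDiff

variable (n) in
/-- The map `(z; v) ↦ (h z; v)`. -/
def baseChange (h : OpenPartialHomeomorph (Cn m) (Cn m)) :
    OpenPartialHomeomorph (Cn (m + n)) (Cn (m + n)) :=
  (appendL m n).symm.toHomeomorph.toOpenPartialHomeomorph.trans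
    ((h.prod (OpenPartialHomeomorph.refl (Cn n))).trans
      (appendL m n).toHomeomorph.toOpenPartialHomeomorph)

theorem baseChange_apply (h : OpenPartialHomeomorph (Cn m) (Cn m)) (p : Cn (m + n)) :
    baseChange n h p = Fin.append (h (horPart p)) (verPart p) := rfl

theorem baseChange_symm_apply (h : OpenPartialHomeomorph (Cn m) (Cn m)) (p : Cn (m + n)) :
    (baseChange n h).symm p = Fin.append (h.symm (horPart p)) (verPart p) := rfl

theorem mem_baseChange_source {h : OpenPartialHomeomorph (Cn m) (Cn m)} {p : Cn (m + n)} :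
    p ∈ (baseChange n h).source ↔ horPart p ∈ h.source := by
  simp [baseChange, appendL_symm_apply]

theorem mem_baseChange_target {h : OpenPartialHomeomorph (Cn m) (Cn m)} {p : Cn (m + n)} :
    p ∈ (baseChange n h).target ↔ horPart p ∈ h.target := by
  simp [baseChange, appendL_symm_apply]

theorem baseChange_mem_groupoid {h : OpenPartialHomeomorph (Cn m) (Cn m)}
    (hh : h ∈ contDiffGroupoid ω 𝓘(ℂ, Cn m)) :
    baseChange n h ∈ contDiffGroupoid ω 𝓘(ℂ, Cn (m + n)) := by
  rw [mem_contDiffGroupoid_iff] at hh ⊢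
  constructor
  · refine contDiff_append.comp_contDiffOn (ContDiffOn.prodMk (hh.1.comp
      contDiff_horPart.contDiffOn fun p hp => ?_) contDiff_verPart.contDiffOn)
    exact mem_baseChange_source.1 hp
  · refine contDiff_append.comp_contDiffOn (ContDiffOn.prodMk (hh.2.comp
      contDiff_horPart.contDiffOn fun p hp => ?_) contDiff_verPart.contDiffOn)
    exact mem_baseChange_target.1 hp

end Append

section Adapted

variable {m n : ℕ} {X M : Type*} [TopologicalSpace X] [TopologicalSpace M] {π : X → M}

/-- The coordinate system `(f ∘ π; v)` obtained from `e = (z; v)` by replacing the coordinates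
`e' = z` of the base by `f`. -/
def withBase (e : OpenPartialHomeomorph X (Cn (m + n))) (e' f : OpenPartialHomeomorph M (Cn m)) :
    OpenPartialHomeomorph X (Cn (m + n)) :=
  e.trans (baseChange n (e'.symm.trans f))

variable {e : OpenPartialHomeomorph X (Cn (m + n))} {e' f : OpenPartialHomeomorph M (Cn m)}

theorem append_mem_withBase_target {y : M} (hy : y ∈ f.source)
    {v : Cn n} : (Fin.append (f y) v : Cn (m + n)) ∈ (withBase e e' f).target ↔
      y ∈ e'.source ∧ (Fin.append (e' y) v : Cn (m + n)) ∈ e.target := by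
  simp only [withBase, OpenPartialHomeomorph.trans_target, Set.mem_inter_iff, Set.mem_preimage,
    mem_baseChange_target, baseChange_symm_apply, horPart_append, verPart_append]
  constructor
  · rintro ⟨⟨h1, h2⟩, h3⟩
    simp only [OpenPartialHomeomorph.symm_target, f.left_inv hy] at h2
    refine ⟨h2, ?_⟩
    simpa [f.left_inv hy] using h3
  · rintro ⟨h1, h2⟩
    refine ⟨⟨f.map_source hy, ?_⟩, ?_⟩
    · simpa [f.left_inv hy] using h1
    · simpa [f.left_inv hy] using h2

theorem withBase_symm_append {y : M} (hy : y ∈ f.source) (v : Cn n) :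
    (withBase e e' f).symm (Fin.append (f y) v) = e.symm (Fin.append (e' y) v) := by
  change e.symm ((baseChange n (e'.symm.trans f)).symm _) = _
  rw [baseChange_symm_apply]
  simp [f.left_inv hy]

variable [ChartedSpace (Cn (m + n)) X] [ChartedSpace (Cn m) M]

theorem IsAdmissible.horPart_eq (h : IsAdmissible m n π e e') {x : X} (hx : x ∈ e.source) :
    horPart (e x) = e' (π x) :=
  funext (h.2.2 x hx).2

theorem IsAdmissible.eq_append (h : IsAdmissible m n π e e') {x : X} (hx : x ∈ e.source) :
    e x = Fin.append (e' (π x)) (verPart (e x)) := by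
  rw [← h.horPart_eq hx, append_horPart_verPart]

theorem IsAdmissible.mem_source (h : IsAdmissible m n π e e') {x : X} (hx : x ∈ e.source) :
    π x ∈ e'.source := (h.2.2 x hx).1

theorem IsAdmissible.map_symm (h : IsAdmissible m n π e e') {p : Cn (m + n)} (hp : p ∈ e.target) :
    π (e.symm p) = e'.symm (horPart p) := by
  have hx := e.map_target hp
  rw [← e'.left_inv (h.mem_source hx), ← h.horPart_eq hx, e.right_inv hp]

theorem IsAdmissible.map_symm_append (h : IsAdmissible m n π e e') {y : M} (hy : y ∈ e'.source)
    {v : Cn n} (hv : (Fin.append (e' y) v : Cn (m + n)) ∈ e.target) :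
    π (e.symm (Fin.append (e' y) v)) = y := by
  rw [h.map_symm hv, horPart_append, e'.left_inv hy]

theorem mem_withBase_source (h : IsAdmissible m n π e e') {x : X} :
    x ∈ (withBase e e' f).source ↔ x ∈ e.source ∧ π x ∈ f.source := by
  simp only [withBase, OpenPartialHomeomorph.trans_source, Set.mem_inter_iff, Set.mem_preimage,
    mem_baseChange_source, OpenPartialHomeomorph.symm_source]
  constructor
  · rintro ⟨hx, h1, h2⟩
    rw [h.horPart_eq hx, e'.left_inv (h.mem_source hx)] at h2
    exact ⟨hx, h2⟩
  · rintro ⟨hx, h2⟩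
    refine ⟨hx, ?_, ?_⟩
    · rw [h.horPart_eq hx]; exact e'.map_source (h.mem_source hx)
    · rw [h.horPart_eq hx, e'.left_inv (h.mem_source hx)]; exact h2

theorem withBase_apply (h : IsAdmissible m n π e e') {x : X} (hx : x ∈ e.source) :
    withBase e e' f x = Fin.append (f (π x)) (verPart (e x)) := by
  change baseChange n (e'.symm.trans f) (e x) = _
  rw [baseChange_apply, h.horPart_eq hx]
  simp [e'.left_inv (h.mem_source hx)]

theorem isAdmissible_withBase (h : IsAdmissible m n π e e')
    (hf : f ∈ IsManifold.maximalAtlas 𝓘(ℂ, Cn m) ω M) :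
    IsAdmissible m n π (withBase e e' f) f := by
  refine ⟨trans_mem_maximalAtlas h.1 (baseChange_mem_groupoid ?_), hf, fun x hx => ?_⟩
  · exact (contDiffGroupoid ω 𝓘(ℂ, Cn m)).compatible_of_mem_maximalAtlas h.2.1 hf
  · rw [mem_withBase_source h] at hx
    refine ⟨hx.2, fun α => ?_⟩
    rw [withBase_apply h hx.1, Fin.append_left]

end Adapted

/-! ### Existence of admissible coordinates and partitions of unity -/

/-- The holomorphic inverse function theorem. -/
theorem exists_mem_contDiffGroupoid {N : ℕ} {Φ : Cn N → Cn N} {p : Cn N}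
    (hΦ : ContDiffAt ℂ ω Φ p) {A : Cn N ≃L[ℂ] Cn N} (hA : HasFDerivAt Φ (A : Cn N →L[ℂ] Cn N) p)
    {U : Set (Cn N)} (hU : U ∈ nhds p) :
    ∃ h ∈ contDiffGroupoid ω 𝓘(ℂ, Cn N), p ∈ h.source ∧ h.source ⊆ U ∧ ∀ q, h q = Φ q := by
  set h₀ := hΦ.toOpenPartialHomeomorph Φ hA (by simp) with hh₀
  have hev : ∀ᶠ q in nhds p, ContDiffAt ℂ ω Φ q ∧
      fderiv ℂ Φ q ∈ Set.range ((↑) : (Cn N ≃L[ℂ] Cn N) → (Cn N →L[ℂ] Cn N)) := by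
    refine (hΦ.eventually (by decide)).and ?_
    have hc : ContinuousAt (fderiv ℂ Φ) p :=
      (hΦ.fderiv_right (m := ω) (by simp)).continuousAt
    refine hc.eventually_mem ?_
    rw [hA.fderiv]
    exact ContinuousLinearEquiv.nhds A
  obtain ⟨W, hWs, hWo, hpW⟩ := mem_nhds_iff.1 (Filter.inter_mem hU hev)
  refine ⟨h₀.restrOpen W hWo, mem_contDiffGroupoid_iff.2 ⟨fun q hq => ?_, fun q hq => ?_⟩,
    ⟨hΦ.mem_toOpenPartialHomeomorph_source hA (by simp), hpW⟩, fun q hq => (hWs hq.2).1,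
    fun q => rfl⟩
  · exact (hWs hq.2).2.1.contDiffWithinAt
  · have hq' := (h₀.restrOpen W hWo).map_target hq
    obtain ⟨h1, B, hB⟩ := (hWs hq'.2).2
    refine ((h₀.restrOpen W hWo).contDiffAt_symm (f₀' := B) hq ?_ h1).contDiffWithinAt
    rw [hB]
    exact (h1.differentiableAt (by simp)).hasFDerivAt

/-- A surjective linear map can be completed to a coordinate system by linear coordinates. -/
theorem exists_complement {m n : ℕ} (A : Cn (m + n) →L[ℂ] Cn m) (hA : Function.Surjective A) :
    ∃ (T : Cn (m + n) →L[ℂ] Cn n) (B : Cn (m + n) ≃L[ℂ] Cn (m + n)),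
      ∀ v, B v = Fin.append (A v) (T v) := by
  have hker : Module.finrank ℂ (LinearMap.ker (A : Cn (m + n) →ₗ[ℂ] Cn m)) = n := by
    have h1 := LinearMap.finrank_range_add_finrank_ker (A : Cn (m + n) →ₗ[ℂ] Cn m)
    rw [LinearMap.range_eq_top.2 hA, finrank_top] at h1
    simp only [Module.finrank_fin_fun] at h1
    omega
  obtain ⟨P, hP⟩ := LinearMap.exists_leftInverse_of_injective
    (LinearMap.ker (A : Cn (m + n) →ₗ[ℂ] Cn m)).subtype (Submodule.ker_subtype _)
  let E : LinearMap.ker (A : Cn (m + n) →ₗ[ℂ] Cn m) ≃ₗ[ℂ] Cn n :=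
    LinearEquiv.ofFinrankEq _ _ (by rw [hker, Module.finrank_fin_fun])
  let T : Cn (m + n) →ₗ[ℂ] Cn n := E.toLinearMap ∘ₗ P
  let B₀ : Cn (m + n) →ₗ[ℂ] Cn (m + n) :=
    (appendL m n).toLinearEquiv.toLinearMap ∘ₗ ((A : Cn (m + n) →ₗ[ℂ] Cn m).prod T)
  have hinj : Function.Injective B₀ := by
    rw [injective_iff_map_eq_zero]
    intro v hv
    have h1 : ((A v, T v) : Cn m × Cn n) = 0 := (appendL m n).injective (hv.trans (map_zero _).symm)
    have h2 : A v = 0 := congrArg Prod.fst h1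
    have h3 : E (P v) = 0 := congrArg Prod.snd h1
    have h4 : P v = 0 := by simpa using h3
    have h5 := LinearMap.congr_fun hP ⟨v, h2⟩
    have h6 : P v = ⟨v, h2⟩ := h5
    rw [h4] at h6
    exact (congrArg Subtype.val h6).symm
  exact ⟨LinearMap.toContinuousLinearMap T,
    (LinearEquiv.ofInjectiveEndo B₀ hinj).toContinuousLinearEquiv, fun v => rfl⟩

theorem isManifold_real {N : ℕ} {X : Type*} [TopologicalSpace X] [ChartedSpace (Cn N) X]
    [IsManifold 𝓘(ℂ, Cn N) ω X] : IsManifold 𝓘(ℝ, Cn N) ∞ X := by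
  refine isManifold_of_contDiffOn _ _ _ fun e e' he he' => ?_
  have h := (mem_contDiffGroupoid_iff.1
    ((contDiffGroupoid ω 𝓘(ℂ, Cn N)).compatible he he')).1
  have := (h.restrict_scalars ℝ).of_le (m := ∞) le_top
  simpa using this

/-- A finite smooth partition of unity subordinate to a family of chart domains. -/
theorem exists_partition {N : ℕ} {X : Type*} [TopologicalSpace X] [ChartedSpace (Cn N) X]
    [IsManifold 𝓘(ℂ, Cn N) ω X] [T2Space X] [CompactSpace X]
    (e : X → OpenPartialHomeomorph X (Cn N)) (he : ∀ x, x ∈ (e x).source) :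
    ∃ (k : ℕ) (s : Fin k → X) (ρ : Fin k → X → ℝ),
      (∀ i, ContMDiff 𝓘(ℝ, Cn N) 𝓘(ℝ, ℝ) ∞ (ρ i)) ∧ (∀ i x, 0 ≤ ρ i x) ∧
      (∀ x, ∑ i, ρ i x = 1) ∧ ∀ i, tsupport (ρ i) ⊆ (e (s i)).source := by
  classical
  obtain ⟨t, ht⟩ := isCompact_univ.elim_nhds_subcover (fun x => (e x).source)
    fun x _ => (e x).open_source.mem_nhds (he x)
  have hm : IsManifold 𝓘(ℝ, Cn N) ∞ X := isManifold_real
  let s : Fin t.card ≃ t := t.equivFin.symm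
  obtain ⟨ρ, hρ⟩ := SmoothPartitionOfUnity.exists_isSubordinate 𝓘(ℝ, Cn N)
    (isClosed_univ (X := X)) (fun i => (e (s i)).source) (fun i => (e (s i)).open_source)
    fun x _ => by
      obtain ⟨y, hy, hxy⟩ := Set.mem_iUnion₂.1 (ht.2 (Set.mem_univ x))
      exact Set.mem_iUnion.2 ⟨s.symm ⟨y, hy⟩, by simpa using hxy⟩
  refine ⟨t.card, fun i => s i, fun i => ρ i, fun i => (ρ i).contMDiff, fun i => ρ.nonneg i,
    fun x => ?_, fun i => hρ i⟩
  rw [← finsum_eq_sum_of_fintype]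
  exact ρ.sum_eq_one (Set.mem_univ x)

section

variable {m n : ℕ} {X M : Type*} [TopologicalSpace X] [ChartedSpace (Cn (m + n)) X]
  [TopologicalSpace M] [ChartedSpace (Cn m) M] {π : X → M}
  [IsManifold 𝓘(ℂ, Cn m) ω M] [IsManifold 𝓘(ℂ, Cn (m + n)) ω X]

/-- By the inverse function theorem, `π` followed by coordinates of the base can be completed to
coordinates of the total space near every point. -/
theorem exists_isAdmissible (hπ : IsHolomorphicFibration m n π) (x : X) :
    ∃ e e', IsAdmissible m n π e e' ∧ x ∈ e.source := by
  set e₀ := chartAt (Cn (m + n)) x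
  set f := chartAt (Cn m) (π x)
  set h : Cn (m + n) → Cn m := f ∘ π ∘ e₀.symm with hh
  have hx₀ : x ∈ e₀.source := mem_chart_source _ x
  have hxf : π x ∈ f.source := mem_chart_source _ (π x)
  have he₀ : e₀ ∈ IsManifold.maximalAtlas 𝓘(ℂ, Cn (m + n)) ω X :=
    IsManifold.chart_mem_maximalAtlas x
  have hf : f ∈ IsManifold.maximalAtlas 𝓘(ℂ, Cn m) ω M := IsManifold.chart_mem_maximalAtlas (π x)
  have hπx := hπ.holomorphic.contMDiffAt (x := x)
  have hhd : ContDiffAt ℂ ω h (e₀ x) := by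
    have h1 := (contMDiffAt_iff.1 hπx).2
    simp only [mfld_simps, contDiffWithinAt_univ] at h1
    exact h1
  have hsurj : Function.Surjective (fderiv ℂ h (e₀ x)) := by
    have h1 := hπ.submersion x
    rw [(hπx.mdifferentiableAt (by simp)).mfderiv] at h1
    simp only [writtenInExtChartAt, mfld_simps, fderivWithin_univ] at h1
    exact h1
  obtain ⟨T, B, hB⟩ := exists_complement (fderiv ℂ h (e₀ x)) hsurj
  set Φ : Cn (m + n) → Cn (m + n) := fun p => Fin.append (h p) (T p) with hΦ
  have hΦd : ContDiffAt ℂ ω Φ (e₀ x) :=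
    contDiff_append.contDiffAt.comp _ (hhd.prodMk T.contDiff.contDiffAt)
  have hΦ' : HasFDerivAt Φ (B : Cn (m + n) →L[ℂ] Cn (m + n)) (e₀ x) := by
    have h1 := (appendL m n).toContinuousLinearMap.hasFDerivAt.comp (e₀ x)
      ((hhd.differentiableAt (by simp)).hasFDerivAt.prodMk T.hasFDerivAt)
    refine h1.congr_fderiv ?_
    ext v : 1
    exact (hB v).symm
  have hU : {p | p ∈ e₀.target ∧ π (e₀.symm p) ∈ f.source} ∈ nhds (e₀ x) := by
    refine Filter.inter_mem (e₀.open_target.mem_nhds (e₀.map_source hx₀)) ?_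
    have hc := e₀.symm.continuousAt (e₀.map_source hx₀)
    rw [ContinuousAt, e₀.left_inv hx₀] at hc
    exact hc ((f.open_source.preimage hπ.proper.continuous).mem_nhds hxf)
  obtain ⟨k, hk, hpk, hkU, hkΦ⟩ := exists_mem_contDiffGroupoid hΦd hΦ' hU
  refine ⟨e₀.trans k, f, ⟨trans_mem_maximalAtlas he₀ hk, hf, fun x' hx' => ?_⟩, hx₀, hpk⟩
  have h1 : π (e₀.symm (e₀ x')) ∈ f.source := (hkU hx'.2).2
  rw [e₀.left_inv hx'.1] at h1
  refine ⟨h1, fun α => ?_⟩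
  rw [OpenPartialHomeomorph.coe_trans, Function.comp_apply, hkΦ]
  simp [hΦ, hh, e₀.left_inv hx'.1]

theorem nonempty_admissiblePartition [T2Space X] [CompactSpace X]
    (hπ : IsHolomorphicFibration m n π) : Nonempty (AdmissiblePartition m n π) := by
  choose e e' he hxe using exists_isAdmissible hπ
  obtain ⟨k, s, ρ, h1, h2, h3, h4⟩ := exists_partition e hxe
  exact ⟨⟨k, fun i => e (s i), fun i => e' (s i), fun i => he _, ρ, h1, h2, h3, h4⟩⟩

end

theorem nonempty_chartPartition {N : ℕ} {X : Type*} [TopologicalSpace X] [ChartedSpace (Cn N) X]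
    [IsManifold 𝓘(ℂ, Cn N) ω X] [T2Space X] [CompactSpace X] : Nonempty (ChartPartition N X) := by
  obtain ⟨k, s, ρ, h1, h2, h3, h4⟩ :=
    exists_partition (chartAt (Cn N)) fun x : X => mem_chart_source (Cn N) x
  exact ⟨⟨k, fun i => chartAt (Cn N) (s i), fun i => IsManifold.chart_mem_maximalAtlas _, ρ,
    h1, h2, h3, h4⟩⟩

/-! ### Charts of the fibres -/

section FibreCharts

variable {m n : ℕ} {X M : Type*} [TopologicalSpace X] [ChartedSpace (Cn (m + n)) X]
  [TopologicalSpace M] [ChartedSpace (Cn m) M] {π : X → M}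
  {e E E₁ : OpenPartialHomeomorph X (Cn (m + n))} {e' f : OpenPartialHomeomorph M (Cn m)}

/-- The fibre of `π` over `y`. -/
abbrev Fibre (π : X → M) (y : M) : Type _ := {x : X // π x = y}

open Classical in
/-- The chart `v` of the fibre over `y` given by admissible coordinates `(z; v)`. The point `y₁` of
the fibre is the value of the inverse outside the target. -/
def fibreChart (h : IsAdmissible m n π E f) {y : M} (hy : y ∈ f.source) (y₁ : Fibre π y) :
    OpenPartialHomeomorph (Fibre π y) (Cn n) where
  toFun x := verPart (E x.1)
  invFun v := if hv : (Fin.append (f y) v : Cn (m + n)) ∈ E.target then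
    ⟨E.symm (Fin.append (f y) v), h.map_symm_append hy hv⟩ else y₁
  source := {x | x.1 ∈ E.source}
  target := {v | (Fin.append (f y) v : Cn (m + n)) ∈ E.target}
  map_source' := fun x hx => by
    have h1 := h.eq_append hx
    rw [x.2] at h1
    change (Fin.append (f y) (verPart (E x.1)) : Cn (m + n)) ∈ E.target
    rw [← h1]
    exact E.map_source hx
  map_target' := fun v hv => by
    have hv' : (Fin.append (f y) v : Cn (m + n)) ∈ E.target := hv
    rw [dif_pos hv']
    exact E.map_target hv'
  left_inv' := fun x hx => by
    have h1 := h.eq_append hx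
    rw [x.2] at h1
    have h2 : (Fin.append (f y) (verPart (E x.1)) : Cn (m + n)) ∈ E.target := by
      rw [← h1]; exact E.map_source hx
    rw [dif_pos h2]
    apply Subtype.ext
    change E.symm _ = x.1
    rw [← h1, E.left_inv hx]
  right_inv' := fun v hv => by
    have hv' : (Fin.append (f y) v : Cn (m + n)) ∈ E.target := hv
    rw [dif_pos hv']
    change verPart (E (E.symm _)) = v
    rw [E.right_inv hv', verPart_append]
  open_source := E.open_source.preimage continuous_subtype_val
  open_target := E.open_target.preimage (contDiff_append_right (r := 0) _).continuous
  continuousOn_toFun :=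
    (contDiff_verPart (r := 0)).continuous.comp_continuousOn
      (E.continuousOn.comp continuous_subtype_val.continuousOn fun _ hx => hx)
  continuousOn_invFun := by
    refine (Topology.IsInducing.induced Subtype.val).continuousOn_iff.2 ?_
    refine (E.continuousOn_symm.comp (contDiff_append_right (r := 0) (f y)).continuous.continuousOn
      fun _ hv => hv).congr fun v hv => ?_
    have hv' : (Fin.append (f y) v : Cn (m + n)) ∈ E.target := hv
    simp only [Function.comp_apply, dif_pos hv']

variable (h : IsAdmissible m n π E f) (h₁ : IsAdmissible m n π E₁ f) {y : M} (hy : y ∈ f.source)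
  (y₁ : Fibre π y)

theorem fibreChart_symm {v : Cn n} (hv : v ∈ (fibreChart h hy y₁).target) :
    ((fibreChart h hy y₁).symm v).1 = E.symm (Fin.append (f y) v) := by
  have hv' : (Fin.append (f y) v : Cn (m + n)) ∈ E.target := hv
  exact congrArg Subtype.val (dif_pos hv')

theorem append_fibreChart {x : Fibre π y} (hx : x.1 ∈ E.source) :
    (Fin.append (f y) (fibreChart h hy y₁ x) : Cn (m + n)) = E x.1 := by
  have h1 := h.eq_append hx
  rw [x.2] at h1
  exact h1.symm

/-- A function near the fibre, expressed in the coordinates of the fibre. -/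
theorem fibreChart_symm_eventuallyEq {F : Type*} (u : X → F) {v : Cn n}
    (hv : v ∈ (fibreChart h hy y₁).target) :
    (fun v => u ((fibreChart h hy y₁).symm v).1) =ᶠ[nhds v]
      fun v => u (E.symm (Fin.append (f y) v)) := by
  filter_upwards [(fibreChart h hy y₁).open_target.mem_nhds hv] with w hw
  rw [fibreChart_symm h hy y₁ hw]

theorem fibreChart_transition_eventuallyEq {x : Fibre π y} (hx : x.1 ∈ E.source) :
    fibreChart h₁ hy y₁ ∘ (fibreChart h hy y₁).symm =ᶠ[nhds (fibreChart h hy y₁ x)]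
      fun v => verPart ((E₁ ∘ E.symm) (Fin.append (f y) v)) :=
  fibreChart_symm_eventuallyEq h hy y₁ (fun x => verPart (E₁ x))
    ((fibreChart h hy y₁).map_source hx)

theorem append_zero_single (a : Fin n) (c : ℂ) :
    (Fin.append (0 : Cn m) (Pi.single a c : Cn n) : Cn (m + n)) = Pi.single (Fin.natAdd m a) c := by
  ext i
  refine Fin.addCases (fun i => ?_) (fun i => ?_) i
  · rw [Fin.append_left, Pi.single_eq_of_ne]
    · rfl
    · simp only [ne_eq, Fin.ext_iff, Fin.val_castAdd, Fin.val_natAdd]; omega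
  · rw [Fin.append_right]
    simp [Pi.single_apply, Fin.ext_iff]

theorem append_single_zero (a : Fin m) (c : ℂ) :
    (Fin.append (Pi.single a c : Cn m) (0 : Cn n) : Cn (m + n)) = Pi.single (Fin.castAdd n a) c := by
  ext i
  refine Fin.addCases (fun i => ?_) (fun i => ?_) i
  · rw [Fin.append_left]
    simp [Pi.single_apply, Fin.ext_iff]
  · rw [Fin.append_right, Pi.single_eq_of_ne]
    · rfl
    · simp only [ne_eq, Fin.ext_iff, Fin.val_castAdd, Fin.val_natAdd]; omega

theorem hasFDerivAt_append_right {𝕜 : Type*} [NontriviallyNormedField 𝕜] [NormedAlgebra 𝕜 ℂ]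
    (z : Cn m) (v : Cn n) : ∃ A : Cn n →L[𝕜] Cn (m + n),
      HasFDerivAt (fun v : Cn n => (Fin.append z v : Cn (m + n))) A v ∧
      ∀ w, A w = Fin.append (0 : Cn m) w := by
  refine ⟨((appendL m n).toContinuousLinearMap.restrictScalars 𝕜).comp
    (ContinuousLinearMap.inr 𝕜 (Cn m) (Cn n)), ?_, fun w => rfl⟩
  exact (((appendL m n).toContinuousLinearMap.restrictScalars 𝕜).hasFDerivAt).comp v
    ((hasFDerivAt_const z v).prodMk (hasFDerivAt_id v))

theorem dz_append {u : Cn (m + n) → ℂ} {z : Cn m} {v : Cn n}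
    (hu : DifferentiableAt ℝ u (Fin.append z v)) (a : Fin n) :
    dz a (fun v => u (Fin.append z v)) v = dz (Fin.natAdd m a) u (Fin.append z v) := by
  obtain ⟨A, hA, hA'⟩ := hasFDerivAt_append_right (𝕜 := ℝ) z v
  have h : HasFDerivAt (fun v => u (Fin.append z v)) _ v := hu.hasFDerivAt.comp v hA
  rw [dz, dz, h.fderiv]
  simp only [ContinuousLinearMap.comp_apply, hA', append_zero_single]

theorem contDiffAt_fibreChart_transition [IsManifold 𝓘(ℂ, Cn (m + n)) ω X] {x : Fibre π y}
    (hx : x.1 ∈ E.source) (hx₁ : x.1 ∈ E₁.source) :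
    ContDiffAt ℂ ω (fibreChart h₁ hy y₁ ∘ (fibreChart h hy y₁).symm) (fibreChart h hy y₁ x) := by
  refine ContDiffAt.congr_of_eventuallyEq ?_ (fibreChart_transition_eventuallyEq h h₁ hy y₁ hx)
  have h1 := contDiffAt_transition h.1 h₁.1 hx hx₁
  rw [← append_fibreChart h hy y₁ hx] at h1
  exact contDiff_verPart.contDiffAt.comp _
    (h1.comp _ (contDiff_append_right (f y)).contDiffAt)

theorem jac_fibreChart_transition [IsManifold 𝓘(ℂ, Cn (m + n)) ω X] {x : Fibre π y}
    (hx : x.1 ∈ E.source) (hx₁ : x.1 ∈ E₁.source) :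
    jac (fibreChart h₁ hy y₁ ∘ (fibreChart h hy y₁).symm) (fibreChart h hy y₁ x) =
      vert (jac (E₁ ∘ E.symm) (E x.1)) := by
  rw [jac_congr (fibreChart_transition_eventuallyEq h h₁ hy y₁ hx)]
  have h1 := (contDiffAt_transition h.1 h₁.1 hx hx₁).differentiableAt (by simp)
  rw [← append_fibreChart h hy y₁ hx] at h1 ⊢
  obtain ⟨A, hA, hA'⟩ := hasFDerivAt_append_right (𝕜 := ℂ) (f y) (fibreChart h hy y₁ x)
  have h2 : HasFDerivAt (fun v : Cn n => verPart ((E₁ ∘ E.symm) (Fin.append (f y) v)))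
      (((ContinuousLinearMap.snd ℂ (Cn m) (Cn n)).comp
        (appendL m n).symm.toContinuousLinearMap).comp
        ((fderiv ℂ (E₁ ∘ E.symm) (Fin.append (f y) (fibreChart h hy y₁ x))).comp A))
      (fibreChart h hy y₁ x) :=
    (((ContinuousLinearMap.snd ℂ (Cn m) (Cn n)).comp
        (appendL m n).symm.toContinuousLinearMap).hasFDerivAt).comp (fibreChart h hy y₁ x)
      (h1.hasFDerivAt.comp (fibreChart h hy y₁ x) hA)
  ext a b
  simp only [jac, h2.fderiv, Matrix.of_apply, Matrix.submatrix_apply,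
    ContinuousLinearMap.comp_apply, hA', append_zero_single]
  rfl

end FibreCharts

section Transition

variable {m n : ℕ} {X M : Type*} [TopologicalSpace X] [ChartedSpace (Cn (m + n)) X]
  [TopologicalSpace M] [ChartedSpace (Cn m) M] {π : X → M}
  {e E : OpenPartialHomeomorph X (Cn (m + n))} {e' f : OpenPartialHomeomorph M (Cn m)}

/-- The differential of a change of admissible coordinates is block triangular. -/
theorem horPart_jac_mulVec (he : IsAdmissible m n π e e') (hE : IsAdmissible m n π E f)
    {x : X} (hx : x ∈ e.source) (hxE : x ∈ E.source) (v : Cn (m + n)) :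
    horPart (jac (E ∘ e.symm) (e x) *ᵥ v) = jac (f ∘ e'.symm) (e' (π x)) *ᵥ horPart v := by
  have h1 := ((contDiffAt_transition he.1 hE.1 hx hxE).differentiableAt (by simp)).hasFDerivAt
  have h2 := ((contDiffAt_transition he.2.1 hE.2.1 (he.mem_source hx)
    (hE.mem_source hxE)).differentiableAt (by simp)).hasFDerivAt
  let P : Cn (m + n) →L[ℂ] Cn m := (ContinuousLinearMap.fst ℂ (Cn m) (Cn n)).comp
        (appendL m n).symm.toContinuousLinearMap
  have h3 := P.hasFDerivAt.comp (e x) h1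
  rw [← he.horPart_eq hx] at h2
  have h4 : HasFDerivAt ((f ∘ e'.symm) ∘ P) _ (e x) := HasFDerivAt.comp (e x) h2 P.hasFDerivAt
  have h5 : P ∘ (E ∘ e.symm) =ᶠ[nhds (e x)] (f ∘ e'.symm) ∘ P := by
    filter_upwards [eventually_symm_mem hx hxE] with p hp
    change horPart (E (e.symm p)) = f (e'.symm (horPart p))
    rw [hE.horPart_eq hp.2, he.map_symm hp.1]
  have h6 := (h4.congr_of_eventuallyEq h5).unique h3
  rw [jac_mulVec, jac_mulVec, ← he.horPart_eq hx]
  exact (DFunLike.congr_fun h6 v).symm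

theorem jac_castAdd_castAdd (he : IsAdmissible m n π e e') (hE : IsAdmissible m n π E f)
    {x : X} (hx : x ∈ e.source) (hxE : x ∈ E.source) (a b : Fin m) :
    jac (E ∘ e.symm) (e x) (Fin.castAdd n a) (Fin.castAdd n b) =
      jac (f ∘ e'.symm) (e' (π x)) a b := by
  have h := congrFun (horPart_jac_mulVec he hE hx hxE (Fin.append (Pi.single b 1) 0)) a
  rw [horPart_append, append_single_zero, Matrix.mulVec_single_one, Matrix.mulVec_single_one] at h
  exact h

theorem jac_castAdd_natAdd (he : IsAdmissible m n π e e') (hE : IsAdmissible m n π E f)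
    {x : X} (hx : x ∈ e.source) (hxE : x ∈ E.source) (a : Fin m) (b : Fin n) :
    jac (E ∘ e.symm) (e x) (Fin.castAdd n a) (Fin.natAdd m b) = 0 := by
  have h := congrFun (horPart_jac_mulVec he hE hx hxE (Fin.append 0 (Pi.single b 1))) a
  rw [horPart_append, append_zero_single, Matrix.mulVec_single_one, Matrix.mulVec_zero] at h
  exact h

theorem jac_castAdd_castAdd_same (he : IsAdmissible m n π e f) (hE : IsAdmissible m n π E f)
    {x : X} (hx : x ∈ e.source) (hxE : x ∈ E.source) (a b : Fin m) :
    jac (E ∘ e.symm) (e x) (Fin.castAdd n a) (Fin.castAdd n b) = if a = b then 1 else 0 := by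
  rw [jac_castAdd_castAdd he hE hx hxE]
  have : f ∘ f.symm =ᶠ[nhds (f (π x))] fun p => p := by
    filter_upwards [f.open_target.mem_nhds (f.map_source (he.mem_source hx))] with p hp
    exact f.right_inv hp
  rw [jac_congr this, jac_id, Matrix.one_apply]

end Transition

/-! ### Fibre integrals in admissible coordinates -/

theorem wedge_apply_comp {V W : Type*} {p q : ℕ} (a : (Fin p → W) → ℝ) (b : (Fin q → W) → ℝ)
    (A : V → W) (v : Fin (p + q) → V) :
    wedge a b (fun j => A (v j)) =
      wedge (fun u => a (fun j => A (u j))) (fun u => b (fun j => A (u j))) v := rfl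

theorem wedgePow_apply_comp {V W : Type*} (a : (Fin 2 → W) → ℝ) (A : V → W) (k : ℕ)
    (v : Fin (2 * k) → V) :
    wedgePow a k (fun j => A (v j)) = wedgePow (fun u => a (fun j => A (u j))) k v := by
  induction k with
  | zero => rfl
  | succ k ih =>
    change wedge (wedgePow a k) a _ = wedge (wedgePow _ k) _ v
    refine (wedge_apply_comp _ _ A v).trans ?_
    congr 1
    funext u
    exact ih u

theorem wedgePow_const_mul {V : Type*} (c : ℝ) (a : (Fin 2 → V) → ℝ) (k : ℕ)
    (v : Fin (2 * k) → V) :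
    wedgePow (fun u => c * a u) k v = c ^ k * wedgePow a k v := by
  induction k with
  | zero => simp [wedgePow]
  | succ k ih =>
    change wedge (wedgePow _ k) _ v = c ^ (k + 1) * wedge (wedgePow a k) a v
    simp only [wedge, ih, Finset.mul_sum]
    exact Finset.sum_congr rfl fun σ _ => by ring

theorem continuousOn_formOfMatrix {T : Type*} [TopologicalSpace T] {N : ℕ}
    {H : T → Matrix (Fin N) (Fin N) ℂ} {s : Set T} (hH : ∀ a b, ContinuousOn (fun t => H t a b) s)
    (v : Fin 2 → Cn N) : ContinuousOn (fun t => formOfMatrix (H t) v) s := by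
  refine Complex.continuous_re.comp_continuousOn ?_
  exact continuousOn_finsetSum _ fun a _ => continuousOn_finsetSum _ fun b _ =>
    (continuousOn_const.mul (hH a b)).mul continuousOn_const

theorem continuousOn_wedgePow {T V : Type*} [TopologicalSpace T] {a : T → (Fin 2 → V) → ℝ}
    {s : Set T} (ha : ∀ v, ContinuousOn (fun t => a t v) s) (k : ℕ) (v : Fin (2 * k) → V) :
    ContinuousOn (fun t => wedgePow (a t) k v) s := by
  induction k with
  | zero => exact continuousOn_const
  | succ k ih =>
    change ContinuousOn (fun t => wedge (wedgePow (a t) k) (a t) v) s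
    exact continuousOn_const.mul (continuousOn_finsetSum _ fun σ _ =>
      continuousOn_const.mul ((ih _).mul (ha _)))

theorem formOfMatrix_vert {m n : ℕ} (H : Matrix (Fin (m + n)) (Fin (m + n)) ℂ)
    (u : Fin 2 → Cn n) :
    formOfMatrix H (fun j => Fin.append (0 : Cn m) (u j)) = formOfMatrix (vert H) u := by
  simp [formOfMatrix, Fin.sum_univ_add]

theorem vert_congruence {m n : ℕ} {J H : Matrix (Fin (m + n)) (Fin (m + n)) ℂ}
    (hJ : ∀ a b, J (Fin.castAdd n a) (Fin.natAdd m b) = 0) :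
    vert (Jᵀ * H * J.map (starRingEnd ℂ)) =
      (vert J)ᵀ * vert H * (vert J).map (starRingEnd ℂ) := by
  ext a b
  simp [Matrix.mul_apply, Fin.sum_univ_add, hJ]

section System

theorem tsupport_comp_val_subset {X M : Type*} [TopologicalSpace X] {π : X → M} {y : M} (ρ : X → ℝ) {x : Fibre π y}
    (hx : x ∈ tsupport fun x : Fibre π y => ρ x.1) : x.1 ∈ tsupport ρ :=
  tsupport_comp_subset_preimage ρ continuous_subtype_val hx


variable {m n : ℕ} {X M : Type*} [TopologicalSpace X] [ChartedSpace (Cn (m + n)) X]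
  [TopologicalSpace M] [ChartedSpace (Cn m) M]

/-- A partition of unity together with admissible coordinate systems over one and the same chart
`f` of the base, each of which contains the part of the support over the domain of `f`. -/
structure IsAdaptedSystem (π : X → M) (f : OpenPartialHomeomorph M (Cn m)) {ι : Type*} [Fintype ι]
    (E : ι → OpenPartialHomeomorph X (Cn (m + n))) (ρ : ι → X → ℝ) : Prop where
  adm : ∀ i, IsAdmissible m n π (E i) f
  smooth : ∀ i, ContMDiff 𝓘(ℝ, Cn (m + n)) 𝓘(ℝ, ℝ) ∞ (ρ i)
  nonneg : ∀ i x, 0 ≤ ρ i x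
  sum_eq_one : ∀ x, ∑ i, ρ i x = 1
  support : ∀ i x, x ∈ tsupport (ρ i) → π x ∈ f.source → x ∈ (E i).source

variable {π : X → M} {E₀ : OpenPartialHomeomorph X (Cn (m + n))}
  {f : OpenPartialHomeomorph M (Cn m)} {ι : Type*}
  [Fintype ι] {E : ι → OpenPartialHomeomorph X (Cn (m + n))} {ρ : ι → X → ℝ}

theorem AdmissiblePartition.isAdaptedSystem (P : AdmissiblePartition m n π)
    (hf : f ∈ IsManifold.maximalAtlas 𝓘(ℂ, Cn m) ω M) :
    IsAdaptedSystem π f (fun i => withBase (P.chart i) (P.base i) f) P.ρ where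
  adm i := isAdmissible_withBase (P.admissible i) hf
  smooth := P.smooth
  nonneg := P.nonneg
  sum_eq_one := P.sum_eq_one
  support i _ hx hy := (mem_withBase_source (P.admissible i)).2 ⟨P.tsupport_subset i hx, hy⟩

theorem contDiffAt_fibre (h : IsAdmissible m n π E₀ f) {y : M} (hy : y ∈ f.source)
    (y₁ : Fibre π y) {F : Type*} [NormedAddCommGroup F] [NormedSpace ℝ F] {u : X → F}
    {r : WithTop ℕ∞} {v : Cn n} (hv : v ∈ (fibreChart h hy y₁).target)
    (hu : ContDiffAt ℝ r (fun p => u (E₀.symm p)) (Fin.append (f y) v)) :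
    ContDiffAt ℝ r (fun v => u ((fibreChart h hy y₁).symm v).1) v := by
  refine ContDiffAt.congr_of_eventuallyEq ?_ (fibreChart_symm_eventuallyEq h hy y₁ u hv)
  exact hu.comp v ((contDiff_append_right (f y)).restrict_scalars ℝ).contDiffAt

/-- The change from `(f ∘ π; v)` to `(z; v)` does not affect `v`. -/
theorem jac_withBase_mulVec {e : OpenPartialHomeomorph X (Cn (m + n))}
    {e' : OpenPartialHomeomorph M (Cn m)} (he : IsAdmissible m n π e e')
    (hf : f ∈ IsManifold.maximalAtlas 𝓘(ℂ, Cn m) ω M) {x : X} (hx : x ∈ e.source)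
    (hxf : π x ∈ f.source) (a : Cn m) (b : Cn n) :
    jac (e ∘ (withBase e e' f).symm) (withBase e e' f x) *ᵥ (Fin.append a b : Cn (m + n)) =
      (Fin.append (jac (e' ∘ f.symm) (f (π x)) *ᵥ a) b : Cn (m + n)) := by
  have hE := isAdmissible_withBase he hf
  have hxE : x ∈ (withBase e e' f).source := (mem_withBase_source he).2 ⟨hx, hxf⟩
  rw [← append_horPart_verPart (jac _ _ *ᵥ _)]
  congr 1
  · rw [horPart_jac_mulVec hE he hxE hx, horPart_append]
  · have h1 := ((contDiffAt_transition hE.1 he.1 hxE hx).differentiableAt (by simp)).hasFDerivAt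
    let P : Cn (m + n) →L[ℂ] Cn n := (ContinuousLinearMap.snd ℂ (Cn m) (Cn n)).comp
        (appendL m n).symm.toContinuousLinearMap
    have h2 : HasFDerivAt (P ∘ (e ∘ (withBase e e' f).symm)) _ (withBase e e' f x) :=
      P.hasFDerivAt.comp _ h1
    have h3 : P ∘ (e ∘ (withBase e e' f).symm) =ᶠ[nhds (withBase e e' f x)] P := by
      filter_upwards [eventually_symm_mem hxE hx] with p hp
      have h4 := withBase_apply (f := f) he hp.2
      rw [(withBase e e' f).right_inv hp.1] at h4
      change verPart (e ((withBase e e' f).symm p)) = verPart p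
      conv_rhs => rw [h4, verPart_append]
    have h5 := h2.unique (P.hasFDerivAt.congr_of_eventuallyEq h3)
    rw [jac_mulVec]
    exact (DFunLike.congr_fun h5 _).trans (verPart_append a b)

variable [IsManifold 𝓘(ℂ, Cn (m + n)) ω X]

theorem IsAdaptedSystem.isChartSystem [CompactSpace X] [T1Space M] (hc : Continuous π)
    (h : IsAdaptedSystem π f E ρ)
    {y : M} (hy : y ∈ f.source) (y₁ : Fibre π y) :
    IsChartSystem (fun i => fibreChart (h.adm i) hy y₁) (fun i x => ρ i x.1) where
  hol i j x hx hx' := contDiffAt_fibreChart_transition (h.adm i) (h.adm j) hy y₁ hx hx'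
  smooth i j v hv := by
    refine contDiffAt_fibre (h.adm i) hy y₁ hv ?_
    have hx := (E i).map_target hv
    have := contDiffAt_comp_symm ((h.smooth j).contMDiffAt) (h.adm i).1 hx
    rwa [(E i).right_inv hv] at this
  sum_eq_one x := h.sum_eq_one x.1
  compact i := by
    have : CompactSpace (Fibre π y) := by
      have h1 : IsClosed (π ⁻¹' {y}) := isClosed_singleton.preimage hc
      exact isCompact_iff_compactSpace.1 h1.isCompact
    exact HasCompactSupport.of_compactSpace _
  subset i x hx := h.support i x.1 (tsupport_comp_val_subset (ρ i) hx) (by rw [x.2]; exact hy)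

variable [IsManifold 𝓘(ℂ, Cn m) ω M]
  {L : X → Type*} [∀ x, AddCommGroup (L x)] [∀ x, Module ℂ (L x)]
  [∀ x, TopologicalSpace (L x)] [TopologicalSpace (Bundle.TotalSpace ℂ L)] [FiberBundle ℂ L]
  [VectorBundle ℂ ℂ L] (φ : HermitianMetric (m + n) L)

/-- The Chern form on the lift of a coordinate frame. -/
theorem chernFormPow_lift {e : OpenPartialHomeomorph X (Cn (m + n))}
    {e' : OpenPartialHomeomorph M (Cn m)} (he : IsAdmissible m n π e e')
    (hf : f ∈ IsManifold.maximalAtlas 𝓘(ℂ, Cn m) ω M) {y : M} (hy : y ∈ f.source) {x : X}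
    (hxe : x ∈ e.source) (hπx : π x = y) (k : ℕ) (w : Fin (2 * k) → Cn m) :
    φ.chernFormPow (n + k) x (fun j : Fin (2 * (n + k)) =>
      (mfderiv 𝓘(ℂ, Cn (m + n)) 𝓘(ℂ, Cn (m + n)) e.symm (e x)
        (if hj : (j : ℕ) < 2 * k then
          (Fin.append (mfderiv 𝓘(ℂ, Cn m) 𝓘(ℂ, Cn m) e' y
            (jac (chartAt (Cn m) y ∘ f.symm) (f y) *ᵥ w ⟨j, hj⟩) : Cn m) (0 : Cn n) : Cn (m + n))
        else (Fin.append (0 : Cn m) (frame n (j - 2 * k)) : Cn (m + n))) : Cn (m + n))) =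
      (2 * Real.pi)⁻¹ ^ (n + k) * wedgePow (formOfMatrix
          (φ.hessian (withBase e e' f) x)) (n + k) (fun j => liftFrame n w j) := by
  have hye : y ∈ e'.source := hπx ▸ he.mem_source hxe
  have hyf : π x ∈ f.source := hπx.symm ▸ hy
  have hE : IsAdmissible m n π (withBase e e' f) f := isAdmissible_withBase he hf
  have hxE : x ∈ (withBase e e' f).source := (mem_withBase_source he).2 ⟨hxe, hyf⟩
  have hfy : f (π x) = f y := by rw [hπx]
  have hc := IsManifold.chart_mem_maximalAtlas (I := 𝓘(ℂ, Cn m)) (n := ω) y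
  have hyc := mem_chart_source (Cn m) y
  have hvec : ∀ j : Fin (2 * (n + k)), (mfderiv 𝓘(ℂ, Cn (m + n)) 𝓘(ℂ, Cn (m + n)) e.symm (e x)
        (if hj : (j : ℕ) < 2 * k then
          (Fin.append (mfderiv 𝓘(ℂ, Cn m) 𝓘(ℂ, Cn m) e' y
            (jac (chartAt (Cn m) y ∘ f.symm) (f y) *ᵥ w ⟨j, hj⟩) : Cn m) (0 : Cn n) : Cn (m + n))
        else (Fin.append (0 : Cn m) (frame n (j - 2 * k)) : Cn (m + n))) : Cn (m + n)) =
      jac (chartAt (Cn (m + n)) x ∘ (withBase e e' f).symm) (withBase e e' f x) *ᵥ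
        liftFrame n w j := by
    intro j
    refine (mfderiv_symm_apply he.1 hxe _).trans ?_
    rw [jac_transition hE.1 he.1
      (IsManifold.chart_mem_maximalAtlas x) hxE hxe (mem_chart_source _ x), ← Matrix.mulVec_mulVec]
    congr 1
    by_cases hj : (j : ℕ) < 2 * k
    · have hl : liftFrame n w j = (Fin.append (w ⟨j, hj⟩) (0 : Cn n) : Cn (m + n)) := dif_pos hj
      rw [hl, jac_withBase_mulVec he hf hxe hyf, hfy]
      refine (dif_pos hj).trans (congrArg (fun a : Cn m => (Fin.append a (0 : Cn n) : Cn (m + n)))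
        ((mfderiv_chart_apply he.2.1 hye _).trans ?_))
      rw [Matrix.mulVec_mulVec, ← jac_transition hf hc he.2.1 hy hyc hye]
    · have hl : liftFrame n w j = (Fin.append (0 : Cn m) (frame n (j - 2 * k)) : Cn (m + n)) :=
        dif_neg hj
      rw [hl, jac_withBase_mulVec he hf hxe hyf, Matrix.mulVec_zero]
      exact dif_neg hj
  refine (congrArg (φ.chernFormPow (n + k) x) (funext hvec)).trans ?_
  refine (wedgePow_const_mul _ (φ.curvatureForm x) (n + k) _).trans ?_
  refine congrArg (fun r => (2 * Real.pi)⁻¹ ^ (n + k) * r) ?_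
  have h := wedgePow_apply_comp (φ.curvatureForm x) (fun u : Cn (m + n) =>
    jac (chartAt (Cn (m + n)) x ∘ (withBase e e' f).symm) (withBase e e' f x) *ᵥ u) (n + k)
    (fun j => liftFrame n w j)
  refine h.trans (congrArg (fun F => wedgePow F (n + k)
    (fun j : Fin (2 * (n + k)) => liftFrame n w (j : ℕ))) ?_)
  funext u
  rw [φ.hessian_transition hE.1 (IsManifold.chart_mem_maximalAtlas x) hxE (mem_chart_source _ x),
    formOfMatrix_congruence _ (φ.isHermitian_hessian (IsManifold.chart_mem_maximalAtlas x)
      (mem_chart_source _ x))]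
  rfl

/-- `S_k(L, φ)` on coordinate vectors of the base. -/
theorem SForm_apply [hP : Nonempty (AdmissiblePartition m n π)]
    (hf : f ∈ IsManifold.maximalAtlas 𝓘(ℂ, Cn m) ω M) {y : M} (hy : y ∈ f.source)
    (y₁ : Fibre π y) (k : ℕ) (w : Fin (2 * k) → Cn m) :
    SForm π φ k y (fun j => (jac (chartAt (Cn m) y ∘ f.symm) (f y) *ᵥ w j : Cn m)) =
      ∑ i, ∫ v in (fibreChart ((hP.some.isAdaptedSystem hf).adm i) hy y₁).target,
        (fun x => hP.some.ρ i x * ((2 * Real.pi)⁻¹ ^ (n + k) * wedgePow (formOfMatrix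
          (φ.hessian (withBase (hP.some.chart i) (hP.some.base i) f) x)) (n + k)
            (fun j => liftFrame n w j)))
        ((fibreChart ((hP.some.isAdaptedSystem hf).adm i) hy y₁).symm v).1 := by
  unfold SForm fiberIntegral
  rw [dif_pos hP]
  generalize hP.some = P
  refine Finset.sum_congr rfl fun i _ => ?_
  have he : IsAdmissible m n π (P.chart i) (P.base i) := P.admissible i
  have hE := isAdmissible_withBase he hf
  have hset : {v : Cn n | y ∈ (P.base i).source ∧
      (Fin.append (P.base i y) v : Cn (m + n)) ∈ (P.chart i).target} =
      (fibreChart hE hy y₁).target := by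
    ext v
    exact (append_mem_withBase_target hy).symm
  have hm : MeasurableSet {v : Cn n | y ∈ (P.base i).source ∧
      (Fin.append (P.base i y) v : Cn (m + n)) ∈ (P.chart i).target} := by
    rw [hset]; exact (fibreChart hE hy y₁).open_target.measurableSet
  rw [← hset]
  refine setIntegral_congr_fun hm fun v hv' => ?_
  have hv : v ∈ (fibreChart hE hy y₁).target := by rw [← hset]; exact hv'
  obtain ⟨hye, hve⟩ := (append_mem_withBase_target hy).1 hv
  have hx1 : ((fibreChart hE hy y₁).symm v).1 =
      (P.chart i).symm (Fin.append (P.base i y) v) := by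
    rw [fibreChart_symm hE hy y₁ hv, withBase_symm_append hy]
  simp only [hx1]
  refine congrArg (fun r => P.ρ i ((P.chart i).symm (Fin.append (P.base i y) v)) * r) ?_
  have h := chernFormPow_lift φ he hf hy ((P.chart i).map_target hve)
    (he.map_symm_append hye hve) k w
  rw [(P.chart i).right_inv hve] at h
  exact h

end System

theorem wedge_sum_integral {V Ω : Type*} [MeasurableSpace Ω] {μ : Measure Ω} {ι : Type*}
    [Fintype ι] {p q : ℕ} (s : ι → Set Ω) (a : ι → Ω → (Fin p → V) → ℝ)
    (ha : ∀ i u, IntegrableOn (fun v => a i v u) (s i) μ) (b : (Fin q → V) → ℝ)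
    (u : Fin (p + q) → V) :
    wedge (fun u => ∑ i, ∫ v in s i, a i v u ∂μ) b u =
      ∑ i, ∫ v in s i, wedge (a i v) b u ∂μ := by
  have h : ∀ i, ∫ v in s i, wedge (a i v) b u ∂μ = ((p.factorial : ℝ) * (q.factorial : ℝ))⁻¹ *
      ∑ σ : Equiv.Perm (Fin (p + q)), ((Equiv.Perm.sign σ : ℤ) : ℝ) *
        ((∫ v in s i, a i v (fun j => u (σ (Fin.castAdd q j))) ∂μ) *
          b (fun j => u (σ (Fin.natAdd p j)))) := by
    intro i
    simp only [wedge]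
    rw [integral_const_mul, integral_finsetSum]
    · simp only [integral_const_mul, integral_mul_const]
    · exact fun σ _ => ((ha i _).mul_const _).const_mul _
  simp only [h]
  rw [← Finset.mul_sum, Finset.sum_comm]
  simp only [wedge, Finset.sum_mul, Finset.mul_sum]

theorem wedge_const_mul_left {V : Type*} {p q : ℕ} (c : ℝ) (a : (Fin p → V) → ℝ)
    (b : (Fin q → V) → ℝ) (u : Fin (p + q) → V) :
    wedge (fun u => c * a u) b u = c * wedge a b u := by
  simp only [wedge, Finset.mul_sum]
  exact Finset.sum_congr rfl fun σ _ => by ring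

section System

variable {m n : ℕ} {X M : Type*} [TopologicalSpace X] [ChartedSpace (Cn (m + n)) X]
  [TopologicalSpace M] [ChartedSpace (Cn m) M] {π : X → M} {f : OpenPartialHomeomorph M (Cn m)}
  {ι : Type*} [Fintype ι] {E : ι → OpenPartialHomeomorph X (Cn (m + n))} {ρ : ι → X → ℝ}

theorem IsAdaptedSystem.integrableOn [CompactSpace X] [T1Space M] (hc : Continuous π)
    (h : IsAdaptedSystem π f E ρ) {y : M} (hy : y ∈ f.source) (y₁ : Fibre π y)
    {F : Type*} [NormedAddCommGroup F] (i : ι) {u : X → F}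
    (hu : ContinuousOn u (E i).source) (hu0 : ∀ x, ρ i x = 0 → u x = 0) :
    IntegrableOn (fun v => u ((fibreChart (h.adm i) hy y₁).symm v).1)
      (fibreChart (h.adm i) hy y₁).target := by
  have hK : IsCompact {x : Fibre π y | x.1 ∈ tsupport (ρ i)} := by
    have : CompactSpace (Fibre π y) := by
      have h1 : IsClosed (π ⁻¹' {y}) := isClosed_singleton.preimage hc
      exact isCompact_iff_compactSpace.1 h1.isCompact
    exact ((isClosed_tsupport (ρ i)).preimage continuous_subtype_val).isCompact
  refine integrableOn_target (f := fun x : Fibre π y => u x.1) hK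
    (fun x hx => h.support i x.1 hx (by rw [x.2]; exact hy)) (fun x hx => ?_)
    (hu.comp continuous_subtype_val.continuousOn fun _ hx => hx)
  exact hu0 _ (notMem_tsupport_eq_zero hx)

variable [IsManifold 𝓘(ℂ, Cn (m + n)) ω X] [IsManifold 𝓘(ℂ, Cn m) ω M]
  {L : X → Type*} [∀ x, AddCommGroup (L x)] [∀ x, Module ℂ (L x)]
  [∀ x, TopologicalSpace (L x)] [TopologicalSpace (Bundle.TotalSpace ℂ L)] [FiberBundle ℂ L]
  [VectorBundle ℂ ℂ L] (φ : HermitianMetric (m + n) L)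

/-- `S₀(L, φ)` is the integral of the determinant of the fibre part of the curvature. -/
theorem SZero_eq [hP : Nonempty (AdmissiblePartition m n π)]
    (hf : f ∈ IsManifold.maximalAtlas 𝓘(ℂ, Cn m) ω M) {y : M} (hy : y ∈ f.source)
    (y₁ : Fibre π y) :
    (SZero π φ y : ℂ) = (((2 * Real.pi)⁻¹ ^ n * (2 ^ n * n.factorial) : ℝ) : ℂ) *
      ∑ i, ∫ v in (fibreChart ((hP.some.isAdaptedSystem hf).adm i) hy y₁).target,
        (fun x => (hP.some.ρ i x : ℂ) *
          (vert (φ.hessian (withBase (hP.some.chart i) (hP.some.base i) f) x)).det)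
        ((fibreChart ((hP.some.isAdaptedSystem hf).adm i) hy y₁).symm v).1 := by
  have h0 : SZero π φ y = SForm π φ 0 y
      (fun j => (jac (chartAt (Cn m) y ∘ f.symm) (f y) *ᵥ (0 : Cn m) : Cn m)) := by
    unfold SZero
    congr 1
    funext j
    exact j.elim0
  rw [h0, SForm_apply φ hf hy y₁ 0 (fun _ => 0), Complex.ofReal_sum, Finset.mul_sum]
  generalize hP.some = P
  refine Finset.sum_congr rfl fun i _ => ?_
  have hE := (P.isAdaptedSystem hf).adm i
  rw [← integral_complex_ofReal, ← integral_const_mul]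
  refine setIntegral_congr_fun (fibreChart hE hy y₁).open_target.measurableSet fun v hv => ?_
  have hx : ((fibreChart hE hy y₁).symm v).1 ∈ (withBase (P.chart i) (P.base i) f).source :=
    (fibreChart hE hy y₁).map_target hv
  have hH := φ.isHermitian_hessian hE.1 hx
  generalize ((fibreChart hE hy y₁).symm v).1 = x at hx hH
  have h1 : (wedgePow (formOfMatrix (φ.hessian (withBase (P.chart i) (P.base i) f) x)) (n + 0)
      (fun j : Fin (2 * (n + 0)) => liftFrame n (fun _ : Fin (2 * 0) => (0 : Cn m)) (j : ℕ))) =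
      wedgePow (formOfMatrix (vert (φ.hessian (withBase (P.chart i) (P.base i) f) x))) n
        (fun j => frame n j) := by
    have h2 := wedgePow_apply_comp (formOfMatrix (φ.hessian (withBase (P.chart i) (P.base i) f) x))
      (fun u : Cn n => (Fin.append (0 : Cn m) u : Cn (m + n))) n (fun j => frame n j)
    simp only [formOfMatrix_vert] at h2
    rw [← h2]
    rfl
  simp only [h1, Complex.ofReal_mul, wedgePow_frame (hH.submatrix (Fin.natAdd m))]
  push_cast
  ring

variable (g : KaehlerMetric m M)

theorem formPow_apply (hf : f ∈ IsManifold.maximalAtlas 𝓘(ℂ, Cn m) ω M) {y : M}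
    (hy : y ∈ f.source) (k : ℕ) (u : Fin (2 * k) → Cn m) :
    g.formPow k y (fun j => (jac (chartAt (Cn m) y ∘ f.symm) (f y) *ᵥ u j : Cn m)) =
      wedgePow (formOfMatrix (g.matrix f y)) k u := by
  refine (wedgePow_apply_comp (g.form y)
    (fun u : Cn m => jac (chartAt (Cn m) y ∘ f.symm) (f y) *ᵥ u) k u).trans ?_
  refine congrArg (fun F => wedgePow F k u) ?_
  funext v
  refine (g.form_eq y _).trans ?_
  rw [g.matrix_eq hf hy, formOfMatrix_congruence _ (g.isHermitian_chartMatrix y)]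

theorem formPow_frame (hf : f ∈ IsManifold.maximalAtlas 𝓘(ℂ, Cn m) ω M) {y : M}
    (hy : y ∈ f.source) :
    (g.formPow m y (fun j => (jac (chartAt (Cn m) y ∘ f.symm) (f y) *ᵥ frame m j : Cn m)) : ℂ) =
      2 ^ m * m.factorial * (g.matrix f y).det := by
  rw [← wedgePow_frame (g.isHermitian_matrix hf hy), ← formPow_apply g hf hy]

theorem continuousOn_hessian {e : OpenPartialHomeomorph X (Cn (m + n))}
    [ContMDiffVectorBundle ω ℂ L 𝓘(ℂ, Cn (m + n))]
    (he : e ∈ IsManifold.maximalAtlas 𝓘(ℂ, Cn (m + n)) ω X) (a b : Fin (m + n)) :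
    ContinuousOn (fun x => φ.hessian e x a b) e.source := by
  intro x hx
  have h1 := (φ.contDiffAt_hessian he (e.map_source hx) a b).continuousAt
  have h2 : ContinuousAt (fun x => φ.hessian e (e.symm (e x)) a b) x :=
    ContinuousAt.comp (g := fun p => φ.hessian e (e.symm p) a b) h1 (e.continuousAt hx)
  refine (h2.congr ?_).continuousWithinAt
  filter_upwards [e.open_source.mem_nhds hx] with x' hx'
  rw [e.left_inv hx']

/-- `S₂(L, φ) ∧ ω^{m-2}` is the integral of a coefficient of `det (φ_{j\bar k} + t g_{j\bar k})`. -/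
theorem STwoWedge_eq [CompactSpace X] [T1Space M] (hm : 2 ≤ m) (hc : Continuous π)
    [ContMDiffVectorBundle ω ℂ L 𝓘(ℂ, Cn (m + n))]
    [hP : Nonempty (AdmissiblePartition m n π)]
    (hf : f ∈ IsManifold.maximalAtlas 𝓘(ℂ, Cn m) ω M) {y : M} (hy : y ∈ f.source)
    (y₁ : Fibre π y) :
    (STwoWedge π g φ y
      (fun j => (jac (chartAt (Cn m) y ∘ f.symm) (f y) *ᵥ frame m j : Cn m)) : ℂ) =
      (((2 * Real.pi)⁻¹ ^ (n + 2) * (2 ^ (m + n) * ((n + 2).factorial * (m - 2).factorial)) : ℝ)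
        : ℂ) *
      ∑ i, ∫ v in (fibreChart ((hP.some.isAdaptedSystem hf).adm i) hy y₁).target,
        (fun x => (hP.some.ρ i x : ℂ) *
          (detPoly (φ.hessian (withBase (hP.some.chart i) (hP.some.base i) f) x)
            (pad n (g.matrix f y))).coeff (m - 2))
        ((fibreChart ((hP.some.isAdaptedSystem hf).adm i) hy y₁).symm v).1 := by
  have h0 : STwoWedge π g φ y
      (fun j => (jac (chartAt (Cn m) y ∘ f.symm) (f y) *ᵥ frame m j : Cn m)) =
      wedge (fun u : Fin (2 * 2) → Cn m => SForm π φ 2 y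
          (fun j => (jac (chartAt (Cn m) y ∘ f.symm) (f y) *ᵥ u j : Cn m)))
        (fun u : Fin (2 * (m - 2)) → Cn m => g.formPow (m - 2) y
          (fun j => (jac (chartAt (Cn m) y ∘ f.symm) (f y) *ᵥ u j : Cn m)))
        (fun j => frame m j) :=
    wedge_apply_comp (W := TangentSpace 𝓘(ℂ, Cn m) y) (SForm π φ 2 y) (g.formPow (m - 2) y)
      (fun u : Cn m => jac (chartAt (Cn m) y ∘ f.symm) (f y) *ᵥ u) (fun j => frame m j)
  rw [h0]
  simp only [formPow_apply g hf hy, SForm_apply φ hf hy y₁]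
  generalize hP.some = P
  have hE := fun i => (P.isAdaptedSystem hf).adm i
  rw [wedge_sum_integral (fun i => (fibreChart (hE i) hy y₁).target) (fun i v u =>
      (fun x => P.ρ i x * ((2 * Real.pi)⁻¹ ^ (n + 2) * wedgePow (formOfMatrix
          (φ.hessian (withBase (P.chart i) (P.base i) f) x)) (n + 2)
            (fun j => liftFrame n u j))) ((fibreChart (hE i) hy y₁).symm v).1),
    Complex.ofReal_sum, Finset.mul_sum]
  · refine Finset.sum_congr rfl fun i _ => ?_
    rw [← integral_complex_ofReal, ← integral_const_mul]
    refine setIntegral_congr_fun (fibreChart (hE i) hy y₁).open_target.measurableSet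
      fun v hv => ?_
    have hx : ((fibreChart (hE i) hy y₁).symm v).1 ∈
      (withBase (P.chart i) (P.base i) f).source := (fibreChart (hE i) hy y₁).map_target hv
    have hH := φ.isHermitian_hessian (hE i).1 hx
    simp only []
    generalize ((fibreChart (hE i) hy y₁).symm v).1 = x at hx hH
    have h1 := wedge_contraction (by omega : 2 + (m - 2) = m) hH (g.isHermitian_matrix hf hy)
    simp only [← mul_assoc]
    rw [wedge_const_mul_left]
    push_cast
    rw [h1, detPoly]
    ring
  · intro i u
    have hcont := continuousOn_wedgePow (fun w => continuousOn_formOfMatrix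
      (fun a b => continuousOn_hessian φ (hE i).1 a b) w) (n + 2)
        (fun j : Fin (2 * (n + 2)) => liftFrame n u (j : ℕ))
    exact (P.isAdaptedSystem hf).integrableOn hc hy y₁ i
      (((P.smooth i).continuous.continuousOn).mul (continuousOn_const.mul hcont))
      fun x hx => by simp [hx]

end System

/-! ### Invariance of integrals of determinants under change of the metric -/

section Invariance

section Coefficients

variable {T : Type*} [TopologicalSpace T] {s : Set T}

theorem continuousOn_coeff_mul {P Q : T → Polynomial ℂ}
    (hP : ∀ k, ContinuousOn (fun t => (P t).coeff k) s)
    (hQ : ∀ k, ContinuousOn (fun t => (Q t).coeff k) s) (k : ℕ) :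
    ContinuousOn (fun t => (P t * Q t).coeff k) s := by
  simp only [Polynomial.coeff_mul]
  exact continuousOn_finsetSum _ fun _ _ => (hP _).mul (hQ _)

theorem continuousOn_coeff_prod {ι : Type*} (S : Finset ι) {P : ι → T → Polynomial ℂ}
    (hP : ∀ i k, ContinuousOn (fun t => (P i t).coeff k) s) (k : ℕ) :
    ContinuousOn (fun t => (∏ i ∈ S, P i t).coeff k) s := by
  classical
  induction S using Finset.induction_on generalizing k with
  | empty => simpa using continuousOn_const
  | insert i S hi ih =>
    simp only [Finset.prod_insert hi]
    exact continuousOn_coeff_mul (hP i) ih k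

theorem continuousOn_coeff_detPoly {ι : Type*} [Fintype ι] [DecidableEq ι]
    {A B : T → Matrix ι ι ℂ} (hA : ∀ i j, ContinuousOn (fun t => A t i j) s)
    (hB : ∀ i j, ContinuousOn (fun t => B t i j) s) (k : ℕ) :
    ContinuousOn (fun t => (detPoly (A t) (B t)).coeff k) s := by
  simp only [detPoly, Matrix.det_apply', Polynomial.finsetSum_coeff]
  refine continuousOn_finsetSum _ fun σ _ => continuousOn_coeff_mul (fun _ => continuousOn_const)
    (fun k => continuousOn_coeff_prod _ (fun i k => ?_) k) k
  simp only [Matrix.add_apply, Matrix.map_apply, Matrix.smul_apply, smul_eq_mul,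
    Polynomial.coeff_add, Polynomial.coeff_C]
  refine ContinuousOn.add ?_ ?_
  · split_ifs
    exacts [hA _ _, continuousOn_const]
  · cases k with
    | zero => simpa using continuousOn_const
    | succ k =>
      simp only [Polynomial.coeff_X_mul, Polynomial.coeff_C]
      split_ifs
      exacts [hB _ _, continuousOn_const]

variable {ι : Type*} [Fintype ι] [DecidableEq ι]

theorem natDegree_detPoly_le (A B : Matrix ι ι ℂ) :
    (detPoly A B).natDegree ≤ Fintype.card ι := by
  rw [detPoly, add_comm]
  exact Polynomial.natDegree_det_X_add_C_le B A

theorem eval_derivative_detPoly (A B : Matrix ι ι ℂ) (t : ℝ) :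
    (detPoly A B).derivative.eval (t : ℂ) =
      ∑ p, ∑ q, (A + (t : ℂ) • B).adjugate q p * B p q := by
  have h1 := ((detPoly A B).hasDerivAt (t : ℂ)).comp_ofReal
  have h2 : ∀ i j, HasFDerivAt (fun t : ℝ => (A + (t : ℂ) • B) i j)
      (Complex.ofRealCLM.smulRight (B i j)) t := by
    intro i j
    have h3 : HasFDerivAt (fun t : ℝ => (t : ℂ) • B i j) (Complex.ofRealCLM.smulRight (B i j)) t :=
      Complex.ofRealCLM.hasFDerivAt.smul_const (B i j)
    simpa using h3.const_add (A i j)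
  have h4 := (hasFDerivAt_det h2).hasDerivAt
  simp only [eval_detPoly] at h1
  have h5 := h1.unique h4
  rw [h5]
  simp [sum_apply]

end Coefficients

variable {Y : Type*} [TopologicalSpace Y] {k : ℕ} {ι : Type*} [Fintype ι]
  {e : ι → OpenPartialHomeomorph Y (Cn k)} {ρ : ι → Y → ℝ}

theorem IsChartSystem.integrableOn (h : IsChartSystem e ρ) (i : ι) {u : Cn k → ℂ}
    (hu : ContinuousOn u (e i).target) :
    IntegrableOn (fun p => (ρ i ((e i).symm p) : ℂ) * u p) (e i).target := by
  have h1 : IntegrableOn (fun p => (fun y => (ρ i y : ℂ) * u (e i y)) ((e i).symm p))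
      (e i).target := by
    refine integrableOn_target (f := fun y => (ρ i y : ℂ) * u (e i y)) (h.compact i) (h.subset i) (fun y hy => ?_) ?_
    · rw [notMem_tsupport_eq_zero hy, Complex.ofReal_zero, zero_mul]
    · exact (Complex.continuous_ofReal.comp_continuousOn (h.continuousOn i i)).mul
        (hu.comp (e i).continuousOn (e i).mapsTo)
  refine h1.congr_fun (fun p hp => ?_) (e i).open_target.measurableSet
  simp only [(e i).right_inv hp]

/-- The integral of `det F`, for a closed `(1,1)`-form `F`, does not change if `i∂∂̄u` is added
to `F`. -/
theorem sum_integral_det_add_complexHessian (h : IsChartSystem e ρ)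
    (A : ι → Cn k → Matrix (Fin k) (Fin k) ℂ) (u : Y → ℝ)
    (hAs : ∀ i, ∀ p ∈ (e i).target, ∀ a c, ContDiffAt ℝ ∞ (fun x => A i x a c) p)
    (hcl : ∀ i, ∀ p ∈ (e i).target, ∀ l a c,
      dz l (fun x => A i x a c) p = dz a (fun x => A i x l c) p)
    (hAt : ∀ i l, ∀ y ∈ (e i).source, y ∈ (e l).source → A i (e i y) =
      (jac (e l ∘ (e i).symm) (e i y))ᵀ * A l (e l y) *
        (jac (e l ∘ (e i).symm) (e i y)).map (starRingEnd ℂ))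
    (hu : ∀ i, ∀ p ∈ (e i).target, ContDiffAt ℝ ∞ (fun p => u ((e i).symm p)) p) :
    ∑ i, ∫ p in (e i).target, (ρ i ((e i).symm p) : ℂ) *
        (A i p + complexHessian (fun p => u ((e i).symm p)) p).det =
      ∑ i, ∫ p in (e i).target, (ρ i ((e i).symm p) : ℂ) * (A i p).det := by
  set B : ι → Cn k → Matrix (Fin k) (Fin k) ℂ := fun i =>
    complexHessian (fun p => u ((e i).symm p)) with hB
  have hBs : ∀ i, ∀ p ∈ (e i).target, ∀ a c, ContDiffAt ℝ ∞ (fun x => B i x a c) p :=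
    fun i p hp a c => contDiffAt_complexHessian (hu i p hp) a c
  have hloc : ∀ i l, ∀ y ∈ (e i).source, y ∈ (e l).source →
      (fun p => u ((e i).symm p)) =ᶠ[nhds (e i y)]
        fun p => (fun p => u ((e l).symm p)) ((e l ∘ (e i).symm) p) := by
    intro i l y hy hy'
    filter_upwards [eventually_symm_mem hy hy'] with p hp
    simp only [Function.comp_apply, (e l).left_inv hp.2]
  have hval : ∀ i l, ∀ y ∈ (e i).source, (e l ∘ (e i).symm) (e i y) = e l y := fun i l y hy => by
    simp only [Function.comp_apply, (e i).left_inv hy]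
  have hBt : ∀ i l, ∀ y ∈ (e i).source, y ∈ (e l).source → B i (e i y) =
      (jac (e l ∘ (e i).symm) (e i y))ᵀ * B l (e l y) *
        (jac (e l ∘ (e i).symm) (e i y)).map (starRingEnd ℂ) := by
    intro i l y hy hy'
    have h1 := hu l (e l y) ((e l).map_source hy')
    rw [← hval i l y hy] at h1 ⊢
    rw [hB, ← complexHessian_comp (h.hol i l y hy hy') h1]
    exact complexHessian_congr (hloc i l y hy hy')
  -- the derivative with respect to `t` of the integral of `det (A + t B)` vanishes
  have hder : ∀ t : ℝ, ∑ i, ∫ p in (e i).target, (ρ i ((e i).symm p) : ℂ) *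
      (detPoly (A i p) (B i p)).derivative.eval (t : ℂ) = 0 := by
    intro t
    have key := sum_integral_variation_eq_zero h (fun i p => A i p + (t : ℂ) • B i p)
      (fun i p c => dzbar c (fun p => (u ((e i).symm p) : ℂ)) p) (fun _ _ _ => 0)
      (fun _ _ _ => 0)
      (fun i p hp a c => (hAs i p hp a c).add (contDiffAt_const.mul (hBs i p hp a c)))
      (fun i p hp a => contDiffAt_dzbar (contDiffAt_ofReal (hu i p hp)) a)
      (fun _ _ => continuousOn_const) (fun _ _ _ _ _ => rfl) (fun _ _ _ => by simp)
      (fun i p hp l a c => ?_) (fun i l y hy hy' => ?_) (fun i l y hy hy' => ?_)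
      (fun i l j y hy hy' => by simp)
    · rw [← key]
      refine Finset.sum_congr rfl fun i _ => setIntegral_congr_fun
        (e i).open_target.measurableSet fun p hp => ?_
      simp only [zero_mul, zero_add, eval_derivative_detPoly]
      rfl
    · have h1 : ∀ a c, DifferentiableAt ℝ (fun x => A i x a c) p :=
        fun a c => (hAs i p hp a c).differentiableAt (by simp)
      have h2 : ∀ a c, DifferentiableAt ℝ (fun x => B i x a c) p :=
        fun a c => (hBs i p hp a c).differentiableAt (by simp)
      simp only [Matrix.add_apply, Matrix.smul_apply, smul_eq_mul]
      rw [dz_add (h1 a c) ((h2 a c).const_mul _), dz_add (h1 l c) ((h2 l c).const_mul _),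
        dz_const_mul (h2 a c), dz_const_mul (h2 l c), hcl i p hp l a c,
        dz_complexHessian (hu i p hp) l a c]
    · rw [hAt i l y hy hy', hBt i l y hy hy']
      simp only [Matrix.mul_add, Matrix.add_mul, Matrix.mul_smul, Matrix.smul_mul]
    · funext c
      have h1 : DifferentiableAt ℝ (fun p => (u ((e l).symm p) : ℂ))
          ((e l ∘ (e i).symm) (e i y)) := by
        rw [hval i l y hy]
        exact (contDiffAt_ofReal (hu l _ ((e l).map_source hy'))).differentiableAt (by simp)
      have h2 : (fun p => (u ((e i).symm p) : ℂ)) =ᶠ[nhds (e i y)]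
          fun p => (fun p => (u ((e l).symm p) : ℂ)) ((e l ∘ (e i).symm) p) := by
        filter_upwards [hloc i l y hy hy'] with p hp
        rw [hp]
      rw [dzbar_congr h2, dzbar_comp ((h.hol i l y hy hy').differentiableAt (by simp)) h1,
        hval i l y hy]
      simp [Matrix.mulVec, dotProduct]
  have hcoeff : ∀ j i, IntegrableOn (fun p => (ρ i ((e i).symm p) : ℂ) *
      (detPoly (A i p) (B i p)).coeff j) (e i).target := fun j i =>
    h.integrableOn i (continuousOn_coeff_detPoly
      (fun a c p hp => (hAs i p hp a c).continuousAt.continuousWithinAt)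
      (fun a c p hp => (hBs i p hp a c).continuousAt.continuousWithinAt) j)
  -- the integral of `det (A + t B)` as a polynomial in `t`
  set I : ℕ → ℂ := fun j => ∑ i, ∫ p in (e i).target, (ρ i ((e i).symm p) : ℂ) *
      (detPoly (A i p) (B i p)).coeff j with hI
  set Q : Polynomial ℂ := ∑ j ∈ Finset.range (k + 1), Polynomial.monomial j (I j) with hQ
  have hdeg : ∀ i p, (detPoly (A i p) (B i p)).natDegree < k + 1 := fun i p =>
    Nat.lt_succ_of_le ((natDegree_detPoly_le _ _).trans (by simp))
  have hQeval : ∀ t : ℂ, Q.eval t = ∑ i, ∫ p in (e i).target, (ρ i ((e i).symm p) : ℂ) *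
      (detPoly (A i p) (B i p)).eval t := by
    intro t
    have h1 : ∀ i, ∫ p in (e i).target, (ρ i ((e i).symm p) : ℂ) *
        (detPoly (A i p) (B i p)).eval t = ∑ j ∈ Finset.range (k + 1),
        (∫ p in (e i).target, (ρ i ((e i).symm p) : ℂ) *
          (detPoly (A i p) (B i p)).coeff j) * t ^ j := by
      intro i
      simp only [← integral_mul_const]
      rw [← integral_finsetSum _ fun j _ => (hcoeff j i).mul_const _]
      refine integral_congr_ae (Filter.Eventually.of_forall fun p => ?_)
      simp only [Polynomial.eval_eq_sum_range' (hdeg i p), Finset.mul_sum, mul_assoc]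
    simp only [h1]
    rw [Finset.sum_comm, hQ, Polynomial.eval_finsetSum]
    simp only [Polynomial.eval_monomial, hI, Finset.sum_mul]
  have hQder : ∀ t : ℝ, Q.derivative.eval (t : ℂ) = 0 := by
    intro t
    rw [← hder t]
    have h1 : ∀ i, ∫ p in (e i).target, (ρ i ((e i).symm p) : ℂ) *
        (detPoly (A i p) (B i p)).derivative.eval (t : ℂ) = ∑ j ∈ Finset.range (k + 1),
        (∫ p in (e i).target, (ρ i ((e i).symm p) : ℂ) *
          (detPoly (A i p) (B i p)).coeff j) * (j * (t : ℂ) ^ (j - 1)) := by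
      intro i
      simp only [← integral_mul_const]
      rw [← integral_finsetSum _ fun j _ => (hcoeff j i).mul_const _]
      refine integral_congr_ae (Filter.Eventually.of_forall fun p => ?_)
      simp only
      conv_lhs => rw [(detPoly (A i p) (B i p)).as_sum_range' _ (hdeg i p)]
      simp only [Polynomial.derivative_sum, Polynomial.derivative_monomial,
        Polynomial.eval_finsetSum, Polynomial.eval_monomial, Finset.mul_sum]
      exact Finset.sum_congr rfl fun j _ => by ring
    simp only [h1]
    rw [Finset.sum_comm, hQ, Polynomial.derivative_sum, Polynomial.eval_finsetSum]
    refine Finset.sum_congr rfl fun j _ => ?_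
    rw [Polynomial.derivative_monomial, Polynomial.eval_monomial, ← Finset.sum_mul]
    ring
  have hQ0 : Q.derivative = 0 := by
    refine Polynomial.eq_zero_of_infinite_isRoot _ (Set.Infinite.mono ?_
      (Set.infinite_range_of_injective Complex.ofReal_injective))
    rintro _ ⟨t, rfl⟩
    exact hQder t
  obtain ⟨c, hc⟩ := Polynomial.natDegree_eq_zero.1
    (Polynomial.derivative_eq_zero.1 hQ0)
  have h0 := hQeval 0
  have h1 := hQeval 1
  simp only [eval_detPoly, zero_smul, one_smul, add_zero] at h0 h1
  rw [← h0, ← h1, ← hc, Polynomial.eval_C, Polynomial.eval_C]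

end Invariance

theorem jac_append {m n : ℕ} (z : Cn m) (v : Cn n) (a : Fin (m + n)) (b : Fin n) :
    jac (fun v : Cn n => (Fin.append z v : Cn (m + n))) v a b =
      (Pi.single (Fin.natAdd m b) 1 : Cn (m + n)) a := by
  obtain ⟨A, hA, hA'⟩ := hasFDerivAt_append_right (𝕜 := ℂ) z v
  rw [jac, Matrix.of_apply, hA.fderiv, hA', append_zero_single]

theorem complexHessian_append {m n : ℕ} {U : Cn (m + n) → ℝ} {z : Cn m} {v : Cn n}
    (hU : ContDiffAt ℝ ∞ U (Fin.append z v)) :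
    complexHessian (fun v => U (Fin.append z v)) v = vert (complexHessian U (Fin.append z v)) := by
  rw [complexHessian_comp (h := fun v : Cn n => (Fin.append z v : Cn (m + n)))
    (contDiff_append_right z).contDiffAt hU]
  ext a b
  simp [Matrix.mul_apply, jac_append, Pi.single_apply]

section System

variable {m n : ℕ} {X M : Type*} [TopologicalSpace X] [ChartedSpace (Cn (m + n)) X]
  [TopologicalSpace M] [ChartedSpace (Cn m) M] {π : X → M} {f : OpenPartialHomeomorph M (Cn m)}
  {ι : Type*} [Fintype ι] {E : ι → OpenPartialHomeomorph X (Cn (m + n))} {ρ : ι → X → ℝ}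
  [IsManifold 𝓘(ℂ, Cn (m + n)) ω X]
  {L : X → Type*} [∀ x, AddCommGroup (L x)] [∀ x, Module ℂ (L x)]
  [∀ x, TopologicalSpace (L x)] [TopologicalSpace (Bundle.TotalSpace ℂ L)] [FiberBundle ℂ L]
  [VectorBundle ℂ ℂ L] (φ ψ : HermitianMetric (m + n) L)
  {E₀ E₁ : OpenPartialHomeomorph X (Cn (m + n))}

theorem vert_hessian_fibreChart (h : IsAdmissible m n π E₀ f) (h₁ : IsAdmissible m n π E₁ f)
    {y : M} (hy : y ∈ f.source) (y₁ : Fibre π y) {x : Fibre π y} (hx : x.1 ∈ E₀.source)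
    (hx₁ : x.1 ∈ E₁.source) :
    vert (φ.hessian E₀ x.1) =
      (jac (fibreChart h₁ hy y₁ ∘ (fibreChart h hy y₁).symm) (fibreChart h hy y₁ x))ᵀ *
        vert (φ.hessian E₁ x.1) *
        (jac (fibreChart h₁ hy y₁ ∘ (fibreChart h hy y₁).symm) (fibreChart h hy y₁ x)).map
          (starRingEnd ℂ) := by
  rw [jac_fibreChart_transition h h₁ hy y₁ hx hx₁, φ.hessian_transition h.1 h₁.1 hx hx₁,
    vert_congruence fun a b => jac_castAdd_natAdd h h₁ hx hx₁ a b]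

variable [ContMDiffVectorBundle ω ℂ L 𝓘(ℂ, Cn (m + n))]

theorem contDiffAt_hessian_fibre (h : IsAdmissible m n π E₀ f) {y : M} (hy : y ∈ f.source)
    (y₁ : Fibre π y) {v : Cn n} (hv : v ∈ (fibreChart h hy y₁).target) (a b : Fin (m + n)) :
    ContDiffAt ℝ ∞ (fun v => φ.hessian E₀ ((fibreChart h hy y₁).symm v).1 a b) v :=
  contDiffAt_fibre h hy y₁ (u := fun x => φ.hessian E₀ x a b) hv
    (φ.contDiffAt_hessian h.1 hv a b)

theorem dz_hessian_fibre (h : IsAdmissible m n π E₀ f) {y : M} (hy : y ∈ f.source)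
    (y₁ : Fibre π y) {v : Cn n} (hv : v ∈ (fibreChart h hy y₁).target) (l : Fin n)
    (a b : Fin (m + n)) :
    dz l (fun v => φ.hessian E₀ ((fibreChart h hy y₁).symm v).1 a b) v =
      dz (Fin.natAdd m l) (fun p => φ.hessian E₀ (E₀.symm p) a b) (Fin.append (f y) v) := by
  rw [dz_congr (fibreChart_symm_eventuallyEq h hy y₁ (fun x => φ.hessian E₀ x a b) hv)]
  exact dz_append (u := fun p => φ.hessian E₀ (E₀.symm p) a b)
    ((φ.contDiffAt_hessian h.1 hv a b).differentiableAt (by simp)) l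

/-- The fibre integral of the determinant of the fibre part of the curvature does not depend on
the metric. -/
theorem IsAdaptedSystem.sum_integral_det_vert [CompactSpace X] [T1Space M] (hc : Continuous π)
    (h : IsAdaptedSystem π f E ρ) {y : M} (hy : y ∈ f.source) (y₁ : Fibre π y) :
    ∑ i, ∫ v in (fibreChart (h.adm i) hy y₁).target,
        (fun x => (ρ i x : ℂ) * (vert (ψ.hessian (E i) x)).det)
          ((fibreChart (h.adm i) hy y₁).symm v).1 =
      ∑ i, ∫ v in (fibreChart (h.adm i) hy y₁).target,
        (fun x => (ρ i x : ℂ) * (vert (φ.hessian (E i) x)).det)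
          ((fibreChart (h.adm i) hy y₁).symm v).1 := by
  have hu : ∀ i, ∀ v ∈ (fibreChart (h.adm i) hy y₁).target,
      ContDiffAt ℝ ∞ (fun p => HermitianMetric.weightDiff φ ψ (((E i).symm p)))
        (Fin.append (f y) v) :=
    fun i v hv => HermitianMetric.contDiffAt_weightDiff φ ψ (h.adm i).1 hv
  have key := sum_integral_det_add_complexHessian (h.isChartSystem hc hy y₁)
    (fun i v => vert (φ.hessian (E i) ((fibreChart (h.adm i) hy y₁).symm v).1))
    (fun x => HermitianMetric.weightDiff φ ψ x.1)
    (fun i v hv a b => contDiffAt_hessian_fibre φ (h.adm i) hy y₁ hv _ _)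
    (fun i v hv l a b => ?_) (fun i l x hx hx' => ?_)
    (fun i v hv => contDiffAt_fibre (h.adm i) hy y₁ hv (hu i v hv))
  · rw [← key]
    refine Finset.sum_congr rfl fun i _ => setIntegral_congr_fun
      (fibreChart (h.adm i) hy y₁).open_target.measurableSet fun v hv => ?_
    have h1 := HermitianMetric.hessian_sub φ ψ (h.adm i).1
      ((fibreChart (h.adm i) hy y₁).map_target hv)
    simp only
    rw [complexHessian_congr (fibreChart_symm_eventuallyEq (h.adm i) hy y₁
      (HermitianMetric.weightDiff φ ψ) hv), complexHessian_append (hu i v hv)]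
    have h2 : E i ((fibreChart (h.adm i) hy y₁).symm v).1 = Fin.append (f y) v := by
      rw [fibreChart_symm (h.adm i) hy y₁ hv, (E i).right_inv hv]
    rw [h2, sub_eq_iff_eq_add'] at h1
    rw [h1]
    rfl
  · simp only [Matrix.submatrix_apply]
    rw [dz_hessian_fibre φ (h.adm i) hy y₁ hv, dz_hessian_fibre φ (h.adm i) hy y₁ hv,
      φ.dz_hessian (h.adm i).1 hv]
  · have h1 := (fibreChart (h.adm i) hy y₁).left_inv hx
    have h2 := (fibreChart (h.adm l) hy y₁).left_inv hx'
    simp only [h1, h2]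
    exact vert_hessian_fibreChart φ (h.adm i) (h.adm l) hy y₁ hx hx'

variable [IsManifold 𝓘(ℂ, Cn m) ω M]

theorem SZero_eq_SZero [CompactSpace X] [T1Space M] (hc : Continuous π)
    [hP : Nonempty (AdmissiblePartition m n π)] {y : M} (y₁ : Fibre π y) :
    SZero π ψ y = SZero π φ y := by
  have hf := IsManifold.chart_mem_maximalAtlas (I := 𝓘(ℂ, Cn m)) (n := ω) y
  have hy := mem_chart_source (Cn m) y
  rw [← Complex.ofReal_inj, SZero_eq φ hf hy y₁, SZero_eq ψ hf hy y₁,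
    (hP.some.isAdaptedSystem hf).sum_integral_det_vert φ ψ hc hy y₁]

end System

/-! ### Constancy of the fibre integral of `c₁(L)^n` -/

theorem norm_le_norm_append {m n : ℕ} (z : Cn m) (v : Cn n) :
    ‖v‖ ≤ ‖(Fin.append z v : Cn (m + n))‖ := by
  rw [pi_norm_le_iff_of_nonneg (norm_nonneg _)]
  intro i
  have h := norm_le_pi_norm (Fin.append z v : Cn (m + n)) (Fin.natAdd m i)
  rwa [Fin.append_right] at h

theorem hasCompactSupport_append {m n : ℕ} {F : Type*} [Zero F] {Φ : Cn (m + n) → F}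
    (hc : HasCompactSupport Φ) (z : Cn m) :
    HasCompactSupport (fun v : Cn n => Φ (Fin.append z v)) := by
  obtain ⟨R, hR⟩ := hc.isBounded.subset_closedBall (0 : Cn (m + n))
  refine HasCompactSupport.intro (isCompact_closedBall (0 : Cn n) R) fun v hv => ?_
  refine image_eq_zero_of_notMem_tsupport fun h => hv ?_
  have h1 := hR h
  rw [mem_closedBall_zero_iff] at h1 ⊢
  exact (norm_le_norm_append z v).trans h1

theorem continuous_append_right {m n : ℕ} (z : Cn m) :
    Continuous (fun v : Cn n => (Fin.append z v : Cn (m + n))) :=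
  (contDiff_append_right (r := 0) z).continuous

/-- Differentiation under the integral sign. -/
theorem dz_integral_append {m n : ℕ} {Φ : Cn (m + n) → ℂ} (hΦ : ContDiff ℝ 1 Φ)
    (hc : HasCompactSupport Φ) (z : Cn m) :
    DifferentiableAt ℝ (fun z : Cn m => ∫ v : Cn n, Φ (Fin.append z v)) z ∧
      ∀ l, dz l (fun z : Cn m => ∫ v : Cn n, Φ (Fin.append z v)) z =
        ∫ v : Cn n, dz (Fin.castAdd n l) Φ (Fin.append z v) := by
  let A : Cn m →L[ℝ] Cn (m + n) := ((appendL m n).toContinuousLinearMap.restrictScalars ℝ).comp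
    (ContinuousLinearMap.inl ℝ (Cn m) (Cn n))
  have hA : ∀ (z : Cn m) (v : Cn n),
      HasFDerivAt (fun z : Cn m => (Fin.append z v : Cn (m + n))) A z := fun z v =>
    (((appendL m n).toContinuousLinearMap.restrictScalars ℝ).hasFDerivAt).comp z
      ((hasFDerivAt_id z).prodMk (hasFDerivAt_const v z))
  have hA' : ∀ w, A w = Fin.append w (0 : Cn n) := fun w => rfl
  have hcf : Continuous (fderiv ℝ Φ) := hΦ.continuous_fderiv one_ne_zero
  obtain ⟨C, hC⟩ := (hc.fderiv (𝕜 := ℝ)).exists_bound_of_continuous hcf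
  obtain ⟨R, hR⟩ := (hc.fderiv (𝕜 := ℝ)).isBounded.subset_closedBall (0 : Cn (m + n))
  have hF'c : ∀ z : Cn m, Continuous fun v : Cn n => (fderiv ℝ Φ (Fin.append z v)).comp A :=
    fun z => ((ContinuousLinearMap.compL ℝ (Cn m) (Cn (m + n)) ℂ).flip A).continuous.comp
      (hcf.comp (continuous_append_right z))
  have hF'i : Integrable fun v : Cn n => (fderiv ℝ Φ (Fin.append z v)).comp A := by
    refine (hF'c z).integrable_of_hasCompactSupport ?_
    exact (hasCompactSupport_append (hc.fderiv (𝕜 := ℝ)) z).comp_left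
      (g := fun T : Cn (m + n) →L[ℝ] ℂ => T.comp A) (by simp)
  have key := hasFDerivAt_integral_of_dominated_of_fderiv_le (μ := (volume : Measure (Cn n)))
    (s := Set.univ) (x₀ := z) (F := fun (z : Cn m) (v : Cn n) => Φ (Fin.append z v))
    (F' := fun z v => (fderiv ℝ Φ (Fin.append z v)).comp A)
    (bound := (Metric.closedBall (0 : Cn n) R).indicator fun _ => C * ‖A‖) Filter.univ_mem
    (Filter.Eventually.of_forall fun z =>
      (hΦ.continuous.comp (continuous_append_right z)).aestronglyMeasurable)
    ((hΦ.continuous.comp (continuous_append_right z)).integrable_of_hasCompactSupport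
      (hasCompactSupport_append hc z))
    (hF'c z).aestronglyMeasurable
    (Filter.Eventually.of_forall fun v z _ => ?_)
    ((integrable_indicator_iff Metric.isClosed_closedBall.measurableSet).2
      (integrableOn_const (isCompact_closedBall _ _).measure_lt_top.ne))
    (Filter.Eventually.of_forall fun v z _ =>
      ((hΦ.differentiable one_ne_zero _).hasFDerivAt).comp z (hA z v))
  · refine ⟨key.differentiableAt, fun l => ?_⟩
    rw [dz_eq, key.fderiv, ← ContinuousLinearMap.integral_comp_comm _ hF'i]
    refine integral_congr_ae (Filter.Eventually.of_forall fun v => ?_)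
    simp only [dz_eq, dzL_apply, ContinuousLinearMap.comp_apply, hA', append_single_zero]
  · by_cases hv : v ∈ Metric.closedBall (0 : Cn n) R
    · rw [Set.indicator_of_mem hv]
      refine (ContinuousLinearMap.opNorm_comp_le _ _).trans ?_
      exact mul_le_mul_of_nonneg_right (hC _) (norm_nonneg _)
    · rw [Set.indicator_of_notMem hv]
      have h0 : fderiv ℝ Φ (Fin.append z v) = 0 := by
        refine image_eq_zero_of_notMem_tsupport fun h => hv ?_
        have h1 := hR h
        rw [mem_closedBall_zero_iff] at h1 ⊢
        exact (norm_le_norm_append z v).trans h1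
      rw [h0]
      simp

/-- A real function with vanishing derivatives `∂/∂z` has vanishing differential. -/
theorem fderiv_eq_zero_of_dz_eq_zero {N : ℕ} {G : Cn N → ℂ} {p : Cn N}
    (hd : DifferentiableAt ℝ G p) (hG : (fun x => (starRingEnd ℂ) (G x)) =ᶠ[nhds p] G)
    (h : ∀ l, dz l G p = 0) : fderiv ℝ G p = 0 := by
  ext w
  rw [realLinear_eq_sum (fderiv ℝ G p) w]
  refine Finset.sum_eq_zero fun q _ => ?_
  have h1 : dzbar q G p = 0 := by
    rw [← dzbar_congr hG, dzbar_conj hd, h, map_zero]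
  rw [← dz_eq, ← dzbar_eq, h, h1, mul_zero, mul_zero, add_zero]

section System

variable {m n : ℕ} {X M : Type*} [TopologicalSpace X] [ChartedSpace (Cn (m + n)) X]
  [TopologicalSpace M] [ChartedSpace (Cn m) M] {π : X → M} {f : OpenPartialHomeomorph M (Cn m)}
  {ι : Type*} [Fintype ι] {E : ι → OpenPartialHomeomorph X (Cn (m + n))} {ρ : ι → X → ℝ}
  [IsManifold 𝓘(ℂ, Cn (m + n)) ω X]
  {L : X → Type*} [∀ x, AddCommGroup (L x)] [∀ x, Module ℂ (L x)]
  [∀ x, TopologicalSpace (L x)] [TopologicalSpace (Bundle.TotalSpace ℂ L)] [FiberBundle ℂ L]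
  [VectorBundle ℂ ℂ L]
  [ContMDiffVectorBundle ω ℂ L 𝓘(ℂ, Cn (m + n))] (φ : HermitianMetric (m + n) L)

theorem IsAdaptedSystem.contDiffAt_weight (h : IsAdaptedSystem π f E ρ) (i j : ι)
    {p : Cn (m + n)} (hp : p ∈ (E i).target) :
    ContDiffAt ℝ ∞ (fun p => ρ j ((E i).symm p)) p := by
  have := contDiffAt_comp_symm ((h.smooth j).contMDiffAt) (h.adm i).1 ((E i).map_target hp)
  rwa [(E i).right_inv hp] at this

/-- The first variation of the fibre integral of the determinant of the curvature in a direction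
`∂/∂z^l` of the base is zero, the curvature being closed. -/
theorem IsAdaptedSystem.sum_integral_dz_eq_zero [CompactSpace X] [T1Space M] (hc : Continuous π)
    (h : IsAdaptedSystem π f E ρ) {y : M} (hy : y ∈ f.source) (y₁ : Fibre π y) (l : Fin m) :
    ∑ i, ∫ v in (fibreChart (h.adm i) hy y₁).target,
      dz (Fin.castAdd n l) (fun p => (ρ i ((E i).symm p) : ℂ) *
        (vert (φ.hessian (E i) ((E i).symm p))).det) (Fin.append (f y) v) = 0 := by
  have hκ : ∀ i, ∀ v ∈ (fibreChart (h.adm i) hy y₁).target,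
      E i ((fibreChart (h.adm i) hy y₁).symm v).1 = Fin.append (f y) v := fun i v hv => by
    rw [fibreChart_symm (h.adm i) hy y₁ hv, (E i).right_inv hv]
  have hρ : ∀ i j, ∀ p ∈ (E i).target, ContDiffAt ℝ ∞ (fun p => (ρ j ((E i).symm p) : ℂ)) p :=
    fun i j p hp => contDiffAt_ofReal (h.contDiffAt_weight i j hp)
  have happ : ∀ i, ∀ x : Fibre π y, x.1 ∈ (E i).source →
      (Fin.append (f y) (fibreChart (h.adm i) hy y₁ x) : Cn (m + n)) = E i x.1 :=
    fun i x hx => append_fibreChart (h.adm i) hy y₁ hx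
  have key := sum_integral_variation_eq_zero (h.isChartSystem hc hy y₁)
    (fun i v => vert (φ.hessian (E i) ((fibreChart (h.adm i) hy y₁).symm v).1))
    (fun i v c => φ.hessian (E i) ((fibreChart (h.adm i) hy y₁).symm v).1
      (Fin.castAdd n l) (Fin.natAdd m c))
    (fun i j v => dz (Fin.castAdd n l) (fun p => (ρ j ((E i).symm p) : ℂ)) (Fin.append (f y) v))
    (fun i i' x a => jac (E i' ∘ (E i).symm) (E i x.1) (Fin.natAdd m a) (Fin.castAdd n l))
    (fun i v hv a b => contDiffAt_hessian_fibre φ (h.adm i) hy y₁ hv _ _)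
    (fun i v hv a => contDiffAt_hessian_fibre φ (h.adm i) hy y₁ hv _ _)
    (fun i j v hv => ?_) (fun i j v hv hvs => ?_) (fun i v hv => ?_) (fun i v hv l a b => ?_)
    (fun i l x hx hx' => ?_) (fun i i' x hx hx' => ?_) (fun i i' j x hx hx' => ?_)
  · rw [← key]
    refine Finset.sum_congr rfl fun i _ => setIntegral_congr_fun
      (fibreChart (h.adm i) hy y₁).open_target.measurableSet fun v hv => ?_
    have hH : ∀ a b, DifferentiableAt ℝ (fun p => φ.hessian (E i) ((E i).symm p) a b)
        (Fin.append (f y) v) := fun a b =>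
      (φ.contDiffAt_hessian (h.adm i).1 hv a b).differentiableAt (by simp)
    have hD : DifferentiableAt ℝ (fun p => (vert (φ.hessian (E i) ((E i).symm p))).det)
        (Fin.append (f y) v) := (contDiffAt_det fun a b =>
      φ.contDiffAt_hessian (h.adm i).1 hv _ _).differentiableAt (by simp)
    show dz _ _ _ = _
    rw [dz_mul ((hρ i i _ hv).differentiableAt (by simp)) hD,
      dz_det (F := fun p => vert (φ.hessian (E i) ((E i).symm p))) (fun a b => hH _ _),
      fibreChart_symm (h.adm i) hy y₁ hv, add_comm, mul_comm (dz _ _ _)]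
    congr 1
    · congr 1
      refine Finset.sum_congr rfl fun a _ => Finset.sum_congr rfl fun b _ => ?_
      rw [dz_hessian_fibre φ (h.adm i) hy y₁ hv, ← φ.dz_hessian (h.adm i).1 hv]
      rfl
  · have h1 : ContDiffAt ℝ ∞ (fun v => dz (Fin.castAdd n l) (fun p => (ρ j ((E i).symm p) : ℂ))
        (Fin.append (f y) v)) v :=
      (contDiffAt_dz (hρ i j _ hv) (Fin.castAdd n l)).comp v
        ((contDiff_append_right (f y)).restrict_scalars ℝ).contDiffAt
    exact h1.continuousAt.continuousWithinAt
  · -- the function `ρ_j ≥ 0` has a minimum at each of its zeros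
    have h0 : ρ j ((E i).symm (Fin.append (f y) v)) = 0 := by
      have := notMem_tsupport_eq_zero hvs
      rwa [fibreChart_symm (h.adm i) hy y₁ hv] at this
    have h1 : fderiv ℝ (fun p => ρ j ((E i).symm p)) (Fin.append (f y) v) = 0 := by
      refine IsLocalMin.fderiv_eq_zero (Filter.Eventually.of_forall fun p => ?_)
      show ρ j _ ≤ ρ j _
      rw [h0]
      exact h.nonneg _ _
    have h2 : HasFDerivAt (fun p => (ρ j ((E i).symm p) : ℂ)) (0 : Cn (m + n) →L[ℝ] ℂ)
        (Fin.append (f y) v) := by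
      have h3 := ((h.contDiffAt_weight i j hv).differentiableAt (by simp)).hasFDerivAt
      rw [h1] at h3
      have h4 := Complex.ofRealCLM.hasFDerivAt.comp _ h3
      rw [ContinuousLinearMap.comp_zero] at h4
      exact h4
    rw [dz_eq, h2.fderiv, map_zero]
  · rw [← dz_sum _ fun j _ => (hρ i j _ hv).differentiableAt (by simp)]
    have : (fun p => ∑ j, (ρ j ((E i).symm p) : ℂ)) = fun _ => 1 := by
      funext p
      rw [← Complex.ofReal_sum, h.sum_eq_one, Complex.ofReal_one]
    rw [this, dz_const]
  · simp only [Matrix.submatrix_apply]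
    rw [dz_hessian_fibre φ (h.adm i) hy y₁ hv, dz_hessian_fibre φ (h.adm i) hy y₁ hv,
      φ.dz_hessian (h.adm i).1 hv]
  · have h1 := (fibreChart (h.adm i) hy y₁).left_inv hx
    have h2 := (fibreChart (h.adm l) hy y₁).left_inv hx'
    simp only [h1, h2]
    exact vert_hessian_fibreChart φ (h.adm i) (h.adm l) hy y₁ hx hx'
  · have h1 := (fibreChart (h.adm i) hy y₁).left_inv hx
    have h2 := (fibreChart (h.adm i') hy y₁).left_inv hx'
    simp only [h1, h2]
    rw [jac_fibreChart_transition (h.adm i) (h.adm i') hy y₁ hx hx',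
      φ.hessian_transition (h.adm i).1 (h.adm i').1 hx hx']
    funext c
    simp [Matrix.mul_apply, Matrix.mulVec, dotProduct, Fin.sum_univ_add,
      jac_castAdd_natAdd (h.adm i) (h.adm i') hx hx',
      jac_castAdd_castAdd_same (h.adm i) (h.adm i') hx hx', mul_comm]
  · have hd := (contDiffAt_transition (h.adm i).1 (h.adm i').1 hx hx').differentiableAt (by simp)
    have hval : (E i' ∘ (E i).symm) (E i x.1) = E i' x.1 := by
      simp only [Function.comp_apply, (E i).left_inv hx]
    have hr : DifferentiableAt ℝ (fun p => (ρ j ((E i').symm p) : ℂ)) (E i' x.1) :=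
      (hρ i' j _ ((E i').map_source hx')).differentiableAt (by simp)
    have hev : (fun p => (ρ j ((E i).symm p) : ℂ)) =ᶠ[nhds (E i x.1)]
        fun p => (fun p => (ρ j ((E i').symm p) : ℂ)) ((E i' ∘ (E i).symm) p) := by
      filter_upwards [eventually_symm_mem hx hx'] with p hp
      simp only [Function.comp_apply, (E i').left_inv hp.2]
    have hfib : ∀ a, dz a (fun v => (ρ j ((fibreChart (h.adm i') hy y₁).symm v).1 : ℂ))
        (fibreChart (h.adm i') hy y₁ x) =
        dz (Fin.natAdd m a) (fun p => (ρ j ((E i').symm p) : ℂ)) (E i' x.1) := fun a => by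
      rw [dz_congr (fibreChart_symm_eventuallyEq (h.adm i') hy y₁ (fun x => (ρ j x : ℂ))
        ((fibreChart (h.adm i') hy y₁).map_source hx')), ← happ i' x hx']
      rw [← happ i' x hx'] at hr
      exact dz_append (u := fun p => (ρ j ((E i').symm p) : ℂ)) hr a
    simp only [hfib, happ i x hx, happ i' x hx']
    refine (dz_congr hev _).trans ((dz_comp (f := fun p => (ρ j ((E i').symm p) : ℂ)) hd
      (by rw [hval]; exact hr) _).trans ?_)
    rw [hval]
    simp [dotProduct, Fin.sum_univ_add, jac_castAdd_castAdd_same (h.adm i) (h.adm i') hx hx']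

end System

section System

variable {m n : ℕ} {X M : Type*} [TopologicalSpace X] [ChartedSpace (Cn (m + n)) X]
  [TopologicalSpace M] [ChartedSpace (Cn m) M] {π : X → M} {f : OpenPartialHomeomorph M (Cn m)}
  {ι : Type*} [Fintype ι] {E : ι → OpenPartialHomeomorph X (Cn (m + n))} {ρ : ι → X → ℝ}
  [IsManifold 𝓘(ℂ, Cn (m + n)) ω X]
  {L : X → Type*} [∀ x, AddCommGroup (L x)] [∀ x, Module ℂ (L x)]
  [∀ x, TopologicalSpace (L x)] [TopologicalSpace (Bundle.TotalSpace ℂ L)] [FiberBundle ℂ L]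
  [VectorBundle ℂ ℂ L]
  [ContMDiffVectorBundle ω ℂ L 𝓘(ℂ, Cn (m + n))] (φ : HermitianMetric (m + n) L)

/-- The fibre integral of the determinant of the curvature, as a function of the point of the base,
is differentiable and its derivatives `∂/∂z^l` are zero. It is written near `z₀` as the integral of
smooth compactly supported functions on `ℂ^(m+n)`, cut off by a bump function of the base. -/
theorem IsAdaptedSystem.exists_fibre_integral [CompactSpace X] [T2Space M] (hc : Continuous π)
    (hs : Function.Surjective π) (h : IsAdaptedSystem π f E ρ) {z₀ : Cn m} (hz₀ : z₀ ∈ f.target) :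
    ∃ (r : ℝ) (G : Cn m → ℂ), 0 < r ∧ Metric.ball z₀ r ⊆ f.target ∧
      ∀ z ∈ Metric.ball z₀ r, (∀ (hy : f.symm z ∈ f.source) (y₁ : Fibre π (f.symm z)),
        G z = ∑ i, ∫ v in (fibreChart (h.adm i) hy y₁).target, (fun x => (ρ i x : ℂ) *
          (vert (φ.hessian (E i) x)).det) ((fibreChart (h.adm i) hy y₁).symm v).1) ∧
        DifferentiableAt ℝ G z ∧ ∀ l, dz l G z = 0 := by
  obtain ⟨R, hR, hRt⟩ := Metric.nhds_basis_closedBall.mem_iff.1 (f.open_target.mem_nhds hz₀)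
  let χ : ContDiffBump z₀ := ⟨R / 2, R, by linarith, by linarith⟩
  have hχ1 : ∀ z ∈ Metric.ball z₀ (R / 2), χ z = 1 := fun z hz =>
    χ.one_of_mem_closedBall (Metric.ball_subset_closedBall hz)
  have hχ0 : ∀ z, z ∉ Metric.closedBall z₀ R → χ z = 0 := fun z hz =>
    χ.zero_of_le_dist (by simpa using (not_le.1 hz).le)
  let C : ι → Set X := fun i => tsupport (ρ i) ∩ π ⁻¹' (f.symm '' Metric.closedBall z₀ R)
  have hC : ∀ i, IsCompact (C i) := fun i => by
    have h1 : IsCompact (f.symm '' Metric.closedBall z₀ R) :=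
      (isCompact_closedBall z₀ R).image_of_continuousOn (f.continuousOn_symm.mono hRt)
    exact ((isClosed_tsupport _).inter (h1.isClosed.preimage hc)).isCompact
  have hCs : ∀ i, C i ⊆ (E i).source := fun i x hx => by
    obtain ⟨z, hz, hzx⟩ := hx.2
    exact h.support i x hx.1 (by rw [← hzx]; exact f.map_target (hRt hz))
  let u : ι → X → ℂ := fun i x => (χ (f (π x)) : ℂ) * ((ρ i x : ℂ) *
    (vert (φ.hessian (E i) x)).det)
  have hu0 : ∀ i, ∀ x ∈ (E i).source, x ∉ C i → u i x = 0 := fun i x hx hxC => by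
    by_cases h1 : x ∈ tsupport (ρ i)
    · have h2 : f (π x) ∉ Metric.closedBall z₀ R := fun h2 => hxC
        ⟨h1, f (π x), h2, f.left_inv ((h.adm i).mem_source hx)⟩
      simp only [u, hχ0 _ h2, Complex.ofReal_zero, zero_mul]
    · simp only [u, notMem_tsupport_eq_zero h1, Complex.ofReal_zero, zero_mul, mul_zero]
  have hI0 : ∀ i x, x ∉ C i → (E i).source.indicator (u i) x = 0 := fun i x hxC => by
    by_cases hx : x ∈ (E i).source
    · rw [Set.indicator_of_mem hx, hu0 i x hx hxC]
    · exact Set.indicator_of_notMem hx _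
  let Φ : ι → Cn (m + n) → ℂ := fun i => chartExt (E i) ((E i).source.indicator (u i))
  have hhor : ∀ i, ∀ p ∈ (E i).target, f (π ((E i).symm p)) = horPart p := fun i p hp => by
    rw [← (h.adm i).horPart_eq ((E i).map_target hp), (E i).right_inv hp]
  have hΦe : ∀ i, ∀ p ∈ (E i).target, Φ i =ᶠ[nhds p] fun p => (χ (horPart p) : ℂ) *
      ((ρ i ((E i).symm p) : ℂ) * (vert (φ.hessian (E i) ((E i).symm p))).det) := fun i p hp => by
    filter_upwards [chartExt_eventuallyEq (E i) ((E i).source.indicator (u i)) hp,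
      (E i).open_target.mem_nhds hp] with q hq hqt
    refine hq.trans ?_
    rw [Set.indicator_of_mem ((E i).map_target hqt)]
    simp only [u, hhor i q hqt]
  have hΦ1 : ∀ i, ∀ p ∈ (E i).target, horPart p ∈ Metric.ball z₀ (R / 2) →
      Φ i =ᶠ[nhds p] fun p => (ρ i ((E i).symm p) : ℂ) *
        (vert (φ.hessian (E i) ((E i).symm p))).det := fun i p hp hpb => by
    have hev : ∀ᶠ q in nhds p, horPart q ∈ Metric.ball z₀ (R / 2) :=
      (contDiff_horPart (r := 0)).continuous.continuousAt.eventually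
        (Metric.isOpen_ball.mem_nhds hpb)
    filter_upwards [hΦe i p hp, hev] with q hq hqb
    rw [hq, hχ1 _ hqb, Complex.ofReal_one, one_mul]
  have hΦs : ∀ i, ContDiff ℝ ∞ (Φ i) := fun i => by
    refine contDiff_chartExt (hC i) (hCs i) (hI0 i) fun p hp => ?_
    refine ContDiffAt.congr_of_eventuallyEq ?_ ((chartExt_eventuallyEq (E i) _ hp).symm.trans
      (hΦe i p hp))
    refine ContDiffAt.mul (contDiffAt_ofReal ?_) (ContDiffAt.mul
      (contDiffAt_ofReal (h.contDiffAt_weight i i hp))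
      (contDiffAt_det fun a b => φ.contDiffAt_hessian (h.adm i).1 hp _ _))
    exact (χ.contDiff.contDiffAt).comp p ((contDiff_horPart.restrict_scalars ℝ).contDiffAt)
  have hΦc : ∀ i, HasCompactSupport (Φ i) := fun i =>
    hasCompactSupport_chartExt (hC i) (hCs i) (hI0 i)
  have hΦz : ∀ i, ∀ p, p ∉ (E i).target → Φ i =ᶠ[nhds p] fun _ => 0 := fun i p hp =>
    chartExt_eventually_zero (hC i) (hCs i) (hI0 i) hp
  refine ⟨R / 2, fun z => ∑ i, ∫ v : Cn n, Φ i (Fin.append z v), by linarith,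
    (Metric.ball_subset_ball (by linarith)).trans (Metric.ball_subset_closedBall.trans hRt),
    fun z hz => ?_⟩
  have hzt : z ∈ f.target :=
    hRt (Metric.ball_subset_closedBall (Metric.ball_subset_ball (by linarith) hz))
  have hd : ∀ i, DifferentiableAt ℝ (fun z : Cn m => ∫ v : Cn n, Φ i (Fin.append z v)) z := fun i =>
    (dz_integral_append ((hΦs i).of_le (by simp)) (hΦc i) z).1
  have hfz : f (f.symm z) = z := f.right_inv hzt
  refine ⟨fun hy y₁ => Finset.sum_congr rfl fun i _ => ?_,
    DifferentiableAt.fun_sum fun i _ => hd i, fun l => ?_⟩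
  · have h0 : ∀ v, v ∉ (fibreChart (h.adm i) hy y₁).target → Φ i (Fin.append z v) = 0 :=
      fun v hv => (hΦz i _ fun h1 => hv (by
        show Fin.append (f (f.symm z)) v ∈ (E i).target
        rwa [hfz])).self_of_nhds
    rw [← setIntegral_eq_integral_of_forall_compl_eq_zero h0]
    refine setIntegral_congr_fun (fibreChart (h.adm i) hy y₁).open_target.measurableSet
      fun v hv => ?_
    have hv' : Fin.append z v ∈ (E i).target := by
      have : Fin.append (f (f.symm z)) v ∈ (E i).target := hv
      rwa [hfz] at this
    refine ((hΦ1 i _ hv' (by rwa [horPart_append])).self_of_nhds).trans ?_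
    simp only [fibreChart_symm (h.adm i) hy y₁ hv, hfz]
  · obtain ⟨x, hx⟩ := hs (f.symm z)
    have hy := f.map_target hzt
    have key := h.sum_integral_dz_eq_zero φ hc hy ⟨x, hx⟩ l
    rw [dz_sum _ fun i _ => hd i, ← key]
    refine Finset.sum_congr rfl fun i _ => ?_
    rw [(dz_integral_append ((hΦs i).of_le (by simp)) (hΦc i) z).2 l, hfz]
    have h0 : ∀ v, v ∉ (fibreChart (h.adm i) hy ⟨x, hx⟩).target →
        dz (Fin.castAdd n l) (Φ i) (Fin.append z v) = 0 :=
      fun v hv => (dz_congr (hΦz i _ fun h1 => hv (by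
        show Fin.append (f (f.symm z)) v ∈ (E i).target
        rwa [hfz])) _).trans (dz_const _ _ _)
    rw [← setIntegral_eq_integral_of_forall_compl_eq_zero h0]
    refine setIntegral_congr_fun (fibreChart (h.adm i) hy ⟨x, hx⟩).open_target.measurableSet
      fun v hv => ?_
    have hv' : Fin.append z v ∈ (E i).target := by
      have : Fin.append (f (f.symm z)) v ∈ (E i).target := hv
      rwa [hfz] at this
    exact dz_congr (hΦ1 i _ hv' (by rwa [horPart_append])) _

/-- The number `S₀(L)` does not depend on the fibre. -/
theorem SZero_const [IsManifold 𝓘(ℂ, Cn m) ω M] [CompactSpace X] [T2Space M] [ConnectedSpace M]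
    [hP : Nonempty (AdmissiblePartition m n π)]
    (hc : Continuous π) (hs : Function.Surjective π) (y y' : M) :
    SZero π φ y = SZero π φ y' := by
  suffices h : IsLocallyConstant (SZero π φ) from h.apply_eq_of_isPreconnected
    isPreconnected_univ (Set.mem_univ _) (Set.mem_univ _)
  rw [IsLocallyConstant.iff_eventually_eq]
  intro y₀
  have hf := IsManifold.chart_mem_maximalAtlas (I := 𝓘(ℂ, Cn m)) (n := ω) y₀
  have hy₀ := mem_chart_source (Cn m) y₀
  generalize chartAt (Cn m) y₀ = f at hf hy₀
  obtain ⟨r, G, hr, hrt, hG⟩ := (hP.some.isAdaptedSystem hf).exists_fibre_integral φ hc hs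
    (f.map_source hy₀)
  set c : ℝ := (2 * Real.pi)⁻¹ ^ n * (2 ^ n * n.factorial)
  have hc0 : (c : ℂ) ≠ 0 := Complex.ofReal_ne_zero.2 (by positivity)
  have hS : ∀ z ∈ Metric.ball (f y₀) r, (SZero π φ (f.symm z) : ℂ) = c * G z := fun z hz => by
    obtain ⟨x, hx⟩ := hs (f.symm z)
    have hy := f.map_target (hrt hz)
    rw [(hG z hz).1 hy ⟨x, hx⟩]
    exact SZero_eq φ hf hy ⟨x, hx⟩
  have hGr : ∀ z ∈ Metric.ball (f y₀) r, (starRingEnd ℂ) (G z) = G z := fun z hz => by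
    have h1 : G z = (c : ℂ)⁻¹ * (SZero π φ (f.symm z) : ℂ) := by
      rw [hS z hz, inv_mul_cancel_left₀ hc0]
    rw [h1, map_mul, map_inv₀, Complex.conj_ofReal, Complex.conj_ofReal]
  have hconst : ∀ z ∈ Metric.ball (f y₀) r, G z = G (f y₀) := fun z hz =>
    Metric.isOpen_ball.is_const_of_fderiv_eq_zero (𝕜 := ℝ)
      (convex_ball (f y₀) r).isPreconnected
      (fun z hz => (hG z hz).2.1.differentiableWithinAt)
      (fun z hz => fderiv_eq_zero_of_dz_eq_zero (hG z hz).2.1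
        (Filter.eventually_of_mem (Metric.isOpen_ball.mem_nhds hz) hGr) (hG z hz).2.2)
      hz (Metric.mem_ball_self hr)
  filter_upwards [f.open_source.mem_nhds hy₀,
    (f.continuousAt hy₀).eventually (Metric.ball_mem_nhds _ hr)] with y hy hyb
  have h1 := hS _ hyb
  have h2 := hS _ (Metric.mem_ball_self hr)
  rw [hconst _ hyb, ← h2, f.left_inv hy, f.left_inv hy₀] at h1
  exact_mod_cast h1

end System

/-! ### Independence of the metric of the integral of `S₂(L) ∧ [ω]^{m-2}` -/

section Fubini

theorem measurePreserving_append (m n : ℕ) :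
    MeasurePreserving (fun q : Cn m × Cn n => (Fin.append q.1 q.2 : Cn (m + n))) := by
  have h1 := volume_measurePreserving_sumPiEquivProdPi_symm (fun _ : Fin m ⊕ Fin n => ℂ)
  have h2 := volume_measurePreserving_piCongrLeft (fun _ : Fin (m + n) => ℂ)
    (finSumFinEquiv (m := m) (n := n))
  have h3 := h2.comp h1
  suffices h4 : (fun q : Cn m × Cn n => (Fin.append q.1 q.2 : Cn (m + n))) =
      (MeasurableEquiv.piCongrLeft (fun _ : Fin (m + n) => ℂ) (finSumFinEquiv (m := m) (n := n))) ∘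
        (MeasurableEquiv.sumPiEquivProdPi (fun _ : Fin m ⊕ Fin n => ℂ)).symm by
    rw [h4]
    exact h3
  funext q
  ext i
  simp only [Function.comp_apply, MeasurableEquiv.coe_piCongrLeft,
    MeasurableEquiv.coe_sumPiEquivProdPi_symm]
  refine Fin.addCases (fun i => ?_) (fun i => ?_) i
  · rw [Fin.append_left, ← finSumFinEquiv_apply_left, Equiv.piCongrLeft_apply_apply]
    rfl
  · rw [Fin.append_right, ← finSumFinEquiv_apply_right, Equiv.piCongrLeft_apply_apply]
    rfl

theorem integral_append {m n : ℕ} {Φ : Cn (m + n) → ℂ} (hΦ : Continuous Φ)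
    (hc : HasCompactSupport Φ) :
    ∫ p, Φ p = ∫ z : Cn m, ∫ v : Cn n, Φ (Fin.append z v) := by
  have h1 : MeasurableEmbedding (fun q : Cn m × Cn n => (Fin.append q.1 q.2 : Cn (m + n))) :=
    (appendL m n).toHomeomorph.measurableEmbedding
  rw [← (measurePreserving_append m n).integral_comp h1, Measure.volume_eq_prod,
    integral_prod]
  exact ((measurePreserving_append m n).integrable_comp_emb h1).2
    (hΦ.integrable_of_hasCompactSupport hc)

variable {Y ι : Type*} [TopologicalSpace Y] {k : ℕ} [Fintype ι]
  {e : ι → OpenPartialHomeomorph Y (Cn k)} {ρ : ι → Y → ℝ}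

theorem dz_add_const_mul {N : ℕ} {f g : Cn N → ℂ} {p : Cn N} (hf : DifferentiableAt ℝ f p)
    (hg : DifferentiableAt ℝ g p) (t : ℂ) (j : Fin N) :
    dz j (fun x => f x + t * g x) p = dz j f p + t * dz j g p := by
  rw [dz_add hf (hg.const_mul _), dz_const_mul hg]

theorem sum_integral_det_pencil (h : IsChartSystem e ρ)
    (A B : ι → Cn k → Matrix (Fin k) (Fin k) ℂ) (u : Y → ℝ)
    (hAs : ∀ i, ∀ p ∈ (e i).target, ∀ a c, ContDiffAt ℝ ∞ (fun x => A i x a c) p)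
    (hBs : ∀ i, ∀ p ∈ (e i).target, ∀ a c, ContDiffAt ℝ ∞ (fun x => B i x a c) p)
    (hAcl : ∀ i, ∀ p ∈ (e i).target, ∀ l a c,
      dz l (fun x => A i x a c) p = dz a (fun x => A i x l c) p)
    (hBcl : ∀ i, ∀ p ∈ (e i).target, ∀ l a c,
      dz l (fun x => B i x a c) p = dz a (fun x => B i x l c) p)
    (hAt : ∀ i l, ∀ y ∈ (e i).source, y ∈ (e l).source → A i (e i y) =
      (jac (e l ∘ (e i).symm) (e i y))ᵀ * A l (e l y) *
        (jac (e l ∘ (e i).symm) (e i y)).map (starRingEnd ℂ))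
    (hBt : ∀ i l, ∀ y ∈ (e i).source, y ∈ (e l).source → B i (e i y) =
      (jac (e l ∘ (e i).symm) (e i y))ᵀ * B l (e l y) *
        (jac (e l ∘ (e i).symm) (e i y)).map (starRingEnd ℂ))
    (hu : ∀ i, ∀ p ∈ (e i).target, ContDiffAt ℝ ∞ (fun p => u ((e i).symm p)) p) (t : ℂ) :
    ∑ i, ∫ p in (e i).target, (ρ i ((e i).symm p) : ℂ) *
        (A i p + complexHessian (fun p => u ((e i).symm p)) p + t • B i p).det =
      ∑ i, ∫ p in (e i).target, (ρ i ((e i).symm p) : ℂ) * (A i p + t • B i p).det := by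
  have hAd : ∀ i, ∀ p ∈ (e i).target, ∀ a c, DifferentiableAt ℝ (fun x => A i x a c) p :=
    fun i p hp a c => (hAs i p hp a c).differentiableAt (by simp)
  have hBd : ∀ i, ∀ p ∈ (e i).target, ∀ a c, DifferentiableAt ℝ (fun x => B i x a c) p :=
    fun i p hp a c => (hBs i p hp a c).differentiableAt (by simp)
  have key := sum_integral_det_add_complexHessian h (fun i p => A i p + t • B i p) u
    (fun i p hp a c => (hAs i p hp a c).add (contDiffAt_const.mul (hBs i p hp a c)))
    (fun i p hp l a c => ?_) (fun i l y hy hy' => ?_) hu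
  · rw [← key]
    simp only [add_right_comm]
  · exact (dz_add_const_mul (hAd i p hp a c) (hBd i p hp a c) t l).trans
      ((congrArg₂ (fun r s => r + t * s) (hAcl i p hp l a c) (hBcl i p hp l a c)).trans
        (dz_add_const_mul (hAd i p hp l c) (hBd i p hp l c) t a).symm)
  · show A i _ + _ • B i _ = _ * (A l _ + _ • B l _) * _
    rw [hAt i l y hy hy', hBt i l y hy hy', Matrix.mul_add, Matrix.add_mul,
      Matrix.mul_smul, Matrix.smul_mul]

/-- The integrals of the mixed products `A^{k-l} ∧ B^l` of closed `(1,1)`-forms do not change if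
`i∂∂̄u` is added to `A`. -/
theorem sum_integral_coeff_detPoly (h : IsChartSystem e ρ)
    (A B : ι → Cn k → Matrix (Fin k) (Fin k) ℂ) (u : Y → ℝ)
    (hAs : ∀ i, ∀ p ∈ (e i).target, ∀ a c, ContDiffAt ℝ ∞ (fun x => A i x a c) p)
    (hBs : ∀ i, ∀ p ∈ (e i).target, ∀ a c, ContDiffAt ℝ ∞ (fun x => B i x a c) p)
    (hAcl : ∀ i, ∀ p ∈ (e i).target, ∀ l a c,
      dz l (fun x => A i x a c) p = dz a (fun x => A i x l c) p)
    (hBcl : ∀ i, ∀ p ∈ (e i).target, ∀ l a c,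
      dz l (fun x => B i x a c) p = dz a (fun x => B i x l c) p)
    (hAt : ∀ i l, ∀ y ∈ (e i).source, y ∈ (e l).source → A i (e i y) =
      (jac (e l ∘ (e i).symm) (e i y))ᵀ * A l (e l y) *
        (jac (e l ∘ (e i).symm) (e i y)).map (starRingEnd ℂ))
    (hBt : ∀ i l, ∀ y ∈ (e i).source, y ∈ (e l).source → B i (e i y) =
      (jac (e l ∘ (e i).symm) (e i y))ᵀ * B l (e l y) *
        (jac (e l ∘ (e i).symm) (e i y)).map (starRingEnd ℂ))
    (hu : ∀ i, ∀ p ∈ (e i).target, ContDiffAt ℝ ∞ (fun p => u ((e i).symm p)) p) (d : ℕ) :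
    ∑ i, ∫ p in (e i).target, (ρ i ((e i).symm p) : ℂ) *
        (detPoly (A i p + complexHessian (fun p => u ((e i).symm p)) p) (B i p)).coeff d =
      ∑ i, ∫ p in (e i).target, (ρ i ((e i).symm p) : ℂ) * (detPoly (A i p) (B i p)).coeff d := by
  -- the generating polynomial of the integrals of the coefficients
  let P : (ι → Cn k → Matrix (Fin k) (Fin k) ℂ) → Polynomial ℂ := fun A =>
    ∑ d ∈ Finset.range (k + 1), Polynomial.C (∑ i, ∫ p in (e i).target,
      (ρ i ((e i).symm p) : ℂ) * (detPoly (A i p) (B i p)).coeff d) * Polynomial.X ^ d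
  have hev : ∀ A : ι → Cn k → Matrix (Fin k) (Fin k) ℂ,
      (∀ i a c, ContinuousOn (fun x => A i x a c) (e i).target) → ∀ t : ℂ, (P A).eval t =
        ∑ i, ∫ p in (e i).target, (ρ i ((e i).symm p) : ℂ) * (A i p + t • B i p).det := by
    intro A hA t
    simp only [P, Polynomial.eval_finsetSum, Polynomial.eval_mul, Polynomial.eval_C,
      Polynomial.eval_pow, Polynomial.eval_X, Finset.sum_mul]
    rw [Finset.sum_comm]
    refine Finset.sum_congr rfl fun i _ => ?_
    simp only [← integral_mul_const]
    rw [← integral_finsetSum]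
    · refine integral_congr_ae (Filter.Eventually.of_forall fun p => ?_)
      simp only [mul_assoc]
      rw [← Finset.mul_sum, ← eval_detPoly, Polynomial.eval_eq_sum_range'
        (Nat.lt_succ_of_le ((natDegree_detPoly_le _ _).trans (Fintype.card_fin k).le))]
    · intro d _
      refine Integrable.mul_const (h.integrableOn i ?_) _
      exact continuousOn_coeff_detPoly (hA i)
        (fun a c p hp => (hBs i p hp a c).continuousAt.continuousWithinAt) d
  have hcoeff : ∀ A : ι → Cn k → Matrix (Fin k) (Fin k) ℂ, d ≤ k → (P A).coeff d =
      ∑ i, ∫ p in (e i).target, (ρ i ((e i).symm p) : ℂ) *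
        (detPoly (A i p) (B i p)).coeff d := by
    intro A hd
    simp only [P, Polynomial.finsetSum_coeff, Polynomial.coeff_C_mul, Polynomial.coeff_X_pow]
    rw [Finset.sum_eq_single d]
    · simp
    · intro b _ hb
      rw [if_neg (Ne.symm hb), mul_zero]
    · intro h
      exact absurd (Finset.mem_range.2 (Nat.lt_succ_of_le hd)) h
  by_cases hd : d ≤ k
  · have h1 := hev A fun i a c p hp => (hAs i p hp a c).continuousAt.continuousWithinAt
    have h2 := hev (fun i p => A i p + complexHessian (fun p => u ((e i).symm p)) p)
      fun i a c p hp => ((hAs i p hp a c).continuousAt.add (g := fun x =>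
        complexHessian (fun p => u ((e i).symm p)) x a c)
        (contDiffAt_complexHessian (hu i p hp) a c).continuousAt).continuousWithinAt
    have h3 := hcoeff (fun i p => A i p + complexHessian (fun p => u ((e i).symm p)) p) hd
    have h4 := hcoeff A hd
    clear_value P
    have h5 : P (fun i p => A i p + complexHessian (fun p => u ((e i).symm p)) p) = P A := by
      refine Polynomial.funext fun t => ?_
      rw [h1, h2]
      exact sum_integral_det_pencil h A B u hAs hBs hAcl hBcl hAt hBt hu t
    rw [← h3, ← h4, h5]
  · have hz : ∀ A B : Matrix (Fin k) (Fin k) ℂ, (detPoly A B).coeff d = 0 := fun A B =>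
      Polynomial.coeff_eq_zero_of_natDegree_lt (lt_of_le_of_lt (natDegree_detPoly_le A B)
        (by rw [Fintype.card_fin]; omega))
    simp only [hz]

end Fubini

theorem pad_congruence {m n : ℕ} (J : Matrix (Fin (m + n)) (Fin (m + n)) ℂ)
    (K G : Matrix (Fin m) (Fin m) ℂ)
    (h1 : ∀ a b, J (Fin.castAdd n a) (Fin.castAdd n b) = K a b)
    (h2 : ∀ a b, J (Fin.castAdd n a) (Fin.natAdd m b) = 0) :
    pad n (Kᵀ * G * K.map (starRingEnd ℂ)) = Jᵀ * pad n G * J.map (starRingEnd ℂ) := by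
  ext i j
  refine Fin.addCases (fun i => ?_) (fun i => ?_) i <;>
    refine Fin.addCases (fun j => ?_) (fun j => ?_) j <;>
    simp [Matrix.mul_apply, Fin.sum_univ_add, h1, h2]

theorem hasFDerivAt_horPart {m n : ℕ} (p : Cn (m + n)) : ∃ A : Cn (m + n) →L[ℝ] Cn m,
    HasFDerivAt (horPart : Cn (m + n) → Cn m) A p ∧ ∀ w, A w = horPart w := by
  let A : Cn (m + n) →L[ℝ] Cn m := (ContinuousLinearMap.fst ℝ (Cn m) (Cn n)).comp
    ((appendL m n).symm.toContinuousLinearMap.restrictScalars ℝ)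
  exact ⟨A, A.hasFDerivAt, fun _ => rfl⟩

theorem horPart_single_castAdd {m n : ℕ} (a : Fin m) (c : ℂ) :
    horPart (Pi.single (Fin.castAdd n a) c : Cn (m + n)) = Pi.single a c := by
  rw [← append_single_zero, horPart_append]

theorem horPart_single_natAdd {m n : ℕ} (a : Fin n) (c : ℂ) :
    horPart (Pi.single (Fin.natAdd m a) c : Cn (m + n)) = 0 := by
  rw [← append_zero_single, horPart_append]

theorem dz_comp_horPart {m n : ℕ} {u : Cn m → ℂ} {p : Cn (m + n)}
    (hu : DifferentiableAt ℝ u (horPart p)) :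
    (∀ a, dz (Fin.castAdd n a) (fun p => u (horPart p)) p = dz a u (horPart p)) ∧
      ∀ a, dz (Fin.natAdd m a) (fun p : Cn (m + n) => u (horPart p)) p = 0 := by
  obtain ⟨A, hA, hA'⟩ := hasFDerivAt_horPart p
  have h : HasFDerivAt (fun p => u (horPart p)) _ p := hu.hasFDerivAt.comp p hA
  constructor <;> intro a <;> rw [dz, h.fderiv] <;>
    simp only [ContinuousLinearMap.comp_apply, hA', horPart_single_castAdd,
      horPart_single_natAdd, map_zero, mul_zero, sub_zero, zero_div]
  rfl

section Total

variable {m n : ℕ} {X M : Type*} [TopologicalSpace X] [ChartedSpace (Cn (m + n)) X]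
  [TopologicalSpace M] [ChartedSpace (Cn m) M] {π : X → M}

/-- The admissible charts obtained from charts of the base and admissible charts. -/
def totalChart (Q : ChartPartition m M) (P : AdmissiblePartition m n π)
    (s : Fin Q.size × Fin P.size) : OpenPartialHomeomorph X (Cn (m + n)) :=
  withBase (P.chart s.2) (P.base s.2) (Q.chart s.1)

/-- The partition of unity subordinate to the charts `totalChart`. -/
def totalWeight (Q : ChartPartition m M) (P : AdmissiblePartition m n π)
    (s : Fin Q.size × Fin P.size) (x : X) : ℝ :=
  Q.ρ s.1 (π x) * P.ρ s.2 x

variable (Q : ChartPartition m M) (P : AdmissiblePartition m n π)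

theorem isAdmissible_totalChart (s : Fin Q.size × Fin P.size) :
    IsAdmissible m n π (totalChart Q P s) (Q.chart s.1) :=
  isAdmissible_withBase (P.admissible s.2) (Q.chart_mem s.1)

theorem mem_totalChart_source {s : Fin Q.size × Fin P.size} {x : X}
    (hx : x ∈ tsupport (P.ρ s.2) ∩ π ⁻¹' tsupport (Q.ρ s.1)) : x ∈ (totalChart Q P s).source :=
  (mem_withBase_source (P.admissible s.2)).2
    ⟨P.tsupport_subset s.2 hx.1, Q.tsupport_subset s.1 hx.2⟩

theorem totalWeight_eq_zero {s : Fin Q.size × Fin P.size} {x : X}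
    (hx : x ∉ tsupport (P.ρ s.2) ∩ π ⁻¹' tsupport (Q.ρ s.1)) : totalWeight Q P s x = 0 := by
  by_cases h : x ∈ tsupport (P.ρ s.2)
  · have h1 : π x ∉ tsupport (Q.ρ s.1) := fun h1 => hx ⟨h, h1⟩
    rw [totalWeight, notMem_tsupport_eq_zero h1, zero_mul]
  · rw [totalWeight, notMem_tsupport_eq_zero h, mul_zero]

theorem contDiffAt_comp_proj {E : OpenPartialHomeomorph X (Cn (m + n))}
    {f : OpenPartialHomeomorph M (Cn m)} (hE : IsAdmissible m n π E f) {F : Type*}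
    [NormedAddCommGroup F] [NormedSpace ℝ F] {u : M → F}
    {p : Cn (m + n)} (hp : p ∈ E.target)
    (hu : ContDiffAt ℝ ∞ (fun z => u (f.symm z)) (horPart p)) :
    ContDiffAt ℝ ∞ (fun p => u (π (E.symm p))) p := by
  have h1 : ContDiffAt ℝ ∞ (fun p : Cn (m + n) => u (f.symm (horPart p))) p :=
    ContDiffAt.comp (g := fun z => u (f.symm z)) p hu
      (contDiff_horPart.restrict_scalars ℝ).contDiffAt
  refine h1.congr_of_eventuallyEq ?_
  filter_upwards [E.open_target.mem_nhds hp] with q hq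
  rw [hE.map_symm hq]

theorem IsAdmissible.horPart_mem {E : OpenPartialHomeomorph X (Cn (m + n))}
    {f : OpenPartialHomeomorph M (Cn m)} (hE : IsAdmissible m n π E f)
    {p : Cn (m + n)} (hp : p ∈ E.target) : horPart p ∈ f.target := by
  have h1 := hE.horPart_eq (E.map_target hp)
  rw [E.right_inv hp] at h1
  rw [h1]
  exact f.map_source (hE.mem_source (E.map_target hp))

variable [IsManifold 𝓘(ℂ, Cn (m + n)) ω X] [IsManifold 𝓘(ℂ, Cn m) ω M]

theorem isChartSystem_total [CompactSpace X] (hc : Continuous π) :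
    IsChartSystem (totalChart Q P) (totalWeight Q P) where
  hol s t x hx hx' := contDiffAt_transition (isAdmissible_totalChart Q P s).1
    (isAdmissible_totalChart Q P t).1 hx hx'
  smooth s t p hp := by
    have hE := isAdmissible_totalChart Q P s
    refine ContDiffAt.mul (contDiffAt_comp_proj hE hp ?_) ?_
    · have h1 := contDiffAt_comp_symm ((Q.smooth t.1).contMDiffAt) (Q.chart_mem s.1)
        ((Q.chart s.1).map_target (hE.horPart_mem hp))
      rwa [(Q.chart s.1).right_inv (hE.horPart_mem hp)] at h1
    · have h1 := contDiffAt_comp_symm ((P.smooth t.2).contMDiffAt) hE.1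
        ((totalChart Q P s).map_target hp)
      rwa [(totalChart Q P s).right_inv hp] at h1
  sum_eq_one x := by
    simp only [totalWeight, Fintype.sum_prod_type, ← Finset.mul_sum, P.sum_eq_one, mul_one,
      Q.sum_eq_one]
  compact s := (isClosed_tsupport _).isCompact
  subset s := by
    refine (closure_minimal (fun x hx => ?_) ?_ : _ ⊆ tsupport (P.ρ s.2) ∩ π ⁻¹' tsupport (Q.ρ s.1)).trans
      fun x hx => mem_totalChart_source Q P hx
    · by_contra h
      exact hx (totalWeight_eq_zero Q P h)
    · exact (isClosed_tsupport _).inter ((isClosed_tsupport _).preimage hc)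

variable {L : X → Type*} [∀ x, AddCommGroup (L x)] [∀ x, Module ℂ (L x)]
  [∀ x, TopologicalSpace (L x)] [TopologicalSpace (Bundle.TotalSpace ℂ L)] [FiberBundle ℂ L]
  [VectorBundle ℂ ℂ L] [ContMDiffVectorBundle ω ℂ L 𝓘(ℂ, Cn (m + n))]
  (φ ψ : HermitianMetric (m + n) L) (g : KaehlerMetric m M)

/-- The integrals of the mixed products of the curvature of `L` and the Kähler form of the base do
not depend on the metric of `L`. -/
theorem sum_integral_coeff_total [CompactSpace X] (hc : Continuous π) (d : ℕ) :
    ∑ s, ∫ p in (totalChart Q P s).target,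
        (totalWeight Q P s ((totalChart Q P s).symm p) : ℂ) *
        (detPoly (ψ.hessian (totalChart Q P s) ((totalChart Q P s).symm p))
          (pad n (g.matrix (Q.chart s.1) (π ((totalChart Q P s).symm p))))).coeff d =
      ∑ s, ∫ p in (totalChart Q P s).target,
        (totalWeight Q P s ((totalChart Q P s).symm p) : ℂ) *
        (detPoly (φ.hessian (totalChart Q P s) ((totalChart Q P s).symm p))
          (pad n (g.matrix (Q.chart s.1) (π ((totalChart Q P s).symm p))))).coeff d := by
  have hE := isAdmissible_totalChart Q P
  have key := sum_integral_coeff_detPoly (isChartSystem_total Q P hc)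
    (fun s p => φ.hessian (totalChart Q P s) ((totalChart Q P s).symm p))
    (fun s p => pad n (g.matrix (Q.chart s.1) (π ((totalChart Q P s).symm p))))
    (HermitianMetric.weightDiff φ ψ)
    (fun s p hp a c => φ.contDiffAt_hessian (hE s).1 hp a c)
    (fun s p hp a c => ?_)
    (fun s p hp l a c => φ.dz_hessian (hE s).1 hp l a c)
    (fun s p hp l a c => ?_)
    (fun s t x hx hx' => ?_) (fun s t x hx hx' => ?_)
    (fun s p hp => φ.contDiffAt_weightDiff ψ (hE s).1 hp) d
  · rw [← key]
    refine Finset.sum_congr rfl fun s _ =>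
      setIntegral_congr_fun (totalChart Q P s).open_target.measurableSet fun p hp => ?_
    have h1 := φ.hessian_sub ψ (hE s).1 ((totalChart Q P s).map_target hp)
    rw [(totalChart Q P s).right_inv hp] at h1
    simp only [← h1, add_sub_cancel]
  · refine Fin.addCases (fun a => ?_) (fun a => ?_) a
    · refine Fin.addCases (fun c => ?_) (fun c => ?_) c
      · simp only [pad_castAdd_castAdd]
        exact contDiffAt_comp_proj (u := fun y => g.matrix (Q.chart s.1) y a c) (hE s) hp
          (g.contDiffAt_matrix (Q.chart_mem s.1) ((hE s).horPart_mem hp) a c)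
      · simp only [pad_natAdd_right]
        exact contDiffAt_const
    · simp only [pad_natAdd_left]
      exact contDiffAt_const
  · have hev : ∀ a c, (fun p => g.matrix (Q.chart s.1) (π ((totalChart Q P s).symm p)) a c) =ᶠ[nhds p]
        fun p => g.matrix (Q.chart s.1) ((Q.chart s.1).symm (horPart p)) a c := fun a c => by
      filter_upwards [(totalChart Q P s).open_target.mem_nhds hp] with q hq
      rw [(hE s).map_symm hq]
    have hd : ∀ a c, DifferentiableAt ℝ
        (fun z => g.matrix (Q.chart s.1) ((Q.chart s.1).symm z) a c) (horPart p) := fun a c =>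
      (g.contDiffAt_matrix (Q.chart_mem s.1) ((hE s).horPart_mem hp) a c).differentiableAt (by simp)
    refine Fin.addCases (fun c => ?_) (fun c => ?_) c
    · refine Fin.addCases (fun a => ?_) (fun a => ?_) a <;>
        refine Fin.addCases (fun l => ?_) (fun l => ?_) l <;>
        simp only [pad_castAdd_castAdd, pad_natAdd_left, dz_const]
      · rw [dz_congr (hev a c), dz_congr (hev l c), (dz_comp_horPart (hd a c)).1,
          (dz_comp_horPart (hd l c)).1]
        exact g.dz_matrix (Q.chart_mem s.1) ((hE s).horPart_mem hp) l a c
      · rw [dz_congr (hev a c), (dz_comp_horPart (hd a c)).2]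
      · rw [dz_congr (hev l c), (dz_comp_horPart (hd l c)).2]
    · simp only [pad_natAdd_right, dz_const]
  · simp only [(totalChart Q P s).left_inv hx, (totalChart Q P t).left_inv hx']
    exact φ.hessian_transition (hE s).1 (hE t).1 hx hx'
  · simp only [(totalChart Q P s).left_inv hx, (totalChart Q P t).left_inv hx']
    rw [g.matrix_transition (Q.chart_mem s.1) (Q.chart_mem t.1) ((hE s).mem_source hx)
      ((hE t).mem_source hx')]
    exact pad_congruence _ _ _ (fun a b => jac_castAdd_castAdd (hE s) (hE t) hx hx' a b)
      (fun a b => jac_castAdd_natAdd (hE s) (hE t) hx hx' a b)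

end Total

theorem topIntegral_eq {m : ℕ} {M : Type*} [TopologicalSpace M] [ChartedSpace (Cn m) M]
    [IsManifold 𝓘(ℂ, Cn m) ω M] [hQ : Nonempty (ChartPartition m M)] {d : ℕ} (η : Form m M d) :
    topIntegral m η = ∑ i, ∫ p in (hQ.some.chart i).target,
      (fun y => hQ.some.ρ i y * η y (fun j => (jac (chartAt (Cn m) y ∘ (hQ.some.chart i).symm)
        (hQ.some.chart i y) *ᵥ frame m j : Cn m))) ((hQ.some.chart i).symm p) := by
  unfold topIntegral
  rw [dif_pos hQ]
  generalize hQ.some = Q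
  refine Finset.sum_congr rfl fun i _ =>
    setIntegral_congr_fun (Q.chart i).open_target.measurableSet fun p hp => ?_
  let η' : M → (Fin d → Cn m) → ℝ := η
  have hx := (Q.chart i).map_target hp
  show _ * η' ((Q.chart i).symm p) _ = _ * η' ((Q.chart i).symm p) _
  refine congrArg (fun w => Q.ρ i ((Q.chart i).symm p) * η' ((Q.chart i).symm p) w)
    (funext fun j => ?_)
  have h := mfderiv_symm_apply (Q.chart_mem i) hx (frame m j)
  rw [(Q.chart i).right_inv hp] at h ⊢
  exact h

theorem integrable_integral_append {m n : ℕ} {Φ : Cn (m + n) → ℂ} (hΦ : Continuous Φ)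
    (hc : HasCompactSupport Φ) : Integrable fun z : Cn m => ∫ v : Cn n, Φ (Fin.append z v) :=
  (((measurePreserving_append m n).integrable_comp_emb
    (appendL m n).toHomeomorph.measurableEmbedding).2
      (hΦ.integrable_of_hasCompactSupport hc)).integral_prod_left

section Total

variable {m n : ℕ} {X M : Type*} [TopologicalSpace X] [ChartedSpace (Cn (m + n)) X]
  [TopologicalSpace M] [ChartedSpace (Cn m) M] {π : X → M}

section Slice

variable {E : OpenPartialHomeomorph X (Cn (m + n))} {f : OpenPartialHomeomorph M (Cn m)}
  {K : Set X} {u : X → ℂ}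

theorem integrable_slice (hK : IsCompact K) (hKs : K ⊆ E.source) (hu0 : ∀ x, x ∉ K → u x = 0)
    (hu : ContinuousOn u E.source) :
    Integrable (fun z : Cn m => ∫ v : Cn n, chartExt E u (Fin.append z v)) :=
  integrable_integral_append (continuous_chartExt hK hKs hu0 hu)
    (hasCompactSupport_chartExt hK hKs hu0)

/-- Integration over a chart of the total space as an iterated integral over the base and the
fibres. -/
theorem setIntegral_slice (hE : IsAdmissible m n π E f) (hK : IsCompact K) (hKs : K ⊆ E.source)
    (hu0 : ∀ x, x ∉ K → u x = 0) (hu : ContinuousOn u E.source) :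
    ∫ z in f.target, ∫ v : Cn n, chartExt E u (Fin.append z v) =
      ∫ p in E.target, u (E.symm p) := by
  rw [setIntegral_target_eq, integral_append (continuous_chartExt hK hKs hu0 hu)
    (hasCompactSupport_chartExt hK hKs hu0)]
  refine setIntegral_eq_integral_of_forall_compl_eq_zero fun z hz => ?_
  refine integral_eq_zero_of_ae (Filter.Eventually.of_forall fun v => ?_)
  exact (chartExt_eventually_zero hK hKs hu0 fun hp => hz (by
    simpa using hE.horPart_mem hp)).self_of_nhds

/-- The integral over a slice of a chart is the integral over the chart of the fibre. -/
theorem slice_eq (hE : IsAdmissible m n π E f) (hK : IsCompact K) (hKs : K ⊆ E.source)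
    (hu0 : ∀ x, x ∉ K → u x = 0) {z : Cn m} (hz : z ∈ f.target) (y₁ : Fibre π (f.symm z)) :
    ∫ v : Cn n, chartExt E u (Fin.append z v) =
      ∫ v in (fibreChart hE (f.map_target hz) y₁).target,
        u ((fibreChart hE (f.map_target hz) y₁).symm v).1 := by
  have hfz := f.right_inv hz
  have h1 : ∀ v, v ∉ (fibreChart hE (f.map_target hz) y₁).target →
      chartExt E u (Fin.append z v) = 0 := fun v hv =>
    (chartExt_eventually_zero hK hKs hu0 fun hp => hv (by
      show Fin.append (f (f.symm z)) v ∈ E.target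
      rwa [hfz])).self_of_nhds
  rw [← setIntegral_eq_integral_of_forall_compl_eq_zero h1]
  refine setIntegral_congr_fun
    (fibreChart hE (f.map_target hz) y₁).open_target.measurableSet fun v hv => ?_
  have hv' : Fin.append z v ∈ E.target := by
    have : Fin.append (f (f.symm z)) v ∈ E.target := hv
    rwa [hfz] at this
  refine ((chartExt_eventuallyEq E u hv').self_of_nhds).trans ?_
  simp only [fibreChart_symm hE (f.map_target hz) y₁ hv, hfz]

end Slice

variable [IsManifold 𝓘(ℂ, Cn (m + n)) ω X] [IsManifold 𝓘(ℂ, Cn m) ω M]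
variable {L : X → Type*} [∀ x, AddCommGroup (L x)] [∀ x, Module ℂ (L x)]
  [∀ x, TopologicalSpace (L x)] [TopologicalSpace (Bundle.TotalSpace ℂ L)] [FiberBundle ℂ L]
  [VectorBundle ℂ ℂ L] [ContMDiffVectorBundle ω ℂ L 𝓘(ℂ, Cn (m + n))]
  (φ ψ : HermitianMetric (m + n) L) (g : KaehlerMetric m M)

theorem continuousOn_matrix {f : OpenPartialHomeomorph M (Cn m)}
    (hf : f ∈ IsManifold.maximalAtlas 𝓘(ℂ, Cn m) ω M) (a b : Fin m) :
    ContinuousOn (fun y => g.matrix f y a b) f.source := by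
  intro y hy
  have h1 := (g.contDiffAt_matrix hf (f.map_source hy) a b).continuousAt
  have h2 : ContinuousAt (fun y => g.matrix f (f.symm (f y)) a b) y :=
    ContinuousAt.comp (g := fun p => g.matrix f (f.symm p) a b) h1 (f.continuousAt hy)
  refine (h2.congr ?_).continuousWithinAt
  filter_upwards [f.open_source.mem_nhds hy] with y' hy'
  rw [f.left_inv hy']

theorem continuousOn_pad_matrix (hc : Continuous π) {E : OpenPartialHomeomorph X (Cn (m + n))}
    {f : OpenPartialHomeomorph M (Cn m)} (hE : IsAdmissible m n π E f) (a b : Fin (m + n)) :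
    ContinuousOn (fun x => pad n (g.matrix f (π x)) a b) E.source := by
  refine Fin.addCases (fun a => ?_) (fun a => ?_) a
  · refine Fin.addCases (fun b => ?_) (fun b => ?_) b
    · simp only [pad_castAdd_castAdd]
      exact (continuousOn_matrix g hE.2.1 a b).comp hc.continuousOn fun x hx => hE.mem_source hx
    · simp only [pad_natAdd_right]
      exact continuousOn_const
  · simp only [pad_natAdd_left]
    exact continuousOn_const

/-- The contribution of a chart of the base to the integral of `S₂(L, φ) ∧ ω^{m-2}`. -/
theorem setIntegral_STwoWedge [CompactSpace X] [T2Space M] (hm : 2 ≤ m) (hc : Continuous π)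
    (hs : Function.Surjective π) (Q : ChartPartition m M) (a : Fin Q.size)
    [hP : Nonempty (AdmissiblePartition m n π)] :
    IntegrableOn (fun p => (fun y => Q.ρ a y * STwoWedge π g φ y
      (fun j => (jac (chartAt (Cn m) y ∘ (Q.chart a).symm) (Q.chart a y) *ᵥ frame m j : Cn m)))
        ((Q.chart a).symm p)) (Q.chart a).target ∧
    ((∫ p in (Q.chart a).target, (fun y => Q.ρ a y * STwoWedge π g φ y
      (fun j => (jac (chartAt (Cn m) y ∘ (Q.chart a).symm) (Q.chart a y) *ᵥ frame m j : Cn m)))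
        ((Q.chart a).symm p) : ℝ) : ℂ) =
      (((2 * Real.pi)⁻¹ ^ (n + 2) * (2 ^ (m + n) * ((n + 2).factorial * (m - 2).factorial)) : ℝ)
        : ℂ) *
      ∑ i, ∫ p in (totalChart Q hP.some (a, i)).target,
        (totalWeight Q hP.some (a, i) ((totalChart Q hP.some (a, i)).symm p) : ℂ) *
        (detPoly (φ.hessian (totalChart Q hP.some (a, i))
            ((totalChart Q hP.some (a, i)).symm p))
          (pad n (g.matrix (Q.chart a)
            (π ((totalChart Q hP.some (a, i)).symm p))))).coeff (m - 2) := by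
  have hST := fun (y : M) (hy : y ∈ (Q.chart a).source) (y₁ : Fibre π y) =>
    STwoWedge_eq φ g hm hc (Q.chart_mem a) hy y₁
  generalize hP.some = P at hST
  generalize (((2 * Real.pi)⁻¹ ^ (n + 2) * (2 ^ (m + n) *
    ((n + 2).factorial * (m - 2).factorial)) : ℝ) : ℂ) = c at hST
  have hE := isAdmissible_totalChart Q P
  let u : Fin P.size → X → ℂ := fun i x => (totalWeight Q P (a, i) x : ℂ) *
    (detPoly (φ.hessian (totalChart Q P (a, i)) x)
      (pad n (g.matrix (Q.chart a) (π x)))).coeff (m - 2)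
  have hu : ∀ i, ContinuousOn (u i) (totalChart Q P (a, i)).source := fun i =>
    (Complex.continuous_ofReal.comp_continuousOn
      ((isChartSystem_total Q P hc).continuousOn (a, i) (a, i))).mul
      (continuousOn_coeff_detPoly (fun b c => continuousOn_hessian φ (hE (a, i)).1 b c)
        (fun b c => continuousOn_pad_matrix g hc (hE (a, i)) b c) _)
  have hK : ∀ i, IsCompact (tsupport (P.ρ i) ∩ π ⁻¹' tsupport (Q.ρ a)) := fun i =>
    ((isClosed_tsupport _).inter ((isClosed_tsupport _).preimage hc)).isCompact
  have hKs : ∀ i, tsupport (P.ρ i) ∩ π ⁻¹' tsupport (Q.ρ a) ⊆ (totalChart Q P (a, i)).source :=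
    fun i x hx => mem_totalChart_source Q P (s := (a, i)) hx
  have hu0 : ∀ i x, x ∉ tsupport (P.ρ i) ∩ π ⁻¹' tsupport (Q.ρ a) → u i x = 0 := fun i x hx => by
    simp only [u, totalWeight_eq_zero Q P (s := (a, i)) hx, Complex.ofReal_zero, zero_mul]
  have key : ∀ z ∈ (Q.chart a).target, (((fun y => Q.ρ a y * STwoWedge π g φ y
      (fun j => (jac (chartAt (Cn m) y ∘ (Q.chart a).symm) (Q.chart a y) *ᵥ frame m j : Cn m)))
        ((Q.chart a).symm z) : ℝ) : ℂ) =
      c * ∑ i, ∫ v : Cn n, chartExt (totalChart Q P (a, i)) (u i) (Fin.append z v) := by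
    intro z hz
    obtain ⟨x, hx⟩ := hs ((Q.chart a).symm z)
    have hy := (Q.chart a).map_target hz
    simp only [Complex.ofReal_mul]
    refine (congrArg (fun r => (Q.ρ a ((Q.chart a).symm z) : ℂ) * r)
      (hST _ hy ⟨x, hx⟩)).trans ?_
    rw [mul_left_comm, Finset.mul_sum]
    refine congrArg (fun r => c * r) (Finset.sum_congr rfl fun i _ => ?_)
    rw [slice_eq (hE (a, i)) (hK i) (hKs i) (hu0 i) hz ⟨x, hx⟩, ← integral_const_mul]
    refine setIntegral_congr_fun
      (fibreChart (hE (a, i)) hy ⟨x, hx⟩).open_target.measurableSet fun v hv => ?_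
    have hπv : π ((fibreChart (hE (a, i)) hy ⟨x, hx⟩).symm v).1 = (Q.chart a).symm z :=
      ((fibreChart (hE (a, i)) hy ⟨x, hx⟩).symm v).2
    simp only [u, totalWeight, hπv, Complex.ofReal_mul, mul_assoc]
    rfl
  have hint : IntegrableOn (fun z => c * ∑ i, ∫ v : Cn n,
      chartExt (totalChart Q P (a, i)) (u i) (Fin.append z v)) (Q.chart a).target :=
    ((integrable_finsetSum _ fun i _ =>
      integrable_slice (hK i) (hKs i) (hu0 i) (hu i)).const_mul c).integrableOn
  constructor
  · refine IntegrableOn.congr_fun hint.re (fun z hz => ?_) (Q.chart a).open_target.measurableSet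
    exact (congrArg RCLike.re (key z hz).symm).trans (Complex.ofReal_re _)
  · rw [← integral_complex_ofReal,
      setIntegral_congr_fun (Q.chart a).open_target.measurableSet key, integral_const_mul,
      integral_finsetSum _ fun i _ =>
        (integrable_slice (hK i) (hKs i) (hu0 i) (hu i)).integrableOn]
    exact congrArg (fun r => c * r) (Finset.sum_congr rfl fun i _ =>
      setIntegral_slice (hE (a, i)) (hK i) (hKs i) (hu0 i) (hu i))

/-- The number `∫_M S₂(L) ∧ [ω]^{m-2}` does not depend on the metric of `L`. -/
theorem topIntegral_STwoWedge_eq [CompactSpace X] [T2Space M] (hm : 2 ≤ m) (hc : Continuous π)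
    (hs : Function.Surjective π) [hP : Nonempty (AdmissiblePartition m n π)] :
    topIntegral m (STwoWedge π g ψ) = topIntegral m (STwoWedge π g φ) := by
  by_cases hQ : Nonempty (ChartPartition m M)
  · have h := fun (φ : HermitianMetric (m + n) L) => (fun a => (setIntegral_STwoWedge φ g hm hc hs hQ.some a).2)
    rw [topIntegral_eq, topIntegral_eq, ← Complex.ofReal_inj, Complex.ofReal_sum,
      Complex.ofReal_sum, Finset.sum_congr rfl fun a _ => h ψ a,
      Finset.sum_congr rfl fun a _ => h φ a, ← Finset.mul_sum, ← Finset.mul_sum]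
    have key := sum_integral_coeff_total hQ.some hP.some φ ψ g hc (m - 2)
    rw [Fintype.sum_prod_type, Fintype.sum_prod_type] at key
    exact congrArg _ key
  · rw [topIntegral, topIntegral, dif_neg hQ, dif_neg hQ]

end Total

/-! ### The pointwise inequality -/

section Inequality

open scoped ComplexOrder

theorem formOfMatrix_apply_I_smul {N : ℕ} {H : Matrix (Fin N) (Fin N) ℂ} (hH : H.IsHermitian)
    (v : Cn N) : (formOfMatrix H ![v, Complex.I • v] : ℂ) = 2 * (v ⬝ᵥ (H *ᵥ star v)) := by
  rw [formOfMatrix_eq_sesq hH, sesq_eq, sesq_eq]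
  simp only [Matrix.cons_val_zero, Matrix.cons_val_one, star_smul, Matrix.mulVec_smul,
    dotProduct_smul, smul_dotProduct, smul_eq_mul, RCLike.star_def, Complex.conj_I]
  linear_combination (-2 * (v ⬝ᵥ (H *ᵥ star v))) * Complex.I_mul_I

theorem detPoly_congruence {N : ℕ} (J H G : Matrix (Fin N) (Fin N) ℂ) :
    detPoly (Jᵀ * H * J.map (starRingEnd ℂ)) (Jᵀ * G * J.map (starRingEnd ℂ)) =
      Polynomial.C (J.det * (starRingEnd ℂ) J.det) * detPoly H G := by
  refine Polynomial.funext fun t => ?_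
  have h1 : (J.map (starRingEnd ℂ)).det = (starRingEnd ℂ) J.det :=
    ((starRingEnd ℂ).map_det J).symm
  rw [Polynomial.eval_mul, Polynomial.eval_C, eval_detPoly, eval_detPoly, ← Matrix.smul_mul,
    ← Matrix.mul_smul, ← Matrix.add_mul, ← Matrix.mul_add, Matrix.det_mul, Matrix.det_mul,
    Matrix.det_transpose, h1]
  ring

/-- The leading coefficient, which comes from `ω^m`. -/
theorem coeff_detPoly_card {N : ℕ} (H G : Matrix (Fin N) (Fin N) ℂ) :
    (detPoly H G).coeff N = G.det := by
  have h := Polynomial.coeff_det_X_add_C_card G H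
  rw [Fintype.card_fin] at h
  rw [detPoly, add_comm]
  exact h

/-- A nonnegative continuous function with zero integral over an open set is zero there. -/
theorem eq_zero_of_setIntegral_eq_zero {n : ℕ} {U : Set (Cn n)} (hU : IsOpen U) {F : Cn n → ℝ}
    (hF : ContinuousOn F U) (hF0 : ∀ v ∈ U, 0 ≤ F v) (hFi : IntegrableOn F U)
    (h : ∫ v in U, F v = 0) : ∀ v ∈ U, F v = 0 := by
  rw [setIntegral_eq_zero_iff_of_nonneg_ae
    ((ae_restrict_iff' hU.measurableSet).2 (Filter.Eventually.of_forall hF0)) hFi] at h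
  exact Measure.eqOn_open_of_ae_eq h hU hF continuousOn_const

section Pointwise

variable {m n : ℕ} {X M : Type*} [TopologicalSpace X] [ChartedSpace (Cn (m + n)) X]
  [TopologicalSpace M] [ChartedSpace (Cn m) M] {π : X → M}
  [IsManifold 𝓘(ℂ, Cn (m + n)) ω X] [IsManifold 𝓘(ℂ, Cn m) ω M]
  {E : OpenPartialHomeomorph X (Cn (m + n))} {f : OpenPartialHomeomorph M (Cn m)}

/-- The coordinate vectors of the fibre are vertical. -/
theorem mfderiv_proj_vertical (hπ : IsHolomorphicFibration m n π) (hE : IsAdmissible m n π E f)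
    {x : X} (hx : x ∈ E.source) (w : Cn n) :
    mfderiv 𝓘(ℂ, Cn (m + n)) 𝓘(ℂ, Cn m) π x
      (mfderiv 𝓘(ℂ, Cn (m + n)) 𝓘(ℂ, Cn (m + n)) E.symm (E x)
        (Fin.append (0 : Cn m) w : Cn (m + n)) : Cn (m + n)) = (0 : Cn m) := by
  have key : ∀ p ∈ E.target, mfderiv 𝓘(ℂ, Cn (m + n)) 𝓘(ℂ, Cn m) π (E.symm p)
      (mfderiv 𝓘(ℂ, Cn (m + n)) 𝓘(ℂ, Cn (m + n)) E.symm p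
        (Fin.append (0 : Cn m) w : Cn (m + n)) : Cn (m + n)) = (0 : Cn m) := by
    intro p hp
    let A : Cn (m + n) →L[ℂ] Cn m := (ContinuousLinearMap.fst ℂ (Cn m) (Cn n)).comp
      (appendL m n).symm.toContinuousLinearMap
    have hA : HasMFDerivAt 𝓘(ℂ, Cn (m + n)) 𝓘(ℂ, Cn m) horPart p A :=
      A.hasFDerivAt.hasMFDerivAt
    have h1 := ((contMDiffAt_symm_of_mem_maximalAtlas hE.1 hp).mdifferentiableAt
      (by simp)).hasMFDerivAt
    have h2 := ((hπ.holomorphic (E.symm p)).mdifferentiableAt (by simp)).hasMFDerivAt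
    have h3 := ((contMDiffAt_symm_of_mem_maximalAtlas hE.2.1 (hE.horPart_mem hp)).mdifferentiableAt
      (by simp)).hasMFDerivAt
    have h4 := h3.comp p hA
    have hev : π ∘ E.symm =ᶠ[nhds p] f.symm ∘ horPart := by
      filter_upwards [E.open_target.mem_nhds hp] with q hq
      exact hE.map_symm hq
    have h5 := hasMFDerivAt_unique (h2.comp p h1) (h4.congr_of_eventuallyEq hev)
    refine (DFunLike.congr_fun h5 (Fin.append (0 : Cn m) w : Cn (m + n))).trans ?_
    have h6 : A (Fin.append (0 : Cn m) w) = 0 := horPart_append _ _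
    exact (congrArg (mfderiv 𝓘(ℂ, Cn m) 𝓘(ℂ, Cn m) f.symm (horPart p)) h6).trans
      (map_zero (mfderiv 𝓘(ℂ, Cn m) 𝓘(ℂ, Cn m) f.symm (horPart p)))
  let D : X → Cn (m + n) → Cn m := fun x v => mfderiv 𝓘(ℂ, Cn (m + n)) 𝓘(ℂ, Cn m) π x v
  have h := key (E x) (E.map_source hx)
  change D (E.symm (E x)) _ = 0 at h
  rwa [E.left_inv hx] at h

variable {L : X → Type*} [∀ x, AddCommGroup (L x)] [∀ x, Module ℂ (L x)]
  [∀ x, TopologicalSpace (L x)] [TopologicalSpace (Bundle.TotalSpace ℂ L)] [FiberBundle ℂ L]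
  [VectorBundle ℂ ℂ L] [ContMDiffVectorBundle ω ℂ L 𝓘(ℂ, Cn (m + n))]
  {φ : HermitianMetric (m + n) L} {g : KaehlerMetric m M}

/-- Relative positivity in admissible coordinates. -/
theorem IsRelativelyPositive.posDef_vert (hφ : IsRelativelyPositive π φ)
    (hπ : IsHolomorphicFibration m n π) (hE : IsAdmissible m n π E f) {x : X}
    (hx : x ∈ E.source) : (vert (φ.hessian E x)).PosDef := by
  have hH := φ.isHermitian_hessian hE.1 hx
  have hV : (vert (φ.hessian E x)).IsHermitian := hH.submatrix (Fin.natAdd m)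
  refine Matrix.PosDef.of_dotProduct_mulVec_pos hV fun v hv => ?_
  let D : Cn (m + n) → Cn (m + n) := fun u =>
    mfderiv 𝓘(ℂ, Cn (m + n)) 𝓘(ℂ, Cn (m + n)) E.symm (E x) u
  have hD : ∀ u, D u = jac (chartAt (Cn (m + n)) x ∘ E.symm) (E x) *ᵥ u := fun u =>
    mfderiv_symm_apply hE.1 hx u
  have hu0 : D (Fin.append (0 : Cn m) (star v)) ≠ 0 := by
    intro h0
    rw [hD] at h0
    have h1 := jac_transition_mul_symm hE.1 (IsManifold.chart_mem_maximalAtlas x) hx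
      (mem_chart_source (Cn (m + n)) x)
    have h2 : (Fin.append (0 : Cn m) (star v) : Cn (m + n)) = 0 := by
      rw [← Matrix.one_mulVec (Fin.append (0 : Cn m) (star v) : Cn (m + n)), ← h1,
        ← Matrix.mulVec_mulVec, h0, Matrix.mulVec_zero]
    refine hv (star_eq_zero.1 ?_)
    rw [← verPart_append (0 : Cn m) (star v), h2]
    rfl
  have h1 := hφ x (D (Fin.append (0 : Cn m) (star v))) (mfderiv_proj_vertical hπ hE hx (star v)) hu0
  have h2 := φ.curvatureForm_mfderiv hE.1 hx
    (fun j => (Fin.append (0 : Cn m) ((![star v, Complex.I • star v] : Fin 2 → Cn n) j) :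
      Cn (m + n)))
  rw [formOfMatrix_vert] at h2
  have h3 : (fun j : Fin 2 => (mfderiv 𝓘(ℂ, Cn (m + n)) 𝓘(ℂ, Cn (m + n)) E.symm (E x)
      (Fin.append (0 : Cn m) ((![star v, Complex.I • star v] : Fin 2 → Cn n) j) : Cn (m + n)) :
        Cn (m + n))) = ![D (Fin.append (0 : Cn m) (star v)),
          Complex.I • D (Fin.append (0 : Cn m) (star v))] := by
    have h4 : (Fin.append (0 : Cn m) (Complex.I • star v) : Cn (m + n)) =
        Complex.I • (Fin.append (0 : Cn m) (star v) : Cn (m + n)) := by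
      ext i
      refine Fin.addCases (fun i => ?_) (fun i => ?_) i <;> simp
    funext j
    match j with
    | 0 => rfl
    | 1 =>
      refine (congrArg D h4).trans ?_
      rw [hD, hD, Matrix.mulVec_smul]
      rfl
  have h5 : φ.curvatureForm x ![D (Fin.append (0 : Cn m) (star v)),
      Complex.I • D (Fin.append (0 : Cn m) (star v))] =
      formOfMatrix (vert (φ.hessian E x)) ![star v, Complex.I • star v] := by
    rw [← h2]
    exact (congrArg (φ.curvatureForm x) h3).symm
  have h6 : 0 < formOfMatrix (vert (φ.hessian E x)) ![star v, Complex.I • star v] :=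
    h5 ▸ h1
  have h7 := formOfMatrix_apply_I_smul hV (star v)
  rw [star_star] at h7
  have h8 : star v ⬝ᵥ (vert (φ.hessian E x) *ᵥ v) =
      ((formOfMatrix (vert (φ.hessian E x)) ![star v, Complex.I • star v] / 2 : ℝ) : ℂ) := by
    push_cast
    rw [h7]
    ring
  rw [h8]
  exact_mod_cast half_pos h6

/-- The defect `δ ≥ 0` of the geodesic curvature from being a multiple of the Kähler form: the
elementary symmetric function of degree two of the eigenvalues of `c(φ)` falls short by `δ` of its
largest value for the given trace. It does not depend on the coordinates, since both the
coefficient of `det (φ_{j\bar k} + t g_{j\bar k})` in degree `m - 2` and the leading one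
are multiplied by `|det J|²` in a change of coordinates with Jacobian `J`. -/
theorem exists_defect (hm : 2 ≤ m) (hπ : IsHolomorphicFibration m n π)
    (hφ : IsRelativelyPositive π φ) {s : ℝ} (hs : TraceGeodesicCurvatureEq π g φ s) (x : X) :
    ∃ δ : ℝ, 0 ≤ δ ∧ (δ = 0 ↔ GeodesicCurvatureEqAt π g φ (s / m) x) ∧
      ∀ e e', IsAdmissible m n π e e' → x ∈ e.source →
        (detPoly (φ.hessian e x) (pad n (g.matrix e' (π x)))).coeff (m - 2) =
          (vert (φ.hessian e x)).det * (g.matrix e' (π x)).det *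
            (((m - 1) / (2 * m) * s ^ 2 - δ : ℝ) : ℂ) := by
  have hloc : ∀ e e', IsAdmissible m n π e e' → x ∈ e.source → ∃ δ : ℝ, 0 ≤ δ ∧
      (δ = 0 ↔ geodesicCurvature φ e x = ((s / m : ℝ) : ℂ) • g.matrix e' (π x)) ∧
        (detPoly (φ.hessian e x) (pad n (g.matrix e' (π x)))).coeff (m - 2) =
          (vert (φ.hessian e x)).det * (g.matrix e' (π x)).det *
            (((m - 1) / (2 * m) * s ^ 2 - δ : ℝ) : ℂ) := by
    intro e e' he hx
    obtain ⟨δ, h1, h2, h3⟩ := coeff_detPoly_eq hm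
      (isHermitian_schur (φ.isHermitian_hessian he.1 hx))
      (g.posDef_matrix he.2.1 (he.mem_source hx)) (hs e e' he x hx)
    refine ⟨δ, h1, h2, ?_⟩
    rw [detPoly_pad _ _ (hφ.posDef_vert hπ he hx).det_pos.ne', Polynomial.coeff_C_mul, h3, mul_assoc]
  obtain ⟨e, e', he, hx⟩ := exists_isAdmissible hπ x
  obtain ⟨δ, h1, h2, h3⟩ := hloc e e' he hx
  -- the defects computed in two coordinate systems agree
  have hind : ∀ E f, IsAdmissible m n π E f → x ∈ E.source → ∀ δ' : ℝ,
      (detPoly (φ.hessian E x) (pad n (g.matrix f (π x)))).coeff (m - 2) =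
        (vert (φ.hessian E x)).det * (g.matrix f (π x)).det *
          (((m - 1) / (2 * m) * s ^ 2 - δ' : ℝ) : ℂ) → δ' = δ := by
    intro E f hE hxE δ' h'
    have hDe := (hφ.posDef_vert hπ he hx).det_pos.ne'
    have hDE := (hφ.posDef_vert hπ hE hxE).det_pos.ne'
    have hGe := (g.posDef_matrix he.2.1 (he.mem_source hx)).det_pos.ne'
    have htr : detPoly (φ.hessian e x) (pad n (g.matrix e' (π x))) =
        Polynomial.C ((jac (E ∘ e.symm) (e x)).det *
          (starRingEnd ℂ) (jac (E ∘ e.symm) (e x)).det) *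
            detPoly (φ.hessian E x) (pad n (g.matrix f (π x))) := by
      rw [φ.hessian_transition he.1 hE.1 hx hxE, g.matrix_transition he.2.1 hE.2.1
        (he.mem_source hx) (hE.mem_source hxE),
        pad_congruence _ _ _ (fun a b => jac_castAdd_castAdd he hE hx hxE a b)
          (fun a b => jac_castAdd_natAdd he hE hx hxE a b), detPoly_congruence]
    set j := (jac (E ∘ e.symm) (e x)).det * (starRingEnd ℂ) (jac (E ∘ e.symm) (e x)).det
    have htop := congrArg (fun P => P.coeff m) htr
    have hsub := congrArg (fun P => P.coeff (m - 2)) htr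
    simp only [Polynomial.coeff_C_mul] at htop hsub
    rw [detPoly_pad _ _ hDe, detPoly_pad _ _ hDE, Polynomial.coeff_C_mul, Polynomial.coeff_C_mul,
      coeff_detPoly_card, coeff_detPoly_card] at htop
    rw [h3, h'] at hsub
    have h4 : (vert (φ.hessian e x)).det * (g.matrix e' (π x)).det *
        ((((m - 1) / (2 * m) * s ^ 2 - δ : ℝ) : ℂ) - (((m - 1) / (2 * m) * s ^ 2 - δ' : ℝ) : ℂ)) =
          0 := by
      rw [mul_sub, hsub, htop]
      ring
    have h5 := (mul_eq_zero.1 h4).resolve_left (mul_ne_zero hDe hGe)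
    have h6 : ((m - 1) / (2 * m) * s ^ 2 - δ : ℝ) = (m - 1) / (2 * m) * s ^ 2 - δ' := by
      exact_mod_cast sub_eq_zero.1 h5
    linarith
  refine ⟨δ, h1, ⟨fun h0 E f hE hxE => ?_, fun h => h2.2 (h e e' he hx)⟩, fun E f hE hxE => ?_⟩
  · obtain ⟨δ', _, h5, h6⟩ := hloc E f hE hxE
    exact h5.1 ((hind E f hE hxE δ' h6).trans h0)
  · obtain ⟨δ', _, _, h6⟩ := hloc E f hE hxE
    rw [← hind E f hE hxE δ' h6]
    exact h6

end Pointwise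

end Inequality

/-! ### The bound on the fibres over a point -/

section Bound

open scoped ComplexOrder

theorem continuousOn_det {T ι : Type*} [TopologicalSpace T] [Fintype ι] [DecidableEq ι]
    {A : T → Matrix ι ι ℂ} {s : Set T} (hA : ∀ i j, ContinuousOn (fun t => A t i j) s) :
    ContinuousOn (fun t => (A t).det) s := by
  simp only [Matrix.det_apply']
  exact continuousOn_finsetSum _ fun σ _ => continuousOn_const.mul
    (continuousOn_finsetProd _ fun i _ => hA _ _)

section Base

variable {m n : ℕ} {X M : Type*} [TopologicalSpace X] [ChartedSpace (Cn (m + n)) X]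
  [TopologicalSpace M] [ChartedSpace (Cn m) M] {π : X → M}
  [IsManifold 𝓘(ℂ, Cn (m + n)) ω X] [IsManifold 𝓘(ℂ, Cn m) ω M]
  {L : X → Type*} [∀ x, AddCommGroup (L x)] [∀ x, Module ℂ (L x)]
  [∀ x, TopologicalSpace (L x)] [TopologicalSpace (Bundle.TotalSpace ℂ L)] [FiberBundle ℂ L]
  [VectorBundle ℂ ℂ L] [ContMDiffVectorBundle ω ℂ L 𝓘(ℂ, Cn (m + n))]
  {φ : HermitianMetric (m + n) L} {g : KaehlerMetric m M}

/-- The identity between the factors in front of the fibre integrals in `S₂ ∧ ω^{m-2}`, `S₀` and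
`ω^m`. -/
theorem factor_identity (hm : 2 ≤ m) (n : ℕ) (s : ℝ) :
    (2 * Real.pi)⁻¹ ^ (n + 2) * (2 ^ (m + n) * ((n + 2).factorial * (m - 2).factorial)) *
      ((m - 1) / (2 * m) * s ^ 2) =
    ((n : ℝ) + 1) * (n + 2) / (8 * Real.pi ^ 2 * (m : ℝ) ^ 2) * s ^ 2 *
      ((2 * Real.pi)⁻¹ ^ n * (2 ^ n * n.factorial)) * (2 ^ m * m.factorial) := by
  obtain ⟨k, rfl⟩ : ∃ k, m = k + 2 := ⟨m - 2, by omega⟩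
  have hπ := Real.pi_ne_zero
  rw [Nat.add_sub_cancel, Nat.factorial_succ (n + 1), Nat.factorial_succ n,
    Nat.factorial_succ (k + 1), Nat.factorial_succ k, pow_add, pow_add 2 (k + 2) n]
  push_cast
  have hk : (k : ℝ) + 2 ≠ 0 := by positivity
  field_simp
  ring

/-- On the fibre over `y`, the form `S₂(L, φ) ∧ ω^{m-2}` falls short of its bound by the integral
`R` of the defect of the geodesic curvature. -/
theorem STwoWedge_eq_sub [CompactSpace X] [T2Space M] (hm : 2 ≤ m)
    (hπ : IsHolomorphicFibration m n π) [hP : Nonempty (AdmissiblePartition m n π)]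
    (hφ : IsRelativelyPositive π φ) {s : ℝ} (hs : TraceGeodesicCurvatureEq π g φ s)
    {f : OpenPartialHomeomorph M (Cn m)} (hf : f ∈ IsManifold.maximalAtlas 𝓘(ℂ, Cn m) ω M) {y : M}
    (hy : y ∈ f.source) :
    ∃ R : ℝ, 0 ≤ R ∧ (R = 0 ↔ ∀ x, π x = y → GeodesicCurvatureEqAt π g φ (s / m) x) ∧
      STwoWedge π g φ y
        (fun j => (jac (chartAt (Cn m) y ∘ f.symm) (f y) *ᵥ frame m j : Cn m)) =
      ((n : ℝ) + 1) * (n + 2) / (8 * Real.pi ^ 2 * (m : ℝ) ^ 2) * s ^ 2 * SZero π φ y *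
        g.formPow m y (fun j => (jac (chartAt (Cn m) y ∘ f.symm) (f y) *ᵥ frame m j : Cn m)) -
        R := by
  have hc : Continuous π := hπ.proper.continuous
  obtain ⟨x₁, hx₁⟩ := hπ.surjective y
  obtain ⟨y₁⟩ : Nonempty (Fibre π y) := ⟨⟨x₁, hx₁⟩⟩
  choose δ hδ0 hδ hδc using exists_defect hm hπ hφ hs
  have hS := SZero_eq φ hf hy y₁
  have hT := STwoWedge_eq φ g hm hc hf hy y₁
  have hω := formPow_frame g hf hy
  have hfac := factor_identity hm n s
  generalize hP.some = P at hS hT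
  set c₂ : ℝ := (2 * Real.pi)⁻¹ ^ (n + 2) * (2 ^ (m + n) * ((n + 2).factorial * (m - 2).factorial))
    with hc₂
  have hc₂0 : 0 < c₂ := by positivity
  clear_value c₂
  generalize (2 * Real.pi)⁻¹ ^ n * (2 ^ n * n.factorial) = c₀ at hS hfac
  set κ : ℝ := (m - 1) / (2 * m) * s ^ 2
  have hA := P.isAdaptedSystem hf
  have hE := hA.adm
  let E : Fin P.size → OpenPartialHomeomorph X (Cn (m + n)) := fun i =>
    withBase (P.chart i) (P.base i) f
  let F : Fin P.size → OpenPartialHomeomorph (Fibre π y) (Cn n) := fun i => fibreChart (hE i) hy y₁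
  have hFm : ∀ i, MeasurableSet (F i).target := fun i => (F i).open_target.measurableSet
  have hFs : ∀ i, ∀ v ∈ (F i).target, ((F i).symm v).1 ∈ (E i).source := fun i v hv =>
    (F i).map_target hv
  obtain ⟨γ, hγ0, hγ⟩ : ∃ γ : ℝ, 0 < γ ∧ (g.matrix f y).det = γ := by
    have h := Complex.pos_iff.1 (g.posDef_matrix hf hy).det_pos
    exact ⟨_, h.1, Complex.ext rfl h.2.symm⟩
  let D : Fin P.size → X → ℝ := fun i x => (vert (φ.hessian (E i) x)).det.re
  have hD : ∀ i, ∀ x ∈ (E i).source, 0 < D i x ∧ (vert (φ.hessian (E i) x)).det = (D i x : ℂ) :=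
    fun i x hx => by
      have h := Complex.pos_iff.1 (hφ.posDef_vert hπ (hE i) hx).det_pos
      exact ⟨h.1, Complex.ext rfl h.2.symm⟩
  let Q : Fin P.size → X → ℂ := fun i x =>
    (detPoly (φ.hessian (E i) x) (pad n (g.matrix f y))).coeff (m - 2)
  have hQ : ∀ i, ∀ x ∈ (E i).source, π x = y → Q i x = ((D i x * γ * (κ - δ x) : ℝ) : ℂ) :=
    fun i x hx hxy => by
      have h := hδc x (E i) f (hE i) hx
      rw [hxy, (hD i x hx).2, hγ] at h
      refine h.trans ?_
      push_cast
      rfl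
  let H : Fin P.size → X → ℝ := fun i x => κ * D i x - γ⁻¹ * (Q i x).re
  have hH : ∀ i, ∀ x ∈ (E i).source, π x = y → H i x = D i x * δ x := fun i x hx hxy => by
    have h1 : (Q i x).re = D i x * γ * (κ - δ x) := by rw [hQ i x hx hxy, Complex.ofReal_re]
    show κ * D i x - γ⁻¹ * (Q i x).re = D i x * δ x
    rw [h1]
    linear_combination (-(D i x * (κ - δ x))) * inv_mul_cancel₀ hγ0.ne'
  have hDc : ∀ i, ContinuousOn (D i) (E i).source := fun i =>
    Complex.continuous_re.comp_continuousOn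
      (continuousOn_det fun a b => continuousOn_hessian φ (hE i).1 _ _)
  have hQc : ∀ i, ContinuousOn (Q i) (E i).source := fun i =>
    continuousOn_coeff_detPoly (A := fun x => φ.hessian (E i) x)
      (B := fun _ => pad n (g.matrix f y)) (fun a b => continuousOn_hessian φ (hE i).1 a b)
      (fun a b => continuousOn_const) (m - 2)
  have hHc : ∀ i, ContinuousOn (H i) (E i).source := fun i =>
    (continuousOn_const.mul (hDc i)).sub
      (continuousOn_const.mul (Complex.continuous_re.comp_continuousOn (hQc i)))
  have hρc : ∀ i, ContinuousOn (P.ρ i) (E i).source := fun i =>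
    (P.smooth i).continuous.continuousOn
  have hDi : ∀ i, IntegrableOn (fun v => (fun x => P.ρ i x * D i x) ((F i).symm v).1)
      (F i).target := fun i =>
    hA.integrableOn hc hy y₁ i (u := fun x => P.ρ i x * D i x) ((hρc i).mul (hDc i))
      fun x hx => by simp only [hx, zero_mul]
  have hHi : ∀ i, IntegrableOn (fun v => (fun x => P.ρ i x * H i x) ((F i).symm v).1)
      (F i).target := fun i =>
    hA.integrableOn hc hy y₁ i (u := fun x => P.ρ i x * H i x) ((hρc i).mul (hHc i))
      fun x hx => by simp only [hx, zero_mul]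
  have hHnn : ∀ i, ∀ v ∈ (F i).target, 0 ≤ (fun x => P.ρ i x * H i x) ((F i).symm v).1 :=
    fun i v hv => by
      simp only [hH i _ (hFs i v hv) ((F i).symm v).2]
      exact mul_nonneg (P.nonneg _ _) (mul_nonneg (hD i _ (hFs i v hv)).1.le (hδ0 _))
  have hB0 : ∀ i, 0 ≤ ∫ v in (F i).target, (fun x => P.ρ i x * H i x) ((F i).symm v).1 := fun i =>
    setIntegral_nonneg (hFm i) (hHnn i)
  refine ⟨c₂ * γ * ∑ i, ∫ v in (F i).target, (fun x => P.ρ i x * H i x) ((F i).symm v).1,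
    mul_nonneg (mul_pos hc₂0 hγ0).le (Finset.sum_nonneg fun i _ => hB0 i), ?_, ?_⟩
  · rw [mul_eq_zero, or_iff_right (mul_pos hc₂0 hγ0).ne',
      Finset.sum_eq_zero_iff_of_nonneg fun i _ => hB0 i]
    constructor
    · intro h x hxy
      obtain ⟨i, hi⟩ : ∃ i, P.ρ i x ≠ 0 := by
        by_contra! h0
        have h1 := P.sum_eq_one x
        simp [h0] at h1
      have hx : x ∈ (E i).source := hA.support i x (subset_tsupport _ hi) (hxy ▸ hy)
      have hxF : (⟨x, hxy⟩ : Fibre π y) ∈ (F i).source := hx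
      have hcont : ContinuousOn (fun v => (fun x => P.ρ i x * H i x) ((F i).symm v).1)
          (F i).target :=
        ((hρc i).mul (hHc i)).comp (continuous_subtype_val.comp_continuousOn (F i).continuousOn_symm)
          (hFs i)
      have h2 := eq_zero_of_setIntegral_eq_zero (F i).open_target hcont (hHnn i) (hHi i)
        (h i (Finset.mem_univ i)) _ ((F i).map_source hxF)
      simp only [(F i).left_inv hxF, hH i x hx hxy] at h2
      exact (hδ x).1 (((mul_eq_zero.1 ((mul_eq_zero.1 h2).resolve_left hi)).resolve_left
        (hD i x hx).1.ne'))
    · intro h i _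
      refine setIntegral_eq_zero_of_forall_eq_zero fun v hv => ?_
      have hy' := ((F i).symm v).2
      simp only [hH i _ (hFs i v hv) hy', (hδ _).2 (h _ hy'), mul_zero]
  · have hS' : SZero π φ y =
        c₀ * ∑ i, ∫ v in (F i).target, (fun x => P.ρ i x * D i x) ((F i).symm v).1 := by
      rw [← Complex.ofReal_inj, hS, Complex.ofReal_mul, Complex.ofReal_sum]
      refine congrArg (fun r => (c₀ : ℂ) * r) (Finset.sum_congr rfl fun i _ => ?_)
      rw [← integral_complex_ofReal]
      refine setIntegral_congr_fun (hFm i) fun v hv => ?_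
      have h := (hD i _ (hFs i v hv)).2
      simp only [Complex.ofReal_mul]
      exact congrArg (fun r => (P.ρ i ((F i).symm v).1 : ℂ) * r) h
    have hω' : g.formPow m y (fun j => (jac (chartAt (Cn m) y ∘ f.symm) (f y) *ᵥ frame m j : Cn m)) =
        2 ^ m * m.factorial * γ := by
      rw [← Complex.ofReal_inj]
      refine hω.trans ?_
      rw [hγ]
      push_cast
      rfl
    have hT' : STwoWedge π g φ y
        (fun j => (jac (chartAt (Cn m) y ∘ f.symm) (f y) *ᵥ frame m j : Cn m)) =
        c₂ * ∑ i, (γ * (κ * (∫ v in (F i).target, (fun x => P.ρ i x * D i x) ((F i).symm v).1) -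
          ∫ v in (F i).target, (fun x => P.ρ i x * H i x) ((F i).symm v).1)) := by
      rw [← Complex.ofReal_inj]
      refine hT.trans ?_
      rw [Complex.ofReal_mul, Complex.ofReal_sum]
      refine congrArg (fun r => (c₂ : ℂ) * r) (Finset.sum_congr rfl fun i _ => ?_)
      rw [← integral_const_mul, ← integral_sub ((hDi i).const_mul κ) (hHi i), ← integral_const_mul,
        ← integral_complex_ofReal]
      refine setIntegral_congr_fun (hFm i) fun v hv => ?_
      have hy' := ((F i).symm v).2
      refine (congrArg (fun r => (P.ρ i ((F i).symm v).1 : ℂ) * r)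
        (hQ i _ (hFs i v hv) hy')).trans ?_
      simp only [hH i _ (hFs i v hv) hy']
      push_cast
      ring
    rw [hT', hS', hω', ← Finset.mul_sum, Finset.sum_sub_distrib, ← Finset.mul_sum]
    linear_combination (γ * ∑ i, ∫ v in (F i).target, (fun x => P.ρ i x * D i x) ((F i).symm v).1) *
      hfac

/-- The coefficient of a top form on the base is its value in the preferred chart, where the
transition matrix is the identity. -/
theorem topCoeff_eq {d : ℕ} (η : Form m M d) (y : M) :
    η y (fun j => (jac (chartAt (Cn m) y ∘ (chartAt (Cn m) y).symm) (chartAt (Cn m) y y) *ᵥ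
      frame m j : Cn m)) = topCoeff m η y := by
  have h : chartAt (Cn m) y ∘ (chartAt (Cn m) y).symm =ᶠ[nhds (chartAt (Cn m) y y)]
      fun p => p := by
    filter_upwards [(chartAt (Cn m) y).open_target.mem_nhds
      ((chartAt (Cn m) y).map_source (mem_chart_source (Cn m) y))] with p hp
    exact (chartAt (Cn m) y).right_inv hp
  rw [jac_congr h, jac_id]
  simp only [Matrix.one_mulVec]
  rfl

theorem integrableOn_formPow [CompactSpace M] (g : KaehlerMetric m M) (Q : ChartPartition m M)
    (a : Fin Q.size) : IntegrableOn (fun p => (fun y => Q.ρ a y * g.formPow m y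
      (fun j => (jac (chartAt (Cn m) y ∘ (Q.chart a).symm) (Q.chart a y) *ᵥ frame m j : Cn m)))
        ((Q.chart a).symm p)) (Q.chart a).target := by
  have h1 : ContinuousOn (fun y => Q.ρ a y * ((2 ^ m * m.factorial *
      (g.matrix (Q.chart a) y).det : ℂ)).re) (Q.chart a).source := by
    refine (Q.smooth a).continuous.continuousOn.mul (Complex.continuous_re.comp_continuousOn
      (continuousOn_const.mul (continuousOn_det fun b c =>
        continuousOn_matrix g (Q.chart_mem a) b c)))
  have h2 := integrableOn_target (isClosed_tsupport (Q.ρ a)).isCompact (Q.tsupport_subset a)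
    (fun y hy => by rw [notMem_tsupport_eq_zero hy, zero_mul]) h1
  refine h2.congr_fun (fun p hp => ?_) (Q.chart a).open_target.measurableSet
  have h3 := formPow_frame g (Q.chart_mem a) ((Q.chart a).map_target hp)
  simp only [← h3, Complex.ofReal_re]

end Base

end Bound

end GeodesicEinstein

end

open GeodesicEinstein

/-- `φ ∈ F⁺(L)` is the geodesic-Einstein metric; `ψ` is an arbitrary smooth Hermitian metric on `L`
and `y₀` an arbitrary point of `M`, through which the quantities that depend only on the class
`c₁(L)` are evaluated: `λ_{X,L}`, the number `S₀(L) = ∫_{X_{y₀}} c₁(L)^n`, and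
`∫_M S₂(L) ∧ [ω]^{m-2}`. -/
theorem theorem4p2 (m n : ℕ) (hm : 2 ≤ m)
    {X M : Type*}
    [TopologicalSpace M] [T2Space M] [CompactSpace M] [ConnectedSpace M]
    [ChartedSpace (Cn m) M] [IsManifold 𝓘(ℂ, Cn m) ω M]
    [TopologicalSpace X] [T2Space X]
    [ChartedSpace (Cn (m + n)) X] [IsManifold 𝓘(ℂ, Cn (m + n)) ω X]
    (π : X → M) (hπ : IsHolomorphicFibration m n π)
    (L : X → Type*) [∀ x, AddCommGroup (L x)] [∀ x, Module ℂ (L x)]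
    [∀ x, TopologicalSpace (L x)] [TopologicalSpace (Bundle.TotalSpace ℂ L)]
    [FiberBundle ℂ L] [VectorBundle ℂ ℂ L]
    [ContMDiffVectorBundle ω ℂ L 𝓘(ℂ, Cn (m + n))]
    (g : KaehlerMetric m M)
    (φ : HermitianMetric (m + n) L) (hφ : IsRelativelyPositive π φ)
    (ψ : HermitianMetric (m + n) L) (y₀ : M)
    (hGE : TraceGeodesicCurvatureEq π g φ (lambdaXL π g ψ)) :
    -- the inequality of forms
    (∀ y : M, topCoeff m (STwoWedge π g φ) y ≤
      ((n : ℝ) + 1) * (n + 2) / (8 * Real.pi ^ 2 * (m : ℝ) ^ 2) * lambdaXL π g ψ ^ 2 *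
        SZero π ψ y₀ * topCoeff m (g.formPow m) y) ∧
    -- the case of equality at a point of the base
    (∀ y : M, topCoeff m (STwoWedge π g φ) y =
        ((n : ℝ) + 1) * (n + 2) / (8 * Real.pi ^ 2 * (m : ℝ) ^ 2) * lambdaXL π g ψ ^ 2 *
          SZero π ψ y₀ * topCoeff m (g.formPow m) y ↔
      ∀ x : X, π x = y → GeodesicCurvatureEqAt π g φ (lambdaXL π g ψ / m) x) ∧
    -- the case of equality everywhere
    ((∀ y : M, topCoeff m (STwoWedge π g φ) y =
        ((n : ℝ) + 1) * (n + 2) / (8 * Real.pi ^ 2 * (m : ℝ) ^ 2) * lambdaXL π g ψ ^ 2 *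
          SZero π ψ y₀ * topCoeff m (g.formPow m) y) ↔
      ∀ x : X, GeodesicCurvatureEqAt π g φ (lambdaXL π g ψ / m) x) ∧
    -- the topological inequality
    topIntegral m (STwoWedge π g ψ) ≤
      ((n : ℝ) + 1) * (n + 2) / (8 * Real.pi ^ 2 * (m : ℝ) ^ 2) * lambdaXL π g ψ ^ 2 *
        SZero π ψ y₀ * topIntegral m (g.formPow m) := by
  have hc : Continuous π := hπ.proper.continuous
  have : CompactSpace X := ⟨by simpa using hπ.proper.isCompact_preimage isCompact_univ⟩
  have hP : Nonempty (AdmissiblePartition m n π) := nonempty_admissiblePartition hπ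
  -- the argument applies to every constant value of the trace
  generalize lambdaXL π g ψ = s at hGE
  have hS : ∀ y, SZero π φ y = SZero π ψ y₀ := fun y => by
    obtain ⟨x, hx⟩ := hπ.surjective y
    rw [← SZero_eq_SZero φ ψ hc ⟨x, hx⟩]
    exact SZero_const ψ hc hπ.surjective y y₀
  have hloc : ∀ y : M, ∃ R : ℝ, 0 ≤ R ∧
      (R = 0 ↔ ∀ x, π x = y → GeodesicCurvatureEqAt π g φ (s / m) x) ∧
      topCoeff m (STwoWedge π g φ) y =
        ((n : ℝ) + 1) * (n + 2) / (8 * Real.pi ^ 2 * (m : ℝ) ^ 2) * s ^ 2 * SZero π ψ y₀ *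
          topCoeff m (g.formPow m) y - R := fun y => by
    obtain ⟨R, h1, h2, h3⟩ := STwoWedge_eq_sub hm hπ hφ hGE
      (IsManifold.chart_mem_maximalAtlas y) (mem_chart_source (Cn m) y)
    rw [hS] at h3
    refine ⟨R, h1, h2, (topCoeff_eq _ y).symm.trans (h3.trans ?_)⟩
    exact congrArg (fun r => _ * r - R) (topCoeff_eq (g.formPow m) y)
  have heq : ∀ y : M, topCoeff m (STwoWedge π g φ) y =
      ((n : ℝ) + 1) * (n + 2) / (8 * Real.pi ^ 2 * (m : ℝ) ^ 2) * s ^ 2 * SZero π ψ y₀ *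
        topCoeff m (g.formPow m) y ↔ ∀ x, π x = y → GeodesicCurvatureEqAt π g φ (s / m) x :=
    fun y => by
      obtain ⟨R, _, h2, h3⟩ := hloc y
      rw [h3, ← h2, sub_eq_self]
  refine ⟨fun y => ?_, heq, ⟨fun h x => (heq (π x)).1 (h _) x rfl,
    fun h y => (heq y).2 fun x _ => h x⟩, ?_⟩
  · obtain ⟨R, h1, _, h3⟩ := hloc y
    rw [h3]
    exact sub_le_self _ h1
  · rw [topIntegral_STwoWedge_eq φ ψ g hm hc hπ.surjective]
    have hQ : Nonempty (ChartPartition m M) := nonempty_chartPartition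
    rw [topIntegral_eq, topIntegral_eq, Finset.mul_sum]
    refine Finset.sum_le_sum fun a _ => ?_
    rw [← MeasureTheory.integral_const_mul]
    refine MeasureTheory.setIntegral_mono_on
      (setIntegral_STwoWedge φ g hm hc hπ.surjective hQ.some a).1
      ((integrableOn_formPow g hQ.some a).const_mul _)
      (hQ.some.chart a).open_target.measurableSet fun p hp => ?_
    obtain ⟨R, h1, _, h3⟩ := STwoWedge_eq_sub hm hπ hφ hGE (hQ.some.chart_mem a)
      ((hQ.some.chart a).map_target hp)
    rw [hS] at h3
    refine (mul_le_mul_of_nonneg_left (h3.le.trans (sub_le_self _ h1))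
      (hQ.some.nonneg a _)).trans (le_of_eq ?_)
    rw [mul_left_comm]
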